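/- Let $\Delta\subset\mathbb{R}\times[-1,1]$ be a reflexive polygon, i.e. the convex hull of finitely many lattice points having the origin as its only interior lattice point. Let $\varphi(x_1,x_2)=\sum_m c_m x_1^{m_1}x_2^{m_2}$ be the integrally tempered Laurent polynomial of $\Delta$: it has Newton polygon $\Delta$, constant term $0$, coefficients $1$ at the vertices of $\Delta$, and every edge polynomial is a power of $w+1$. (The edge polynomial of an edge from a vertex $v$ to a vertex $v'$ is $\sum_k c_{v+ke}w^k$, with $e$ the primitive lattice vector from $v$ towards $v'$, summed over the lattice points $v+ke$ of the edge.) Let $a\in\mathbb{C}$, $a\neq 0$, be such that the closure $E_a$ of $E_a^*=\{x\in(\mathbb{C}^*)^2:\varphi(x)+a=0\}$ in the toric surface $\mathbb{P}_\Delta$ is smooth; here the fan of $\mathbb{P}_\Delta$ has as rays those through the nonzero lattice points of the polar polygon of $\Delta$. Then $E_a$ is an elliptic curve. Put $$\omega=\frac1{2\pi i}\operatorname{Res}_{E_a}\frac{\frac{dx_1}{x_1}\wedge\frac{dx_2}{x_2}}{1+a^{-1}\varphi},$$ and, for a loop $L$ in $E_a^*$ based at $p$, put $\omega_L=\int_L\omega$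 and $$R_L=\int_L\log(-x_1)\,\frac{dx_2}{x_2}-\log(-x_2(p))\int_L\frac{dx_1}{x_1}$$ with $\log(-x_1)$ continued analytically along $L$. This is the regulator period of the symbol $\{-x_1,-x_2\}$; modulo $(2\pi i)^2\mathbb{Z}$ it depends only on the class of $L$ in $H_1(E_a,\mathbb{Z})$. Let $\gamma,\beta$ be loops in $E_a^*$ with a common base point whose classes form a basis of $H_1(E_a,\mathbb{Z})$, let $\Lambda(a)=\mathbb{Z}\omega_\gamma+\mathbb{Z}\omega_\beta$, and let $$V(a)=\frac1{4\pi^2}\left(R_\gamma\,\omega_\beta-R_\beta\,\omega_\gamma\right),$$ the higher normal function, which is well defined modulo $\Lambda(a)$. On $L^2(\mathbb{R})$ let $\hat x_1$ be multiplication by $e^r$ and $\hat x_2=e^{-2\pi i\partial_r}$ the shift $f(r)\mapsto f(r-2\pi i)$ (that is, $\hbar=2\pi$), and let $\hat\varphi=-\varphi(-\hat x_1,-\hat x_2)$. It is a positive symmetric operator on the space of entire functions that decay faster than every exponential in each horizontal strip; write $\hat\varphi$ also for its self-adjoint Friedrichs extension. Theorem. If $V(a)\in\Lambda(a)$, then $a$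 is an eigenvalue of $\hat\varphi$: there is a nonzero $\psi\in L^2(\mathbb{R})$ in the domain of $\hat\varphi$ with $\hat\varphi\psi=a\psi$. -/

import Mathlib

noncomputable section

namespace QuantumCurve

open MeasureTheory Filter Topology Set

/-! ### Laurent polynomials in two variables -/

/-- Laurent polynomials in `x₁, x₂` over `ℂ`, as finitely supported coefficient functions:
`φ m` is the coefficient of `x₁ ^ m.1 * x₂ ^ m.2`. -/
abbrev LaurentPoly : Type := (ℤ × ℤ) →₀ ℂ

/-- The value of a Laurent polynomial. -/
def eval (φ : LaurentPoly) (x : ℂ × ℂ) : ℂ :=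
  φ.sum fun m c => c * x.1 ^ m.1 * x.2 ^ m.2

/-- The value of `∂φ/∂x₁`. -/
def partial₁ (φ : LaurentPoly) (x : ℂ × ℂ) : ℂ :=
  φ.sum fun m c => c * ((m.1 : ℂ) * x.1 ^ (m.1 - 1)) * x.2 ^ m.2

/-- The value of `∂φ/∂x₂`. -/
def partial₂ (φ : LaurentPoly) (x : ℂ × ℂ) : ℂ :=
  φ.sum fun m c => c * x.1 ^ m.1 * ((m.2 : ℂ) * x.2 ^ (m.2 - 1))

/-! ### Reflexive polygons and integrally tempered Laurent polynomials -/

/-- A lattice point as a point of the plane. -/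
def latticePoint (m : ℤ × ℤ) : ℝ × ℝ := ((m.1 : ℝ), (m.2 : ℝ))

/-- A reflexive polygon (genus one): the convex hull of finitely many lattice points, such that
the origin is its one and only interior lattice point. -/
structure IsReflexive (Δ : Set (ℝ × ℝ)) : Prop where
  isLattice : ∃ S : Finset (ℤ × ℤ), Δ = convexHull ℝ (latticePoint '' (S : Set (ℤ × ℤ)))
  interior_iff : ∀ m : ℤ × ℤ, latticePoint m ∈ interior Δ ↔ m = 0

/-- `v` is a vertex of `Δ`. -/
def IsVertex (Δ : Set (ℝ × ℝ)) (v : ℤ × ℤ) : Prop :=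
  latticePoint v ∈ Δ.extremePoints ℝ

/-- The segment from `v` to `v'` is an edge of the polygon `Δ`: both ends are vertices, and
the segment lies in the boundary. -/
def IsEdge (Δ : Set (ℝ × ℝ)) (v v' : ℤ × ℤ) : Prop :=
  IsVertex Δ v ∧ IsVertex Δ v' ∧ v ≠ v' ∧
    segment ℝ (latticePoint v) (latticePoint v') ⊆ frontier Δ

/-- The lattice length of the segment from `v` to `v'`. -/
def latticeLength (v v' : ℤ × ℤ) : ℕ := Int.gcd (v'.1 - v.1) (v'.2 - v.2)

/-- The primitive lattice vector pointing from `v` to `v'`. -/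
def primitiveVector (v v' : ℤ × ℤ) : ℤ × ℤ :=
  ((v'.1 - v.1) / (latticeLength v v' : ℤ), (v'.2 - v.2) / (latticeLength v v' : ℤ))

/-- The edge polynomial `∑ₖ φ(v + k • e) wᵏ`, where `e` is the primitive vector from `v` to `v'`
and `v + k • e` runs through the lattice points of the edge from `v` to `v'`. -/
def edgePolynomial (φ : LaurentPoly) (v v' : ℤ × ℤ) : Polynomial ℂ :=
  ∑ k ∈ Finset.range (latticeLength v v' + 1),
    Polynomial.monomial k (φ (v + (k : ℤ) • primitiveVector v v'))

/-- `φ` is the integrally tempered Laurent polynomial of the reflexive polygon `Δ`: it has Newton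
polygon `Δ`, constant term `0`, coefficients `1` at the vertices, and every edge polynomial is a
power of `w + 1`. -/
structure IsIntegrallyTempered (Δ : Set (ℝ × ℝ)) (φ : LaurentPoly) : Prop where
  support_subset : ∀ m ∈ φ.support, latticePoint m ∈ Δ
  constantTerm : φ 0 = 0
  vertex : ∀ v, IsVertex Δ v → φ v = 1
  edge : ∀ v v', IsEdge Δ v v' → ∃ n : ℕ, edgePolynomial φ v v' = (Polynomial.X + 1) ^ n

/-! ### The curve `φ + a = 0` and its compactification -/

/-- The affine curve `E_a^* = {φ + a = 0}` in `(ℂ^*)²`. -/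
def affineCurve (φ : LaurentPoly) (a : ℂ) : Set (ℂ × ℂ) :=
  {x | x.1 ≠ 0 ∧ x.2 ≠ 0 ∧ eval φ x + a = 0}

/-- The pairing of a covector with a lattice point. -/
def pairing (n m : ℤ × ℤ) : ℤ := n.1 * m.1 + n.2 * m.2

/-- Let `n, n'` be a basis of `ℤ²` with `⟨n, m⟩ ≥ -1` for all monomials `m` of `φ` (so that `n` is a
nonzero lattice point of the polar polygon). In the toric chart with coordinates `(u, v)`, where
`x ^ m = u ^ ⟨n, m⟩ * v ^ ⟨n', m⟩`, this is the local equation `u * (φ + a)` of the closure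
of `{φ + a = 0}`; `u = 0 ≠ v` is the open orbit in the toric divisor of the ray through `n`. -/
def chartEquation (φ : LaurentPoly) (a : ℂ) (n n' : ℤ × ℤ) : LaurentPoly :=
  (φ + Finsupp.single 0 a).mapDomain fun m => (pairing n m + 1, pairing n' m)

/-- The closure `E_a` of `{φ + a = 0}` in the toric surface `ℙ_Δ` is smooth, where the rays of the
fan of `ℙ_Δ` go through the nonzero lattice points of the polar polygon: it is smooth in the torus
and along each of the toric divisors. (It does not meet the torus-fixed points, since
the coefficients at the vertices of the Newton polygon do not vanish.) -/
structure IsSmoothFiber (φ : LaurentPoly) (a : ℂ) : Prop where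
  torus : ∀ x ∈ affineCurve φ a, partial₁ φ x ≠ 0 ∨ partial₂ φ x ≠ 0
  boundary : ∀ n n' : ℤ × ℤ, n.1 * n'.2 - n.2 * n'.1 = 1 → (∀ m ∈ φ.support, -1 ≤ pairing n m) →
    ∀ v : ℂ, v ≠ 0 → eval (chartEquation φ a n n') (0, v) = 0 →
      partial₁ (chartEquation φ a n n') (0, v) ≠ 0 ∨ partial₂ (chartEquation φ a n n') (0, v) ≠ 0

/-- The parameter space: nonzero `a` for which `E_a` is smooth. -/
def moduli (φ : LaurentPoly) : Set ℂ := {a | a ≠ 0 ∧ IsSmoothFiber φ a}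

/-- All monomials `x ^ m`, `m ∈ ℤ²`, as a point of a product of Riemann spheres. -/
def monomialMap (x : ℂ × ℂ) : ℤ × ℤ → OnePoint ℂ :=
  fun m => ((x.1 ^ m.1 * x.2 ^ m.2 : ℂ) : OnePoint ℂ)

/-- The compact curve `E_a` as a topological space: the closure of `E_a^*` under the embedding by
all monomials. Every monomial is a map `E_a → ℙ¹` when `E_a` is smooth, and together they separate
the points of `E_a`, as there is just one point of `E_a` on the toric divisor of each edge. -/
def completeCurve (φ : LaurentPoly) (a : ℂ) : Set (ℤ × ℤ → OnePoint ℂ) :=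
  closure (monomialMap '' affineCurve φ a)

/-- A point of `E_a^*` as a point of `E_a`. -/
def toComplete {φ : LaurentPoly} {a : ℂ} (x : ℂ × ℂ) (hx : x ∈ affineCurve φ a) :
    completeCurve φ a :=
  ⟨monomialMap x, subset_closure ⟨x, hx, rfl⟩⟩

/-! ### Loops, periods and regulator periods -/

/-- A `C¹` loop in the affine curve `E_a^*`, based at `p` and parametrized by `[0, 1]`. -/
structure CurveLoop (φ : LaurentPoly) (a : ℂ) (p : ℂ × ℂ) where
  toFun : ℝ → ℂ × ℂ
  contDiff : ContDiff ℝ 1 toFun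
  mem : ∀ t ∈ Icc (0 : ℝ) 1, toFun t ∈ affineCurve φ a
  source : toFun 0 = p
  target : toFun 1 = p

variable {φ : LaurentPoly} {a : ℂ} {p : ℂ × ℂ}

theorem CurveLoop.base_mem (L : CurveLoop φ a p) : p ∈ affineCurve φ a :=
  L.source ▸ L.mem 0 (by simp)

/-- The loop as a continuous path in the compact curve `E_a`. -/
def CurveLoop.toPath (L : CurveLoop φ a p) :
    Path (toComplete p L.base_mem) (toComplete p L.base_mem) where
  toFun t := toComplete (L.toFun t) (L.mem t t.2)
  continuous_toFun := by
    have hc : Continuous fun t : unitInterval => L.toFun t :=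
      L.contDiff.continuous.comp continuous_subtype_val
    refine Continuous.subtype_mk (continuous_pi fun m => ?_) _
    refine OnePoint.continuous_coe.comp (Continuous.mul ?_ ?_)
    · exact (continuous_fst.comp hc).zpow₀ m.1 fun t => Or.inl (L.mem t t.2).1
    · exact (continuous_snd.comp hc).zpow₀ m.2 fun t => Or.inl (L.mem t t.2).2.1
  source' := by
    apply Subtype.ext
    simp [toComplete, L.source]
  target' := by
    apply Subtype.ext
    simp [toComplete, L.target]

/-- `H₁(E_a, ℤ)`, as the abelianization of the fundamental group (written multiplicatively). -/
abbrev H₁ (hp : p ∈ affineCurve φ a) : Type :=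
  Abelianization (FundamentalGroup (completeCurve φ a) (toComplete p hp))

/-- The homology class of a loop in `H₁(E_a, ℤ)`. -/
def CurveLoop.homologyClass (L : CurveLoop φ a p) : H₁ L.base_mem :=
  Abelianization.of (FundamentalGroup.fromPath (Path.Homotopic.Quotient.mk L.toPath))

/-- The classes of `γ` and `β` generate `H₁(E_a, ℤ)`; since this group is isomorphic to `ℤ²`
for the smooth curve `E_a` of genus one, they form a basis. -/
def IsHomologyBasis (γ β : CurveLoop φ a p) : Prop :=
  Subgroup.closure ({γ.homologyClass, β.homologyClass} : Set (H₁ γ.base_mem)) = ⊤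

/-- The value at the tangent vector `w` at the point `x` of `E_a^*` of the holomorphic form
`ω = (2πi)⁻¹ Res (dx₁/x₁ ∧ dx₂/x₂) / (1 + a⁻¹ φ)`. By `Res (dF/F ∧ η) = η` for `F = φ + a`, the
residue of `dx₁ ∧ dx₂ / F` is `-dx₁ / ∂₂F` where `∂₂F ≠ 0` and `dx₂ / ∂₁F` where `∂₁F ≠ 0`. -/
def holomorphicForm (φ : LaurentPoly) (a : ℂ) (x w : ℂ × ℂ) : ℂ :=
  (2 * Real.pi * Complex.I)⁻¹ * (a / (x.1 * x.2)) *
    (if partial₂ φ x = 0 then w.2 / partial₁ φ x else -w.1 / partial₂ φ x)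

/-- The period `∫_L ω`. -/
def CurveLoop.period (L : CurveLoop φ a p) : ℂ :=
  ∫ t in (0 : ℝ)..1, holomorphicForm φ a (L.toFun t) (deriv L.toFun t)

/-- The form `dlog x₁ = dlog (-x₁)` along the loop. -/
def CurveLoop.dlog₁ (L : CurveLoop φ a p) (t : ℝ) : ℂ := (deriv L.toFun t).1 / (L.toFun t).1

/-- The form `dlog x₂ = dlog (-x₂)` along the loop. -/
def CurveLoop.dlog₂ (L : CurveLoop φ a p) (t : ℝ) : ℂ := (deriv L.toFun t).2 / (L.toFun t).2

/-- The analytic continuation of `log (-x₁)` along the loop. -/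
def CurveLoop.log₁ (L : CurveLoop φ a p) (t : ℝ) : ℂ :=
  Complex.log (-p.1) + ∫ s in (0 : ℝ)..t, L.dlog₁ s

/-- The regulator period of the symbol `{-x₁, -x₂}`,
`R_L = ∫_L log(-x₁) dlog(-x₂) - log(-x₂(p)) ∫_L dlog(-x₁)`.
Modulo `ℤ(2) = (2πi)² ℤ` it does not depend on the branches of the logarithms, and for
integrally tempered `φ` it depends on the homology class of `L` in `E_a` only. -/
def CurveLoop.regulator (L : CurveLoop φ a p) : ℂ :=
  (∫ t in (0 : ℝ)..1, L.log₁ t * L.dlog₂ t) -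
    Complex.log (-p.2) * ∫ t in (0 : ℝ)..1, L.dlog₁ t

/-- The period lattice `Λ(a) = ℤ⟨ω_γ, ω_β⟩`. -/
def periodLattice (γ β : CurveLoop φ a p) : AddSubgroup ℂ :=
  AddSubgroup.closure {γ.period, β.period}

/-- The higher normal function `V = (4π²)⁻¹ (R_γ ω_β - R_β ω_γ)`, well defined modulo the period
lattice. -/
def normalFunction (γ β : CurveLoop φ a p) : ℂ :=
  (4 * (Real.pi : ℂ) ^ 2)⁻¹ * (γ.regulator * β.period - β.regulator * γ.period)

/-! ### The quantum operator at `ħ = 2π` -/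

/-- The inner product `⟨f, g⟩ = ∫ f ḡ` on functions on the real line. -/
def innerL2 (f g : ℝ → ℂ) : ℂ := ∫ r : ℝ, f r * (starRingEnd ℂ) (g r)

/-- The common dense invariant domain of all the operators `x̂₁ ^ m₁ x̂₂ ^ m₂`: entire functions that
decay faster than any exponential in each horizontal strip. -/
def testFunctions : Set (ℂ → ℂ) :=
  {h | Differentiable ℂ h ∧ ∀ b K : ℝ, ∃ C : ℝ, ∀ z : ℂ, |z.im| ≤ b →
    ‖h z‖ ≤ C * Real.exp (-K * |z.re|)}

/-- The action of `φ̂ = -φ(-x̂₁, -x̂₂)` on entire functions, where `x̂₁` is the multiplication by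
`e ^ z` and `x̂₂ = e ^ (-2πi ∂)` is the shift `h(z) ↦ h(z - 2πi)`. -/
def quantumAction (φ : LaurentPoly) (h : ℂ → ℂ) (z : ℂ) : ℂ :=
  -φ.sum fun m c => c * (-Complex.exp z) ^ m.1 *
    ((-1) ^ m.2 * h (z - 2 * Real.pi * Complex.I * m.2))

/-- The restriction of a function to the real line. -/
def onReal (h : ℂ → ℂ) (r : ℝ) : ℂ := h r

/-- The form domain of the Friedrichs extension: `L²`-limits of sequences of test functions that are
Cauchy for the quadratic form `h ↦ ⟨φ̂ h, h⟩`. -/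
def InFormDomain (φ : LaurentPoly) (f : ℝ → ℂ) : Prop :=
  ∃ h : ℕ → ℂ → ℂ, (∀ n, h n ∈ testFunctions) ∧
    Tendsto (fun n => eLpNorm (fun r => onReal (h n) r - f r) 2 volume) atTop (𝓝 0) ∧
    Tendsto (fun n : ℕ × ℕ =>
        innerL2 (onReal (quantumAction φ (h n.1 - h n.2))) (onReal (h n.1 - h n.2)))
      atTop (𝓝 0)

/-- The graph of `φ̂` as a self-adjoint operator on `L²(ℝ)`, the Friedrichs extension of the positive
symmetric operator `φ̂` on test functions: `f` lies in the form domain, and `φ̂ f = g` weakly. -/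
def QuantumGraph (φ : LaurentPoly) (f g : ℝ → ℂ) : Prop :=
  MemLp f 2 volume ∧ MemLp g 2 volume ∧ InFormDomain φ f ∧
    ∀ h ∈ testFunctions, innerL2 f (onReal (quantumAction φ h)) = innerL2 g (onReal h)

/-- `a` is an eigenvalue of `φ̂` on `L²(ℝ)`. -/
def IsQuantumEigenvalue (φ : LaurentPoly) (a : ℂ) : Prop :=
  ∃ ψ : ℝ → ℂ, ¬ ψ =ᵐ[volume] 0 ∧ QuantumGraph φ ψ fun r => a * ψ r

end QuantumCurve

end

namespace QuantumCurve

open MeasureTheory Filter Topology Set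

noncomputable section

/-! ### Parallel transport in a local system of rank one -/

/-! Put x₁ = -exp r. Because Δ lies in the strip, φ + a = A(r) x₂ + b(r) + C(r)/x₂. So E_a is a
double cover of the x₁-line with discriminant D = b² - 4AC, and Y = A x₂ - C/x₂ is a square root of
D on the curve. Temperedness makes A and C monomials times powers of 1 + x₁, and reflexivity leaves
three possibilities for each of the coefficients α, β of x₁ and x₁⁻¹.

The eigenfunction comes from a function F on the curve with logarithmic differential -(2πi)⁻¹ r dlog
x₂ + κω. It depends on r rather than on x₁ alone, and passing from r to r - 2πi multiplies it by
-x₂. Given such an F, let ψ(r) be the sum of F/Y, and θ(r) the sum of F, over the two points above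
r. Since A x₂ = (Y - b)/2 and C/x₂ = (-Y - b)/2, one gets A ψ(r - 2πi) = (bψ - θ)/2 and C ψ(r + 2πi)
= (bψ + θ)/2. Adding these gives φ̂ψ = aψ.

Existence of F is a question about a local system of rank one. By temperedness it has local sections
near every point of the compact curve, including the points at the toric boundary (`exists_isChart`,
`exists_ends`, `exists_isBaseChart`). Its monodromy along L is exp(-R_L/(2πi) + κω_L)
(`exists_transport`), and since the group is commutative a basis of H₁ decides
(`LocalSections.exists_global`). The hypothesis V = mω_γ + nω_β reads (R_γ - 4π²n) ω_β = (R_β +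
4π²m) ω_γ. This provides one κ that kills the monodromy along both loops, as soon as the two periods
are not both zero (`exists_flat_of_mem`). If they were, exp ∫ω would be single valued on E_a. The
sum of its values over Y would then be a bounded entire function tending to 0, hence 0, so the two
branches would agree although their logarithmic derivatives are opposite and nonzero
(`not_flatOn_zero`).

It remains to see that ψ is a genuine eigenfunction of the Friedrichs extension. Over x₁ = -1 the
form r dlog x₂ has residues proportional to r. Hence ψ is holomorphic for |Im r| < 2π, which is
enough to test the equation against test functions by moving contours by π
(`FlatOn.innerL2_quantumAction`). On the lines Im r = ±π one has x₁ > 0, and the quadratic form of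
φ̂ becomes a sum of three weighted L²-norms with nonnegative weights
(`Represents.innerL2_quantumAction_self`). The asymptotics of F at the ends show that ψ decays in
all three norms (`FlatOn.exists_bounds`), and Gaussian mollifications of ψ are test functions that
converge to it there (`FlatOn.inFormDomain`). -/

/-- Local sections `s i` on an open cover `U i` whose quotients are locally constant. -/
structure LocalSections (X G ι : Type*) [TopologicalSpace X] [CommGroup G] where
  U : ι → Set X
  isOpen : ∀ i, IsOpen (U i)
  index : X → ι
  mem_index : ∀ x, x ∈ U (index x)
  s : ι → X → G
  locallyConst : ∀ i j, ∀ x ∈ U i ∩ U j, ∀ᶠ y in 𝓝 x, s i y / s j y = s i x / s j x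

namespace LocalSections

variable {X G ι : Type*} [TopologicalSpace X] [CommGroup G] (S : LocalSections X G ι)

/-- `v` is a flat section along the curve `L`. -/
def IsTransport (L : unitInterval → X) (v : unitInterval → G) : Prop :=
  ∀ t, ∃ i, L t ∈ S.U i ∧ ∀ᶠ t' in 𝓝 t, v t' / S.s i (L t') = v t / S.s i (L t)

variable {S}

/-- Quotients of local sections are locally constant, so flatness at a point may be tested in every
chart that contains it. -/
theorem IsTransport.eventually {L : unitInterval → X} {v : unitInterval → G}
    (h : S.IsTransport L v) (hL : Continuous L) {t : unitInterval} {i : ι} (hi : L t ∈ S.U i) :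
    ∀ᶠ t' in 𝓝 t, v t' / S.s i (L t') = v t / S.s i (L t) := by
  obtain ⟨j, hj, hv⟩ := h t
  filter_upwards [hv, hL.continuousAt.eventually (S.locallyConst i j _ ⟨hi, hj⟩)] with t' h1 h2
  have e1 : v t' / S.s i (L t') = (v t' / S.s j (L t')) / (S.s i (L t') / S.s j (L t')) := by
    rw [div_div_div_cancel_right]
  rw [e1, h1, h2, div_div_div_cancel_right]

theorem IsTransport.const_mul {L : unitInterval → X} {v : unitInterval → G}
    (h : S.IsTransport L v) (g : G) : S.IsTransport L fun t => g * v t := by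
  intro t
  obtain ⟨i, hi, hv⟩ := h t
  refine ⟨i, hi, ?_⟩
  filter_upwards [hv] with t' ht'
  rw [mul_div_assoc, ht', mul_div_assoc]

variable [TopologicalSpace G] [DiscreteTopology G]

variable (S) in
/-- The bundle of flat sections. -/
def core : FiberBundleCore ι X G where
  baseSet := S.U
  isOpen_baseSet := S.isOpen
  indexAt := S.index
  mem_baseSet_at := S.mem_index
  -- The value of a flat section is its coordinate in the chart `i` times `s i`; the transition
  -- keeps this product fixed.
  coordChange i j x v := v * (S.s i x / S.s j x)
  coordChange_self i x _ v := by simp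
  continuousOn_coordChange i j := by
    rintro ⟨x, v⟩ ⟨hx, -⟩
    apply ContinuousAt.continuousWithinAt
    have h1 : ContinuousAt (fun q : X × G => S.s i q.1 / S.s j q.1) (x, v) := by
      have h0 : (fun _ : X × G => S.s i x / S.s j x) =ᶠ[𝓝 (x, v)]
          fun q : X × G => S.s i q.1 / S.s j q.1 := by
        have : ContinuousAt Prod.fst (x, v) := continuousAt_fst
        filter_upwards [this.eventually (S.locallyConst i j x hx)] with q hq using hq.symm
      exact continuousAt_const.congr h0
    exact (continuous_mul (M := G)).continuousAt.comp (continuousAt_snd.prodMk h1)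
  coordChange_comp i j k x _ v := by
    rw [mul_assoc, div_mul_div_cancel]

-- A bundle with discrete fibre is a covering. Path lifting and monodromy of coverings therefore
-- give parallel transport and its homotopy invariance.
variable (S) in
theorem isCoveringMap : IsCoveringMap S.core.proj :=
  FiberBundle.isCoveringMap (F := G) (E := S.core.Fiber)

variable (S) in
/-- The value of a point of the bundle, with respect to the local sections. -/
def val (e : S.core.TotalSpace) : G := @id G e.2 * S.s (S.index e.1) e.1

variable (S) in
/-- The point of the bundle with a given value. -/
def pt (x : X) (g : G) : S.core.TotalSpace := ⟨x, (g / S.s (S.index x) x : G)⟩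

theorem pt_val (e : S.core.TotalSpace) : S.pt e.1 (S.val e) = e := by
  obtain ⟨x, g⟩ := e
  simp only [pt, val, mul_div_cancel_right]
  rfl

/-- Lifts of a path to the covering are exactly the flat sections along it: in a local
trivialization, continuity into the discrete fibre means a locally constant coordinate. -/
theorem continuous_iff_isTransport {Γ : unitInterval → S.core.TotalSpace}
    (hL : Continuous fun t => (Γ t).1) :
    Continuous Γ ↔ S.IsTransport (fun t => (Γ t).1) fun t => S.val (Γ t) := by
  have key : ∀ t, ContinuousAt Γ t ↔ ∀ᶠ t' in 𝓝 t,
      S.val (Γ t') / S.s (S.index (Γ t).1) (Γ t').1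
        = S.val (Γ t) / S.s (S.index (Γ t).1) (Γ t).1 := by
    intro t
    rw [FiberBundle.continuousAt_totalSpace G (E := S.core.Fiber) Γ]
    have hc : ∀ t', ((trivializationAt G S.core.Fiber (Γ t).1) (Γ t')).2 =
        S.val (Γ t') / S.s (S.index (Γ t).1) (Γ t').1 := by
      intro t'
      change @id G (Γ t').2 * (S.s (S.index (Γ t').1) (Γ t').1 / S.s (S.index (Γ t).1) (Γ t').1) = _
      rw [val, mul_div_assoc]
    simp only [hc]
    constructor
    · rintro ⟨-, h⟩
      exact h.eventually (IsOpen.mem_nhds (isOpen_discrete {_}) rfl)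
    · intro h
      exact ⟨hL.continuousAt, tendsto_nhds_of_eventually_eq h⟩
  constructor
  · intro h t
    exact ⟨_, S.mem_index _, (key t).1 h.continuousAt⟩
  · intro h
    refine continuous_iff_continuousAt.2 fun t => (key t).2 (h.eventually hL (S.mem_index _))

theorem exists_isTransport {x y : X} (L : Path x y) (g : G) :
    ∃ v, S.IsTransport L v ∧ v 0 = g := by
  obtain ⟨Γ, h1, h2⟩ := S.isCoveringMap.exists_path_lifts (L : C(unitInterval, X)) (S.pt x g)
    (by simp [pt])
  have h3 : (fun t => (Γ t).1) = L := funext fun t => congr_fun h1 t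
  refine ⟨fun t => S.val (Γ t), ?_, ?_⟩
  · have := (continuous_iff_isTransport (Γ := Γ) (by rw [h3]; exact L.continuous)).1 Γ.continuous
    rwa [h3] at this
  · change S.val (Γ 0) = g
    rw [h2]
    simp [val, pt]

theorem val_monodromy {x y : X} (L : Path x y) {v : unitInterval → G} (hv : S.IsTransport L v)
    (e : S.core.proj ⁻¹' {x}) (he : S.val e = v 0) :
    S.val (S.isCoveringMap.monodromy (Path.Homotopic.Quotient.mk L) e) = v 1 := by
  have hc : Continuous fun t => S.pt (L t) (v t) := by
    refine (continuous_iff_isTransport (by simpa [pt] using L.continuous)).2 ?_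
    simpa [pt, val] using hv
  have h0 : (fun t => S.pt (L t) (v t)) 0 = e := by
    obtain ⟨e, he'⟩ := e
    obtain rfl : e.1 = x := he'
    change S.pt (L 0) (v 0) = e
    rw [L.source, ← he, pt_val]
  have h := (S.isCoveringMap.eq_liftPath_iff (γ := (L : C(unitInterval, X))) (e := (e : S.core.TotalSpace))
    (γ_0 := L.source.trans e.2.symm) (Γ := fun t => S.pt (L t) (v t))).2
    ⟨hc, by ext t; simp [pt], h0⟩
  change S.val (S.isCoveringMap.liftPath (L : C(unitInterval, X)) e _ 1) = _
  rw [← h]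
  simp [val, pt]

variable (S) in
/-- The point with value `1` over `x`. -/
def unitPoint (x : X) (g : G) : S.core.proj ⁻¹' {x} := ⟨S.pt x g, by simp [pt]⟩

theorem val_unitPoint (x : X) (g : G) : S.val (S.unitPoint x g : S.core.TotalSpace) = g := by
  simp [unitPoint, pt, val]

/-- Multiplication by `G` acts on the fibres and preserves flatness, so monodromy multiplies all
values in a fibre by the same element. -/
theorem val_monodromy_mul {x y : X} (q : Path.Homotopic.Quotient x y)
    (e e' : S.core.proj ⁻¹' {x}) :
    S.val (S.isCoveringMap.monodromy q e) * S.val e' =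
      S.val (S.isCoveringMap.monodromy q e') * S.val e := by
  obtain ⟨L⟩ := q
  obtain ⟨v, hv, h0⟩ := exists_isTransport (S := S) L 1
  have h := fun e : S.core.proj ⁻¹' {x} =>
    val_monodromy L (hv.const_mul (S.val e)) e (by rw [h0, mul_one])
  change S.val (S.isCoveringMap.monodromy (Path.Homotopic.Quotient.mk L) e) * _ =
    S.val (S.isCoveringMap.monodromy (Path.Homotopic.Quotient.mk L) e') * _
  rw [h e, h e', mul_right_comm, mul_right_comm (S.val e'.1), mul_comm (S.val e.1) (S.val e'.1)]

variable (S) in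
/-- The monodromy representation. -/
def monodromyHom (p : X) : FundamentalGroup X p →* G where
  toFun q := S.val (S.isCoveringMap.monodromy q (S.unitPoint p 1))
  map_one' := by
    change S.val (S.isCoveringMap.monodromy (Path.Homotopic.Quotient.refl p) _) = 1
    rw [IsCoveringMap.monodromy_refl, id, val_unitPoint]
  map_mul' q q' := by
    -- The product `q * q'` is the concatenation that runs through `q'` first.
    change S.val (S.isCoveringMap.monodromy (Path.Homotopic.Quotient.trans q' q) _) = _
    rw [IsCoveringMap.monodromy_trans_apply]
    have := val_monodromy_mul (S := S) q (S.isCoveringMap.monodromy q' (S.unitPoint p 1))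
      (S.unitPoint p 1)
    rwa [val_unitPoint, mul_one] at this

/-- If the monodromy is trivial along loops that generate `H₁`, then there is a global flat
section. -/
theorem exists_global (p : X) (T : Set (FundamentalGroup X p))
    (hT : Subgroup.closure (Abelianization.of '' T) = ⊤)
    (hmon : ∀ q ∈ T, ∃ L : Path p p, q = FundamentalGroup.fromPath (Path.Homotopic.Quotient.mk L) ∧
      ∃ v, S.IsTransport L v ∧ v 0 = v 1) :
    ∃ f : X → G, ∀ x y : X, Joined p x → ∀ (L : Path x y) (v : unitInterval → G),
      S.IsTransport L v → v 1 / v 0 = f y / f x := by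
  -- As `G` is commutative, the representation factors through H₁, where it is trivial on
  -- generators.
  have hker : S.monodromyHom p = 1 := by
    have h1 : Abelianization.lift (S.monodromyHom p) = 1 := by
      refine MonoidHom.eq_of_eqOn_dense hT ?_
      rintro _ ⟨q, hq, rfl⟩
      rw [Abelianization.lift_apply_of, MonoidHom.one_apply]
      obtain ⟨L, rfl, v, hv, hv0⟩ := hmon q hq
      have := val_monodromy L (hv.const_mul (v 0)⁻¹) (S.unitPoint p 1)
        (by rw [val_unitPoint, inv_mul_cancel])
      exact this.trans (by rw [← hv0, inv_mul_cancel])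
    ext q
    have := DFunLike.congr_fun h1 (Abelianization.of q)
    simpa using this
  classical
  -- The global section is the transport of `1` from `p` along any path. Its value at points not
  -- joined to `p` is irrelevant.
  let f : X → G := fun x => if h : Joined p x then
    S.val (S.isCoveringMap.monodromy (Path.Homotopic.Quotient.mk h.somePath) (S.unitPoint p 1))
    else 1
  have hf : ∀ x (L : Path p x), f x =
      S.val (S.isCoveringMap.monodromy (Path.Homotopic.Quotient.mk L) (S.unitPoint p 1)) := by
    intro x L
    have hx : Joined p x := ⟨L⟩
    simp only [f, dif_pos hx]
    set M := hx.somePath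
    -- Insert `L⁻¹ L`: the two paths from `p` differ by a loop at `p`, whose monodromy is trivial.
    have h1 : Path.Homotopic.Quotient.mk M = ((Path.Homotopic.Quotient.mk M).trans
        (Path.Homotopic.Quotient.mk L.symm)).trans (Path.Homotopic.Quotient.mk L) := by
      rw [Path.Homotopic.Quotient.trans_assoc]
      simp
    have h2 : S.val (S.isCoveringMap.monodromy ((Path.Homotopic.Quotient.mk M).trans
        (Path.Homotopic.Quotient.mk L.symm)) (S.unitPoint p 1)) = 1 :=
      DFunLike.congr_fun hker (FundamentalGroup.fromPath ((Path.Homotopic.Quotient.mk M).trans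
        (Path.Homotopic.Quotient.mk L.symm)))
    have h3 := val_monodromy_mul (S := S) (Path.Homotopic.Quotient.mk L)
      (S.isCoveringMap.monodromy ((Path.Homotopic.Quotient.mk M).trans
        (Path.Homotopic.Quotient.mk L.symm)) (S.unitPoint p 1)) (S.unitPoint p 1)
    rw [h2, val_unitPoint, mul_one, mul_one, ← IsCoveringMap.monodromy_trans_apply, ← h1] at h3
    exact h3
  refine ⟨f, fun x y hx L v hv => ?_⟩
  set M := hx.somePath
  rw [hf y (M.trans L), hf x M, Path.Homotopic.Quotient.mk_trans,
    IsCoveringMap.monodromy_trans_apply]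
  set e := S.isCoveringMap.monodromy (Path.Homotopic.Quotient.mk M) (S.unitPoint p 1)
  have := val_monodromy L (hv.const_mul (S.val e / v 0)) e (by simp)
  rw [this]
  rw [div_mul_eq_mul_div, div_div, mul_div_mul_comm, mul_comm]
  simp [div_eq_mul_inv]

end LocalSections

/-! ### The shape of an integrally tempered polynomial in the strip -/

theorem primitiveVector_smul (v v' : ℤ × ℤ) :
    v + (latticeLength v v' : ℤ) • primitiveVector v v' = v' := by
  have h1 : (latticeLength v v' : ℤ) ∣ v'.1 - v.1 := Int.gcd_dvd_left ..
  have h2 : (latticeLength v v' : ℤ) ∣ v'.2 - v.2 := Int.gcd_dvd_right ..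
  ext
  · simp [primitiveVector, Int.mul_ediv_cancel' h1]
  · simp [primitiveVector, Int.mul_ediv_cancel' h2]

/-- The exponent of the power of `w + 1` must be the lattice length: the coefficient at that degree
is the vertex coefficient 1, and the edge polynomial has no terms beyond it. The coefficients on the
edge are thus binomial. -/
theorem IsIntegrallyTempered.edge_coeff {Δ : Set (ℝ × ℝ)} {φ : LaurentPoly}
    (hφ : IsIntegrallyTempered Δ φ) {v v' : ℤ × ℤ} (h : IsEdge Δ v v') {t : ℕ}
    (ht : t ≤ latticeLength v v') :
    φ (v + (t : ℤ) • primitiveVector v v') = (latticeLength v v').choose t := by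
  obtain ⟨n, hn⟩ := hφ.edge v v' h
  have hc : ∀ s, (edgePolynomial φ v v').coeff s =
      if s ≤ latticeLength v v' then φ (v + (s : ℤ) • primitiveVector v v') else 0 := by
    intro s
    simp [edgePolynomial, Polynomial.coeff_monomial]
  have hlast : (edgePolynomial φ v v').coeff (latticeLength v v') = 1 := by
    rw [hc, if_pos le_rfl, primitiveVector_smul, hφ.vertex _ h.2.1]
  have hnl : n = latticeLength v v' := by
    rw [hn, Polynomial.coeff_X_add_one_pow] at hlast
    have h1 : latticeLength v v' ≤ n := by
      by_contra hlt
      rw [Nat.choose_eq_zero_of_lt (by omega)] at hlast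
      simp at hlast
    by_contra hne
    have h2 := hc n
    rw [hn, Polynomial.coeff_X_add_one_pow, if_neg (by omega)] at h2
    simp at h2
  have := hc t
  rw [if_pos ht, hn, Polynomial.coeff_X_add_one_pow, hnl] at this
  exact this.symm

theorem latticePoint_smul_add (a b : ℝ) (p q : ℝ × ℝ) (m : ℤ × ℤ)
    (h : a • p + b • q = latticePoint m) :
    a * p.1 + b * q.1 = m.1 ∧ a * p.2 + b * q.2 = m.2 := by
  have h1 := congrArg Prod.fst h
  have h2 := congrArg Prod.snd h
  simpa [latticePoint] using And.intro h1 h2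

theorem IsReflexive.ball {Δ : Set (ℝ × ℝ)} (hΔ : IsReflexive Δ) :
    ∃ ε > 0, ∀ x y : ℝ, |x| ≤ ε → |y| ≤ ε → (x, y) ∈ Δ := by
  have h0 : ((0 : ℝ), (0 : ℝ)) ∈ interior Δ := by
    have := (hΔ.interior_iff 0).2 rfl
    simpa [latticePoint] using this
  obtain ⟨ε, hε, h⟩ := Metric.isOpen_iff.1 isOpen_interior _ h0
  refine ⟨ε / 2, by positivity, fun x y hx hy => interior_subset (h ?_)⟩
  rw [Metric.mem_ball, Prod.dist_eq]
  simp only [Real.dist_eq, sub_zero]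
  exact max_lt (by linarith) (by linarith)

theorem IsReflexive.convex {Δ : Set (ℝ × ℝ)} (hΔ : IsReflexive Δ) : Convex ℝ Δ := by
  obtain ⟨S, rfl⟩ := hΔ.isLattice
  exact convex_convexHull ..

/-- A lattice point that lies strictly between an interior point and a point of `Δ` is `0`. -/
theorem IsReflexive.eq_zero_of_openSegment {Δ : Set (ℝ × ℝ)} (hΔ : IsReflexive Δ) {m : ℤ × ℤ}
    {p q : ℝ × ℝ} (hp : p ∈ interior Δ) (hq : q ∈ Δ) (h : latticePoint m ∈ openSegment ℝ p q) :
    m = 0 :=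
  (hΔ.interior_iff m).1
    (hΔ.convex.openSegment_interior_self_subset_interior hp hq h)

theorem IsReflexive.zero_mem_interior {Δ : Set (ℝ × ℝ)} (hΔ : IsReflexive Δ) :
    ((0 : ℝ), (0 : ℝ)) ∈ interior Δ := by
  have := (hΔ.interior_iff 0).2 rfl
  simpa [latticePoint] using this

theorem snd_cases {Δ : Set (ℝ × ℝ)} (hstrip : Δ ⊆ univ ×ˢ Icc (-1 : ℝ) 1) {m : ℤ × ℤ}
    (hm : latticePoint m ∈ Δ) : m.2 = 1 ∨ m.2 = -1 ∨ m.2 = 0 := by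
  have h := (hstrip hm).2
  simp only [latticePoint, mem_Icc] at h
  have h1 : (-1 : ℤ) ≤ m.2 := by exact_mod_cast h.1
  have h2 : m.2 ≤ (1 : ℤ) := by exact_mod_cast h.2
  omega

/-- The lattice points of `Δ` in the row `y = ε` with `ε = ±1`, and the coefficients there. -/
theorem exists_row {Δ : Set (ℝ × ℝ)} (hΔ : IsReflexive Δ)
    (hstrip : Δ ⊆ univ ×ˢ Icc (-1 : ℝ) 1) {φ : LaurentPoly} (hφ : IsIntegrallyTempered Δ φ)
    (ε : ℤ) (hε : ε = 1 ∨ ε = -1) :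
    ∃ (i : ℤ) (k : ℕ), IsVertex Δ (i, ε) ∧ IsVertex Δ (i + k, ε) ∧
      (∀ m : ℤ × ℤ, latticePoint m ∈ Δ → m.2 = ε → i ≤ m.1 ∧ m.1 ≤ i + k) ∧
      ∀ t ≤ k, φ (i + t, ε) = k.choose t := by
  classical
  obtain ⟨S, hS⟩ := hΔ.isLattice
  have hε2 : (ε : ℝ) * ε = 1 := by rcases hε with rfl | rfl <;> norm_num
  have hSΔ : ∀ m ∈ S, latticePoint m ∈ Δ := fun m hm => hS ▸ subset_convexHull ℝ _ ⟨m, hm, rfl⟩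
  have hrow : ∀ p ∈ Δ, (ε : ℝ) * p.2 ≤ 1 := by
    intro p hp
    have := (hstrip hp).2
    rcases hε with rfl | rfl <;> simp at this ⊢ <;> linarith
  have hmin : ∀ T : Set (ℝ × ℝ), Convex ℝ T → (∀ m ∈ S, latticePoint m ∈ T) → Δ ⊆ T := by
    intro T hT h
    rw [hS]
    refine convexHull_min ?_ hT
    rintro _ ⟨m, hm, rfl⟩
    exact h m hm
  have hlin : ∀ u v c : ℝ, Convex ℝ {p : ℝ × ℝ | u * p.1 + v * p.2 ≤ c} := by
    intro u v c
    refine convex_halfSpace_le (f := fun p : ℝ × ℝ => u * p.1 + v * p.2) ⟨?_, ?_⟩ c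
    · intro x y; simp; ring
    · intro a x; simp; ring
  set R := S.filter fun m => m.2 = ε with hR
  -- Without a generator in the row, Δ would lie in the half plane ε y ≤ 0 and 0 would not be
  -- interior.
  have hne : R.Nonempty := by
    by_contra hempty
    have h1 : Δ ⊆ {p : ℝ × ℝ | 0 * p.1 + ε * p.2 ≤ 0} := by
      refine hmin _ (hlin _ _ _) fun m hm => ?_
      have h2 : m.2 ≠ ε := fun h => hempty ⟨m, by simp [hR, hm, h]⟩
      have h3 := snd_cases hstrip (hSΔ m hm)
      have h4 : ε * m.2 ≤ 0 := by rcases hε with rfl | rfl <;> omega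
      have h5 : (ε : ℝ) * m.2 ≤ 0 := by exact_mod_cast h4
      simpa [latticePoint] using h5
    obtain ⟨δ, hδ, hb⟩ := hΔ.ball
    have := h1 (hb 0 (ε * δ) (by simp [hδ.le]) (by
      rcases hε with rfl | rfl <;> simp [abs_of_pos hδ]))
    simp only [mem_ofPred_eq, zero_mul, zero_add, ← mul_assoc, hε2, one_mul] at this
    linarith
  -- the vertex at the end of the row in direction `σ`
  have hend : ∀ σ : ℤ, σ = 1 ∨ σ = -1 → ∃ u : ℤ, IsVertex Δ (u, ε) ∧
      ∀ p ∈ Δ, p.2 = ε → (σ : ℝ) * p.1 ≤ σ * u := by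
    intro σ hσ
    have hσ2 : (σ : ℝ) * σ = 1 := by rcases hσ with rfl | rfl <;> norm_num
    obtain ⟨m, hm, hmax⟩ := R.exists_max_image (fun m => σ * m.1) hne
    obtain ⟨hmS, hm2⟩ := Finset.mem_filter.1 hm
    -- With `N` this large, the functional σ x + N ε y is maximal on Δ at the chosen end of the row;
    -- on the row itself it bounds σ x.
    obtain ⟨N, hN0, hN⟩ : ∃ N : ℝ, 0 ≤ N ∧ ∀ n ∈ S, (σ : ℝ) * n.1 ≤ σ * m.1 + N := by
      obtain ⟨M, hM⟩ := (S.image fun n => (σ : ℝ) * n.1 - σ * m.1).bddAbove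
      refine ⟨max M 0, le_max_right _ _, fun n hn => ?_⟩
      have := hM (Finset.mem_coe.2 (Finset.mem_image_of_mem _ hn))
      have := le_max_left M 0
      linarith
    have h1 : Δ ⊆ {p : ℝ × ℝ | σ * p.1 + (N * ε) * p.2 ≤ σ * m.1 + N} := by
      refine hmin _ (hlin _ _ _) fun n hn => ?_
      change (σ : ℝ) * n.1 + N * ε * n.2 ≤ _
      by_cases h : n.2 = ε
      · have h2 : σ * n.1 ≤ σ * m.1 := hmax n (by simp [hR, hn, h])
        have h3 : (σ : ℝ) * n.1 ≤ σ * m.1 := by exact_mod_cast h2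
        rw [h, mul_assoc, hε2]
        linarith
      · have h3 := snd_cases hstrip (hSΔ n hn)
        have h4 : ε * n.2 ≤ 0 := by rcases hε with rfl | rfl <;> omega
        have h5 : (ε : ℝ) * n.2 ≤ 0 := by exact_mod_cast h4
        have := hN n hn
        nlinarith
    have h2 : ∀ p ∈ Δ, p.2 = ε → (σ : ℝ) * p.1 ≤ σ * m.1 := by
      intro p hp hp2
      have := h1 hp
      simp only [mem_ofPred_eq, hp2, mul_assoc, hε2] at this
      linarith
    refine ⟨m.1, ?_, h2⟩
    have hmε : ((m.1, ε) : ℤ × ℤ) = m := by rw [← hm2]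
    rw [hmε, IsVertex, mem_extremePoints]
    refine ⟨hSΔ m hmS, ?_⟩
    rintro p hp q hq ⟨a, b, ha, hb, hab, h⟩
    obtain ⟨hx, hy⟩ := latticePoint_smul_add a b p q m h
    rw [hm2] at hy
    have hp1 := hrow p hp
    have hq1 := hrow q hq
    have e1 : a * (1 - ε * p.2) + b * (1 - ε * q.2) = 0 := by
      linear_combination hab - ε * hy - hε2
    have hpa : 1 - (ε : ℝ) * p.2 = 0 := by nlinarith [mul_nonneg hb.le (sub_nonneg.2 hq1)]
    have hqa : 1 - (ε : ℝ) * q.2 = 0 := by nlinarith [mul_nonneg ha.le (sub_nonneg.2 hp1)]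
    have hp2 : p.2 = ε := by linear_combination (-ε : ℝ) * hpa - p.2 * hε2
    have hq2 : q.2 = ε := by linear_combination (-ε : ℝ) * hqa - q.2 * hε2
    have hp3 := h2 p hp hp2
    have hq3 := h2 q hq hq2
    have e2 : a * (σ * m.1 - σ * p.1) + b * (σ * m.1 - σ * q.1) = 0 := by
      linear_combination σ * m.1 * hab - σ * hx
    have hpb : (σ : ℝ) * m.1 - σ * p.1 = 0 := by nlinarith [mul_nonneg hb.le (sub_nonneg.2 hq3)]
    have hqb : (σ : ℝ) * m.1 - σ * q.1 = 0 := by nlinarith [mul_nonneg ha.le (sub_nonneg.2 hp3)]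
    constructor
    · ext
      · simp only [latticePoint]
        linear_combination (-σ : ℝ) * hpb + (m.1 - p.1 : ℝ) * hσ2
      · simp [latticePoint, hp2, hm2]
    · ext
      · simp only [latticePoint]
        linear_combination (-σ : ℝ) * hqb + (m.1 - q.1 : ℝ) * hσ2
      · simp [latticePoint, hq2, hm2]
  obtain ⟨i, hiv, hi⟩ := hend (-1) (Or.inr rfl)
  obtain ⟨i', hiv', hi'⟩ := hend 1 (Or.inl rfl)
  have hbd : ∀ m : ℤ × ℤ, latticePoint m ∈ Δ → m.2 = ε → i ≤ m.1 ∧ m.1 ≤ i' := by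
    intro m hm hm2
    have h1 := hi _ hm (by simp [latticePoint, hm2])
    have h2 := hi' _ hm (by simp [latticePoint, hm2])
    simp only [latticePoint, Int.cast_neg, Int.cast_one, neg_mul, one_mul, neg_le_neg_iff] at h1 h2
    exact ⟨by exact_mod_cast h1, by exact_mod_cast h2⟩
  have hii' : i ≤ i' := (hbd (i, ε) hiv.1 rfl).2
  obtain ⟨k, hk⟩ := Int.eq_ofNat_of_zero_le (sub_nonneg.2 hii')
  obtain rfl : i' = i + k := by omega
  refine ⟨i, k, hiv, hiv', hbd, fun t ht => ?_⟩
  rcases Nat.eq_zero_or_pos k with hk0 | hk0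
  · obtain rfl : t = 0 := by omega
    simp [hφ.vertex _ hiv]
  · have hlen : latticeLength (i, ε) (i + k, ε) = k := by
      simp [latticeLength]
    have hprim : primitiveVector (i, ε) (i + k, ε) = (1, 0) := by
      have : (k : ℤ) ≠ 0 := by omega
      simp only [primitiveVector, hlen]
      simp [Int.ediv_self this]
    have hedge : IsEdge Δ (i, ε) (i + k, ε) := by
      refine ⟨hiv, hiv', by simp; omega, ?_⟩
      intro p hp
      have hpΔ : p ∈ Δ := hΔ.convex.segment_subset hiv.1 hiv'.1 hp
      have hp2 : p.2 = ε := by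
        obtain ⟨a, b, -, -, hab, rfl⟩ := hp
        simp [latticePoint, ← add_mul, hab]
      refine ⟨subset_closure hpΔ, fun hint => ?_⟩
      obtain ⟨δ, hδ, hb⟩ := Metric.isOpen_iff.1 isOpen_interior _ hint
      have hmem : (p.1, p.2 + ε * (δ / 2)) ∈ Metric.ball p δ := by
        rw [Metric.mem_ball, Prod.dist_eq]
        simp
        have h3 : |(ε : ℝ)| = 1 := by rcases hε with rfl | rfl <;> simp
        rw [h3, abs_of_pos hδ]
        exact ⟨hδ, by linarith⟩
      have h3 := hrow _ (interior_subset (hb hmem))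
      simp only [hp2, mul_add, ← mul_assoc, hε2] at h3
      linarith
    have := hφ.edge_coeff hedge (t := t) (by rw [hlen]; exact ht)
    rw [hlen, hprim] at this
    simpa using this

/-- The coefficient on the horizontal axis, between the ends of the two rows. -/
theorem axis_cases {Δ : Set (ℝ × ℝ)} (hΔ : IsReflexive Δ)
    (hstrip : Δ ⊆ univ ×ˢ Icc (-1 : ℝ) 1) {φ : LaurentPoly} (hφ : IsIntegrallyTempered Δ φ)
    (σ : ℤ) (hσ : σ = 1 ∨ σ = -1) (u v : ℤ) (hu : IsVertex Δ (u, 1)) (hv : IsVertex Δ (v, -1))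
    (hu' : ∀ m : ℤ × ℤ, latticePoint m ∈ Δ → m.2 = 1 → σ * m.1 ≤ σ * u)
    (hv' : ∀ m : ℤ × ℤ, latticePoint m ∈ Δ → m.2 = -1 → σ * m.1 ≤ σ * v) :
    (∀ m : ℤ, latticePoint (m, 0) ∈ Δ → σ * m ≤ 1) ∧
    ((σ * (u + v) = 2 ∧ φ (σ, 0) = 2) ∨ (σ * (u + v) ≤ 1 ∧ φ (σ, 0) = 1) ∨
      (σ * (u + v) = 1 ∧ φ (σ, 0) = 0)) := by
  have hσ2 : (σ : ℝ) * σ = 1 := by rcases hσ with rfl | rfl <;> norm_num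
  have hσ2' : σ * σ = 1 := by rcases hσ with rfl | rfl <;> norm_num
  have hσ0 : ((σ, 0) : ℤ × ℤ) ≠ 0 := by rcases hσ with rfl | rfl <;> simp
  -- a point of the axis beyond `σ` is impossible
  have hfar : ∀ x : ℝ, (x, (0 : ℝ)) ∈ Δ → σ * x ≤ 1 := by
    intro x hx
    by_contra hlt
    push Not at hlt
    refine hσ0 (hΔ.eq_zero_of_openSegment hΔ.zero_mem_interior hx ?_)
    refine ⟨1 - (σ * x)⁻¹, (σ * x)⁻¹, ?_, by positivity, by ring, ?_⟩
    · have := inv_lt_one_of_one_lt₀ hlt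
      linarith
    · have hx0 : x ≠ 0 := by rintro rfl; norm_num at hlt
      have hs0 : (σ : ℝ) ≠ 0 := by rintro h; simp [h] at hσ2
      ext
      · simp [latticePoint]
        field_simp
        linear_combination -hσ2
      · simp [latticePoint]
  refine ⟨fun m hm => ?_, ?_⟩
  · have := hfar m (by simpa [latticePoint] using hm)
    exact_mod_cast this
  have hmid : (((u + v : ℤ) : ℝ) / 2, (0 : ℝ)) ∈ Δ := by
    have := hΔ.convex hu.1 hv.1 (a := 1 / 2) (b := 1 / 2) (by norm_num) (by norm_num) (by norm_num)
    convert this using 1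
    ext
    · simp [latticePoint]; ring
    · simp [latticePoint]
  have hle2 : σ * (u + v) ≤ 2 := by
    have := hfar _ hmid
    have h2 : (σ : ℝ) * ((u + v : ℤ) : ℝ) ≤ 2 := by linarith
    exact_mod_cast h2
  rcases hle2.eq_or_lt with heq | hlt
  · -- the point `(σ, 0)` is the midpoint of an edge
    left
    have huv : u + v = 2 * σ := by linear_combination (u + v) * (-hσ2') + σ * heq
    refine ⟨heq, ?_⟩
    obtain rfl : v = 2 * σ - u := by omega
    have hg : latticeLength (u, 1) (2 * σ - u, -1) = 2 := by
      have h1 : (2 * σ - u) - u = 2 * (σ - u) := by ring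
      have h2 : (-1 - 1 : ℤ) = 2 * (-1) := by norm_num
      simp only [latticeLength, h1, h2, Int.gcd_mul_left]
      simp
    have hp : primitiveVector (u, 1) (2 * σ - u, -1) = (σ - u, -1) := by
      simp only [primitiveVector, hg]
      ext
      · simp; omega
      · simp
    have hedge : IsEdge Δ (u, 1) (2 * σ - u, -1) := by
      refine ⟨hu, hv, by simp, ?_⟩
      rintro p ⟨a, b, ha, hb, hab, rfl⟩
      set p := a • latticePoint (u, 1) + b • latticePoint (2 * σ - u, -1) with hp
      have hpΔ : p ∈ Δ := hΔ.convex hu.1 hv.1 ha hb hab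
      refine ⟨subset_closure hpΔ, fun hint => ?_⟩
      have hb' : b = 1 - a := by linarith
      -- An interior point of the segment would make its midpoint (σ, 0) interior: the midpoint is
      -- that point itself or lies between it and one of the two vertices.
      rcases lt_trichotomy a (1 / 2) with h | h | h
      · refine hσ0 (hΔ.eq_zero_of_openSegment hint hu.1 ?_)
        have h1 : (0 : ℝ) < 1 - a := by linarith
        refine ⟨(1 / 2) / (1 - a), 1 - (1 / 2) / (1 - a), by positivity, ?_, by ring, ?_⟩
        · rw [sub_pos, div_lt_one h1]; linarith
        · ext
          · simp [hp, latticePoint, hb']; field_simp; ring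
          · simp [hp, latticePoint, hb']; field_simp; ring
      · refine hσ0 ((hΔ.interior_iff _).1 ?_)
        convert hint using 1
        ext
        · simp [hp, latticePoint, hb', h]; ring
        · simp [hp, latticePoint, hb', h]; norm_num
      · refine hσ0 (hΔ.eq_zero_of_openSegment hint hv.1 ?_)
        have h1 : (0 : ℝ) < a := by linarith
        refine ⟨(1 / 2) / a, 1 - (1 / 2) / a, by positivity, ?_, by ring, ?_⟩
        · rw [sub_pos, div_lt_one h1]; linarith
        · ext
          · simp [hp, latticePoint, hb']; field_simp; ring
          · simp [hp, latticePoint, hb']; field_simp; ring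
    have := hφ.edge_coeff hedge (t := 1) (by rw [hg]; norm_num)
    rw [hg, hp] at this
    simpa using this
  right
  obtain ⟨S, hS⟩ := hΔ.isLattice
  have hSΔ : ∀ m ∈ S, latticePoint m ∈ Δ := fun m hm => hS ▸ subset_convexHull ℝ _ ⟨m, hm, rfl⟩
  have hmin : ∀ T : Set (ℝ × ℝ), Convex ℝ T → (∀ m ∈ S, latticePoint m ∈ T) → Δ ⊆ T := by
    intro T hT h
    rw [hS]
    refine convexHull_min ?_ hT
    rintro _ ⟨m, hm, rfl⟩
    exact h m hm
  have hlin : ∀ u v c : ℝ, Convex ℝ {p : ℝ × ℝ | u * p.1 + v * p.2 ≤ c} := by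
    intro u v c
    refine convex_halfSpace_le (f := fun p : ℝ × ℝ => u * p.1 + v * p.2) ⟨?_, ?_⟩ c
    · intro x y; simp; ring
    · intro a x; simp; ring
  -- The slope for which σ x + τ y takes the same value σ(u + v)/2 at (u, 1) and (v, -1).
  set τ : ℝ := σ * ((v : ℝ) - u) / 2 with hτ
  have hrows : ∀ m ∈ S, (m.2 = 1 ∧ σ * (m.1 : ℝ) ≤ σ * u) ∨ (m.2 = -1 ∧ σ * (m.1 : ℝ) ≤ σ * v) ∨
      m.2 = 0 := by
    intro m hm
    rcases snd_cases hstrip (hSΔ m hm) with h | h | h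
    · exact Or.inl ⟨h, by exact_mod_cast hu' m (hSΔ m hm) h⟩
    · exact Or.inr (Or.inl ⟨h, by exact_mod_cast hv' m (hSΔ m hm) h⟩)
    · exact Or.inr (Or.inr h)
  have hlt' : σ * (u + v) ≤ 1 := by omega
  by_cases h1 : latticePoint (σ, 0) ∈ Δ
  · left
    refine ⟨hlt', hφ.vertex _ ?_⟩
    have hltR : (σ : ℝ) * (u + v) ≤ 1 := by exact_mod_cast hlt'
    -- Together the two inequalities say σ x + τ y + |y|/2 ≤ 1 on Δ. Equality holds at (σ, 0), and
    -- the term |y|/2 confines any segment through that point to the axis, so it is a vertex.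
    have hbound : ∀ s : ℝ, s = 1 / 2 ∨ s = -1 / 2 → ∀ p ∈ Δ, σ * p.1 + (τ + s) * p.2 ≤ 1 := by
      intro s hs
      refine hmin _ (hlin _ _ _) fun m hm => ?_
      change (σ : ℝ) * m.1 + (τ + s) * m.2 ≤ 1
      rcases hrows m hm with ⟨h, h'⟩ | ⟨h, h'⟩ | h
      · rw [h, hτ]; push_cast
        rcases hs with rfl | rfl <;> linarith
      · rw [h, hτ]; push_cast
        rcases hs with rfl | rfl <;> linarith
      · have h3 := hfar m.1 (by
          have := hSΔ m hm
          simpa [latticePoint, h] using this)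
        rw [h]; simpa using h3
    rw [IsVertex, mem_extremePoints]
    refine ⟨h1, ?_⟩
    rintro p hp q hq ⟨a, b, ha, hb, hab, h⟩
    obtain ⟨hx, hy⟩ := latticePoint_smul_add a b p q _ h
    simp only [Int.cast_zero] at hx hy
    have e : ∀ z ∈ Δ, σ * z.1 + τ * z.2 + |z.2| / 2 ≤ 1 := by
      intro z hz
      have e1 := hbound (1 / 2) (Or.inl rfl) z hz
      have e2 := hbound (-1 / 2) (Or.inr rfl) z hz
      rcases abs_cases z.2 with ⟨h, -⟩ | ⟨h, -⟩ <;> rw [h] <;> linarith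
    have ep := e p hp
    have eq := e q hq
    have e3 : a * (1 - σ * p.1 - τ * p.2) + b * (1 - σ * q.1 - τ * q.2) = 0 := by
      linear_combination hab - σ * hx - τ * hy - hσ2
    have hap := abs_nonneg p.2
    have haq := abs_nonneg q.2
    have zp : 1 - σ * p.1 - τ * p.2 = 0 := by
      nlinarith [mul_nonneg hb.le (show 0 ≤ 1 - σ * q.1 - τ * q.2 by linarith)]
    have zq : 1 - σ * q.1 - τ * q.2 = 0 := by
      nlinarith [mul_nonneg ha.le (show 0 ≤ 1 - σ * p.1 - τ * p.2 by linarith)]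
    have yp : p.2 = 0 := abs_eq_zero.1 (le_antisymm (by linarith) hap)
    have yq : q.2 = 0 := abs_eq_zero.1 (le_antisymm (by linarith) haq)
    rw [yp] at zp
    rw [yq] at zq
    constructor
    · ext
      · simp only [latticePoint]
        linear_combination (-σ : ℝ) * zp - p.1 * hσ2
      · simp [latticePoint, yp]
    · ext
      · simp only [latticePoint]
        linear_combination (-σ : ℝ) * zq - q.1 * hσ2
      · simp [latticePoint, yq]
  · right
    have hzero : φ (σ, 0) = 0 := by
      by_contra h
      exact h1 (hφ.support_subset _ (Finsupp.mem_support_iff.2 h))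
    refine ⟨?_, hzero⟩
    by_contra hne
    -- Then Δ would lie in the half plane σ x + τ y ≤ 0, contradicting that 0 is interior.
    have hle0 : σ * (u + v) ≤ 0 := by omega
    have hleR : (σ : ℝ) * (u + v) ≤ 0 := by exact_mod_cast hle0
    have hsub : Δ ⊆ {p : ℝ × ℝ | σ * p.1 + τ * p.2 ≤ 0} := by
      refine hmin _ (hlin _ _ _) fun m hm => ?_
      change (σ : ℝ) * m.1 + τ * m.2 ≤ 0
      rcases hrows m hm with ⟨h, h'⟩ | ⟨h, h'⟩ | h
      · rw [h, hτ]; push_cast; linarith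
      · rw [h, hτ]; push_cast; linarith
      · rw [h]
        have hmem := hSΔ m hm
        have h3 := hfar m.1 (by simpa [latticePoint, h] using hmem)
        have h4 : σ * m.1 ≤ 1 := by exact_mod_cast h3
        have h5 : σ * m.1 ≠ 1 := by
          intro h6
          apply h1
          have : m = (σ, 0) := by
            ext
            · simp only; linear_combination (-m.1) * hσ2' + σ * h6
            · exact h
          rwa [← this]
        have h6 : σ * m.1 ≤ 0 := by omega
        have h7 : (σ : ℝ) * m.1 ≤ 0 := by exact_mod_cast h6
        simpa using h7
    obtain ⟨δ, hδ, hb⟩ := hΔ.ball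
    have := hsub (hb (σ * δ) 0 (by
      rcases hσ with rfl | rfl <;> simp [abs_of_pos hδ]) (by simp [hδ.le]))
    simp only [mem_ofPred_eq, ← mul_assoc, hσ2] at this
    linarith

/-- The data of a tempered polynomial
`x₁ ^ i (1 + x₁) ^ k x₂ + α x₁ + β x₁⁻¹ + x₁ ^ j (1 + x₁) ^ l x₂⁻¹` and of a parameter `a`. -/
structure CurveData where
  i : ℤ
  j : ℤ
  k : ℕ
  l : ℕ
  α : ℂ
  β : ℂ
  a : ℂ

namespace CurveData

/-- `φ` is the Laurent polynomial of the data, in terms of linear functionals. -/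
def Represents (d : CurveData) (φ : LaurentPoly) : Prop :=
  ∀ f : ℤ × ℤ → ℂ, (φ.sum fun m c => c * f m) =
    (∑ t ∈ Finset.range (d.k + 1), (d.k.choose t : ℂ) * f (d.i + t, 1)) +
    (∑ t ∈ Finset.range (d.l + 1), (d.l.choose t : ℂ) * f (d.j + t, -1)) +
    d.α * f (1, 0) + d.β * f (-1, 0)

end CurveData

/-- An integrally tempered Laurent polynomial of a reflexive polygon in the strip. -/
theorem exists_curveData {Δ : Set (ℝ × ℝ)} (hΔ : IsReflexive Δ)
    (hstrip : Δ ⊆ univ ×ˢ Icc (-1 : ℝ) 1) {φ : LaurentPoly} (hφ : IsIntegrallyTempered Δ φ)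
    (a : ℂ) : ∃ d : CurveData, d.a = a ∧ d.Represents φ ∧
      ((d.i + d.k + (d.j + d.l) = 2 ∧ d.α = 2) ∨ (d.i + d.k + (d.j + d.l) ≤ 1 ∧ d.α = 1) ∨
        (d.i + d.k + (d.j + d.l) = 1 ∧ d.α = 0)) ∧
      ((d.i + d.j = -2 ∧ d.β = 2) ∨ (-1 ≤ d.i + d.j ∧ d.β = 1) ∨
        (d.i + d.j = -1 ∧ d.β = 0)) := by
  classical
  obtain ⟨i, k, hi, hi', hik, hA⟩ := exists_row hΔ hstrip hφ 1 (Or.inl rfl)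
  obtain ⟨j, l, hj, hj', hjl, hC⟩ := exists_row hΔ hstrip hφ (-1) (Or.inr rfl)
  obtain ⟨hr, hr'⟩ := axis_cases hΔ hstrip hφ 1 (Or.inl rfl) (i + k) (j + l) hi' hj'
    (fun m hm h => by have := hik m hm h; omega) (fun m hm h => by have := hjl m hm h; omega)
  obtain ⟨hl, hl'⟩ := axis_cases hΔ hstrip hφ (-1) (Or.inr rfl) i j hi hj
    (fun m hm h => by have := hik m hm h; omega) (fun m hm h => by have := hjl m hm h; omega)
  refine ⟨⟨i, j, k, l, φ (1, 0), φ (-1, 0), a⟩, rfl, ?_, ?_, ?_⟩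
  · intro f
    set T₁ := (Finset.range (k + 1)).image fun t : ℕ => ((i + t, 1) : ℤ × ℤ)
    set T₂ := (Finset.range (l + 1)).image fun t : ℕ => ((j + t, -1) : ℤ × ℤ)
    set T₃ : Finset (ℤ × ℤ) := {(1, 0), (-1, 0)}
    have hsub : φ.support ⊆ T₁ ∪ T₂ ∪ T₃ := by
      rintro ⟨x, y⟩ hm
      have hmΔ := hφ.support_subset _ hm
      rcases snd_cases hstrip hmΔ with h | h | h
      · obtain rfl : y = 1 := h
        have := hik _ hmΔ rfl
        refine Finset.mem_union_left _ (Finset.mem_union_left _ (Finset.mem_image.2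
          ⟨(x - i).toNat, ?_, ?_⟩))
        · simp; omega
        · ext <;> simp; omega
      · obtain rfl : y = -1 := h
        have := hjl _ hmΔ rfl
        refine Finset.mem_union_left _ (Finset.mem_union_right _ (Finset.mem_image.2
          ⟨(x - j).toNat, ?_, ?_⟩))
        · simp; omega
        · ext <;> simp; omega
      · obtain rfl : y = 0 := h
        have h1 := hr x hmΔ
        have h2 := hl x hmΔ
        have h3 : x ≠ 0 := by
          rintro rfl
          exact Finsupp.mem_support_iff.1 hm hφ.constantTerm
        refine Finset.mem_union_right _ ?_
        simp [T₃]; omega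
    rw [Finsupp.sum_of_support_subset _ hsub _ (by simp), Finset.sum_union, Finset.sum_union]
    · rw [Finset.sum_image (by intro x _ y _ h; simpa using h),
        Finset.sum_image (by intro x _ y _ h; simpa using h), add_assoc _ (_ * f (1, 0))]
      congr 1
      · congr 1
        · refine Finset.sum_congr rfl fun t ht => ?_
          rw [hA t (by simpa [Nat.lt_succ_iff] using ht)]
        · refine Finset.sum_congr rfl fun t ht => ?_
          rw [hC t (by simpa [Nat.lt_succ_iff] using ht)]
      · simp [T₃]
    · rw [Finset.disjoint_left]
      intro m h1 h2
      obtain ⟨t, -, rfl⟩ := Finset.mem_image.1 h1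
      obtain ⟨s, -, h⟩ := Finset.mem_image.1 h2
      simp at h
    · rw [Finset.disjoint_left]
      intro m h1 h2
      rcases Finset.mem_union.1 h1 with h1 | h1 <;> obtain ⟨t, -, rfl⟩ := Finset.mem_image.1 h1 <;>
        simp [T₃] at h2
  · simpa using hr'
  · rcases hl' with ⟨h, h'⟩ | ⟨h, h'⟩ | ⟨h, h'⟩
    · exact Or.inl ⟨by simp only; omega, h'⟩
    · exact Or.inr (Or.inl ⟨by simp only; omega, h'⟩)
    · exact Or.inr (Or.inr ⟨by simp only; omega, h'⟩)

/-! ### Binomial sums -/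

theorem sum_choose_mul_zpow {x : ℂ} (hx : x ≠ 0) (i : ℤ) (k : ℕ) :
    ∑ t ∈ Finset.range (k + 1), (k.choose t : ℂ) * x ^ (i + t) = x ^ i * (1 + x) ^ k := by
  rw [add_comm 1 x, add_pow, Finset.mul_sum]
  refine Finset.sum_congr rfl fun t _ => ?_
  rw [zpow_add₀ hx, zpow_natCast, one_pow]
  ring

/-- Differentiate the binomial identity and multiply by `x`. For k = 0 the truncated exponent `k -
1` does no harm because of the factor `k`. -/
theorem sum_choose_mul_zpow_deriv {x : ℂ} (hx : x ≠ 0) (i : ℤ) (k : ℕ) :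
    ∑ t ∈ Finset.range (k + 1), (k.choose t : ℂ) * (((i + t : ℤ) : ℂ) * x ^ (i + t)) =
      i * (x ^ i * (1 + x) ^ k) + k * (x ^ (i + 1) * (1 + x) ^ (k - 1)) := by
  have h1 : HasDerivAt (fun z : ℂ => ∑ t ∈ Finset.range (k + 1), (k.choose t : ℂ) * z ^ (i + t))
      (∑ t ∈ Finset.range (k + 1), (k.choose t : ℂ) * (((i + t : ℤ) : ℂ) * x ^ (i + t - 1))) x := by
    refine HasDerivAt.fun_sum fun t _ => ?_
    exact (hasDerivAt_zpow (i + t) x (Or.inl hx)).const_mul _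
  have h2 : HasDerivAt (fun z : ℂ => z ^ i * (1 + z) ^ k)
      (i * x ^ (i - 1) * (1 + x) ^ k + x ^ i * (k * (1 + x) ^ (k - 1) * 1)) x :=
    (hasDerivAt_zpow i x (Or.inl hx)).mul (((hasDerivAt_id x).const_add 1).pow k)
  have h3 := (h1.congr_of_eventuallyEq (f₁ := fun z : ℂ => z ^ i * (1 + z) ^ k) (by
    filter_upwards [isOpen_ne.mem_nhds hx] with z hz
    exact (sum_choose_mul_zpow hz i k).symm)).unique h2
  have h4 := congrArg (· * x) h3
  simp only [Finset.sum_mul, mul_one, add_mul] at h4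
  have h5 : x ^ (i - 1) * x = x ^ i := by
    rw [← zpow_add_one₀ hx]; congr 1; ring
  rw [show (i : ℂ) * x ^ (i - 1) * (1 + x) ^ k * x = i * ((x ^ (i - 1) * x) * (1 + x) ^ k) by ring,
    h5, show x ^ i * (k * (1 + x) ^ (k - 1)) * x = k * ((x ^ i * x) * (1 + x) ^ (k - 1)) by ring,
    ← zpow_add_one₀ hx] at h4
  rw [← h4]
  refine Finset.sum_congr rfl fun t _ => ?_
  rw [mul_assoc, mul_assoc, ← zpow_add_one₀ hx]
  congr 3; ring

/-! ### The curve in the coordinates r and x₂, where x₁ = -exp r -/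

namespace CurveData

variable (d : CurveData)

/-- The coefficient of `x₂`, as a function of `r` where `x₁ = -exp r`. -/
def A (r : ℂ) : ℂ := (-Complex.exp r) ^ d.i * (1 - Complex.exp r) ^ d.k

/-- The coefficient of `x₂⁻¹`. -/
def C (r : ℂ) : ℂ := (-Complex.exp r) ^ d.j * (1 - Complex.exp r) ^ d.l

/-- The coefficient of `x₂ ^ 0` in `φ + a`. -/
def b (r : ℂ) : ℂ := -d.α * Complex.exp r - d.β * Complex.exp (-r) + d.a

/-- The discriminant. -/
def D (r : ℂ) : ℂ := d.b r ^ 2 - 4 * (d.A r * d.C r)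

/-- The derivative of `A`. -/
def A' (r : ℂ) : ℂ := d.i * d.A r +
  d.k * ((-Complex.exp r) ^ (d.i + 1) * (1 - Complex.exp r) ^ (d.k - 1))

/-- The derivative of `C`. -/
def C' (r : ℂ) : ℂ := d.j * d.C r +
  d.l * ((-Complex.exp r) ^ (d.j + 1) * (1 - Complex.exp r) ^ (d.l - 1))

/-- The derivative of `b`. -/
def b' (r : ℂ) : ℂ := -d.α * Complex.exp r + d.β * Complex.exp (-r)

/-- The derivative of the discriminant. -/
def D' (r : ℂ) : ℂ := 2 * (d.b r * d.b' r) - 4 * (d.A' r * d.C r + d.A r * d.C' r)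

theorem hasDerivAt_row (i : ℤ) (k : ℕ) (r : ℂ) :
    HasDerivAt (fun r => (-Complex.exp r) ^ i * (1 - Complex.exp r) ^ k)
      (i * ((-Complex.exp r) ^ i * (1 - Complex.exp r) ^ k) +
        k * ((-Complex.exp r) ^ (i + 1) * (1 - Complex.exp r) ^ (k - 1))) r := by
  have hx : -Complex.exp r ≠ 0 := neg_ne_zero.2 (Complex.exp_ne_zero r)
  have h1 := (hasDerivAt_zpow i (-Complex.exp r) (Or.inl hx)).comp r (Complex.hasDerivAt_exp r).neg
  have h2 := ((Complex.hasDerivAt_exp r).const_sub 1).pow k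
  convert! h1.mul h2 using 1
  have h5 : (-Complex.exp r) ^ i = (-Complex.exp r) ^ (i - 1) * (-Complex.exp r) := by
    rw [← zpow_add_one₀ hx]; congr 1; ring
  rw [zpow_add_one₀ hx, h5]
  simp [h5]
  ring

theorem hasDerivAt_A (r : ℂ) : HasDerivAt d.A (d.A' r) r := hasDerivAt_row d.i d.k r

theorem hasDerivAt_C (r : ℂ) : HasDerivAt d.C (d.C' r) r := hasDerivAt_row d.j d.l r

theorem hasDerivAt_b (r : ℂ) : HasDerivAt d.b (d.b' r) r := by
  have h1 := (Complex.hasDerivAt_exp r).const_mul (-d.α)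
  have h2 := ((Complex.hasDerivAt_exp (-r)).comp r (hasDerivAt_neg r)).const_mul d.β
  convert! (h1.sub h2).add_const d.a using 1
  simp [b']

theorem hasDerivAt_D (r : ℂ) : HasDerivAt d.D (d.D' r) r := by
  have h := ((d.hasDerivAt_b r).pow 2).sub
    (((d.hasDerivAt_A r).mul (d.hasDerivAt_C r)).const_mul 4)
  convert! h using 1
  simp [D']
  ring

/-- The left hand side of the equation of the curve. -/
def curveEq (r x : ℂ) : ℂ := d.A r * x + d.b r + d.C r / x

/-- The function `x₂ ∂₂ φ`. -/
def Y (r x : ℂ) : ℂ := d.A r * x - d.C r / x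

/-- The function `x₁ ∂₁ φ`. -/
def X₁ (r x : ℂ) : ℂ := d.A' r * x + d.b' r + d.C' r / x

variable {d} {φ : LaurentPoly} (h : d.Represents φ)
include h

/-- Testing the representation against the indicator function of `m` computes the coefficient of
`m`, which vanishes unless `m` occurs in the list. -/
theorem Represents.forall_support {P : ℤ × ℤ → Prop}
    (h1 : ∀ t : ℕ, t ≤ d.k → P (d.i + t, 1)) (h2 : ∀ t : ℕ, t ≤ d.l → P (d.j + t, -1))
    (h3 : P (1, 0)) (h4 : P (-1, 0)) : ∀ m ∈ φ.support, P m := by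
  classical
  intro m hm
  by_contra hP
  have h0 := h fun n => if n = m then 1 else 0
  have e1 : (φ.sum fun n c => c * (if n = m then 1 else 0)) = φ m := by
    rw [Finsupp.sum]
    simp only [mul_ite, mul_one, mul_zero]
    rw [Finset.sum_ite_eq']
    simp [hm]
  rw [e1, Finset.sum_eq_zero, Finset.sum_eq_zero, if_neg, if_neg] at h0
  · apply Finsupp.mem_support_iff.1 hm
    simpa using h0
  · rintro rfl; exact hP h4
  · rintro rfl; exact hP h3
  · intro t ht
    rw [if_neg, mul_zero]
    rintro rfl
    exact hP (h2 t (by simpa [Nat.lt_succ_iff] using ht))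
  · intro t ht
    rw [if_neg, mul_zero]
    rintro rfl
    exact hP (h1 t (by simpa [Nat.lt_succ_iff] using ht))

theorem Represents.eval_eq (r x : ℂ) :
    eval φ (-Complex.exp r, x) + d.a = d.curveEq r x := by
  have hx : -Complex.exp r ≠ 0 := neg_ne_zero.2 (Complex.exp_ne_zero r)
  have h0 := h fun m => (-Complex.exp r) ^ m.1 * x ^ m.2
  simp only [eval, mul_assoc, h0]
  simp only [← mul_assoc, ← Finset.sum_mul, sum_choose_mul_zpow hx]
  simp [curveEq, A, b, C, Complex.exp_neg, sub_eq_add_neg, div_eq_mul_inv]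
  ring

theorem Represents.partial₂_eq (r x : ℂ) (hx2 : x ≠ 0) :
    x * partial₂ φ (-Complex.exp r, x) = d.Y r x := by
  have hx : -Complex.exp r ≠ 0 := neg_ne_zero.2 (Complex.exp_ne_zero r)
  have h0 := h fun m => (-Complex.exp r) ^ m.1 * (m.2 * x ^ (m.2 - 1))
  simp only [partial₂, mul_assoc, h0]
  simp only [← mul_assoc, ← Finset.sum_mul, sum_choose_mul_zpow hx]
  simp [Y, A, C, sub_eq_add_neg]
  rw [mul_add]
  field_simp

theorem Represents.partial₁_eq (r x : ℂ) :
    -Complex.exp r * partial₁ φ (-Complex.exp r, x) = d.X₁ r x := by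
  have hx : -Complex.exp r ≠ 0 := neg_ne_zero.2 (Complex.exp_ne_zero r)
  have h0 := h fun m => m.1 * (-Complex.exp r) ^ m.1 * x ^ m.2
  have h1 : -Complex.exp r * partial₁ φ (-Complex.exp r, x) =
      φ.sum fun m c => c * (m.1 * (-Complex.exp r) ^ m.1 * x ^ m.2) := by
    rw [partial₁, Finsupp.mul_sum]
    refine Finsupp.sum_congr fun m _ => ?_
    have : (-Complex.exp r) ^ m.1 = (-Complex.exp r) ^ (m.1 - 1) * (-Complex.exp r) := by
      rw [← zpow_add_one₀ hx]; congr 1; ring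
    rw [this]
    ring
  rw [h1, h0]
  simp only [← mul_assoc, ← Finset.sum_mul]
  simp only [mul_assoc, sum_choose_mul_zpow_deriv hx]
  simp [X₁, A', b', C', A, C, Complex.exp_neg, sub_eq_add_neg, div_eq_mul_inv]
  ring

/-- The local equation is φ + a multiplied by u, so the constant term becomes a u and contributes `g
(1, 0)`. -/
theorem Represents.chart_sum (n n' : ℤ × ℤ) (g : ℤ × ℤ → ℂ) :
    ((chartEquation φ d.a n n').sum fun m c => c * g m) =
    (∑ t ∈ Finset.range (d.k + 1), (d.k.choose t : ℂ) *
      g (pairing n (d.i + t, 1) + 1, pairing n' (d.i + t, 1))) +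
    (∑ t ∈ Finset.range (d.l + 1), (d.l.choose t : ℂ) *
      g (pairing n (d.j + t, -1) + 1, pairing n' (d.j + t, -1))) +
    d.α * g (pairing n (1, 0) + 1, pairing n' (1, 0)) +
    d.β * g (pairing n (-1, 0) + 1, pairing n' (-1, 0)) + d.a * g (1, 0) := by
  rw [chartEquation, Finsupp.sum_mapDomain_index (by simp) (by intros; ring),
    Finsupp.sum_add_index' (by simp) (by intros; ring),
    h fun m => g (pairing n m + 1, pairing n' m), Finsupp.sum_single_index (by simp)]
  simp [pairing]

end CurveData

/-! ### What smoothness says along the toric divisors and in the torus -/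

/-- The conditions on the data that come from reflexivity and smoothness. -/
structure CurveData.Admissible (d : CurveData) : Prop where
  right : (d.i + d.k + (d.j + d.l) = 2 ∧ d.α = 2 ∧ d.a ≠ d.k + d.l) ∨
    (d.i + d.k + (d.j + d.l) ≤ 1 ∧ d.α = 1) ∨ (d.i + d.k + (d.j + d.l) = 1 ∧ d.α = 0)
  left : (d.i + d.j = -2 ∧ d.β = 2 ∧ d.a ≠ d.k + d.l) ∨ (-1 ≤ d.i + d.j ∧ d.β = 1) ∨
    (d.i + d.j = -1 ∧ d.β = 0)
  simple : ∀ r, d.D r = 0 → d.D' r ≠ 0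
  a_ne : d.a ≠ 0

namespace CurveData

variable {d : CurveData} {φ : LaurentPoly}

/-- Near x₂ = ∞, with u = x₂⁻¹ and v = x₁, the local equation is A + b u + C u². If A has a multiple
zero at x₁ = -1 and b vanishes there, both partial derivatives vanish at (0, -1). -/
theorem smooth_top (h : d.Represents φ) (hs : IsSmoothFiber φ d.a) {r : ℂ}
    (hr : Complex.exp r = 1) (hb : d.b r = 0) : d.k ≤ 1 := by
  by_contra hk
  have hneg : (-1 : ℂ) ≠ 0 := by norm_num
  have h0 : (0 : ℂ) ^ d.k = 0 := zero_pow (by omega)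
  have h0' : (0 : ℂ) ^ (d.k - 1) = 0 := zero_pow (by omega)
  have := hs.boundary (0, -1) (1, 0) (by norm_num)
    (h.forall_support (by simp [pairing]) (by simp [pairing]) (by simp [pairing])
      (by simp [pairing])) (-1) hneg ?_
  · rcases this with h1 | h1 <;> apply h1
    · simp only [partial₁, mul_assoc]
      rw [h.chart_sum (0, -1) (1, 0) fun m => m.1 * ((0 : ℂ) ^ (m.1 - 1) * (-1) ^ m.2)]
      simp only [b, Complex.exp_neg, hr] at hb
      simp [pairing]
      linear_combination hb
    · simp only [partial₂, mul_assoc]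
      rw [h.chart_sum (0, -1) (1, 0) fun m => (0 : ℂ) ^ m.1 * (m.2 * (-1) ^ (m.2 - 1))]
      have h2 := sum_choose_mul_zpow_deriv hneg d.i d.k
      rw [show (1 : ℂ) + -1 = 0 by norm_num, h0, h0'] at h2
      simp only [pairing]
      simp [zpow_sub₀ hneg, div_neg] at h2 ⊢
      exact h2
  · simp only [eval, mul_assoc]
    rw [h.chart_sum (0, -1) (1, 0) fun m => (0 : ℂ) ^ m.1 * (-1) ^ m.2]
    have h2 := sum_choose_mul_zpow hneg d.i d.k
    rw [show (1 : ℂ) + -1 = 0 by norm_num, h0] at h2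
    simp only [pairing]
    simp at h2 ⊢
    exact h2

/-- The mirror image at x₂ = 0, where u = x₂ and v = x₁⁻¹, with A and C exchanged. -/
theorem smooth_bottom (h : d.Represents φ) (hs : IsSmoothFiber φ d.a) {r : ℂ}
    (hr : Complex.exp r = 1) (hb : d.b r = 0) : d.l ≤ 1 := by
  by_contra hk
  have hneg : (-1 : ℂ) ≠ 0 := by norm_num
  have h0 : (0 : ℂ) ^ d.l = 0 := zero_pow (by omega)
  have h0' : (0 : ℂ) ^ (d.l - 1) = 0 := zero_pow (by omega)
  have hinv : ∀ t : ℤ, (-1 : ℂ) ^ (-t) = (-1) ^ t := fun t => by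
    rw [zpow_neg, ← inv_zpow]; norm_num
  have := hs.boundary (0, 1) (-1, 0) (by norm_num)
    (h.forall_support (by simp [pairing]) (by simp [pairing]) (by simp [pairing])
      (by simp [pairing])) (-1) hneg ?_
  · rcases this with h1 | h1 <;> apply h1
    · simp only [partial₁, mul_assoc]
      rw [h.chart_sum (0, 1) (-1, 0) fun m => m.1 * ((0 : ℂ) ^ (m.1 - 1) * (-1) ^ m.2)]
      simp only [b, Complex.exp_neg, hr] at hb
      simp [pairing]
      linear_combination hb
    · simp only [partial₂, mul_assoc]
      rw [h.chart_sum (0, 1) (-1, 0) fun m => (0 : ℂ) ^ m.1 * (m.2 * (-1) ^ (m.2 - 1))]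
      have h2 := sum_choose_mul_zpow_deriv hneg d.j d.l
      rw [show (1 : ℂ) + -1 = 0 by norm_num, h0, h0'] at h2
      have h3 : ∀ t : ℕ, (-1 : ℂ) ^ (-(t : ℤ) + -(d.j : ℤ)) = (-1) ^ (d.j + t) := fun t => by
        rw [← hinv]; congr 1; ring
      simp only [pairing]
      simp [zpow_sub₀ hneg, h3, div_neg] at h2 ⊢
      rw [← neg_eq_zero, ← Finset.sum_neg_distrib, ← h2]
      exact Finset.sum_congr rfl fun t _ => by ring
  · simp only [eval, mul_assoc]
    rw [h.chart_sum (0, 1) (-1, 0) fun m => (0 : ℂ) ^ m.1 * (-1) ^ m.2]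
    have h2 := sum_choose_mul_zpow hneg d.j d.l
    rw [show (1 : ℂ) + -1 = 0 by norm_num, h0] at h2
    have h3 : ∀ t : ℕ, (-1 : ℂ) ^ (-(t : ℤ) + -(d.j : ℤ)) = (-1) ^ (d.j + t) := fun t => by
      rw [← hinv]; congr 1; ring
    simp only [pairing]
    simp [h3] at h2 ⊢
    exact h2

/-- The ends of the two rows are joined by an edge of lattice length 2. In the chart of its inner
normal the equation on u = 0 is v⁻¹ + 2 + v, with a double zero at v = -1. There the u-derivative
collects the coefficients k, l next to the ends of the rows and the constant term, and equals a - k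
- l. -/
theorem smooth_right (h : d.Represents φ) (hs : IsSmoothFiber φ d.a)
    (hij : d.i + d.k + (d.j + d.l) = 2) (hα : d.α = 2) : d.a ≠ d.k + d.l := by
  intro ha
  have hneg : (-1 : ℂ) ≠ 0 := by norm_num
  have hp1 : ∀ t : ℤ, pairing (-1, d.i + d.k - 1) (d.i + t, 1) + 1 = d.k - t := fun t => by
    simp [pairing]; ring
  have hp2 : ∀ t : ℤ, pairing (-1, d.i + d.k - 1) (d.j + t, -1) + 1 = d.l - t := fun t => by
    simp [pairing]; linear_combination -hij
  have hz : ∀ n t : ℕ, t ∈ Finset.range (n + 1) → t ≠ n → (0 : ℂ) ^ ((n : ℤ) - t) = 0 := by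
    intro n t ht hne
    apply zero_zpow
    omega
  have hz' : ∀ n t : ℕ, t ∈ Finset.range (n + 1) → t ≠ n → ∀ c : ℂ,
      (n.choose t : ℂ) * ((((n : ℤ) - t : ℤ) : ℂ) * ((0 : ℂ) ^ ((n : ℤ) - t - 1) * c)) =
        if t = n - 1 then n * c else 0 := by
    intro n t ht hne c
    have ht' : t < n := by simp at ht; omega
    split_ifs with h1
    · subst h1
      rw [Nat.choose_symm (n := n) (k := 1) (by omega)]
      have : ((n : ℤ) - (n - 1 : ℕ) : ℤ) = 1 := by omega
      simp [this]
    · rw [zero_zpow _ (by omega)]; simp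
  have hsum : ∀ (n : ℕ) (c : ℂ), ∑ t ∈ Finset.range (n + 1), (n.choose t : ℂ) *
      ((((n : ℤ) - t : ℤ) : ℂ) * ((0 : ℂ) ^ ((n : ℤ) - t - 1) * c)) = n * c := by
    intro n c
    rw [Finset.sum_range_succ]
    rw [Finset.sum_congr rfl fun t ht => hz' n t (by simp at ht ⊢; omega)
      (by simp at ht; omega) c]
    rcases Nat.eq_zero_or_pos n with rfl | hn
    · simp
    · rw [Finset.sum_ite_eq' , if_pos (by simp; omega)]; simp
  have hsum0 : ∀ (n : ℕ) (c : ℂ), ∑ t ∈ Finset.range (n + 1), (n.choose t : ℂ) *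
      ((0 : ℂ) ^ ((n : ℤ) - t) * c) = c := by
    intro n c
    rw [Finset.sum_eq_single n (fun t ht hne => by rw [hz n t ht hne]; simp) (by simp)]
    simp
  have := hs.boundary (-1, d.i + d.k - 1) (0, -1) (by norm_num) ?_ (-1) hneg ?_
  · rcases this with h1 | h1 <;> apply h1
    · simp only [partial₁, mul_assoc]
      rw [h.chart_sum _ _ fun m => m.1 * ((0 : ℂ) ^ (m.1 - 1) * (-1) ^ m.2)]
      simp only [hp1, hp2]
      simp only [pairing, zero_mul, mul_one, zero_add, mul_neg, neg_neg, neg_mul, one_mul]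
      rw [hsum, hsum, ha]
      simp
      ring
    · simp only [partial₂, mul_assoc]
      rw [h.chart_sum _ _ fun m => (0 : ℂ) ^ m.1 * (m.2 * (-1) ^ (m.2 - 1))]
      simp only [hp1, hp2]
      simp only [pairing, zero_mul, mul_one, zero_add, mul_neg, neg_neg, neg_mul, one_mul]
      rw [hsum0, hsum0]
      simp
  · refine h.forall_support (fun t ht => ?_) (fun t ht => ?_) ?_ ?_
    · have := hp1 t; omega
    · have := hp2 t; omega
    · simp [pairing]
    · simp [pairing]
  · simp only [eval, mul_assoc]
    rw [h.chart_sum _ _ fun m => (0 : ℂ) ^ m.1 * (-1) ^ m.2]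
    simp only [hp1, hp2]
    simp only [pairing, zero_mul, mul_one, zero_add, mul_neg, neg_neg, neg_mul, one_mul]
    rw [hsum0, hsum0, hα]
    simp
    norm_num

/-- The same computation for the edge that joins the left ends of the two rows. -/
theorem smooth_left (h : d.Represents φ) (hs : IsSmoothFiber φ d.a)
    (hij : d.i + d.j = -2) (hβ : d.β = 2) : d.a ≠ d.k + d.l := by
  intro ha
  have hneg : (-1 : ℂ) ≠ 0 := by norm_num
  have hp1 : ∀ t : ℤ, pairing (1, -1 - d.i) (d.i + t, 1) + 1 = t := fun t => by
    simp [pairing]; ring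
  have hp2 : ∀ t : ℤ, pairing (1, -1 - d.i) (d.j + t, -1) + 1 = t := fun t => by
    simp [pairing]; linear_combination hij
  have hz' : ∀ n t : ℕ, ∀ c : ℂ,
      (n.choose t : ℂ) * (((t : ℤ) : ℂ) * ((0 : ℂ) ^ ((t : ℤ) - 1) * c)) =
        if t = 1 then n * c else 0 := by
    intro n t c
    split_ifs with h1
    · subst h1
      simp
    · rcases Nat.eq_zero_or_pos t with rfl | ht
      · simp
      · rw [zero_zpow _ (by omega)]; simp
  have hsum : ∀ (n : ℕ) (c : ℂ), ∑ t ∈ Finset.range (n + 1), (n.choose t : ℂ) *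
      (((t : ℤ) : ℂ) * ((0 : ℂ) ^ ((t : ℤ) - 1) * c)) = n * c := by
    intro n c
    simp only [hz']
    rcases Nat.eq_zero_or_pos n with rfl | hn
    · simp
    · rw [Finset.sum_ite_eq', if_pos (by simp; omega)]
  have hsum0 : ∀ (n : ℕ) (c : ℂ), ∑ t ∈ Finset.range (n + 1), (n.choose t : ℂ) *
      ((0 : ℂ) ^ (t : ℤ) * c) = c := by
    intro n c
    rw [Finset.sum_eq_single 0 (fun t ht hne => by simp [hne]) (by simp)]
    simp
  have := hs.boundary (1, -1 - d.i) (0, 1) (by norm_num) ?_ (-1) hneg ?_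
  · rcases this with h1 | h1 <;> apply h1
    · simp only [partial₁, mul_assoc]
      rw [h.chart_sum _ _ fun m => m.1 * ((0 : ℂ) ^ (m.1 - 1) * (-1) ^ m.2)]
      simp only [hp1, hp2]
      simp only [pairing, zero_mul, mul_one, zero_add, mul_neg, mul_zero, add_zero]
      rw [hsum, hsum, ha]
      simp
      ring
    · simp only [partial₂, mul_assoc]
      rw [h.chart_sum _ _ fun m => (0 : ℂ) ^ m.1 * (m.2 * (-1) ^ (m.2 - 1))]
      simp only [hp1, hp2]
      simp only [pairing, zero_mul, mul_one, zero_add, mul_neg, mul_zero, add_zero]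
      rw [hsum0, hsum0]
      simp
  · refine h.forall_support (fun t ht => ?_) (fun t ht => ?_) ?_ ?_
    · have := hp1 t; omega
    · have := hp2 t; omega
    · simp [pairing]
    · simp [pairing]
  · simp only [eval, mul_assoc]
    rw [h.chart_sum _ _ fun m => (0 : ℂ) ^ m.1 * (-1) ^ m.2]
    simp only [hp1, hp2]
    simp only [pairing, zero_mul, mul_one, zero_add, mul_neg, mul_zero, add_zero]
    rw [hsum0, hsum0, hβ]
    simp
    norm_num

theorem mem_affineCurve (h : d.Represents φ) (r x : ℂ) :
    (-Complex.exp r, x) ∈ affineCurve φ d.a ↔ x ≠ 0 ∧ d.curveEq r x = 0 := by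
  simp [affineCurve, h.eval_eq]

theorem discriminant_eq (d : CurveData) {r x : ℂ} (hx : x ≠ 0) (h : d.curveEq r x = 0) :
    d.Y r x ^ 2 = d.D r := by
  have hb : d.b r = -(d.A r * x + d.C r / x) := by rw [curveEq] at h; linear_combination h
  rw [Y, D, hb]
  field_simp
  ring

/-- At a branch point the derivative of the discriminant is x₁∂₁φ times -4 A x₂. This is how
smoothness of the curve controls the order of the zeros of D. -/
theorem D'_eq (d : CurveData) {r x : ℂ} (hx : x ≠ 0) (h : d.curveEq r x = 0) (hY : d.Y r x = 0) :
    d.D' r = -4 * (d.A r * x * d.X₁ r x) := by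
  have hC : d.C r = d.A r * x ^ 2 := by
    rw [Y] at hY; field_simp at hY; linear_combination -hY
  have hb : d.b r = -(2 * (d.A r * x)) := by
    rw [curveEq, hC] at h; field_simp at h; linear_combination h
  rw [D', X₁, hb, hC]
  field_simp
  ring

theorem exp_eq_one_of_A_eq_zero (d : CurveData) {r : ℂ} (h : d.A r = 0) :
    Complex.exp r = 1 ∧ d.k ≠ 0 := by
  rcases mul_eq_zero.1 h with h | h
  · exact absurd h (zpow_ne_zero _ (neg_ne_zero.2 (Complex.exp_ne_zero r)))
  · refine ⟨?_, ?_⟩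
    · linear_combination -(eq_zero_of_pow_eq_zero h)
    · rintro h0; simp [h0] at h

theorem exp_eq_one_of_C_eq_zero (d : CurveData) {r : ℂ} (h : d.C r = 0) :
    Complex.exp r = 1 ∧ d.l ≠ 0 :=
  exp_eq_one_of_A_eq_zero ⟨d.j, d.i, d.l, d.k, d.α, d.β, d.a⟩ h

theorem smooth_torus (h : d.Represents φ) (hs : IsSmoothFiber φ d.a) {r x : ℂ} (hx : x ≠ 0)
    (he : d.curveEq r x = 0) (hY : d.Y r x = 0) : d.X₁ r x ≠ 0 := by
  have h1 := hs.torus _ ((mem_affineCurve h r x).2 ⟨hx, he⟩)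
  rw [← h.partial₁_eq]
  rw [← h.partial₂_eq r x hx] at hY
  have h2 := (mul_eq_zero.1 hY).resolve_left hx
  exact mul_ne_zero (neg_ne_zero.2 (Complex.exp_ne_zero r)) (h1.resolve_right (not_not.2 h2))

/-- If AC ≠ 0, the double root x₂ = -b/(2A) is a point of the curve with Y = 0, and smoothness in
the torus applies through `D'_eq`. If AC = 0, then b = 0 and x₁ = -1, so k, l ≤ 1 by smoothness at
the toric boundary. -/
theorem simple_of_smooth (h : d.Represents φ) (hs : IsSmoothFiber φ d.a) (r : ℂ)
    (hD : d.D r = 0) : d.D' r ≠ 0 := by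
  have hx1 : -Complex.exp r ≠ 0 := neg_ne_zero.2 (Complex.exp_ne_zero r)
  by_cases hAC : d.A r * d.C r = 0
  · have hb : d.b r = 0 := by
      rw [D, hAC] at hD; simpa using hD
    have hr : Complex.exp r = 1 := by
      rcases mul_eq_zero.1 hAC with h | h
      · exact (d.exp_eq_one_of_A_eq_zero h).1
      · exact (d.exp_eq_one_of_C_eq_zero h).1
    have hk := smooth_top h hs hr hb
    have hl := smooth_bottom h hs hr hb
    have hu : ∀ t : ℤ, (-1 : ℂ) ^ t ≠ 0 := fun t => zpow_ne_zero _ (by norm_num)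
    have hkl : d.k = 0 ∧ d.l = 1 ∨ d.k = 1 ∧ d.l = 0 ∨ d.k = 1 ∧ d.l = 1 := by
      rcases mul_eq_zero.1 hAC with h | h
      · have := (d.exp_eq_one_of_A_eq_zero h).2; omega
      · have := (d.exp_eq_one_of_C_eq_zero h).2; omega
    rcases hkl with ⟨h1, h2⟩ | ⟨h1, h2⟩ | ⟨h1, h2⟩
    · simp [D', hb, A, C, A', C', h1, h2, hr, hu]
    · simp [D', hb, A, C, A', C', h1, h2, hr, hu]
    -- Now A, b and C all vanish at x₁ = -1, so every x₂ ≠ 0 is on the curve. A root of the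
    -- quadratic polynomial x₂·X₁ in x₂ is a singular point.
    · exfalso
      have hquad := exists_quadratic_eq_zero (K := ℂ) (a := (-1) ^ (d.i + 1)) (b := d.b' r)
        (c := (-1) ^ (d.j + 1)) (hu _) (by
          obtain ⟨s, hs⟩ := IsAlgClosed.exists_pow_nat_eq
            (discrim ((-1 : ℂ) ^ (d.i + 1)) (d.b' r) ((-1) ^ (d.j + 1))) (n := 2) (by norm_num)
          exact ⟨s, by rw [← hs, sq]⟩)
      obtain ⟨x, hx⟩ := hquad
      have hx0 : x ≠ 0 := by
        rintro rfl
        simp at hx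
        exact hu _ hx
      refine smooth_torus h hs (r := r) (x := x) hx0 ?_ ?_ ?_
      · simp [curveEq, A, C, h1, h2, hr, hb]
      · simp [Y, A, C, h1, h2, hr]
      · simp only [X₁, A', C', A, C, h1, h2, hr]
        simp
        field_simp
        linear_combination hx
  · have hA := left_ne_zero_of_mul hAC
    have hb2 : d.b r ^ 2 = 4 * (d.A r * d.C r) := by rw [D] at hD; linear_combination hD
    have hb : d.b r ≠ 0 := by
      intro h0; rw [h0] at hb2; apply hAC; linear_combination -hb2 / 4
    set x := -d.b r / (2 * d.A r) with hx
    have hx0 : x ≠ 0 := div_ne_zero (neg_ne_zero.2 hb) (mul_ne_zero two_ne_zero hA)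
    have hAx : d.A r * x = -d.b r / 2 := by rw [hx]; field_simp
    have hCx : d.C r / x = -d.b r / 2 := by
      rw [hx]; field_simp; linear_combination hb2
    have he : d.curveEq r x = 0 := by rw [curveEq, hAx, hCx]; ring
    have hY : d.Y r x = 0 := by rw [Y, hAx, hCx]; ring
    rw [d.D'_eq hx0 he hY]
    refine mul_ne_zero (by norm_num) (mul_ne_zero (mul_ne_zero hA hx0) ?_)
    exact smooth_torus h hs hx0 he hY

end CurveData

theorem exists_admissible {Δ : Set (ℝ × ℝ)} (hΔ : IsReflexive Δ)
    (hstrip : Δ ⊆ univ ×ˢ Icc (-1 : ℝ) 1) {φ : LaurentPoly} (hφ : IsIntegrallyTempered Δ φ)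
    {a : ℂ} (ha : a ∈ moduli φ) :
    ∃ d : CurveData, d.a = a ∧ d.Represents φ ∧ d.Admissible := by
  obtain ⟨d, rfl, h, hr, hl⟩ := exists_curveData hΔ hstrip hφ a
  refine ⟨d, rfl, h, ?_, ?_, CurveData.simple_of_smooth h ha.2, ha.1⟩
  · rcases hr with hr | hr | hr
    · exact Or.inl ⟨hr.1, hr.2, CurveData.smooth_right h ha.2 hr.1 hr.2⟩
    · exact Or.inr (Or.inl hr)
    · exact Or.inr (Or.inr hr)
  · rcases hl with hl | hl | hl
    · exact Or.inl ⟨hl.1, hl.2, CurveData.smooth_left h ha.2 hl.1 hl.2⟩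
    · exact Or.inr (Or.inl hl)
    · exact Or.inr (Or.inr hl)

open Metric

local notation "πi" => (Real.pi * Complex.I : ℂ)

/-! ### Holomorphic functions on discs -/

theorem exists_log_ball {f : ℂ → ℂ} {c : ℂ} {ρ : ℝ} (hρ : 0 < ρ) (hf : DifferentiableOn ℂ f (ball c ρ))
    (h0 : ∀ z ∈ ball c ρ, f z ≠ 0) (w : ℂ) (hw : Complex.exp w = f c) :
    ∃ L : ℂ → ℂ, L c = w ∧ (∀ z ∈ ball c ρ, HasDerivAt L (deriv f z / f z) z) ∧
      ∀ z ∈ ball c ρ, Complex.exp (L z) = f z := by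
  have hd : DifferentiableOn ℂ (fun z => deriv f z / f z) (ball c ρ) :=
    (hf.deriv isOpen_ball).div hf h0
  obtain ⟨L, hL, hL'⟩ := hd.isExactOn_ball.with_val_at c w
  refine ⟨L, hL, hL', ?_⟩
  have hder : ∀ z ∈ ball c ρ, HasDerivAt (fun z => f z * Complex.exp (-L z)) 0 z := by
    intro z hz
    have h1 := (hf.differentiableAt (isOpen_ball.mem_nhds hz)).hasDerivAt.mul (hL' z hz).neg.cexp
    convert! h1 using 1
    have := h0 z hz
    field_simp
    ring
  have hconst : ∀ z ∈ ball c ρ, f z * Complex.exp (-L z) = f c * Complex.exp (-L c) := by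
    intro z hz
    refine (convex_ball c ρ).is_const_of_fderivWithin_eq_zero (𝕜 := ℂ)
      (f := fun z => f z * Complex.exp (-L z))
      (fun z hz => (hder z hz).differentiableAt.differentiableWithinAt) ?_ hz (mem_ball_self hρ)
    intro z hz
    rw [fderivWithin_of_isOpen isOpen_ball hz]
    ext
    simp [(hder z hz).deriv]
  intro z hz
  have := hconst z hz
  rw [hL, ← hw, ← Complex.exp_add, add_neg_cancel, Complex.exp_zero, Complex.exp_neg] at this
  field_simp at this
  exact this.symm

theorem exists_sqrt_ball {f : ℂ → ℂ} {c : ℂ} {ρ : ℝ} (hρ : 0 < ρ)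
    (hf : DifferentiableOn ℂ f (ball c ρ)) (h0 : ∀ z ∈ ball c ρ, f z ≠ 0) (w : ℂ)
    (hw : w ^ 2 = f c) :
    ∃ s : ℂ → ℂ, s c = w ∧ (∀ z ∈ ball c ρ, s z ^ 2 = f z) ∧ (∀ z ∈ ball c ρ, s z ≠ 0) ∧
      ∀ z ∈ ball c ρ, HasDerivAt s (deriv f z / (2 * s z)) z := by
  have hc : f c ≠ 0 := h0 c (mem_ball_self hρ)
  have hw0 : w ≠ 0 := by rintro rfl; apply hc; rw [← hw]; simp
  obtain ⟨L, hL, hL', he⟩ := exists_log_ball hρ hf h0 (2 * Complex.log w)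
    (by rw [two_mul, Complex.exp_add, Complex.exp_log hw0, ← hw, sq])
  have hsq : ∀ z ∈ ball c ρ, Complex.exp (L z / 2) ^ 2 = f z := by
    intro z hz
    rw [sq, ← Complex.exp_add, add_halves, he z hz]
  refine ⟨fun z => Complex.exp (L z / 2), ?_, hsq, fun z _ => Complex.exp_ne_zero _, ?_⟩
  · simp [hL, Complex.exp_log hw0]
  · intro z hz
    convert! ((hL' z hz).div_const 2).cexp using 1
    rw [← hsq z hz]
    have := Complex.exp_ne_zero (L z / 2)
    field_simp

/-- The holomorphic solution of 2(z - c)M' + M = 2m is the average of 2m(c + u²(z - c)) over u in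
[0, 1]. The equation follows by integrating the u-derivative of 2u m(c + u²(z - c)). -/
theorem exists_radial_average {m : ℂ → ℂ} {c : ℂ} {δ : ℝ} (hm : DifferentiableOn ℂ m (ball c δ)) :
    ∃ M M' : ℂ → ℂ, ∀ z ∈ ball c δ, HasDerivAt M (M' z) z ∧
      2 * (z - c) * M' z + M z = 2 * m z := by
  set F : ℂ → ℝ → ℂ := fun z u => 2 * m (c + u ^ 2 * (z - c)) with hF
  set F' : ℂ → ℝ → ℂ := fun z u => 2 * (deriv m (c + u ^ 2 * (z - c)) * u ^ 2) with hF'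
  refine ⟨fun z => ∫ u in (0 : ℝ)..1, F z u, fun z => ∫ u in (0 : ℝ)..1, F' z u, ?_⟩
  have hmem : ∀ ρ : ℝ, ∀ z ∈ ball c ρ, ∀ u ∈ Icc (0 : ℝ) 1, c + (u : ℂ) ^ 2 * (z - c) ∈ ball c ρ := by
    intro ρ z hz u hu
    rw [mem_ball, dist_eq_norm] at hz ⊢
    rw [add_sub_cancel_left, norm_mul]
    have h1 : ‖(u : ℂ) ^ 2‖ ≤ 1 := by
      rw [norm_pow, Complex.norm_real, Real.norm_of_nonneg hu.1]
      exact pow_le_one₀ hu.1 hu.2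
    have := norm_nonneg (z - c)
    nlinarith
  have hdm : DifferentiableOn ℂ (deriv m) (ball c δ) := hm.deriv isOpen_ball
  have hlin : ∀ z, Continuous fun u : ℝ => c + (u : ℂ) ^ 2 * (z - c) := fun z => by fun_prop
  have hcF : ∀ z ∈ ball c δ, ContinuousOn (F z) (Icc 0 1) := fun z hz =>
    continuousOn_const.mul (hm.continuousOn.comp (hlin z).continuousOn (hmem δ z hz))
  have hcF' : ∀ z ∈ ball c δ, ContinuousOn (F' z) (Icc 0 1) := fun z hz =>
    continuousOn_const.mul ((hdm.continuousOn.comp (hlin z).continuousOn (hmem δ z hz)).mul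
      (by fun_prop))
  have hI : uIoc (0 : ℝ) 1 ⊆ Icc 0 1 := by
    rw [uIoc_of_le zero_le_one]; exact Ioc_subset_Icc_self
  intro z hz
  have hint : IntervalIntegrable (F z) volume 0 1 :=
    (hcF z hz).intervalIntegrable_of_Icc zero_le_one
  have hint' : IntervalIntegrable (F' z) volume 0 1 :=
    (hcF' z hz).intervalIntegrable_of_Icc zero_le_one
  constructor
  · obtain ⟨ρ, hρ1, hρ2⟩ := exists_between (mem_ball.1 hz)
    obtain ⟨B, hB⟩ := ((isCompact_closedBall c ρ).image_of_continuousOn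
      (hdm.continuousOn.mono (closedBall_subset_ball hρ2))).isBounded.exists_norm_le
    have hB' : ∀ w ∈ ball c ρ, ‖deriv m w‖ ≤ B := fun w hw =>
      hB _ ⟨w, ball_subset_closedBall hw, rfl⟩
    refine (intervalIntegral.hasDerivAt_integral_of_dominated_loc_of_deriv_le (F := F) (F' := F')
      (s := ball c ρ) (bound := fun _ => 2 * B) (isOpen_ball.mem_nhds hρ1) ?_ hint ?_ ?_ ?_ ?_).2
    · filter_upwards [isOpen_ball.mem_nhds hz] with w hw
      exact ((hcF w hw).mono hI).aestronglyMeasurable measurableSet_uIoc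
    · exact ((hcF' z hz).mono hI).aestronglyMeasurable measurableSet_uIoc
    · refine Eventually.of_forall fun u hu w hw => ?_
      have h1 := hB' _ (hmem ρ w hw u (hI hu))
      have h2 : ‖(u : ℂ) ^ 2‖ ≤ 1 := by
        rw [norm_pow, Complex.norm_real, Real.norm_of_nonneg (hI hu).1]
        exact pow_le_one₀ (hI hu).1 (hI hu).2
      have h3 := norm_nonneg ((u : ℂ) ^ 2)
      have h4 := norm_nonneg (deriv m (c + u ^ 2 * (w - c)))
      simp only [hF', norm_mul, Complex.norm_ofNat]
      nlinarith
    · simp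
    · refine Eventually.of_forall fun u hu w hw => ?_
      have h1 : HasDerivAt (fun w : ℂ => c + (u : ℂ) ^ 2 * (w - c)) ((u : ℂ) ^ 2) w := by
        simpa using (((hasDerivAt_id w).sub_const c).const_mul ((u : ℂ) ^ 2)).const_add c
      have h2 : c + (u : ℂ) ^ 2 * (w - c) ∈ ball c δ :=
        ball_subset_ball hρ2.le (hmem ρ w hw u (hI hu))
      exact ((hm.differentiableAt (isOpen_ball.mem_nhds h2)).hasDerivAt.comp w h1).const_mul 2
  · have hN : ∀ u ∈ uIcc (0 : ℝ) 1, HasDerivAt (fun u : ℝ => 2 * (u : ℂ) * m (c + u ^ 2 * (z - c)))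
        (2 * (z - c) * F' z u + F z u) u := by
      intro u hu
      rw [uIcc_of_le zero_le_one] at hu
      have h1 : HasDerivAt (fun u : ℂ => c + u ^ 2 * (z - c)) (2 * (u : ℂ) * (z - c)) u := by
        simpa using (((hasDerivAt_id (u : ℂ)).pow 2).mul_const (z - c)).const_add c
      have h2 := (hm.differentiableAt (isOpen_ball.mem_nhds (hmem δ z hz u hu))).hasDerivAt
      have h3 := (((hasDerivAt_id (u : ℂ)).const_mul 2).mul (h2.comp (u : ℂ) h1)).comp_ofReal
      convert! h3 using 1
      simp only [hF, hF', Function.comp]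
      simp
      ring
    have hsum := intervalIntegral.integral_eq_sub_of_hasDerivAt hN
      ((hint'.const_mul _).add hint)
    rw [intervalIntegral.integral_add (hint'.const_mul _) hint,
      intervalIntegral.integral_const_mul] at hsum
    rw [hsum]
    simp

/-- A first order linear equation with at most a regular singular point of exponent `-1/2`. -/
theorem exists_singular_ode {D D' g : ℂ → ℂ} {c : ℂ} {δ : ℝ} (hδ : 0 < δ)
    (hD : ∀ z, HasDerivAt D (D' z) z) (hg : DifferentiableOn ℂ g (ball c δ))
    (h0 : D c = 0 → D' c ≠ 0) :
    ∃ ε > 0, ε ≤ δ ∧ ∃ K K' : ℂ → ℂ, ∀ z ∈ ball c ε, HasDerivAt K (K' z) z ∧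
      D z * K' z + D' z * K z / 2 = g z := by
  have hDd : Differentiable ℂ D := fun z => (hD z).differentiableAt
  have hDe : deriv D = D' := funext fun z => (hD z).deriv
  -- a smaller disc on which a given function does not vanish
  have hsmall : ∀ f : ℂ → ℂ, Continuous f → f c ≠ 0 → ∃ ε > 0, ε ≤ δ ∧ ∀ z ∈ ball c ε, f z ≠ 0 := by
    intro f hf hfc
    obtain ⟨ε, hε, h⟩ := Metric.eventually_nhds_iff_ball.1 (hf.continuousAt.eventually_ne hfc)
    exact ⟨min ε δ, lt_min hε hδ, min_le_right _ _, fun z hz =>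
      h z (ball_subset_ball (min_le_left _ _) hz)⟩
  by_cases hc : D c = 0
  -- At a simple zero write D = (z - c)s². With K = M/s the equation turns into 2(z - c)M' + M =
  -- 2g/s, which the radial average solves.
  · have hdd : Differentiable ℂ (dslope D c) := by
      rw [← differentiableOn_univ] at hDd ⊢
      exact (Complex.differentiableOn_dslope univ_mem).2 hDd
    have hne : dslope D c c ≠ 0 := by rw [dslope_same, hDe]; exact h0 hc
    obtain ⟨ε, hε, hεδ, hnz⟩ := hsmall _ hdd.continuous hne
    obtain ⟨w, hw⟩ := IsAlgClosed.exists_pow_nat_eq (dslope D c c) (n := 2) (by norm_num)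
    obtain ⟨s, -, hs, hs0, hs'⟩ := exists_sqrt_ball hε hdd.differentiableOn hnz w hw
    have hsd : DifferentiableOn ℂ s (ball c ε) := fun z hz =>
      (hs' z hz).differentiableAt.differentiableWithinAt
    obtain ⟨M, M', hM⟩ := exists_radial_average ((hg.mono (ball_subset_ball hεδ)).div hsd hs0)
    refine ⟨ε, hε, hεδ, fun z => M z / s z, _, fun z hz =>
      ⟨(hM z hz).1.div (hs' z hz) (hs0 z hz), ?_⟩⟩
    have h1 : D z = (z - c) * s z ^ 2 := by
      rw [hs z hz, ← smul_eq_mul, sub_smul_dslope, hc, sub_zero]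
    have h2 : D' z = s z ^ 2 + (z - c) * deriv (dslope D c) z := by
      have h3 : HasDerivAt (fun z => (z - c) * dslope D c z)
          (1 * dslope D c z + (z - c) * deriv (dslope D c) z) z :=
        ((hasDerivAt_id z).sub_const c).mul (hdd z).hasDerivAt
      have h4 : D = fun z => (z - c) * dslope D c z := by
        ext z; rw [← smul_eq_mul, sub_smul_dslope, hc, sub_zero]
      have h5 := hD z
      rw [h4] at h5
      rw [h5.unique h3, hs z hz, one_mul]
    have h3 := (hM z hz).2
    have hsz := hs0 z hz
    simp only [Pi.div_apply] at h3
    rw [h1, h2]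
    field_simp
    field_simp at h3
    linear_combination s z * h3
  -- Away from the zeros D = s², and K = J/s with J' = g/s is a solution.
  · obtain ⟨ε, hε, hεδ, hnz⟩ := hsmall _ hDd.continuous hc
    obtain ⟨w, hw⟩ := IsAlgClosed.exists_pow_nat_eq (D c) (n := 2) (by norm_num)
    obtain ⟨s, -, hs, hs0, hs'⟩ := exists_sqrt_ball hε hDd.differentiableOn hnz w hw
    have hsd : DifferentiableOn ℂ s (ball c ε) := fun z hz =>
      (hs' z hz).differentiableAt.differentiableWithinAt
    obtain ⟨J, hJ⟩ := ((hg.mono (ball_subset_ball hεδ)).div hsd hs0).isExactOn_ball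
    refine ⟨ε, hε, hεδ, fun z => J z / s z, _, fun z hz =>
      ⟨(hJ z hz).div (hs' z hz) (hs0 z hz), ?_⟩⟩
    have hsz := hs0 z hz
    rw [hDe, ← hs z hz]
    simp only [Pi.div_apply]
    field_simp
    ring

/-! ### The Todd function -/

theorem two_pi_I_ne : 2 * πi ≠ 0 := by
  simp [Real.pi_ne_zero]

/-- The set where the Todd function `r eʳ / (eʳ - 1)` is regular. -/
def toddRegular : Set ℂ := {r | dslope Complex.exp 0 r ≠ 0}

/-- The Todd function `r eʳ / (eʳ - 1)`. -/
def todd (r : ℂ) : ℂ := Complex.exp r / dslope Complex.exp 0 r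

theorem differentiable_dslope_exp : Differentiable ℂ (dslope Complex.exp 0) := by
  rw [← differentiableOn_univ]
  exact (Complex.differentiableOn_dslope univ_mem).2 Complex.differentiable_exp.differentiableOn

theorem isOpen_toddRegular : IsOpen toddRegular :=
  isOpen_ne.preimage differentiable_dslope_exp.continuous

theorem mul_dslope_exp (r : ℂ) : r * dslope Complex.exp 0 r = Complex.exp r - 1 := by
  have := sub_smul_dslope Complex.exp 0 r
  simpa using this

theorem mem_toddRegular {r : ℂ} : r ∈ toddRegular ↔ r = 0 ∨ Complex.exp r ≠ 1 := by
  rcases eq_or_ne r 0 with rfl | h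
  · simp [toddRegular]
  · have := mul_dslope_exp r
    simp only [toddRegular, mem_ofPred_eq, h, false_or, not_iff_not]
    constructor
    · intro h0; rw [h0] at this; linear_combination -this
    · intro h0
      rw [h0, sub_self] at this
      exact (mul_eq_zero.1 this).resolve_left h

theorem differentiableOn_todd : DifferentiableOn ℂ todd toddRegular :=
  Complex.differentiable_exp.differentiableOn.div differentiable_dslope_exp.differentiableOn
    fun _ h => h

theorem todd_mul {r : ℂ} (hr : r ∈ toddRegular) :
    todd r * (Complex.exp r - 1) = r * Complex.exp r := by
  rw [← mul_dslope_exp, todd]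
  have : dslope Complex.exp 0 r ≠ 0 := hr
  field_simp

/-! ### Flat sections and charts around points with x₁ ≠ 0, ∞ -/

namespace CurveData

variable (d : CurveData)

/-- The points of the curve, in the coordinates `r` and `x₂`. -/
def OnCurve (r x : ℂ) : Prop := x ≠ 0 ∧ d.curveEq r x = 0

/-- The points that are neither branch points nor in the fibre over `x₁ = -1`. -/
def Generic (r : ℂ) : Prop := d.D r ≠ 0 ∧ Complex.exp r ≠ 1

/-- The holomorphic form at the point `(r, x)` on the vector `(v, w)`. -/
def ω (r x v w : ℂ) : ℂ :=
  (2 * πi)⁻¹ * d.a * (if d.Y r x = 0 then w / x / d.X₁ r x else -v / d.Y r x)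

/-- The logarithmic derivative of flat sections. -/
def Λ (e : ℕ) (κ r x : ℂ) : ℂ := (e * r * d.X₁ r x - κ * d.a) / (2 * πi * d.Y r x)

/-- Flat sections of the line bundle over the part of the curve over `R`. -/
structure FlatOn (e : ℕ) (κ : ℂ) (R : Set ℂ) (σ : ℂ → ℂ → ℂ) : Prop where
  ne_zero : ∀ r ∈ R, d.Generic r → ∀ x, d.OnCurve r x → σ r x ≠ 0
  shift : ∀ r ∈ R, d.Generic r → ∀ x, d.OnCurve r x → σ (r - 2 * πi) x = (-x) ^ e * σ r x
  hasDerivAt : ∀ r ∈ R, d.Generic r → ∀ X : ℂ → ℂ, DifferentiableAt ℂ X r →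
    (∀ᶠ z in 𝓝 r, d.OnCurve z (X z)) →
    HasDerivAt (fun z => σ z (X z)) (σ r (X r) * d.Λ e κ r (X r)) r

theorem exp_add_int (r : ℂ) (n : ℤ) : Complex.exp (r + 2 * πi * n) = Complex.exp r := by
  rw [show r + 2 * πi * n = r + n * (2 * πi) by ring]
  have := Complex.exp_periodic.int_mul n r
  rw [show (2 : ℂ) * πi = 2 * Real.pi * Complex.I by ring]
  exact this

theorem A_add_int (r : ℂ) (n : ℤ) : d.A (r + 2 * πi * n) = d.A r := by simp [A, exp_add_int]

theorem C_add_int (r : ℂ) (n : ℤ) : d.C (r + 2 * πi * n) = d.C r := by simp [C, exp_add_int]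

theorem b_add_int (r : ℂ) (n : ℤ) : d.b (r + 2 * πi * n) = d.b r := by
  simp only [b, exp_add_int, Complex.exp_neg]

theorem A'_add_int (r : ℂ) (n : ℤ) : d.A' (r + 2 * πi * n) = d.A' r := by
  simp [A', exp_add_int, A_add_int]

theorem C'_add_int (r : ℂ) (n : ℤ) : d.C' (r + 2 * πi * n) = d.C' r := by
  simp [C', exp_add_int, C_add_int]

theorem b'_add_int (r : ℂ) (n : ℤ) : d.b' (r + 2 * πi * n) = d.b' r := by
  simp only [b', exp_add_int, Complex.exp_neg]

theorem D_add_int (r : ℂ) (n : ℤ) : d.D (r + 2 * πi * n) = d.D r := by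
  simp [D, A_add_int, b_add_int, C_add_int]

theorem Y_add_int (r x : ℂ) (n : ℤ) : d.Y (r + 2 * πi * n) x = d.Y r x := by
  simp [Y, A_add_int, C_add_int]

theorem X₁_add_int (r x : ℂ) (n : ℤ) : d.X₁ (r + 2 * πi * n) x = d.X₁ r x := by
  simp [X₁, A'_add_int, b'_add_int, C'_add_int]

theorem onCurve_add_int (r x : ℂ) (n : ℤ) : d.OnCurve (r + 2 * πi * n) x ↔ d.OnCurve r x := by
  simp [OnCurve, curveEq, A_add_int, b_add_int, C_add_int]

theorem ω_add_int (r x v w : ℂ) (n : ℤ) : d.ω (r + 2 * πi * n) x v w = d.ω r x v w := by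
  simp [ω, X₁_add_int, Y_add_int]

theorem generic_add_int (r : ℂ) (n : ℤ) : d.Generic (r + 2 * πi * n) ↔ d.Generic r := by
  simp [Generic, D_add_int, exp_add_int]

variable {d}

theorem OnCurve.sq_Y {r x : ℂ} (h : d.OnCurve r x) : d.Y r x ^ 2 = d.D r :=
  d.discriminant_eq h.1 h.2

theorem OnCurve.Y_ne_zero {r x : ℂ} (h : d.OnCurve r x) (hr : d.D r ≠ 0) : d.Y r x ≠ 0 := by
  intro h0
  apply hr
  rw [← h.sq_Y, h0]
  simp

theorem OnCurve.X₁_ne_zero (hd : d.Admissible) {r x : ℂ} (h : d.OnCurve r x)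
    (hY : d.Y r x = 0) : d.X₁ r x ≠ 0 := by
  have hD : d.D r = 0 := by rw [← h.sq_Y, hY]; simp
  have h1 := hd.simple r hD
  rw [d.D'_eq h.1 h.2 hY] at h1
  exact right_ne_zero_of_mul (right_ne_zero_of_mul h1)

/-- Add the equation of the curve to the definition of Y. This identity and the next one turn
multiplication by x₂ and by x₂⁻¹ into b and Y, and thereby produce the difference equation for the
traces. -/
theorem OnCurve.A_mul {r x : ℂ} (h : d.OnCurve r x) : d.A r * x = (d.Y r x - d.b r) / 2 := by
  have := h.2
  rw [curveEq] at this
  rw [Y]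
  linear_combination this / 2

theorem OnCurve.C_div {r x : ℂ} (h : d.OnCurve r x) : d.C r / x = (-d.Y r x - d.b r) / 2 := by
  have := h.2
  rw [curveEq] at this
  rw [Y]
  linear_combination this / 2

section Curves

variable {𝕜 : Type*} [NontriviallyNormedField 𝕜] [NormedAlgebra 𝕜 ℂ]

theorem hasDerivAt_along {H K : ℂ → ℂ} {H' K' : ℂ} {ρ x : 𝕜 → ℂ} {ρ' x' : ℂ} {t : 𝕜}
    (hρ : HasDerivAt ρ ρ' t) (hx : HasDerivAt x x' t) (hx0 : x t ≠ 0)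
    (hH : HasDerivAt H H' (ρ t)) (hK : HasDerivAt K K' (ρ t)) :
    HasDerivAt (fun t => H (ρ t) + d.Y (ρ t) (x t) * K (ρ t))
      (H' * ρ' + ((d.A' (ρ t) * x t - d.C' (ρ t) / x t) * ρ' +
        (d.A (ρ t) + d.C (ρ t) / x t ^ 2) * x') * K (ρ t) + d.Y (ρ t) (x t) * K' * ρ') t := by
  have h1 := hH.scomp t hρ
  have h2 := hK.scomp t hρ
  have h3 := (d.hasDerivAt_A (ρ t)).scomp t hρ
  have h4 := (d.hasDerivAt_C (ρ t)).scomp t hρ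
  convert! h1.add (((h3.mul hx).sub (h4.div hx hx0)).mul h2) using 1
  simp only [Function.comp, smul_eq_mul, Y, Pi.mul_apply, Pi.div_apply, Pi.sub_apply]
  field_simp
  ring

/-- The differential of the equation of the curve. The field `𝕜` is left open because the curves are
both complex sheets and real loops. -/
theorem tangent_of_eventually {ρ x : 𝕜 → ℂ} {ρ' x' : ℂ} {t : 𝕜}
    (hρ : HasDerivAt ρ ρ' t) (hx : HasDerivAt x x' t)
    (h : ∀ᶠ s in 𝓝 t, d.OnCurve (ρ s) (x s)) :
    d.X₁ (ρ t) (x t) * ρ' + d.Y (ρ t) (x t) * (x' / x t) = 0 := by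
  have hx0 : x t ≠ 0 := h.self_of_nhds.1
  have h3 := (d.hasDerivAt_A (ρ t)).scomp t hρ
  have h4 := (d.hasDerivAt_C (ρ t)).scomp t hρ
  have h5 := (d.hasDerivAt_b (ρ t)).scomp t hρ
  have h6 := ((h3.mul hx).add h5).add (h4.div hx hx0)
  have h7 : HasDerivAt (fun _ : 𝕜 => (0 : ℂ)) _ t := h6.congr_of_eventuallyEq (by
    filter_upwards [h] with s hs
    exact hs.2.symm)
  have h8 := h7.unique (hasDerivAt_const t 0)
  rw [← h8]
  simp only [Function.comp, smul_eq_mul, Y, X₁]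
  field_simp
  ring

end Curves

/-- The local equation for flat sections: `exp (H + Y K)` is flat. -/
structure IsChart (d : CurveData) (e : ℕ) (κ c : ℂ) (ε : ℝ) (H K H' K' : ℂ → ℂ) : Prop where
  pos : 0 < ε
  lt_one : ε < 1
  hasDerivAt_H : ∀ z ∈ ball c ε, HasDerivAt H (H' z) z
  hasDerivAt_K : ∀ z ∈ ball c ε, HasDerivAt K (K' z) z
  generic : ∀ z ∈ ball c ε, z ≠ c → d.Generic z
  rel : ∀ z ∈ ball c ε, ∀ x, d.OnCurve z x → ∀ v w : ℂ,
    d.X₁ z x * v + d.Y z x * (w / x) = 0 →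
    H' z * v + ((d.A' z * x - d.C' z / x) * v + (d.A z + d.C z / x ^ 2) * w) * K z +
      d.Y z x * K' z * v = -(e / (2 * πi)) * z * (w / x) + κ * d.ω z x v w

/-- The logarithmic derivative of A has a pole where exp r = 1. The factor r turns it into the Todd
function, which is regular at r = 0 but not at the other such points. -/
theorem r_mul_A' (d : CurveData) {r : ℂ} (hr : r ∈ toddRegular) :
    r * d.A' r = (d.i * r + d.k * todd r) * d.A r := by
  have hx : -Complex.exp r ≠ 0 := neg_ne_zero.2 (Complex.exp_ne_zero r)
  have h := todd_mul hr
  rw [A', A, zpow_add_one₀ hx]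
  rcases Nat.eq_zero_or_pos d.k with hk | hk
  · simp [hk]; ring
  · have h2 : (1 - Complex.exp r) ^ d.k = (1 - Complex.exp r) ^ (d.k - 1) * (1 - Complex.exp r) := by
      rw [← pow_succ]; congr 1; omega
    rw [h2]
    linear_combination (d.k * (-Complex.exp r) ^ d.i * (1 - Complex.exp r) ^ (d.k - 1)) * h

theorem r_mul_C' (d : CurveData) {r : ℂ} (hr : r ∈ toddRegular) :
    r * d.C' r = (d.j * r + d.l * todd r) * d.C r :=
  r_mul_A' ⟨d.j, d.i, d.l, d.k, d.α, d.β, d.a⟩ hr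

/-- Split the logarithmic derivative of a flat section into parts even and odd under Y ↦ -Y. With P
= rA'/A and Q = rC'/C one has rX₁ = Y(P - Q)/2 - (b(P + Q)/2 - rb'). The even part is the derivative
of H. The odd part g/Y is the derivative of YK exactly when DK' + D'K/2 = g, and this has a
holomorphic solution even at a branch point since D has simple zeros. -/
theorem exists_isChart (hd : d.Admissible) (e : ℕ) (κ : ℂ) {c : ℂ} (hc : c ∈ toddRegular) :
    ∃ ε H K H' K', d.IsChart e κ c ε H K H' K' := by
  set P : ℂ → ℂ := fun r => d.i * r + d.k * todd r with hP
  set Q : ℂ → ℂ := fun r => d.j * r + d.l * todd r with hQ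
  set g : ℂ → ℂ := fun r => -(2 * πi)⁻¹ *
    (e * (d.b r * (P r + Q r) / 2 - r * d.b' r) + κ * d.a) with hg
  have hgen : ∀ᶠ z in 𝓝[≠] c, d.Generic z := by
    refine Filter.Eventually.and ?_ ?_
    · by_cases h : d.D c = 0
      · exact (d.hasDerivAt_D c).eventually_ne (hd.simple c h)
      · exact ((d.hasDerivAt_D c).continuousAt.eventually_ne h).filter_mono nhdsWithin_le_nhds
    · exact (Complex.hasDerivAt_exp c).eventually_ne (Complex.exp_ne_zero c)
  rw [eventually_nhdsWithin_iff] at hgen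
  obtain ⟨δ, hδ, hball⟩ := Metric.eventually_nhds_iff_ball.1
    (hgen.and (isOpen_toddRegular.mem_nhds hc))
  have hreg : ball c δ ⊆ toddRegular := fun z hz => (hball z hz).2
  have hlin : ∀ u : ℂ, DifferentiableOn ℂ (fun r => u * r) (ball c δ) := fun u => by fun_prop
  have htodd : DifferentiableOn ℂ todd (ball c δ) := differentiableOn_todd.mono hreg
  have hPd : DifferentiableOn ℂ P (ball c δ) := (hlin _).add (htodd.const_mul _)
  have hQd : DifferentiableOn ℂ Q (ball c δ) := (hlin _).add (htodd.const_mul _)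
  have hbd : DifferentiableOn ℂ d.b (ball c δ) := fun z _ =>
    (d.hasDerivAt_b z).differentiableAt.differentiableWithinAt
  have hb'd : DifferentiableOn ℂ d.b' (ball c δ) := by
    unfold b'; fun_prop
  have hgd : DifferentiableOn ℂ g (ball c δ) :=
    ((((hbd.mul (hPd.add hQd)).div_const 2).sub (differentiableOn_id.mul hb'd)).const_mul _
      |>.add_const _).const_mul _
  obtain ⟨H, hH⟩ := (((hPd.sub hQd).const_mul ((e : ℂ) / (2 * πi) / 2))).isExactOn_ball
  obtain ⟨ε, hε, hεδ, K, K', hK⟩ := exists_singular_ode hδ d.hasDerivAt_D hgd (hd.simple c)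
  have hsub : ball c (min ε (1 / 2)) ⊆ ball c ε := ball_subset_ball (min_le_left _ _)
  have hsub' : ball c (min ε (1 / 2)) ⊆ ball c δ := hsub.trans (ball_subset_ball hεδ)
  -- A radius below 1 keeps the translates of the disc by multiples of 2πi apart.
  refine ⟨min ε (1 / 2), H, K, _, K', lt_min hε (by norm_num),
    (min_le_right _ _).trans_lt (by norm_num), fun z hz => hH z (hsub' hz),
    fun z hz => (hK z (hsub hz)).1, fun z hz hne => (hball z (hsub' hz)).1 hne, ?_⟩
  intro z hz x hx v w ht
  have hK2 := (hK z (hsub hz)).2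
  have hA' := d.r_mul_A' (hreg (hsub' hz))
  have hC' := d.r_mul_C' (hreg (hsub' hz))
  have hx0 := hx.1
  have hAx := hx.A_mul
  have hCx := hx.C_div
  have hY2 := hx.sq_Y
  set y := d.Y z x with hy
  have hPz : d.i * z + d.k * todd z = P z := rfl
  have hQz : d.j * z + d.l * todd z = Q z := rfl
  rw [hPz] at hA'
  rw [hQz] at hC'
  -- the relation `r X₁ = Y (P - Q) / 2 - b (P + Q) / 2 + r b'`
  have hX : z * d.X₁ z x = y * ((P z - Q z) / 2) - (d.b z * (P z + Q z) / 2 - z * d.b' z) := by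
    rw [X₁, mul_add, mul_add, ← mul_assoc, hA', mul_div_assoc', hC', mul_assoc, hAx, mul_div_assoc,
      hCx]
    ring
  have hpi := two_pi_I_ne
  have hω : d.ω z x v w = (2 * πi)⁻¹ * d.a * (if y = 0 then w / x / d.X₁ z x else -v / y) := rfl
  have hbeq : d.b z = -(d.A z * x + d.C z / x) := by rw [hAx, hCx]; ring
  have hyeq : y = d.A z * x - d.C z / x := rfl
  -- At a branch point tangent vectors have v = 0, so only the coefficients of w have to be
  -- compared.
  by_cases hy0 : y = 0
  · have hX1 := OnCurve.X₁_ne_zero hd hx hy0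
    rw [hy0, zero_mul, add_zero] at ht
    have hv : v = 0 := (mul_eq_zero.1 ht).resolve_left hX1
    have hD0 : d.D z = 0 := by rw [← hY2, hy0]; simp
    have hD' := d.D'_eq hx0 hx.2 hy0
    have hAC : d.C z / x = d.A z * x := by rw [hyeq] at hy0; linear_combination -hy0
    have hs : (d.A z + d.C z / x ^ 2) * w = 2 * (d.A z * x) * (w / x) := by
      rw [show d.C z / x ^ 2 = d.C z / x / x by field_simp, hAC]
      field_simp
      ring
    rw [hω, if_pos hy0, hv, hs]
    rw [hD0, zero_mul, zero_add, hD'] at hK2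
    rw [hy0, zero_mul, zero_sub] at hX
    have hkey : 2 * (d.A z * x) * K z * d.X₁ z x =
        (2 * πi)⁻¹ * (-(e * (z * d.X₁ z x)) + κ * d.a) := by
      have e1 : 2 * (d.A z * x) * K z * d.X₁ z x = -g z := by
        linear_combination -hK2
      rw [e1, hg, hX]
      ring
    have e2 : 2 * (d.A z * x) * K z = (2 * πi)⁻¹ * (-(e * z) + κ * d.a / d.X₁ z x) := by
      have : 2 * (d.A z * x) * K z = 2 * (d.A z * x) * K z * d.X₁ z x / d.X₁ z x := by
        field_simp
      rw [this, hkey]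
      field_simp
    simp only [mul_zero, zero_add, add_zero]
    rw [mul_right_comm, e2]
    ring
  · have hw : w / x = -(d.X₁ z x * v) / y := by
      field_simp at ht ⊢
      linear_combination ht
    have hs : (d.A z + d.C z / x ^ 2) * w = -d.b z * (w / x) := by
      rw [hbeq]; field_simp
    rw [hω, if_neg hy0, hs, hw]
    -- `2 Y dY = D' dr`
    have hDY : y * ((d.A' z * x - d.C' z / x)) + d.b z * d.X₁ z x = d.D' z / 2 := by
      rw [D', X₁, hyeq, hbeq]
      field_simp
      ring
    have hK3 : y ^ 2 * K' z + d.D' z * K z / 2 = g z := by rw [hY2]; exact hK2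
    have hfin : y * ((2 * πi)⁻¹ * (e * ((P z - Q z) / 2))) + g z =
        (2 * πi)⁻¹ * (e * (z * d.X₁ z x) - κ * d.a) := by
      rw [hX, hg]; ring
    simp only [Pi.sub_apply]
    have e3 : (d.A' z * x - d.C' z / x) = (d.D' z / 2 - d.b z * d.X₁ z x) / y := by
      rw [eq_div_iff hy0]; linear_combination hDY
    rw [e3]
    have e4 : K' z = (g z - d.D' z * K z / 2) / y ^ 2 := by
      rw [eq_div_iff (pow_ne_zero 2 hy0)]; linear_combination hK3
    rw [e4]
    have e5 : g z = (2 * πi)⁻¹ * (e * (z * d.X₁ z x) - κ * d.a) -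
      y * ((2 * πi)⁻¹ * (e * ((P z - Q z) / 2))) := by linear_combination hfin
    rw [e5]
    field_simp
    ring

end CurveData

/-! ### Chart sections on all branches of the logarithm -/

/-- The number of turns that brings `r` close to `c`. -/
def winding (c r : ℂ) : ℤ := round ((c - r).im / (2 * Real.pi))

/-- The imaginary parts differ by less than 1 < π, so rounding to the nearest turn recovers n. -/
theorem winding_eq {c r : ℂ} {ε : ℝ} (hε : ε < 1) {n : ℤ} (h : r + 2 * πi * n ∈ ball c ε) :
    winding c r = n := by
  have h1 : |(r + 2 * πi * n - c).im| < 1 :=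
    (Complex.abs_im_le_norm _).trans_lt ((mem_ball_iff_norm.1 h).trans hε)
  have h2 : (r + 2 * πi * n - c).im = -((c - r).im - 2 * Real.pi * n) := by
    simp; ring
  rw [h2, abs_neg] at h1
  have hpi := Real.pi_gt_three
  have h3 : |(c - r).im / (2 * Real.pi) - n| < 1 / 2 := by
    have : (c - r).im / (2 * Real.pi) - n = ((c - r).im - 2 * Real.pi * n) / (2 * Real.pi) := by
      field_simp
    rw [this, abs_div, abs_of_pos (by positivity : 0 < 2 * Real.pi), div_lt_iff₀ (by positivity)]
    linarith
  rw [winding, round_eq, Int.floor_eq_iff]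
  rw [abs_lt] at h3
  constructor <;> linarith

namespace CurveData

variable {d : CurveData}

/-- The section `exp (H + Y K)` of a chart, extended to all branches of `r`. -/
def chartSection (d : CurveData) (e : ℕ) (c : ℂ) (H K : ℂ → ℂ) (r x : ℂ) : ℂ :=
  Complex.exp (H (r + 2 * πi * winding c r) + d.Y r x * K (r + 2 * πi * winding c r)) *
    ((-x) ^ e) ^ winding c r

/-- The branches of `r` over a disc. -/
def chartRegion (c : ℂ) (ε : ℝ) : Set ℂ := {r | ∃ n : ℤ, r + 2 * πi * n ∈ ball c ε}

section

variable {e : ℕ} {κ c : ℂ} {ε : ℝ} {H K H' K' : ℂ → ℂ}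

theorem IsChart.section_eq (h : d.IsChart e κ c ε H K H' K') {r x : ℂ} {n : ℤ}
    (hn : r + 2 * πi * n ∈ ball c ε) :
    d.chartSection e c H K r x =
      Complex.exp (H (r + 2 * πi * n) + d.Y (r + 2 * πi * n) x * K (r + 2 * πi * n)) *
        ((-x) ^ e) ^ n := by
  rw [chartSection, winding_eq h.lt_one hn, Y_add_int]

theorem chartSection_ne_zero {r x : ℂ} (hx : x ≠ 0) : d.chartSection e c H K r x ≠ 0 :=
  mul_ne_zero (Complex.exp_ne_zero _) (zpow_ne_zero _ (pow_ne_zero _ (neg_ne_zero.2 hx)))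

theorem chartSection_sub (r : ℂ) {x : ℂ} (hx : x ≠ 0) :
    d.chartSection e c H K (r - 2 * πi) x = (-x) ^ e * d.chartSection e c H K r x := by
  have h1 : winding c (r - 2 * πi) = winding c r + 1 := by
    have : (c - (r - 2 * πi)).im / (2 * Real.pi) = (c - r).im / (2 * Real.pi) + 1 := by
      have := Real.pi_ne_zero
      field_simp
      simp
      ring
    rw [winding, this, round_add_one, winding]
  have h2 : r - 2 * πi + 2 * πi * ((winding c r + 1 : ℤ) : ℂ) = r + 2 * πi * winding c r := by
    push_cast; ring
  have h3 : d.Y (r - 2 * πi) x = d.Y r x := by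
    have := d.Y_add_int (r - 2 * πi) x 1
    rw [← this]; congr 1; push_cast; ring
  have h4 : ((-x) ^ e) ^ (winding c r + 1) = ((-x) ^ e) ^ winding c r * (-x) ^ e :=
    zpow_add_one₀ (pow_ne_zero _ (neg_ne_zero.2 hx)) _
  rw [chartSection, h1, h2, h3, h4, chartSection]
  ring

/-- On the branch r + 2πi n the exponential has logarithmic differential -(e/(2πi))(r + 2πi n) dlog
x₂ + κω. The factor ((-x₂)^e)^n contributes e n dlog x₂ and thus cancels the dependence on n. -/
theorem hasDerivAt_section {𝕜 : Type*} [NontriviallyNormedField 𝕜] [NormedAlgebra 𝕜 ℂ]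
    (h : d.IsChart e κ c ε H K H' K') {ρ x : 𝕜 → ℂ} {ρ' x' : ℂ} {t : 𝕜}
    (hρ : HasDerivAt ρ ρ' t) (hx : HasDerivAt x x' t) (hx0 : x t ≠ 0)
    (hr : ρ t ∈ chartRegion c ε) :
    ∃ Θ, HasDerivAt (fun s => d.chartSection e c H K (ρ s) (x s)) Θ t ∧
      (d.OnCurve (ρ t) (x t) → d.X₁ (ρ t) (x t) * ρ' + d.Y (ρ t) (x t) * (x' / x t) = 0 →
        Θ = d.chartSection e c H K (ρ t) (x t) *
        (-(e / (2 * πi)) * ρ t * (x' / x t) + κ * d.ω (ρ t) (x t) ρ' x')) := by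
  obtain ⟨n, hn⟩ := hr
  have hρn : HasDerivAt (fun s => ρ s + 2 * πi * n) ρ' t := hρ.add_const _
  have h1 := (Complex.hasDerivAt_exp _).scomp t
    (hasDerivAt_along (d := d) hρn hx hx0 (h.hasDerivAt_H _ hn) (h.hasDerivAt_K _ hn))
  have hx1 : (-x t) ^ e ≠ 0 := pow_ne_zero _ (neg_ne_zero.2 hx0)
  have h2 := (hasDerivAt_zpow n ((-x t) ^ e) (Or.inl hx1)).scomp t
    ((hasDerivAt_pow e (-x t)).scomp t hx.neg)
  have h3 := (h1.mul h2).congr_of_eventuallyEq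
    (f₁ := fun s => d.chartSection e c H K (ρ s) (x s)) (by
      filter_upwards [hρn.continuousAt.eventually (isOpen_ball.mem_nhds hn)] with s hs
      exact h.section_eq hs)
  refine ⟨_, h3, fun hcurve ht => ?_⟩
  have hrel := h.rel _ hn (x t) ((d.onCurve_add_int _ _ _).2 hcurve) ρ' x'
    (by rwa [X₁_add_int, Y_add_int])
  rw [hrel, h.section_eq hn, d.ω_add_int]
  simp only [Function.comp, smul_eq_mul]
  have h5 : ((-x t) ^ e) ^ n = ((-x t) ^ e) ^ (n - 1) * (-x t) ^ e := by
    rw [← zpow_add_one₀ hx1]; congr 1; ring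
  have h6 : (e : ℂ) * (-x t) ^ (e - 1) * x t = -(e * (-x t) ^ e) := by
    rcases Nat.eq_zero_or_pos e with he | he
    · simp [he]
    · have : (-x t) ^ e = (-x t) ^ (e - 1) * (-x t) := by rw [← pow_succ]; congr 1; omega
      rw [this]; ring
  have h7 : -x' * ((e : ℂ) * (-x t) ^ (e - 1)) = x' / x t * (e * (-x t) ^ e) := by
    field_simp
    linear_combination (-x') * h6
  have hpi := two_pi_I_ne
  have h8 : (n : ℂ) * ((-x t) ^ e) ^ (n - 1) * (e * (-x t) ^ (e - 1) * -x') =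
      ((-x t) ^ e) ^ n * (n * e * (x' / x t)) := by
    rw [h5]
    linear_combination ((n : ℂ) * ((-x t) ^ e) ^ (n - 1)) * h7
  have h9 : (e : ℂ) / (2 * πi) * (2 * πi * n) = e * n := by field_simp
  linear_combination (Complex.exp (H (ρ t + 2 * πi * n) +
    d.Y (ρ t + 2 * πi * n) (x t) * K (ρ t + 2 * πi * n))) * h8 -
    (Complex.exp (H (ρ t + 2 * πi * n) +
    d.Y (ρ t + 2 * πi * n) (x t) * K (ρ t + 2 * πi * n))) * ((-x t) ^ e) ^ n * (x' / x t) * h9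

/-- `Λ` is the derivative of flat sections along a sheet. -/
theorem Λ_eq {r : ℂ} {X : ℂ → ℂ} {X' : ℂ} (hr : d.D r ≠ 0) (hX : HasDerivAt X X' r)
    (hc : ∀ᶠ z in 𝓝 r, d.OnCurve z (X z)) :
    -(e / (2 * πi)) * r * (X' / X r) + κ * d.ω r (X r) 1 X' = d.Λ e κ r (X r) := by
  have hY := hc.self_of_nhds.Y_ne_zero hr
  have ht := tangent_of_eventually (hasDerivAt_id r) hX hc
  have h1 : X' / X r = -d.X₁ r (X r) / d.Y r (X r) := by
    rw [eq_div_iff hY]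
    simp only [id] at ht
    linear_combination ht
  have hpi := two_pi_I_ne
  rw [h1, ω, if_neg hY, Λ]
  field_simp
  ring

theorem IsChart.flatOn (h : d.IsChart e κ c ε H K H' K') :
    d.FlatOn e κ (chartRegion c ε) (d.chartSection e c H K) where
  ne_zero r _ _ x hx := chartSection_ne_zero hx.1
  shift r _ _ x hx := chartSection_sub r hx.1
  hasDerivAt r hr hg X hX hc := by
    obtain ⟨Θ, h1, h2⟩ := hasDerivAt_section h (hasDerivAt_id r) hX.hasDerivAt
      hc.self_of_nhds.1 hr
    rw [h2 hc.self_of_nhds (tangent_of_eventually (hasDerivAt_id r) hX.hasDerivAt hc)] at h1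
    rw [← Λ_eq hg.1 hX.hasDerivAt hc]
    exact h1

end

end CurveData

/-! ### Sheets over generic points, and the uniqueness of flat sections -/

namespace CurveData

variable {d : CurveData}

theorem Generic.A_ne_zero {r : ℂ} (h : d.Generic r) : d.A r ≠ 0 :=
  fun h0 => h.2 (d.exp_eq_one_of_A_eq_zero h0).1

theorem Generic.C_ne_zero {r : ℂ} (h : d.Generic r) : d.C r ≠ 0 :=
  fun h0 => h.2 (d.exp_eq_one_of_C_eq_zero h0).1

/-- The root of the quadratic equation of the curve with a given value of `Y`. -/
def root (d : CurveData) (r s : ℂ) : ℂ := (s - d.b r) / (2 * d.A r)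

theorem Y_root {r s : ℂ} (hA : d.A r ≠ 0) (hC : d.C r ≠ 0) (hs : s ^ 2 = d.D r) :
    d.OnCurve r (d.root r s) ∧ d.Y r (d.root r s) = s := by
  rw [D] at hs
  have h0 : s - d.b r ≠ 0 := by
    intro h
    apply mul_ne_zero hA hC
    rw [sub_eq_zero.1 h] at hs
    linear_combination (1 / 4) * hs
  refine ⟨⟨div_ne_zero h0 (mul_ne_zero two_ne_zero hA), ?_⟩, ?_⟩
  · rw [curveEq, root]
    field_simp
    linear_combination hs
  · rw [Y, root]
    field_simp
    linear_combination -hs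

theorem OnCurve.eq_root {r x : ℂ} (h : d.OnCurve r x) (hA : d.A r ≠ 0) :
    x = d.root r (d.Y r x) := by
  have := h.A_mul
  rw [root, eq_div_iff (mul_ne_zero two_ne_zero hA)]
  linear_combination 2 * this

theorem OnCurve.eq_or_eq {r x s : ℂ} (h : d.OnCurve r x) (hA : d.A r ≠ 0) (hs : s ^ 2 = d.D r) :
    x = d.root r s ∨ x = d.root r (-s) := by
  rcases sq_eq_sq_iff_eq_or_eq_neg.1 (h.sq_Y.trans hs.symm) with h1 | h1
  · left; rw [← h1]; exact h.eq_root hA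
  · right; rw [← h1]; exact h.eq_root hA

theorem continuous_D (d : CurveData) : Continuous d.D :=
  continuous_iff_continuousAt.2 fun z => (d.hasDerivAt_D z).continuousAt

theorem continuous_A (d : CurveData) : Continuous d.A :=
  continuous_iff_continuousAt.2 fun z => (d.hasDerivAt_A z).continuousAt

theorem continuous_C (d : CurveData) : Continuous d.C :=
  continuous_iff_continuousAt.2 fun z => (d.hasDerivAt_C z).continuousAt

theorem continuous_b (d : CurveData) : Continuous d.b :=
  continuous_iff_continuousAt.2 fun z => (d.hasDerivAt_b z).continuousAt

theorem isOpen_generic (d : CurveData) : IsOpen {r | d.Generic r} :=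
  (isOpen_ne.preimage d.continuous_D).inter (isOpen_ne.preimage Complex.continuous_exp)

theorem continuousAt_Y {r x : ℂ} (hx : x ≠ 0) :
    ContinuousAt (fun p : ℂ × ℂ => d.Y p.1 p.2) (r, x) := by
  have h1 : ContinuousAt (fun p : ℂ × ℂ => d.A p.1) (r, x) :=
    (d.continuous_A.comp continuous_fst).continuousAt
  have h2 : ContinuousAt (fun p : ℂ × ℂ => d.C p.1) (r, x) :=
    (d.continuous_C.comp continuous_fst).continuousAt
  have h3 : ContinuousAt (fun p : ℂ × ℂ => p.2) (r, x) := continuous_snd.continuousAt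
  exact (h1.mul h3).sub (h2.div h3 hx)

/-- Take the branch s of √D with s(r₀) = Y. A nearby point of the curve has Y = ±s, and the sign -1
is excluded because Y + s stays away from 0. -/
theorem exists_local_sheet {r₀ x₀ : ℂ} (hg : d.Generic r₀) (hx : d.OnCurve r₀ x₀) {R : Set ℂ}
    (hR : R ∈ 𝓝 r₀) :
    ∃ δ > 0, ∃ s : ℂ → ℂ, s r₀ = d.Y r₀ x₀ ∧ (∀ z ∈ ball r₀ δ, z ∈ R ∧ d.Generic z ∧
      DifferentiableAt ℂ s z ∧ s z ^ 2 = d.D z ∧ s z ≠ 0) ∧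
      ∀ᶠ p in 𝓝 (r₀, x₀), d.OnCurve p.1 p.2 → p.2 = d.root p.1 (s p.1) := by
  obtain ⟨δ, hδ, hball⟩ := Metric.mem_nhds_iff.1
    (inter_mem hR (d.isOpen_generic.mem_nhds hg))
  obtain ⟨s, hs0, hs1, hs2, hs3⟩ := exists_sqrt_ball (f := d.D) (c := r₀) hδ
    (fun z _ => (d.hasDerivAt_D z).differentiableAt.differentiableWithinAt)
    (fun z hz => (hball hz).2.1) (d.Y r₀ x₀) hx.sq_Y
  refine ⟨δ, hδ, s, hs0, fun z hz => ⟨(hball hz).1, (hball hz).2,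
    (hs3 z hz).differentiableAt, hs1 z hz, hs2 z hz⟩, ?_⟩
  have h1 : ContinuousAt (fun p : ℂ × ℂ => d.Y p.1 p.2 + s p.1) (r₀, x₀) :=
    (continuousAt_Y hx.1).add
      (ContinuousAt.comp (x := (r₀, x₀)) (hs3 r₀ (mem_ball_self hδ)).continuousAt continuousAt_fst)
  have h2 : d.Y r₀ x₀ + s r₀ ≠ 0 := by
    rw [hs0, ← two_mul]
    exact mul_ne_zero two_ne_zero (hx.Y_ne_zero hg.1)
  have h3 : ∀ᶠ p : ℂ × ℂ in 𝓝 (r₀, x₀), p.1 ∈ ball r₀ δ :=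
    continuousAt_fst.eventually (isOpen_ball.mem_nhds (mem_ball_self hδ))
  filter_upwards [h1.eventually_ne h2, h3] with p hp hp2 hc
  rcases sq_eq_sq_iff_eq_or_eq_neg.1 (hc.sq_Y.trans (hs1 _ hp2).symm) with h | h
  · rw [← h]; exact hc.eq_root (hball hp2).2.A_ne_zero
  · exact absurd (by rw [h, neg_add_cancel]) hp

theorem differentiableAt_root {s : ℂ → ℂ} {z : ℂ} (hs : DifferentiableAt ℂ s z)
    (hz : d.Generic z) : DifferentiableAt ℂ (fun z => d.root z (s z)) z :=
  (hs.sub (d.hasDerivAt_b z).differentiableAt).div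
    ((d.hasDerivAt_A z).differentiableAt.const_mul 2) (mul_ne_zero two_ne_zero hz.A_ne_zero)

section

variable {e : ℕ} {κ : ℂ} {R : Set ℂ} {F σ : ℂ → ℂ → ℂ}

theorem FlatOn.mono (h : d.FlatOn e κ R F) {R' : Set ℂ} (hR : R' ⊆ R) : d.FlatOn e κ R' F where
  ne_zero r hr := h.ne_zero r (hR hr)
  shift r hr := h.shift r (hR hr)
  hasDerivAt r hr := h.hasDerivAt r (hR hr)

/-- Two flat sections have the same logarithmic derivative on each sheet, so their quotient is
locally constant. -/
theorem FlatOn.ratio_eventually (hF : d.FlatOn e κ R F) (hσ : d.FlatOn e κ R σ) {r₀ x₀ : ℂ}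
    (hR : R ∈ 𝓝 r₀) (hg : d.Generic r₀) (hx : d.OnCurve r₀ x₀) :
    ∀ᶠ p : ℂ × ℂ in 𝓝 (r₀, x₀), d.OnCurve p.1 p.2 →
      F p.1 p.2 / σ p.1 p.2 = F r₀ x₀ / σ r₀ x₀ := by
  obtain ⟨δ, hδ, s, hs0, hs, hev⟩ := exists_local_sheet hg hx hR
  have hc : ∀ z ∈ ball r₀ δ, d.OnCurve z (d.root z (s z)) := fun z hz =>
    (Y_root (hs z hz).2.1.A_ne_zero (hs z hz).2.1.C_ne_zero (hs z hz).2.2.2.1).1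
  have hd : ∀ z ∈ ball r₀ δ,
      HasDerivAt (fun z => F z (d.root z (s z)) / σ z (d.root z (s z))) 0 z := by
    intro z hz
    obtain ⟨hzR, hzg, hzd, hz2, -⟩ := hs z hz
    have hev : ∀ᶠ w in 𝓝 z, d.OnCurve w (d.root w (s w)) := by
      filter_upwards [isOpen_ball.mem_nhds hz] with w hw using hc w hw
    have h1 := hF.hasDerivAt z hzR hzg _ (differentiableAt_root hzd hzg) hev
    have h2 := hσ.hasDerivAt z hzR hzg _ (differentiableAt_root hzd hzg) hev
    convert! h1.div h2 (hσ.ne_zero z hzR hzg _ (hc z hz)) using 1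
    ring
  have hconst : ∀ z ∈ ball r₀ δ, F z (d.root z (s z)) / σ z (d.root z (s z)) =
      F r₀ (d.root r₀ (s r₀)) / σ r₀ (d.root r₀ (s r₀)) := fun z hz =>
    isOpen_ball.is_const_of_deriv_eq_zero (convex_ball _ _).isPreconnected
      (fun w hw => (hd w hw).differentiableAt.differentiableWithinAt)
      (fun w hw => (hd w hw).deriv) hz (mem_ball_self hδ)
  have h3 : ∀ᶠ p : ℂ × ℂ in 𝓝 (r₀, x₀), p.1 ∈ ball r₀ δ :=
    continuousAt_fst.eventually (isOpen_ball.mem_nhds (mem_ball_self hδ))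
  filter_upwards [hev, h3] with p hp hp2 hpc
  rw [hp hpc, hconst _ hp2, hs0, ← hx.eq_root hg.A_ne_zero]

end

/-- A locally constant function on the generic part of the curve is constant on connected sets. -/
theorem const_of_eventually {T E : Type*} [TopologicalSpace T] {G : ℂ → ℂ → E} {V : Set T}
    (hV : IsPreconnected V) {ρ X : T → ℂ} (hρ : ContinuousOn ρ V) (hX : ContinuousOn X V)
    (hc : ∀ t ∈ V, d.OnCurve (ρ t) (X t))
    (hG : ∀ t ∈ V, ∀ᶠ p : ℂ × ℂ in 𝓝 (ρ t, X t), d.OnCurve p.1 p.2 →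
      G p.1 p.2 = G (ρ t) (X t)) {t t' : T} (ht : t ∈ V) (ht' : t' ∈ V) :
    G (ρ t) (X t) = G (ρ t') (X t') := by
  have : PreconnectedSpace V := isPreconnected_iff_preconnectedSpace.1 hV
  have : IsLocallyConstant fun t : V => G (ρ t) (X t) := by
    refine (IsLocallyConstant.iff_eventually_eq _).2 fun t => ?_
    have h1 : ContinuousAt (fun t : V => (ρ t, X t)) t :=
      (continuousOn_iff_continuous_domRestrict.1 hρ).continuousAt.prodMk
        (continuousOn_iff_continuous_domRestrict.1 hX).continuousAt
    filter_upwards [h1.eventually (hG t t.2)] with s hs using hs (hc s s.2)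
  exact this.apply_eq_of_preconnectedSpace ⟨t, ht⟩ ⟨t', ht'⟩

/-- Two flat sections are proportional over a connected set. -/
theorem FlatOn.ratio_const {e : ℕ} {κ : ℂ} {R : Set ℂ} {F σ : ℂ → ℂ → ℂ} {T : Type*}
    [TopologicalSpace T] (hF : d.FlatOn e κ R F)
    (hσ : d.FlatOn e κ R σ) {V : Set T} (hV : IsPreconnected V) {ρ X : T → ℂ}
    (hρ : ContinuousOn ρ V) (hX : ContinuousOn X V) (hR : ∀ t ∈ V, R ∈ 𝓝 (ρ t))
    (hg : ∀ t ∈ V, d.Generic (ρ t)) (hc : ∀ t ∈ V, d.OnCurve (ρ t) (X t)) {t t' : T}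
    (ht : t ∈ V) (ht' : t' ∈ V) :
    F (ρ t) (X t) / σ (ρ t) (X t) = F (ρ t') (X t') / σ (ρ t') (X t') :=
  const_of_eventually (G := fun r x => F r x / σ r x) hV hρ hX hc
    (fun t ht => hF.ratio_eventually hσ (hR t ht) (hg t ht) (hc t ht)) ht ht'

end CurveData

/-! ### The ends of the curve -/

theorem exists_bound_half_ball {f : ℂ → ℂ} {δ : ℝ} (hf : DifferentiableOn ℂ f (ball 0 δ))
    (hδ : 0 < δ) : ∃ C, 0 ≤ C ∧ ∀ q ∈ ball (0 : ℂ) (δ / 2), ‖f q‖ ≤ C := by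
  obtain ⟨C, hC⟩ := (isCompact_closedBall (0 : ℂ) (δ / 2)).exists_bound_of_continuousOn
    (hf.continuousOn.mono (closedBall_subset_ball (by linarith)))
  exact ⟨C, (norm_nonneg _).trans (hC 0 (by simp; linarith)),
    fun q hq => hC q (ball_subset_closedBall hq)⟩

theorem exists_linear_bound {f : ℂ → ℂ} {δ : ℝ} (hf : DifferentiableOn ℂ f (ball 0 δ))
    (hδ : 0 < δ) (h0 : f 0 = 0) :
    ∃ C, 0 ≤ C ∧ ∀ q ∈ ball (0 : ℂ) (δ / 2), ‖f q‖ ≤ C * ‖q‖ := by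
  obtain ⟨C, hC0, hC⟩ := exists_bound_half_ball
    ((Complex.differentiableOn_dslope (isOpen_ball.mem_nhds (mem_ball_self hδ))).2 hf) hδ
  refine ⟨C, hC0, fun q hq => ?_⟩
  have h := sub_smul_dslope f 0 q
  rw [h0, sub_zero, sub_zero, smul_eq_mul] at h
  rw [← h, norm_mul, mul_comm]
  exact mul_le_mul_of_nonneg_right (hC q hq) (norm_nonneg _)

theorem norm_exp_neg_div (r : ℂ) (N : ℕ) :
    ‖Complex.exp (-r / N)‖ = Real.exp (-r.re / N) := by
  rw [Complex.norm_exp, ← Complex.ofReal_natCast, Complex.div_ofReal_re, Complex.neg_re]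

namespace CurveData

variable {d : CurveData}

/-- A sheet of the curve over a neighbourhood of `x₁ = ∞`, ramified of order `N`, with a
flat section `S`. -/
structure IsEndSheet (d : CurveData) (e : ℕ) (κ : ℂ) (M B : ℝ) (N : ℕ) (m : ℤ) (ph : ℂ)
    (X S η ξ : ℂ → ℂ) : Prop where
  pos : 0 < N
  nonneg : 0 ≤ B
  ph_pow : ph ^ N = (-1) ^ (m * N)
  generic : ∀ r : ℂ, M < r.re → d.Generic r
  onCurve : ∀ r : ℂ, M < r.re → d.OnCurve r (X r)
  X_eq : ∀ r, X r = -ph * Complex.exp (m / N * r + η r)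
  S_eq : ∀ r, S r = Complex.exp (-(e * m / (4 * πi * N)) * r ^ 2 + ξ r)
  differentiableAt : ∀ r : ℂ, M < r.re → DifferentiableAt ℂ η r
  hasDerivAt : ∀ r : ℂ, M < r.re → HasDerivAt S (S r * d.Λ e κ r (X r)) r
  shift_η : ∀ r, η (r - 2 * πi * N) = η r
  shift_ξ : ∀ r, ξ (r - 2 * πi * N) = ξ r + e * N * η r
  norm_η : ∀ r : ℂ, M < r.re → ‖η r‖ ≤ B * Real.exp (-r.re / N)
  norm_ξ : ∀ r : ℂ, M < r.re → ‖ξ r‖ ≤ B * (1 + ‖r‖) * Real.exp (-r.re / N)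
  norm_Y : ∀ r : ℂ, M < r.re → ‖(d.Y r (X r))⁻¹‖ ≤ B * Real.exp (-r.re / N)

/-- With the uniformizer q = exp(-r/N), integrate -(e/(2πi)) r dlog X + κω term by term. The leading
part of dlog X gives the term in r², ∫ r dη = rη - ∫ η dr gives rη + E(q), and ω is holomorphic in q
with primitive U(q). The factor r in rη makes ξ change by e N η under r ↦ r - 2πi N. -/
theorem exists_isEndSheet (d : CurveData) (e : ℕ) (κ : ℂ) {N : ℕ} (hN : 0 < N) {m : ℤ} {ph : ℂ}
    (hph : ph ^ N = (-1) ^ (m * N)) {δ : ℝ} (hδ : 0 < δ) {η v : ℂ → ℂ}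
    (hη : DifferentiableOn ℂ η (ball 0 δ)) (hη0 : η 0 = 0) (hv : DifferentiableOn ℂ v (ball 0 δ))
    (h : ∀ r : ℂ, Complex.exp (-r / N) ∈ ball (0 : ℂ) δ → d.Generic r ∧
      d.OnCurve r (-ph * Complex.exp (m / N * r + η (Complex.exp (-r / N)))) ∧
      d.Y r (-ph * Complex.exp (m / N * r + η (Complex.exp (-r / N)))) *
        (Complex.exp (-r / N) * v (Complex.exp (-r / N))) = 1) :
    ∃ M B X S η ξ, d.IsEndSheet e κ M B N m ph X S η ξ ∧ ∀ r : ℂ, M < r.re →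
      d.Y r (X r) * (Complex.exp (-r / N) * v (Complex.exp (-r / N))) = 1 := by
  have hN0 : (N : ℂ) ≠ 0 := Nat.cast_ne_zero.2 hN.ne'
  have hNR : (0 : ℝ) < N := Nat.cast_pos.2 hN
  have hpi := two_pi_I_ne
  have hpi1 : πi ≠ 0 := right_ne_zero_of_mul hpi
  set q : ℂ → ℂ := fun r => Complex.exp (-r / N) with hq
  have hd : DifferentiableOn ℂ (dslope η 0) (ball 0 δ) :=
    (Complex.differentiableOn_dslope (isOpen_ball.mem_nhds (mem_ball_self hδ))).2 hη
  -- Along r ↦ q the derivative of E(q) is -η, because dq/dr = -q/N.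
  obtain ⟨E, hE0, hE⟩ := (hd.const_mul (N : ℂ)).isExactOn_ball.with_val_at 0 0
  obtain ⟨U, hU0, hU⟩ := (hv.const_mul (N * d.a / (2 * πi))).isExactOn_ball.with_val_at 0 0
  obtain ⟨B₁, hB₁0, hB₁⟩ := exists_linear_bound hη hδ hη0
  obtain ⟨B₂, hB₂0, hB₂⟩ := exists_linear_bound
    (fun z hz => (hE z hz).differentiableAt.differentiableWithinAt) hδ hE0
  obtain ⟨B₃, hB₃0, hB₃⟩ := exists_linear_bound
    (fun z hz => (hU z hz).differentiableAt.differentiableWithinAt) hδ hU0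
  obtain ⟨B₄, hB₄0, hB₄⟩ := exists_bound_half_ball hv hδ
  set ξ : ℂ → ℂ := fun r => -(e / (2 * πi)) * (r * η (q r) + E (q r)) + κ * U (q r) with hξ
  set X : ℂ → ℂ := fun r => -ph * Complex.exp (m / N * r + η (q r)) with hX
  set S : ℂ → ℂ := fun r => Complex.exp (-(e * m / (4 * πi * N)) * r ^ 2 + ξ r) with hS
  set c := ‖(e / (2 * πi) : ℂ)‖ with hc
  have hc0 : 0 ≤ c := norm_nonneg _
  -- the half plane
  have hqnorm : ∀ r : ℂ, ‖q r‖ = Real.exp (-r.re / N) := fun r => norm_exp_neg_div r N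
  have hmem : ∀ r : ℂ, -N * Real.log (δ / 2) < r.re → q r ∈ ball (0 : ℂ) (δ / 2) := by
    intro r hr
    rw [mem_ball_zero_iff, hqnorm, ← Real.lt_log_iff_exp_lt (by linarith), div_lt_iff₀ hNR]
    linarith
  have hmem' : ∀ r : ℂ, -N * Real.log (δ / 2) < r.re → q r ∈ ball (0 : ℂ) δ := fun r hr =>
    ball_subset_ball (by linarith) (hmem r hr)
  have hq' : ∀ r, HasDerivAt q (-q r / N) r := by
    intro r
    convert! ((hasDerivAt_id r).neg.div_const (N : ℂ)).cexp using 1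
    simp [hq]; ring
  have hqshift : ∀ r, q (r - 2 * πi * N) = q r := by
    intro r
    simp only [hq]
    rw [show -(r - 2 * πi * N) / N = -r / N + 2 * Real.pi * Complex.I by field_simp; ring]
    exact Complex.exp_periodic _
  have hηq : ∀ r : ℂ, -N * Real.log (δ / 2) < r.re →
      HasDerivAt (fun r => η (q r)) (deriv η (q r) * (-q r / N)) r := fun r hr =>
    (hη.differentiableAt (isOpen_ball.mem_nhds (hmem' r hr))).hasDerivAt.comp r (hq' r)
  refine ⟨-N * Real.log (δ / 2), B₁ + (c * (B₁ + B₂) + ‖κ‖ * B₃) + B₄, X, S, fun r => η (q r), ξ,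
    ⟨hN, by positivity, hph, fun r hr => (h r (hmem' r hr)).1, fun r hr => (h r (hmem' r hr)).2.1,
    fun r => rfl, fun r => rfl, fun r hr => (hηq r hr).differentiableAt, ?_, fun r => ?_,
    fun r => ?_, ?_, ?_, ?_⟩, fun r hr => (h r (hmem' r hr)).2.2⟩
  · intro r hr
    obtain ⟨hg, hcv, hY⟩ := h r (hmem' r hr)
    have h1 : HasDerivAt (fun r => E (q r)) _ r := (hE _ (hmem' r hr)).comp r (hq' r)
    have h2 : HasDerivAt (fun r => U (q r)) _ r := (hU _ (hmem' r hr)).comp r (hq' r)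
    have h3 : HasDerivAt ξ _ r :=
      ((((hasDerivAt_id r).mul (hηq r hr)).add h1).const_mul (-(e / (2 * πi)))).add
        (h2.const_mul κ)
    have h4 : HasDerivAt S _ r :=
      ((((hasDerivAt_id r).pow 2).const_mul (-(e * m / (4 * πi * N)))).add h3).cexp
    have hXd : HasDerivAt X _ r :=
      ((((hasDerivAt_id r).const_mul (m / N : ℂ)).add (hηq r hr)).cexp).const_mul (-ph)
    have hYr : d.Y r (X r) ≠ 0 := left_ne_zero_of_mul_eq_one hY
    have hcurve : ∀ᶠ z in 𝓝 r, d.OnCurve z (X z) := by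
      filter_upwards [(isOpen_lt continuous_const Complex.continuous_re).mem_nhds hr] with z hz
        using (h z (hmem' z hz)).2.1
    have hX0 : X r ≠ 0 := hcv.1
    convert! h4 using 1
    rw [← Λ_eq hg.1 hXd hcurve, ω, if_neg hYr]
    have hdl : q r * dslope η 0 (q r) = η (q r) := by
      have := sub_smul_dslope η 0 (q r)
      rwa [hη0, sub_zero, sub_zero, smul_eq_mul] at this
    have hinv : (-1 : ℂ) / d.Y r (X r) = -(q r * v (q r)) := by
      rw [div_eq_iff hYr]; linear_combination hY
    have hlog : (-ph * (Complex.exp (m / N * r + η (q r)) *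
        (m / N * 1 + deriv η (q r) * (-q r / N)))) / X r =
        m / N + deriv η (q r) * (-q r / N) := by
      rw [div_eq_iff hX0, hX]; ring
    simp only [id, Pi.add_apply, Pi.pow_apply] at hlog ⊢
    rw [hlog, hinv]
    have e1 : N * dslope η 0 (q r) * (-q r / N) = -η (q r) := by
      rw [← hdl]; field_simp
    rw [e1]
    change S r * _ = S r * _
    congr 1
    field_simp
    ring
  · rw [hqshift]
  · simp only [hξ, hqshift]
    field_simp
    ring
  · intro r hr
    refine (hB₁ _ (hmem r hr)).trans ?_
    rw [hqnorm]
    gcongr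
    nlinarith [norm_nonneg κ, mul_nonneg (norm_nonneg κ) hB₃0, mul_nonneg hc0 hB₁0,
      mul_nonneg hc0 hB₂0]
  · intro r hr
    have h1 := hB₁ _ (hmem r hr)
    have h2 := hB₂ _ (hmem r hr)
    have h3 := hB₃ _ (hmem r hr)
    rw [hqnorm] at h1 h2 h3
    set t := Real.exp (-r.re / N)
    have ht : 0 ≤ t := (Real.exp_pos _).le
    have hr0 := norm_nonneg r
    calc ‖ξ r‖ ≤ ‖-(e / (2 * πi)) * (r * η (q r) + E (q r))‖ + ‖κ * U (q r)‖ := norm_add_le _ _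
      _ ≤ c * (‖r‖ * ‖η (q r)‖ + ‖E (q r)‖) + ‖κ‖ * ‖U (q r)‖ := by
          rw [norm_mul, norm_neg, norm_mul]
          gcongr
          refine (norm_add_le _ _).trans ?_
          rw [norm_mul]
      _ ≤ c * (‖r‖ * (B₁ * t) + B₂ * t) + ‖κ‖ * (B₃ * t) := by gcongr
      _ ≤ (c * (B₁ + B₂) + ‖κ‖ * B₃) * (1 + ‖r‖) * t := by
          have e1 : 0 ≤ c * B₁ * t := by positivity
          have e2 : 0 ≤ c * B₂ * t * ‖r‖ := by positivity
          have e3 : 0 ≤ ‖κ‖ * B₃ * t * ‖r‖ := by positivity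
          nlinarith
      _ ≤ _ := by
          refine mul_le_mul_of_nonneg_right (mul_le_mul_of_nonneg_right ?_ (by positivity)) ht
          linarith
  · intro r hr
    obtain ⟨hg, hcv, hY⟩ := h r (hmem' r hr)
    rw [inv_eq_of_mul_eq_one_right hY, norm_mul, hqnorm, mul_comm]
    gcongr
    refine (hB₄ _ (hmem r hr)).trans ?_
    nlinarith [norm_nonneg κ, mul_nonneg (norm_nonneg κ) hB₃0, mul_nonneg hc0 hB₁0,
      mul_nonneg hc0 hB₂0]

end CurveData

/-! ### Asymptotics of the sheets over x₁ = ∞ -/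

namespace CurveData

variable {d : CurveData}

theorem row_eq (i : ℤ) (k : ℕ) (r : ℂ) : (-Complex.exp r) ^ i * (1 - Complex.exp r) ^ k =
    (-Complex.exp r) ^ (i + k) * (1 - Complex.exp (-r)) ^ k := by
  have h : 1 - Complex.exp r = -Complex.exp r * (1 - Complex.exp (-r)) := by
    rw [Complex.exp_neg]
    have := Complex.exp_ne_zero r
    field_simp
    ring
  rw [h, mul_pow, ← mul_assoc, zpow_add₀ (neg_ne_zero.2 (Complex.exp_ne_zero r)), zpow_natCast]

theorem neg_exp_zpow (r : ℂ) (i : ℤ) :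
    (-Complex.exp r) ^ i = (-1) ^ i * Complex.exp (i * r) := by
  rw [neg_eq_neg_one_mul, mul_zpow, Complex.exp_int_mul]

theorem A_eq (d : CurveData) (r : ℂ) : d.A r =
    (-1) ^ (d.i + d.k) * Complex.exp ((d.i + d.k : ℤ) * r) * (1 - Complex.exp (-r)) ^ d.k := by
  rw [A, row_eq, neg_exp_zpow]

theorem C_eq (d : CurveData) (r : ℂ) : d.C r =
    (-1) ^ (d.j + d.l) * Complex.exp ((d.j + d.l : ℤ) * r) * (1 - Complex.exp (-r)) ^ d.l := by
  rw [C, row_eq, neg_exp_zpow]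

theorem neg_one_zpow_neg (n : ℤ) : (-1 : ℂ) ^ (-n) = (-1) ^ n := by
  rw [zpow_neg, ← inv_zpow]
  norm_num

/-- The coefficient `b` in the coordinate `w = exp (-r)`. -/
def P (d : CurveData) (w : ℂ) : ℂ := d.α - d.a * w + d.β * w ^ 2

/-- The discriminant in the coordinate `w = exp (-r)`. -/
def Q (d : CurveData) (p : ℕ) (w : ℂ) : ℂ := d.P w ^ 2 - 4 * ((-w) ^ p * (1 - w) ^ (d.k + d.l))

theorem b_eq (d : CurveData) (r : ℂ) : d.b r = -(Complex.exp r * d.P (Complex.exp (-r))) := by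
  rw [b, P, Complex.exp_neg]
  have := Complex.exp_ne_zero r
  field_simp
  ring

/-- Scaling by exp(2r) makes the discriminant a polynomial in w = exp(-r). Its order of vanishing at
w = 0 decides whether x₁ = ∞ is a branch point. -/
theorem D_eq (d : CurveData) {p : ℕ} (hp : (p : ℤ) = 2 - (d.i + d.k + (d.j + d.l))) (r : ℂ) :
    d.D r = Complex.exp r ^ 2 * d.Q p (Complex.exp (-r)) := by
  have hr : -Complex.exp r ≠ 0 := neg_ne_zero.2 (Complex.exp_ne_zero r)
  have h1 : (-Complex.exp r) ^ (d.i + d.k) * (-Complex.exp r) ^ (d.j + d.l) =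
      Complex.exp r ^ 2 * (-Complex.exp (-r)) ^ p := by
    rw [← zpow_add₀ hr, show d.i + d.k + (d.j + d.l) = 2 - p by omega, zpow_sub₀ hr, zpow_natCast,
      Complex.exp_neg, ← inv_neg, inv_pow, div_eq_mul_inv]
    norm_cast
    ring
  rw [D, A, C, row_eq, row_eq, b_eq, Q, pow_add]
  linear_combination (-4 * (1 - Complex.exp (-r)) ^ d.k * (1 - Complex.exp (-r)) ^ d.l) * h1

theorem differentiable_Q (d : CurveData) (p : ℕ) : Differentiable ℂ (d.Q p) := by
  unfold Q P; fun_prop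

theorem exp_neg_div_pow {N : ℕ} (hN : 0 < N) (r : ℂ) :
    Complex.exp (-r / N) ^ N = Complex.exp (-r) := by
  rw [← Complex.exp_nat_mul]
  congr 1
  have : (N : ℂ) ≠ 0 := Nat.cast_ne_zero.2 hN.ne'
  field_simp

theorem exists_small_ball {u : ℂ → ℂ} {δ : ℝ} (hδ : 0 < δ) (hu : DifferentiableOn ℂ u (ball 0 δ))
    (hu0 : u 0 = 1) {N : ℕ} (hN : 0 < N) : ∃ δ' > 0, δ' ≤ δ ∧ ∀ q ∈ ball (0 : ℂ) δ',
      u q ∈ Complex.slitPlane ∧ 1 - q ^ N ∈ Complex.slitPlane := by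
  have h1 : ∀ᶠ q in 𝓝 (0 : ℂ), u q ∈ Complex.slitPlane :=
    (hu.differentiableAt (isOpen_ball.mem_nhds (mem_ball_self hδ))).continuousAt.eventually
      (Complex.isOpen_slitPlane.mem_nhds (by simp [hu0]))
  have h2 : ∀ᶠ q in 𝓝 (0 : ℂ), 1 - q ^ N ∈ Complex.slitPlane :=
    (Continuous.continuousAt (by fun_prop : Continuous fun q : ℂ => 1 - q ^ N)).eventually
      (Complex.isOpen_slitPlane.mem_nhds (by simp [hN.ne']))
  obtain ⟨δ', hδ', h⟩ := Metric.eventually_nhds_iff_ball.1 (h1.and h2)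
  exact ⟨min δ' δ, lt_min hδ' hδ, min_le_right _ _, fun q hq =>
    h q (ball_subset_ball (min_le_left _ _) hq)⟩

theorem generic_of_sq {r y : ℂ} (hy : y ≠ 0) (hyD : y ^ 2 = d.D r)
    (hw : 1 - Complex.exp (-r) ≠ 0) : d.Generic r := by
  refine ⟨by rw [← hyD]; exact pow_ne_zero 2 hy, fun h => hw ?_⟩
  rw [Complex.exp_neg, h]; simp

/-- Here y = (q v(q))⁻¹ is the value of Y on the sheet. The root is recovered from A x₂ = (y - b)/2,
and dividing by A contributes -k log(1 - q^N) to η. -/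
theorem exists_endSheet_top (d : CurveData) (e : ℕ) (κ : ℂ) {N : ℕ} (hN : 0 < N) {m : ℤ}
    (hph : (-(-1) ^ (d.i + d.k) : ℂ) ^ N = (-1) ^ (m * N)) {δ : ℝ} (hδ : 0 < δ) {u v : ℂ → ℂ}
    (hu : DifferentiableOn ℂ u (ball 0 δ)) (hu0 : u 0 = 1) (hv : DifferentiableOn ℂ v (ball 0 δ))
    (hv0 : ∀ q ∈ ball (0 : ℂ) δ, v q ≠ 0)
    (h : ∀ r : ℂ, Complex.exp (-r / N) ∈ ball (0 : ℂ) δ →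
      (Complex.exp (-r / N) * v (Complex.exp (-r / N)))⁻¹ ^ 2 = d.D r ∧
      ((Complex.exp (-r / N) * v (Complex.exp (-r / N)))⁻¹ - d.b r) / 2 =
        Complex.exp ((m / N + (d.i + d.k : ℤ)) * r) * u (Complex.exp (-r / N))) :
    ∃ M B X S η ξ, d.IsEndSheet e κ M B N m (-(-1) ^ (d.i + d.k)) X S η ξ ∧ ∀ r : ℂ, M < r.re →
      d.Y r (X r) * (Complex.exp (-r / N) * v (Complex.exp (-r / N))) = 1 := by
  obtain ⟨δ', hδ', hle, hsmall⟩ := exists_small_ball hδ hu hu0 hN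
  have hsub : ball (0 : ℂ) δ' ⊆ ball 0 δ := ball_subset_ball hle
  refine exists_isEndSheet d e κ hN hph hδ'
    (η := fun q => Complex.log (u q) - d.k * Complex.log (1 - q ^ N)) ?_ ?_ (hv.mono hsub) ?_
  · refine ((hu.mono hsub).clog fun q hq => (hsmall q hq).1).sub (DifferentiableOn.const_mul ?_ _)
    exact DifferentiableOn.clog (by fun_prop) fun q hq => (hsmall q hq).2
  · simp [hu0, hN.ne']
  · intro r hr
    obtain ⟨h1, h2⟩ := h r (hsub hr)
    obtain ⟨h3, h4⟩ := hsmall _ hr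
    set q := Complex.exp (-r / N) with hq
    have hy : (q * v q)⁻¹ ≠ 0 := inv_ne_zero (mul_ne_zero (Complex.exp_ne_zero _) (hv0 q (hsub hr)))
    have hw : 1 - Complex.exp (-r) ≠ 0 := by
      rw [← exp_neg_div_pow hN]; exact Complex.slitPlane_ne_zero h4
    have hg := generic_of_sq hy h1 hw
    obtain ⟨h5, h6⟩ := Y_root hg.A_ne_zero hg.C_ne_zero h1
    have hX : -(-(-1) ^ (d.i + d.k)) * Complex.exp (m / N * r +
        (Complex.log (u q) - d.k * Complex.log (1 - q ^ N))) = d.root r (q * v q)⁻¹ := by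
      have hA := hg.A_ne_zero
      rw [root, mul_comm (2 : ℂ), ← div_div, div_right_comm, h2, eq_div_iff hA, A_eq,
        Complex.exp_add, Complex.exp_sub, Complex.exp_log (Complex.slitPlane_ne_zero h3),
        Complex.exp_nat_mul, Complex.exp_log (Complex.slitPlane_ne_zero h4), exp_neg_div_pow hN,
        add_mul, Complex.exp_add]
      have h7 : ((-1 : ℂ) ^ (d.i + d.k)) * (-1) ^ (d.i + d.k) = 1 := by
        rw [← mul_zpow]; simp
      field_simp
      linear_combination (u q) * h7
    refine ⟨hg, ?_⟩
    rw [hX]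
    exact ⟨h5, by rw [h6]; exact inv_mul_cancel₀ (fun h0 => hy (by rw [h0, inv_zero]))⟩

/-- On the other unramified sheet the leading terms of y - b cancel, so x₂ is read off from C/x₂ =
(-y - b)/2 instead. -/
theorem exists_endSheet_bottom (d : CurveData) (e : ℕ) (κ : ℂ)
    {δ : ℝ} (hδ : 0 < δ) {u v : ℂ → ℂ}
    (hu : DifferentiableOn ℂ u (ball 0 δ)) (hu0 : u 0 = 1) (hv : DifferentiableOn ℂ v (ball 0 δ))
    (hv0 : ∀ q ∈ ball (0 : ℂ) δ, v q ≠ 0)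
    (h : ∀ r : ℂ, Complex.exp (-r / (1 : ℕ)) ∈ ball (0 : ℂ) δ →
      (Complex.exp (-r / (1 : ℕ)) * v (Complex.exp (-r / (1 : ℕ))))⁻¹ ^ 2 = d.D r ∧
      (-(Complex.exp (-r / (1 : ℕ)) * v (Complex.exp (-r / (1 : ℕ))))⁻¹ - d.b r) / 2 =
        Complex.exp r * u (Complex.exp (-r / (1 : ℕ)))) :
    ∃ M B X S η ξ, d.IsEndSheet e κ M B 1 (d.j + d.l - 1) (-(-1) ^ (d.j + d.l)) X S η ξ ∧
      ∀ r : ℂ, M < r.re →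
      d.Y r (X r) * (Complex.exp (-r / (1 : ℕ)) * v (Complex.exp (-r / (1 : ℕ)))) = 1 := by
  obtain ⟨δ', hδ', hle, hsmall⟩ := exists_small_ball hδ hu hu0 one_pos
  have hsub : ball (0 : ℂ) δ' ⊆ ball 0 δ := ball_subset_ball hle
  refine exists_isEndSheet d e κ one_pos ?_ hδ'
    (η := fun q => d.l * Complex.log (1 - q ^ 1) - Complex.log (u q)) ?_ ?_ (hv.mono hsub) ?_
  · simp [zpow_sub₀, div_neg]
  · refine DifferentiableOn.sub (DifferentiableOn.const_mul ?_ _)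
      ((hu.mono hsub).clog fun q hq => (hsmall q hq).1)
    exact DifferentiableOn.clog (by fun_prop) fun q hq => (hsmall q hq).2
  · simp [hu0]
  · intro r hr
    obtain ⟨h1, h2⟩ := h r (hsub hr)
    obtain ⟨h3, h4⟩ := hsmall _ hr
    set q := Complex.exp (-r / (1 : ℕ)) with hq
    have hy : (q * v q)⁻¹ ≠ 0 := inv_ne_zero (mul_ne_zero (Complex.exp_ne_zero _) (hv0 q (hsub hr)))
    have hqr : q ^ 1 = Complex.exp (-r) := exp_neg_div_pow one_pos r
    have hw : 1 - Complex.exp (-r) ≠ 0 := by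
      rw [← hqr]; exact Complex.slitPlane_ne_zero h4
    have hg := generic_of_sq hy h1 hw
    obtain ⟨h5, h6⟩ := Y_root hg.A_ne_zero hg.C_ne_zero h1
    have hX : -(-(-1) ^ (d.j + d.l)) * Complex.exp ((d.j + d.l - 1 : ℤ) / (1 : ℕ) * r +
        (d.l * Complex.log (1 - q ^ 1) - Complex.log (u q))) = d.root r (q * v q)⁻¹ := by
      have h7 := h5.C_div
      rw [h6, h2, div_eq_iff h5.1, C_eq] at h7
      have hu1 := Complex.slitPlane_ne_zero h3
      have hE := Complex.exp_ne_zero r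
      rw [Complex.exp_add, Complex.exp_sub, Complex.exp_log hu1,
        Complex.exp_nat_mul, Complex.exp_log (Complex.slitPlane_ne_zero h4), hqr]
      have h8 : Complex.exp ((d.j + d.l - 1 : ℤ) / (1 : ℕ) * r) =
          Complex.exp ((d.j + d.l : ℤ) * r) / Complex.exp r := by
        rw [← Complex.exp_sub]; congr 1; push_cast; ring
      rw [h8]
      field_simp
      rw [one_div]
      linear_combination h7
    refine ⟨hg, ?_⟩
    rw [hX]
    exact ⟨h5, by rw [h6]; exact inv_mul_cancel₀ (fun h0 => hy (by rw [h0, inv_zero]))⟩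

theorem IsEndSheet.mono {e : ℕ} {κ : ℂ} {M B : ℝ} {N : ℕ} {m : ℤ} {ph : ℂ} {X S η ξ : ℂ → ℂ}
    (h : d.IsEndSheet e κ M B N m ph X S η ξ) {M' B' : ℝ} (hM : M ≤ M') (hB : B ≤ B') :
    d.IsEndSheet e κ M' B' N m ph X S η ξ where
  pos := h.pos
  nonneg := h.nonneg.trans hB
  ph_pow := h.ph_pow
  generic r hr := h.generic r (hM.trans_lt hr)
  onCurve r hr := h.onCurve r (hM.trans_lt hr)
  X_eq := h.X_eq
  S_eq := h.S_eq
  differentiableAt r hr := h.differentiableAt r (hM.trans_lt hr)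
  hasDerivAt r hr := h.hasDerivAt r (hM.trans_lt hr)
  shift_η := h.shift_η
  shift_ξ := h.shift_ξ
  norm_η r hr := (h.norm_η r (hM.trans_lt hr)).trans (by gcongr)
  norm_ξ r hr := (h.norm_ξ r (hM.trans_lt hr)).trans (by gcongr)
  norm_Y r hr := (h.norm_Y r (hM.trans_lt hr)).trans (by gcongr)

/-- At a simple zero of `d.Q p` at w = 0, the root √D is odd in the uniformizer q = exp(-r/2). The
turn r ↦ r - 2πi sends q to -q and therefore exchanges the two sheets. -/
theorem exists_end_ramified (d : CurveData) (e : ℕ) (κ : ℂ) {p : ℕ}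
    (hp : (p : ℤ) = 2 - (d.i + d.k + (d.j + d.l))) (hQ0 : d.Q p 0 = 0) {s₀ : ℂ}
    (hs₀ : s₀ ^ 2 = dslope (d.Q p) 0 0) (hne : s₀ ≠ 0) (m : ℤ) {g : ℂ × ℂ → ℂ}
    (hg : Differentiable ℂ g) (hg0 : g (0, s₀) = 1)
    (h : ∀ r s : ℂ, (s / Complex.exp (-r / (2 : ℕ)) - d.b r) / 2 =
      Complex.exp ((m / (2 : ℕ) + (d.i + d.k : ℤ)) * r) * g (Complex.exp (-r / (2 : ℕ)), s)) :
    ∃ M B X S η ξ, d.IsEndSheet e κ M B 2 m (-(-1) ^ (d.i + d.k)) X S η ξ ∧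
      ∀ r : ℂ, M < r.re → d.Y (r - 2 * πi) (X (r - 2 * πi)) = -d.Y r (X r) := by
  have hq3 : Differentiable ℂ (dslope (d.Q p) 0) := by
    rw [← differentiableOn_univ]
    exact (Complex.differentiableOn_dslope univ_mem).2 (d.differentiable_Q p).differentiableOn
  obtain ⟨δ, hδ, hball⟩ := Metric.eventually_nhds_iff_ball.1
    (hq3.continuous.continuousAt.eventually_ne (by rw [← hs₀]; exact pow_ne_zero 2 hne :
      dslope (d.Q p) 0 0 ≠ 0))
  obtain ⟨s, hs0, hs2, hsne, hs'⟩ := exists_sqrt_ball hδ hq3.differentiableOn hball s₀ hs₀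
  have hmap : ∀ q ∈ ball (0 : ℂ) (min δ 1), q ^ 2 ∈ ball (0 : ℂ) δ := by
    intro q hq
    rw [mem_ball_zero_iff, lt_min_iff] at hq
    rw [mem_ball_zero_iff, norm_pow]
    nlinarith [norm_nonneg q]
  have hsd : DifferentiableOn ℂ (fun q => s (q ^ 2)) (ball 0 (min δ 1)) := fun q hq =>
    ((hs' _ (hmap q hq)).differentiableAt.comp q (by fun_prop)).differentiableWithinAt
  obtain ⟨M, B, X, S, η, ξ, hS, hY⟩ := d.exists_endSheet_top e κ (N := 2) two_pos (m := m)
    (by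
      rw [show (m * (2 : ℕ) : ℤ) = 2 * m by push_cast; ring, zpow_mul, neg_sq, ← zpow_natCast,
        ← zpow_mul, mul_comm, zpow_mul]
      norm_num)
    (lt_min hδ one_pos) (u := fun q => g (q, s (q ^ 2))) (v := fun q => (s (q ^ 2))⁻¹)
    (hg.comp_differentiableOn (differentiableOn_id.prodMk hsd))
    (by simp [hs0, hg0]) (hsd.inv fun q hq => hsne _ (hmap q hq))
    (fun q hq => inv_ne_zero (hsne _ (hmap q hq))) (by
      intro r hr
      have hq0 := Complex.exp_ne_zero (-r / (2 : ℕ))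
      have hqr := exp_neg_div_pow two_pos r
      refine ⟨?_, ?_⟩
      · have h1 := sub_smul_dslope (d.Q p) 0 (Complex.exp (-r))
        rw [hQ0, sub_zero, sub_zero, smul_eq_mul] at h1
        have h2 := hs2 _ (hmap _ hr)
        rw [hqr] at h2
        rw [D_eq d hp, ← h1, ← h2, mul_inv, inv_inv, hqr, mul_pow, inv_pow, hqr, Complex.exp_neg]
        have := Complex.exp_ne_zero r
        field_simp
      · rw [← h, mul_inv, inv_inv]
        ring)
  refine ⟨M, B, X, S, η, ξ, hS, fun r hr => ?_⟩
  have h1 := hY r hr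
  have h2 := hY (r - 2 * πi) (by simpa using hr)
  have h3 : Complex.exp (-(r - 2 * πi) / (2 : ℕ)) = -Complex.exp (-r / (2 : ℕ)) := by
    rw [show -(r - 2 * πi) / (2 : ℕ) = -r / (2 : ℕ) + Real.pi * Complex.I by push_cast; ring,
      Complex.exp_add, Complex.exp_pi_mul_I]
    ring
  rw [h3] at h2
  simp only [neg_sq] at h2
  have h4 := right_ne_zero_of_mul_eq_one h1
  apply mul_right_cancel₀ h4
  linear_combination -h2 + h1

/-- The ends over `x₁ = ∞`: two unramified sheets or a ramified one. -/
theorem exists_ends (hd : d.Admissible) (e : ℕ) (κ : ℂ) :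
    (d.α = 1 ∧ d.i + d.k + (d.j + d.l) ≤ 1 ∧ ∃ M B X S η ξ X' S' η' ξ',
      d.IsEndSheet e κ M B 1 (1 - (d.i + d.k)) (-(-1) ^ (d.i + d.k)) X S η ξ ∧
      d.IsEndSheet e κ M B 1 (d.j + d.l - 1) (-(-1) ^ (d.j + d.l)) X' S' η' ξ' ∧
      ∀ r : ℂ, M < r.re → d.Y r (X' r) = -d.Y r (X r)) ∨
    (d.α = 2 ∧ d.i + d.k + (d.j + d.l) = 2 ∧ ∃ M B X S η ξ,
      d.IsEndSheet e κ M B 2 (2 - 2 * (d.i + d.k)) (-(-1) ^ (d.i + d.k)) X S η ξ ∧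
      ∀ r : ℂ, M < r.re → d.Y (r - 2 * πi) (X (r - 2 * πi)) = -d.Y r (X r)) ∨
    (d.α = 0 ∧ d.i + d.k + (d.j + d.l) = 1 ∧ ∃ M B X S η ξ,
      d.IsEndSheet e κ M B 2 (1 - 2 * (d.i + d.k)) (-(-1) ^ (d.i + d.k)) X S η ξ ∧
      ∀ r : ℂ, M < r.re → d.Y (r - 2 * πi) (X (r - 2 * πi)) = -d.Y r (X r)) := by
  rcases hd.right with ⟨hn, hα, ha⟩ | ⟨hn, hα⟩ | ⟨hn, hα⟩
  · refine Or.inr (Or.inl ⟨hα, hn, ?_⟩)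
    -- The leading terms of b² and 4AC cancel. The zero at infinity is simple by the smoothness
    -- condition a ≠ k + l.
    have hQ' : HasDerivAt (d.Q 0) (4 * (d.k + d.l - d.a)) 0 := by
      have h1 : HasDerivAt d.P (-d.a) 0 := by
        convert! (((hasDerivAt_id (0 : ℂ)).const_mul d.a).const_sub d.α).add
          (((hasDerivAt_id (0 : ℂ)).pow 2).const_mul d.β) using 1
        simp
      have h2 := ((((hasDerivAt_id (0 : ℂ)).const_sub 1).pow (d.k + d.l)).const_mul 1).const_mul 4
      convert! (h1.pow 2).sub h2 using 1
      simp [P, hα]; ring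
    obtain ⟨s₀, hs₀⟩ := IsAlgClosed.exists_pow_nat_eq (dslope (d.Q 0) 0 0) two_pos
    have hs₁ : dslope (d.Q 0) 0 0 = 4 * (d.k + d.l - d.a) := by rw [dslope_same, hQ'.deriv]
    refine d.exists_end_ramified e κ (p := 0) (by omega) (by simp [Q, P, hα]; norm_num) hs₀ ?_
      _ (g := fun z => (z.1 * z.2 + d.P (z.1 ^ 2)) / 2) ?_ ?_ ?_
    · rintro rfl
      rw [hs₁] at hs₀
      apply ha
      linear_combination (1 / 4) * hs₀
    · unfold P; fun_prop
    · simp [P, hα]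
    · intro r s
      have hqr := exp_neg_div_pow two_pos r
      have hq0 := Complex.exp_ne_zero (-r / (2 : ℕ))
      rw [show ((2 - 2 * (d.i + d.k) : ℤ) / (2 : ℕ) + (d.i + d.k : ℤ) : ℂ) * r = r by
        push_cast; ring]
      simp only [b_eq, hqr]
      have h1 : Complex.exp r = (Complex.exp (-r / (2 : ℕ)) ^ 2)⁻¹ := by
        rw [hqr, Complex.exp_neg, inv_inv]
      rw [h1]
      field_simp
      ring
  · refine Or.inl ⟨hα, hn, ?_⟩
    obtain ⟨p, hp⟩ := Int.eq_ofNat_of_zero_le (a := 2 - (d.i + d.k + (d.j + d.l))) (by omega)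
    -- For p > 0 the product AC is negligible against b², so the discriminant has a nonzero leading
    -- coefficient and the end is unramified.
    have hp0 : p ≠ 0 := by omega
    have hQ0 : d.Q p 0 = 1 := by simp [Q, P, hα, hp0]
    obtain ⟨δ, hδ, hball⟩ := Metric.eventually_nhds_iff_ball.1
      ((d.differentiable_Q p).continuous.continuousAt.eventually_ne (by rw [hQ0]; exact one_ne_zero :
        d.Q p 0 ≠ 0))
    obtain ⟨s, hs0, hs2, hsne, hs'⟩ := exists_sqrt_ball hδ (d.differentiable_Q p).differentiableOn
      hball 1 (by rw [hQ0]; simp)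
    have hsd : DifferentiableOn ℂ s (ball 0 δ) := fun q hq =>
      (hs' q hq).differentiableAt.differentiableWithinAt
    have hud : DifferentiableOn ℂ (fun q => (s q + d.P q) / 2) (ball 0 δ) :=
      (hsd.add (by unfold P; fun_prop)).div_const 2
    have hu0 : (s 0 + d.P 0) / 2 = 1 := by rw [hs0]; simp [P, hα]
    have hq1 : ∀ r : ℂ, Complex.exp (-r / (1 : ℕ)) = Complex.exp (-r) := fun r => by simp
    obtain ⟨M, B, X, S, η, ξ, hS, hY⟩ := d.exists_endSheet_top e κ (N := 1) one_pos
      (m := 1 - (d.i + d.k)) (by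
        rw [pow_one, Nat.cast_one, mul_one, sub_eq_add_neg, zpow_add₀ (by norm_num) 1, zpow_one,
          neg_one_zpow_neg]
        ring) hδ hud hu0
      (v := fun q => (s q)⁻¹) (hsd.inv hsne) (fun q hq => inv_ne_zero (hsne q hq)) (by
        intro r hr
        rw [hq1] at hr ⊢
        have hE := Complex.exp_ne_zero r
        refine ⟨?_, ?_⟩
        · rw [D_eq d hp.symm, ← hs2 _ hr, Complex.exp_neg]
          field_simp
        · rw [b_eq, show (((1 - (d.i + d.k) : ℤ) : ℂ) / (1 : ℕ) + (d.i + d.k : ℤ)) * r = r by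
            push_cast; ring, Complex.exp_neg]
          field_simp
          ring)
    obtain ⟨M', B', X', S', η', ξ', hS', hY'⟩ := d.exists_endSheet_bottom e κ hδ hud hu0
      (v := fun q => -(s q)⁻¹) (hsd.inv hsne).neg (fun q hq => neg_ne_zero.2 (inv_ne_zero (hsne q hq)))
      (by
        intro r hr
        rw [hq1] at hr ⊢
        have hE := Complex.exp_ne_zero r
        refine ⟨?_, ?_⟩
        · rw [D_eq d hp.symm, ← hs2 _ hr, Complex.exp_neg]
          field_simp
        · rw [b_eq, Complex.exp_neg]
          field_simp
          ring)
    refine ⟨max M M', max B B', X, S, η, ξ, X', S', η', ξ',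
      hS.mono (le_max_left _ _) (le_max_left _ _), hS'.mono (le_max_right _ _) (le_max_right _ _),
      fun r hr => ?_⟩
    have h1 := hY r ((le_max_left _ _).trans_lt hr)
    have h2 := hY' r ((le_max_right _ _).trans_lt hr)
    apply mul_right_cancel₀ (right_ne_zero_of_mul_eq_one h1)
    linear_combination -h2 + h1
  · refine Or.inr (Or.inr ⟨hα, hn, ?_⟩)
    -- For α = 0 the term AC dominates b². Its odd degree forces ramification, with no further
    -- condition on a.
    have hQ' : HasDerivAt (d.Q 1) 4 0 := by
      have h1 : HasDerivAt d.P (-d.a) 0 := by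
        convert! (((hasDerivAt_id (0 : ℂ)).const_mul d.a).const_sub d.α).add
          (((hasDerivAt_id (0 : ℂ)).pow 2).const_mul d.β) using 1
        simp
      have h2 := (((hasDerivAt_neg (0 : ℂ)).pow 1).mul
        (((hasDerivAt_id (0 : ℂ)).const_sub 1).pow (d.k + d.l))).const_mul 4
      convert! (h1.pow 2).sub h2 using 1
      simp [P, hα]
    have hs₁ : dslope (d.Q 1) 0 0 = 4 := by rw [dslope_same, hQ'.deriv]
    refine d.exists_end_ramified e κ (p := 1) (by omega) (by simp [Q, P, hα]) (s₀ := 2)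
      (by rw [hs₁]; norm_num) two_ne_zero
      _ (g := fun z => (z.2 - d.a * z.1 + d.β * z.1 ^ 3) / 2) ?_ ?_ ?_
    · fun_prop
    · simp
    · intro r s
      have hqr := exp_neg_div_pow two_pos r
      have hq0 := Complex.exp_ne_zero (-r / (2 : ℕ))
      rw [show ((1 - 2 * (d.i + d.k) : ℤ) / (2 : ℕ) + (d.i + d.k : ℤ) : ℂ) * r = -(-r / (2 : ℕ)) by
        push_cast; ring]
      have h1 : Complex.exp r = (Complex.exp (-r / (2 : ℕ)) ^ 2)⁻¹ := by
        rw [hqr, Complex.exp_neg, inv_inv]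
      rw [b_eq, h1, ← hqr, Complex.exp_neg, P, hα]
      field_simp
      ring

end CurveData

/-! ### The two sheets at infinity as a pair -/

namespace CurveData

variable {d : CurveData}

/-- The two sheets over a neighbourhood of `x₁ = ∞`, with flat sections; the turn `r ↦ r - 2πi`
permutes the sheets by `τ`. -/
structure IsEndPair (d : CurveData) (e : ℕ) (κ : ℂ) (M B : ℝ) (N : ℕ) (τ : Bool → Bool)
    (μ : Bool → ℝ) (ζ : Bool → ℂ) (X S ξ : Bool → ℂ → ℂ) : Prop where
  pos : 0 < N
  nonneg : 0 ≤ B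
  generic : ∀ r : ℂ, M < r.re → d.Generic r
  onCurve : ∀ t (r : ℂ), M < r.re → d.OnCurve r (X t r)
  Y_not : ∀ t (r : ℂ), M < r.re → d.Y r (X (!t) r) = -d.Y r (X t r)
  differentiableAt : ∀ t (r : ℂ), M < r.re → DifferentiableAt ℂ (X t) r
  hasDerivAt : ∀ t (r : ℂ), M < r.re → HasDerivAt (S t) (S t r * d.Λ e κ r (X t r)) r
  shift_X : ∀ t (r : ℂ), M < r.re → X t (r - 2 * πi) = X (τ t) r
  shift_S : ∀ t (r : ℂ), M < r.re → S t (r - 2 * πi) = (-X (τ t) r) ^ e * S (τ t) r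
  norm_ζ : ∀ t, ‖ζ t‖ = 1
  S_eq : ∀ t (r : ℂ), M < r.re → S t r = ζ t * Complex.exp (-(e * μ t / (4 * πi)) * r ^ 2 + ξ t r)
  norm_ξ : ∀ t (r : ℂ), M < r.re → ‖ξ t r‖ ≤ B * (1 + ‖r‖) * Real.exp (-r.re / N)
  norm_Y : ∀ t (r : ℂ), M < r.re → ‖(d.Y r (X t r))⁻¹‖ ≤ B * Real.exp (-r.re / N)

theorem sub_two_pi_I (r : ℂ) : r - 2 * πi = r + 2 * πi * (-1 : ℤ) := by
  push_cast; ring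

theorem Y_sub (d : CurveData) (r x : ℂ) : d.Y (r - 2 * πi) x = d.Y r x := by
  rw [sub_two_pi_I, Y_add_int]

theorem X₁_sub (d : CurveData) (r x : ℂ) : d.X₁ (r - 2 * πi) x = d.X₁ r x := by
  rw [sub_two_pi_I, X₁_add_int]

theorem onCurve_sub {d : CurveData} {r x : ℂ} : d.OnCurve (r - 2 * πi) x ↔ d.OnCurve r x := by
  rw [sub_two_pi_I, onCurve_add_int]

/-- A choice according to a boolean. -/
def pick {α : Type*} (x y : α) (t : Bool) : α := cond t x y

section Sheet

variable {e : ℕ} {κ : ℂ} {M B : ℝ} {N : ℕ} {m : ℤ} {ph : ℂ} {X S η ξ : ℂ → ℂ}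

theorem IsEndSheet.differentiableAt_X (h : d.IsEndSheet e κ M B N m ph X S η ξ) {r : ℂ}
    (hr : M < r.re) : DifferentiableAt ℂ X r := by
  have h1 : X = fun r => -ph * Complex.exp (m / N * r + η r) := funext h.X_eq
  have := h.differentiableAt r hr
  rw [h1]
  fun_prop

theorem IsEndSheet.neg_X (h : d.IsEndSheet e κ M B N m ph X S η ξ) (r : ℂ) :
    -X r = ph * Complex.exp (m / N * r + η r) := by
  rw [h.X_eq]; ring

theorem IsEndSheet.shift_X (h : d.IsEndSheet e κ M B N m ph X S η ξ) (r : ℂ) :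
    X (r - 2 * πi * N) = X r := by
  have hN : (N : ℂ) ≠ 0 := Nat.cast_ne_zero.2 h.pos.ne'
  rw [h.X_eq, h.X_eq, h.shift_η]
  have : (m / N : ℂ) * (r - 2 * πi * N) + η r =
      m / N * r + η r - m * (2 * Real.pi * Complex.I) := by
    field_simp
    ring
  rw [this, Complex.exp_sub, Complex.exp_int_mul_two_pi_mul_I, div_one]

theorem IsEndSheet.shift_S (h : d.IsEndSheet e κ M B N m ph X S η ξ) (r : ℂ) :
    S (r - 2 * πi * N) = ((-X r) ^ N) ^ e * S r := by
  have hN : (N : ℂ) ≠ 0 := Nat.cast_ne_zero.2 h.pos.ne'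
  have hpi := two_pi_I_ne
  have hpi1 : πi ≠ 0 := right_ne_zero_of_mul hpi
  rw [h.S_eq, h.S_eq, h.shift_ξ, h.neg_X, mul_pow, h.ph_pow, ← Complex.exp_nat_mul]
  have h1 : ((-1 : ℂ)) ^ (m * N) = Complex.exp (-(m * N * πi)) := by
    rw [← neg_one_zpow_neg, ← Complex.exp_pi_mul_I, ← Complex.exp_int_mul]
    congr 1; push_cast; ring
  rw [h1, ← Complex.exp_add, ← Complex.exp_nat_mul, ← Complex.exp_add]
  congr 1
  have hI : (Real.pi : ℂ) * Complex.I * (Real.pi * Complex.I) = -(Real.pi : ℂ) ^ 2 := by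
    linear_combination (Real.pi : ℂ) ^ 2 * Complex.I_mul_I
  field_simp
  ring

theorem isEndPair_unramified {m' : ℤ} {ph' : ℂ} {X' S' η' ξ' : ℂ → ℂ}
    (h : d.IsEndSheet e κ M B 1 m ph X S η ξ) (h' : d.IsEndSheet e κ M B 1 m' ph' X' S' η' ξ')
    (hY : ∀ r : ℂ, M < r.re → d.Y r (X' r) = -d.Y r (X r)) :
    d.IsEndPair e κ M B 1 id (pick m m') (pick 1 1) (pick X X') (pick S S') (pick ξ ξ') where
  pos := h.pos
  nonneg := h.nonneg
  generic := h.generic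
  onCurve := by rintro (_ | _); exacts [h'.onCurve, h.onCurve]
  Y_not := by
    rintro (_ | _) r hr
    · simp [pick, hY r hr]
    · exact hY r hr
  differentiableAt := by
    rintro (_ | _) r hr; exacts [h'.differentiableAt_X hr, h.differentiableAt_X hr]
  hasDerivAt := by rintro (_ | _); exacts [h'.hasDerivAt, h.hasDerivAt]
  shift_X := by
    rintro (_ | _) r -
    · simpa [pick] using h'.shift_X r
    · simpa [pick] using h.shift_X r
  shift_S := by
    rintro (_ | _) r -
    · simpa [pick] using h'.shift_S r
    · simpa [pick] using h.shift_S r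
  norm_ζ := by rintro (_ | _) <;> simp [pick]
  S_eq := by
    rintro (_ | _) r -
    · simpa [pick] using h'.S_eq r
    · simpa [pick] using h.S_eq r
  norm_ξ := by rintro (_ | _); exacts [h'.norm_ξ, h.norm_ξ]
  norm_Y := by rintro (_ | _); exacts [h'.norm_Y, h.norm_Y]

/-- The second sheet is the first one seen from r - 2πi. Dividing by (-X(r - 2πi))^e undoes the
factor that flat sections acquire under the turn. Completing the square in (r - 2πi)² leaves the
same quadratic exponent and a constant phase. -/
theorem isEndPair_ramified (h : d.IsEndSheet e κ M B 2 m ph X S η ξ)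
    (hY : ∀ r : ℂ, M < r.re → d.Y (r - 2 * πi) (X (r - 2 * πi)) = -d.Y r (X r)) :
    d.IsEndPair e κ M (B * (1 + 2 * Real.pi + e)) 2 not (fun _ => m / 2)
      (pick 1 ((ph⁻¹ * Complex.exp (m / 2 * πi)) ^ e)) (pick X fun r => X (r - 2 * πi))
      (pick S fun r => S (r - 2 * πi) / (-X (r - 2 * πi)) ^ e)
      (pick ξ fun r => ξ (r - 2 * πi) - e * η (r - 2 * πi)) := by
  have hpi := two_pi_I_ne
  have hpi1 : πi ≠ 0 := right_ne_zero_of_mul hpi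
  have hre : ∀ r : ℂ, M < r.re → M < (r - 2 * πi).re := fun r hr => by simpa using hr
  have hX4 : ∀ r : ℂ, X (r - 2 * πi - 2 * πi) = X r := fun r => by
    rw [← h.shift_X r]; congr 1; push_cast; ring
  have hcurve : ∀ r : ℂ, M < r.re → d.OnCurve r (X (r - 2 * πi)) := fun r hr =>
    onCurve_sub.1 (h.onCurve _ (hre r hr))
  have hYs : ∀ r : ℂ, M < r.re → d.Y r (X (r - 2 * πi)) = -d.Y r (X r) := fun r hr => by
    have := hY r hr
    rwa [Y_sub] at this
  have hph2 : ph ^ 2 = 1 := by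
    rw [h.ph_pow, mul_comm, zpow_mul]
    norm_num
  have hph : ‖ph‖ = 1 := by
    have := congrArg norm hph2
    rw [norm_pow, norm_one] at this
    exact (pow_eq_one_iff_of_nonneg (norm_nonneg _) two_ne_zero).1 this
  have hph0 : ph ≠ 0 := by rintro rfl; simp at hph
  have hB : B ≤ B * (1 + 2 * Real.pi + e) := by
    have : 0 ≤ 2 * Real.pi + e := by positivity
    nlinarith [h.nonneg]
  refine ⟨h.pos, ?_, h.generic, ?_, ?_, ?_, ?_, ?_, ?_, ?_, ?_, ?_, ?_⟩
  · exact h.nonneg.trans hB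
  · rintro (_ | _) r hr
    · exact hcurve r hr
    · exact h.onCurve r hr
  · rintro (_ | _) r hr
    · simp [pick, hYs r hr]
    · exact hYs r hr
  · rintro (_ | _) r hr
    · exact DifferentiableAt.comp (g := X) r (h.differentiableAt_X (hre r hr))
        (by fun_prop : DifferentiableAt ℂ (fun r : ℂ => r - 2 * πi) r)
    · exact h.differentiableAt_X hr
  · rintro (_ | _) r hr
    · have hX0 : -X (r - 2 * πi) ≠ 0 := neg_ne_zero.2 (hcurve r hr).1
      have h1 : HasDerivAt (fun r => S (r - 2 * πi)) _ r :=
        (h.hasDerivAt _ (hre r hr)).comp_sub_const r (2 * πi)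
      have h2 : HasDerivAt (fun r => X (r - 2 * πi)) _ r :=
        (h.differentiableAt_X (hre r hr)).hasDerivAt.comp_sub_const r (2 * πi)
      have hYr : d.Y r (X (r - 2 * πi)) ≠ 0 := (hcurve r hr).Y_ne_zero (h.generic r hr).1
      have hev : ∀ᶠ z in 𝓝 r, d.OnCurve z (X (z - 2 * πi)) := by
        filter_upwards [(isOpen_lt continuous_const Complex.continuous_re).mem_nhds hr] with z hz
          using hcurve z hz
      have ht := tangent_of_eventually (hasDerivAt_id r) h2 hev
      convert! h1.div (h2.neg.pow e) (pow_ne_zero e hX0) using 1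
      have h3 : d.Λ e κ (r - 2 * πi) (X (r - 2 * πi)) = d.Λ e κ r (X (r - 2 * πi)) +
          e * (deriv X (r - 2 * πi) / X (r - 2 * πi)) := by
        have h4 : deriv X (r - 2 * πi) / X (r - 2 * πi) =
            -d.X₁ r (X (r - 2 * πi)) / d.Y r (X (r - 2 * πi)) := by
          rw [eq_div_iff hYr]
          simp only [id] at ht
          linear_combination ht
        rw [h4, Λ, Λ, X₁_sub, Y_sub]
        field_simp
        ring
      rw [h3]
      simp only [pick, cond_false, Pi.neg_apply, Pi.pow_apply]
      have hX0' : X (r - 2 * πi) ≠ 0 := (hcurve r hr).1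
      rcases Nat.eq_zero_or_pos e with he | he
      · simp [he]
      · have h5 : (-X (r - 2 * πi)) ^ e = (-X (r - 2 * πi)) ^ (e - 1) * -X (r - 2 * πi) := by
          rw [← pow_succ]; congr 1; omega
        rw [h5]
        have h6 := pow_ne_zero (e - 1) hX0
        generalize (-X (r - 2 * πi)) ^ (e - 1) = w at h6 ⊢
        generalize X (r - 2 * πi) = x at hX0' ⊢
        field_simp
        ring
    · exact h.hasDerivAt r hr
  · rintro (_ | _) r -
    · exact hX4 r
    · rfl
  · rintro (_ | _) r hr
    · have h1 : S (r - 2 * πi - 2 * πi) = ((-X r) ^ 2) ^ e * S r := by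
        rw [← h.shift_S r]; congr 1; push_cast; ring
      have hX0 : -X r ≠ 0 := neg_ne_zero.2 (h.onCurve r hr).1
      have h2 := pow_ne_zero e hX0
      simp only [pick, cond_false, Bool.not_false, cond_true]
      rw [h1, hX4, ← pow_mul, mul_comm 2 e, pow_mul]
      field_simp
    · have hX0 : -X (r - 2 * πi) ≠ 0 := neg_ne_zero.2 (hcurve r hr).1
      simp only [pick, cond_false, Bool.not_true, cond_true]
      rw [mul_div_cancel₀ _ (pow_ne_zero e hX0)]
  · rintro (_ | _)
    · have : ‖Complex.exp (m / 2 * πi)‖ = 1 := by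
        rw [Complex.norm_exp]; simp
      simp only [pick, cond_false, norm_pow, norm_mul, norm_inv, hph, this]
      simp
    · simp [pick]
  · rintro (_ | _) r hr
    · simp only [pick, cond_false]
      rw [h.S_eq, h.neg_X, mul_pow, mul_pow, ← Complex.exp_nat_mul,
        ← Complex.exp_nat_mul, inv_pow, div_eq_mul_inv, mul_inv, ← Complex.exp_neg, mul_left_comm,
        ← Complex.exp_add, mul_assoc (ph ^ e)⁻¹, ← Complex.exp_add]
      congr 2
      push_cast
      field_simp
      ring
    · simpa [pick, div_div, mul_div_assoc', mul_comm, mul_left_comm] using h.S_eq r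
  · rintro (_ | _) r hr
    · have h1 := h.norm_ξ _ (hre r hr)
      have h2 := h.norm_η _ (hre r hr)
      have hre' : (r - 2 * πi).re = r.re := by simp
      rw [hre'] at h1 h2
      have h3 : ‖r - 2 * πi‖ ≤ ‖r‖ + 2 * Real.pi := by
        refine (norm_sub_le _ _).trans_eq ?_
        simp [abs_of_pos Real.pi_pos]
      set q := Real.exp (-r.re / (2 : ℕ)) with hq
      have hq0 : 0 ≤ q := (Real.exp_pos _).le
      have hB0 := h.nonneg
      have hr0 := norm_nonneg r
      have hp0 := Real.pi_pos
      calc ‖ξ (r - 2 * πi) - e * η (r - 2 * πi)‖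
          ≤ ‖ξ (r - 2 * πi)‖ + e * ‖η (r - 2 * πi)‖ := by
            refine (norm_sub_le _ _).trans_eq ?_
            simp
        _ ≤ B * (1 + (‖r‖ + 2 * Real.pi)) * q + e * (B * q) := by
            refine add_le_add (h1.trans ?_) (mul_le_mul_of_nonneg_left h2 (Nat.cast_nonneg e))
            gcongr
        _ = B * (1 + ‖r‖ + 2 * Real.pi + e) * q := by ring
        _ ≤ B * (1 + 2 * Real.pi + e) * (1 + ‖r‖) * q := by
            have : 1 + ‖r‖ + 2 * Real.pi + e ≤ (1 + 2 * Real.pi + e) * (1 + ‖r‖) := by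
              have : 0 ≤ (2 * Real.pi + e) * ‖r‖ := by positivity
              nlinarith
            rw [mul_assoc B (1 + 2 * Real.pi + e)]
            exact mul_le_mul_of_nonneg_right (mul_le_mul_of_nonneg_left this hB0) hq0
    · refine (h.norm_ξ r hr).trans ?_
      gcongr
  · rintro (_ | _) r hr
    · simp only [pick, cond_false]
      rw [hYs r hr, inv_neg, norm_neg]
      refine (h.norm_Y r hr).trans ?_
      gcongr
    · refine (h.norm_Y r hr).trans ?_
      gcongr

end Sheet

end CurveData

/-! ### Traces over the two sheets and their bounds at infinity -/

namespace CurveData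

variable {d : CurveData}

/-- A square root of the discriminant. -/
def sqrtD (d : CurveData) (r : ℂ) : ℂ := d.D r ^ (1 / 2 : ℂ)

theorem sqrtD_sq (d : CurveData) (r : ℂ) : d.sqrtD r ^ 2 = d.D r := by
  rw [sqrtD, ← Complex.cpow_nat_mul]
  norm_num

/-- The sum of the values at the two points over `r`. -/
def trace (d : CurveData) (F : ℂ → ℂ → ℂ) (r : ℂ) : ℂ :=
  F r (d.root r (d.sqrtD r)) + F r (d.root r (-d.sqrtD r))

/-- The sum of the values of `F / Y` at the two points over `r`. -/
def traceY (d : CurveData) (F : ℂ → ℂ → ℂ) (r : ℂ) : ℂ :=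
  (F r (d.root r (d.sqrtD r)) - F r (d.root r (-d.sqrtD r))) / d.sqrtD r

/-- The trace is symmetric in the two roots, so any square root of the discriminant may replace the
chosen one. In `traceY` both numerator and denominator change sign. -/
theorem trace_eq (F : ℂ → ℂ → ℂ) {r s : ℂ} (hs : s ^ 2 = d.D r) :
    d.trace F r = F r (d.root r s) + F r (d.root r (-s)) := by
  rcases sq_eq_sq_iff_eq_or_eq_neg.1 ((d.sqrtD_sq r).trans hs.symm) with h | h
  · rw [trace, h]
  · rw [trace, h, neg_neg, add_comm]

theorem traceY_eq (F : ℂ → ℂ → ℂ) {r s : ℂ} (hs : s ^ 2 = d.D r) :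
    d.traceY F r = (F r (d.root r s) - F r (d.root r (-s))) / s := by
  rcases sq_eq_sq_iff_eq_or_eq_neg.1 ((d.sqrtD_sq r).trans hs.symm) with h | h
  · rw [traceY, h]
  · rw [traceY, h, neg_neg, div_neg, ← neg_div, neg_sub]

theorem trace_eq_of_onCurve (F : ℂ → ℂ → ℂ) {r x x' : ℂ} (hA : d.A r ≠ 0) (hx : d.OnCurve r x)
    (hx' : d.OnCurve r x') (hY : d.Y r x' = -d.Y r x) : d.trace F r = F r x + F r x' := by
  rw [trace_eq F hx.sq_Y, ← hY, ← hx.eq_root hA, ← hx'.eq_root hA]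

theorem traceY_eq_of_onCurve (F : ℂ → ℂ → ℂ) {r x x' : ℂ} (hA : d.A r ≠ 0) (hx : d.OnCurve r x)
    (hx' : d.OnCurve r x') (hY : d.Y r x' = -d.Y r x) :
    d.traceY F r = (F r x - F r x') / d.Y r x := by
  rw [traceY_eq F hx.sq_Y, ← hY, ← hx.eq_root hA, ← hx'.eq_root hA]

/-- The section over a neighbourhood of `x₁ = ∞` with given values on the two sheets. -/
def pairSection (X S : Bool → ℂ → ℂ) (r x : ℂ) : ℂ :=
  open Classical in if x = X true r then S true r else S false r

section Pair

variable {e : ℕ} {κ : ℂ} {M B : ℝ} {N : ℕ} {τ : Bool → Bool} {μ : Bool → ℝ} {ζ : Bool → ℂ}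
  {X S ξ : Bool → ℂ → ℂ}

theorem IsEndPair.eventually_onCurve (h : d.IsEndPair e κ M B N τ μ ζ X S ξ) (t : Bool) {r : ℂ}
    (hr : M < r.re) : ∀ᶠ z in 𝓝 r, d.OnCurve z (X t z) := by
  filter_upwards [(isOpen_lt continuous_const Complex.continuous_re).mem_nhds hr] with z hz
    using h.onCurve t z hz

/-- Equal roots would give Y = -Y, but Y ≠ 0 at generic points. -/
theorem IsEndPair.ne (h : d.IsEndPair e κ M B N τ μ ζ X S ξ) {r : ℂ} (hr : M < r.re) :
    X false r ≠ X true r := by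
  intro h0
  have h1 := h.Y_not true r hr
  have h2 := (h.onCurve true r hr).Y_ne_zero (h.generic r hr).1
  rw [Bool.not_true, h0] at h1
  exact h2 (by linear_combination h1 / 2)

theorem IsEndPair.section_X (h : d.IsEndPair e κ M B N τ μ ζ X S ξ) (t : Bool) {r : ℂ}
    (hr : M < r.re) : pairSection X S r (X t r) = S t r := by
  cases t
  · rw [pairSection, if_neg (h.ne hr)]
  · rw [pairSection, if_pos rfl]

theorem IsEndPair.exists_eq (h : d.IsEndPair e κ M B N τ μ ζ X S ξ) {r x : ℂ} (hr : M < r.re)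
    (hx : d.OnCurve r x) : ∃ t, x = X t r := by
  have hA := (h.generic r hr).A_ne_zero
  rcases hx.eq_or_eq hA (h.onCurve true r hr).sq_Y with h1 | h1
  · exact ⟨true, by rw [h1, ← (h.onCurve true r hr).eq_root hA]⟩
  · refine ⟨false, ?_⟩
    rw [h1, ← h.Y_not true r hr, Bool.not_true, ← (h.onCurve false r hr).eq_root hA]

theorem IsEndPair.S_ne_zero (h : d.IsEndPair e κ M B N τ μ ζ X S ξ) (t : Bool) {r : ℂ}
    (hr : M < r.re) : S t r ≠ 0 := by
  rw [h.S_eq t r hr]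
  refine mul_ne_zero ?_ (Complex.exp_ne_zero _)
  intro h0
  have := h.norm_ζ t
  rw [h0, norm_zero] at this
  exact zero_ne_one this

theorem IsEndPair.flatOn (h : d.IsEndPair e κ M B N τ μ ζ X S ξ) :
    d.FlatOn e κ {r | M < r.re} (pairSection X S) where
  ne_zero r hr _ x hx := by
    obtain ⟨t, rfl⟩ := h.exists_eq hr hx
    rw [h.section_X t hr]
    exact h.S_ne_zero t hr
  shift r hr _ x hx := by
    have hr' : M < (r - 2 * πi).re := by simpa using hr
    obtain ⟨t, rfl⟩ := h.exists_eq hr hx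
    obtain ⟨t', ht'⟩ := h.exists_eq hr' (onCurve_sub.2 hx)
    have h1 : τ t' = t := by
      rw [h.shift_X t' r hr] at ht'
      have hne := h.ne hr
      cases t <;> cases hq : τ t' <;> rw [hq] at ht' <;> simp_all
    rw [h.section_X t hr, ht', h.section_X t' hr', h.shift_S t' r hr, h.shift_X t' r hr, h1]
  hasDerivAt r hr hg Z hZ hc := by
    obtain ⟨t, ht⟩ := h.exists_eq hr hc.self_of_nhds
    obtain ⟨δ, hδ, s, hs0, hs, hev⟩ := exists_local_sheet hg hc.self_of_nhds univ_mem
    have h1 : Tendsto (fun z => (z, Z z)) (𝓝 r) (𝓝 (r, Z r)) :=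
      continuousAt_id.prodMk hZ.continuousAt
    have h2 : Tendsto (fun z => (z, X t z)) (𝓝 r) (𝓝 (r, Z r)) := by
      rw [ht]
      exact continuousAt_id.prodMk (h.differentiableAt t r hr).continuousAt
    rw [ht, h.section_X t hr]
    refine (h.hasDerivAt t r hr).congr_of_eventuallyEq ?_
    filter_upwards [h1.eventually hev, h2.eventually hev, hc, h.eventually_onCurve t hr,
      (isOpen_lt continuous_const Complex.continuous_re).mem_nhds hr] with z e1 e2 e3 e4 e5
    rw [e1 e3, ← e2 e4, h.section_X t e5]

/-- A flat section is proportional to the flat section on each sheet. -/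
theorem IsEndPair.exists_const (h : d.IsEndPair e κ M B N τ μ ζ X S ξ) {F : ℂ → ℂ → ℂ}
    (hF : d.FlatOn e κ univ F) : ∃ c : Bool → ℂ, (∀ t, c (τ t) = c t) ∧
      ∀ t (r : ℂ), M < r.re → F r (X t r) = c t * S t r := by
  have hopen : IsOpen {r : ℂ | M < r.re} := isOpen_lt continuous_const Complex.continuous_re
  set r₀ : ℂ := ((M + 1 : ℝ) : ℂ) with hr₀
  have hr₀' : M < r₀.re := by simp [hr₀]
  have hconv : IsPreconnected {r : ℂ | M < r.re} := (convex_halfSpace_re_gt M).isPreconnected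
  have key : ∀ t (r : ℂ), M < r.re → F r (X t r) = F r₀ (X t r₀) / S t r₀ * S t r := by
    intro t r hr
    have h1 := (hF.mono (subset_univ {r : ℂ | M < r.re})).ratio_const h.flatOn hconv
      (ρ := id) (X := X t) continuousOn_id
      (fun r hr => (h.differentiableAt t r hr).continuousAt.continuousWithinAt)
      (fun r hr => hopen.mem_nhds hr) h.generic (h.onCurve t) hr hr₀'
    simp only [id, h.section_X t hr, h.section_X t hr₀'] at h1
    rw [← h1, div_mul_cancel₀ _ (h.S_ne_zero t hr)]
  refine ⟨fun t => F r₀ (X t r₀) / S t r₀, fun t => ?_, key⟩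
  have hr' : M < (r₀ - 2 * πi).re := by simpa using hr₀'
  have h1 := key t _ hr'
  have hc := h.onCurve (τ t) r₀ hr₀'
  rw [h.shift_X t r₀ hr₀', h.shift_S t r₀ hr₀', hF.shift r₀ (mem_univ _) (h.generic r₀ hr₀') _ hc]
    at h1
  have hX0 : (-X (τ t) r₀) ^ e ≠ 0 := pow_ne_zero e (neg_ne_zero.2 hc.1)
  rw [div_eq_iff (h.S_ne_zero _ hr₀')]
  apply mul_left_cancel₀ hX0
  linear_combination h1

/-- A quadratic phase has modulus depending on Re r · Im r. On the lines Im r = ±π it becomes the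
exponential exp(∓eμ Re r/2), which has to be balanced against the weights of the quadratic form. -/
theorem norm_exp_quadratic (e : ℕ) (μ : ℝ) (r : ℂ) :
    ‖Complex.exp (-(e * μ / (4 * πi)) * r ^ 2)‖ = Real.exp (-(e * μ * r.re * r.im / (2 * Real.pi))) := by
  have h : -(e * μ / (4 * πi)) * r ^ 2 =
      ((e * μ / (4 * Real.pi) : ℝ) : ℂ) * (Complex.I * r ^ 2) := by
    have := Complex.ofReal_ne_zero.2 Real.pi_ne_zero
    have hI := Complex.I_ne_zero
    push_cast
    field_simp
    linear_combination (-(e * μ * r ^ 2) : ℂ) * Complex.I_sq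
  rw [Complex.norm_exp, h, Complex.re_ofReal_mul]
  congr 1
  have := Real.pi_ne_zero
  simp [sq]
  field_simp
  ring

theorem one_add_mul_exp_le {N : ℕ} (hN : 0 < N) {x : ℝ} :
    (1 + x) * Real.exp (-x / N) ≤ N := by
  have hN' : (1 : ℝ) ≤ N := Nat.one_le_cast.2 hN
  have h1 := Real.add_one_le_exp (x / N)
  have h2 : 1 + x ≤ N * Real.exp (x / N) := by
    have : N * (x / N + 1) = x + N := by field_simp
    nlinarith
  have h3 : Real.exp (x / N) * Real.exp (-x / N) = 1 := by
    rw [← Real.exp_add, neg_div, add_neg_cancel, Real.exp_zero]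
  calc (1 + x) * Real.exp (-x / N) ≤ N * Real.exp (x / N) * Real.exp (-x / N) := by gcongr
    _ = N := by rw [mul_assoc, h3, mul_one]

theorem one_add_norm_le {r : ℂ} (h0 : 0 ≤ r.re) (him : |r.im| ≤ Real.pi) :
    1 + ‖r‖ ≤ (1 + Real.pi) * (1 + r.re) := by
  have h1 := Complex.norm_le_abs_re_add_abs_im r
  rw [abs_of_nonneg h0] at h1
  have := mul_nonneg Real.pi_pos.le h0
  linarith

theorem IsEndPair.norm_ξ_le (h : d.IsEndPair e κ M B N τ μ ζ X S ξ) (t : Bool) {r : ℂ}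
    (hr : M < r.re) (h0 : 0 ≤ r.re) (him : |r.im| ≤ Real.pi) :
    ‖ξ t r‖ ≤ B * (1 + Real.pi) * ((1 + r.re) * Real.exp (-r.re / N)) := by
  have hB := h.nonneg
  refine (h.norm_ξ t r hr).trans ?_
  rw [← mul_assoc, mul_assoc B (1 + Real.pi)]
  gcongr
  exact one_add_norm_le h0 him

theorem IsEndPair.norm_ξ_le' (h : d.IsEndPair e κ M B N τ μ ζ X S ξ) (t : Bool) {r : ℂ}
    (hr : M < r.re) (h0 : 0 ≤ r.re) (him : |r.im| ≤ Real.pi) :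
    ‖ξ t r‖ ≤ B * (1 + Real.pi) * N := by
  have hB := h.nonneg
  have hp := Real.pi_pos
  refine (h.norm_ξ_le t hr h0 him).trans ?_
  gcongr
  exact one_add_mul_exp_le h.pos

theorem IsEndPair.norm_S_le (h : d.IsEndPair e κ M B N τ μ ζ X S ξ) (t : Bool) {r : ℂ}
    (hr : M < r.re) (h0 : 0 ≤ r.re) (him : |r.im| ≤ Real.pi) :
    ‖S t r‖ ≤ Real.exp (B * (1 + Real.pi) * N) *
      Real.exp (-(e * μ t * r.re * r.im / (2 * Real.pi))) := by
  rw [h.S_eq t r hr, norm_mul, h.norm_ζ, one_mul, Complex.exp_add, norm_mul, norm_exp_quadratic,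
    mul_comm]
  gcongr
  rw [Complex.norm_exp]
  exact Real.exp_le_exp.2 ((Complex.re_le_norm _).trans (h.norm_ξ_le' t hr h0 him))

theorem norm_exp_sub_exp_le (x y : ℂ) {L : ℝ} (hx : ‖x‖ ≤ L) (hy : ‖y‖ ≤ L) :
    ‖Complex.exp x - Complex.exp y‖ ≤ Real.exp (3 * L) * (‖x‖ + ‖y‖) := by
  have h1 : Complex.exp x - Complex.exp y = Complex.exp y * (Complex.exp (x - y) - 1) := by
    rw [mul_sub, ← Complex.exp_add]; ring_nf
  have h2 := Complex.norm_exp_sub_sum_le_norm_mul_exp (x - y) 1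
  simp at h2
  have h3 : ‖x - y‖ ≤ ‖x‖ + ‖y‖ := norm_sub_le _ _
  rw [h1, norm_mul, Complex.norm_exp, show 3 * L = L + 2 * L by ring, Real.exp_add, mul_assoc]
  gcongr
  · exact (Complex.re_le_norm _).trans hy
  · refine h2.trans ?_
    rw [mul_comm]
    gcongr
    linarith

/-- With equal quadratic exponents and phases the two sections differ only through ξ, which tends to
0. Their difference therefore gains a factor (1 + Re r) exp(-Re r/N). -/
theorem IsEndPair.norm_S_sub_le (h : d.IsEndPair e κ M B N τ μ ζ X S ξ) (hμ : μ false = μ true)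
    (hζ : ζ false = ζ true) {r : ℂ}
    (hr : M < r.re) (h0 : 0 ≤ r.re) (him : |r.im| ≤ Real.pi) :
    ‖S true r - S false r‖ ≤ Real.exp (3 * (B * (1 + Real.pi) * N)) * (2 * (B * (1 + Real.pi))) *
      ((1 + r.re) * Real.exp (-r.re / N)) *
      Real.exp (-(e * μ true * r.re * r.im / (2 * Real.pi))) := by
  have h1 := norm_exp_sub_exp_le _ _ (h.norm_ξ_le' true hr h0 him) (h.norm_ξ_le' false hr h0 him)
  have h2 := h.norm_ξ_le true hr h0 him
  have h3 := h.norm_ξ_le false hr h0 him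
  rw [h.S_eq true r hr, h.S_eq false r hr, hμ, hζ, ← mul_sub, norm_mul, h.norm_ζ, one_mul,
    Complex.exp_add, Complex.exp_add, ← mul_sub, norm_mul, norm_exp_quadratic, mul_comm]
  gcongr
  refine h1.trans ?_
  rw [mul_assoc (Real.exp (3 * _)) (2 * (B * (1 + Real.pi)))]
  refine mul_le_mul_of_nonneg_left ?_ (Real.exp_pos _).le
  linarith

/-- Bounds for the traces of a flat section near an end. -/
theorem IsEndPair.exists_bounds (h : d.IsEndPair e κ M B N τ μ ζ X S ξ) {F : ℂ → ℂ → ℂ}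
    (hF : d.FlatOn e κ univ F) : ∃ K, 0 ≤ K ∧ ∀ r : ℂ, M < r.re → 0 ≤ r.re → |r.im| ≤ Real.pi →
      ‖d.trace F r‖ ≤ K * ∑ t, Real.exp (-(e * μ t * r.re * r.im / (2 * Real.pi))) ∧
      ‖d.traceY F r‖ ≤ K * Real.exp (-r.re / N) *
        ∑ t, Real.exp (-(e * μ t * r.re * r.im / (2 * Real.pi))) ∧
      (τ true = false → μ false = μ true → ζ false = ζ true → ‖d.traceY F r‖ ≤
        K * ((1 + r.re) * Real.exp (-r.re / N)) * Real.exp (-r.re / N) *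
          Real.exp (-(e * μ true * r.re * r.im / (2 * Real.pi)))) := by
  obtain ⟨c, hcτ, hc⟩ := h.exists_const hF
  have hB := h.nonneg
  have hp := Real.pi_pos
  set L := Real.exp (B * (1 + Real.pi) * N) with hL
  set L' := Real.exp (3 * (B * (1 + Real.pi) * N)) * (2 * (B * (1 + Real.pi))) with hL'
  set k := ‖c true‖ + ‖c false‖ with hk
  have hk0 : 0 ≤ k := by positivity
  have hL0 : 0 ≤ L := (Real.exp_pos _).le
  have hL'0 : 0 ≤ L' := by positivity
  refine ⟨k * L + k * L * B + k * L' * B, by positivity, fun r hr h0 him => ?_⟩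
  have hA := (h.generic r hr).A_ne_zero
  have hX := h.onCurve true r hr
  have hX' := h.onCurve false r hr
  have hY := h.Y_not true r hr
  rw [Bool.not_true] at hY
  have hsum : ∀ t, ‖F r (X t r)‖ ≤ ‖c t‖ * (L * ∑ t, Real.exp (-(e * μ t * r.re * r.im / (2 * Real.pi)))) := by
    intro t
    rw [hc t r hr, norm_mul]
    gcongr
    refine (h.norm_S_le t hr h0 him).trans ?_
    gcongr
    exact Finset.single_le_sum (f := fun t => Real.exp (-(e * μ t * r.re * r.im / (2 * Real.pi))))
      (fun _ _ => (Real.exp_pos _).le) (Finset.mem_univ t)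
  set T₂ := ∑ t, Real.exp (-(e * μ t * r.re * r.im / (2 * Real.pi))) with hT₂
  have hT₂0 : 0 ≤ T₂ := Finset.sum_nonneg fun _ _ => (Real.exp_pos _).le
  have h1 := hsum true
  have h2 := hsum false
  have h12 : ‖F r (X true r)‖ + ‖F r (X false r)‖ ≤ k * L * T₂ := by
    rw [hk]; linarith
  have hYn := h.norm_Y true r hr
  set E := Real.exp (-r.re / N) with hE
  have hE0 : 0 ≤ E := (Real.exp_pos _).le
  refine ⟨?_, ?_, ?_⟩
  · rw [trace_eq_of_onCurve F hA hX hX' hY]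
    refine (norm_add_le _ _).trans (h12.trans ?_)
    gcongr
    have : 0 ≤ k * L * B := by positivity
    have : 0 ≤ k * L' * B := by positivity
    linarith
  · rw [traceY_eq_of_onCurve F hA hX hX' hY, div_eq_mul_inv, norm_mul]
    calc ‖F r (X true r) - F r (X false r)‖ * ‖(d.Y r (X true r))⁻¹‖
        ≤ (k * L * T₂) * (B * E) := by
          gcongr
          exact (norm_sub_le _ _).trans h12
      _ = (k * L * B) * E * T₂ := by ring
      _ ≤ _ := by
          gcongr
          have : 0 ≤ k * L := by positivity
          have : 0 ≤ k * L' * B := by positivity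
          linarith
  · intro hτ hμ hζ
    -- On a ramified end the turn connects the two sheets, so F has the same constant on both.
    have hcc : c false = c true := by rw [← hτ, hcτ]
    have h3 := h.norm_S_sub_le hμ hζ hr h0 him
    rw [traceY_eq_of_onCurve F hA hX hX' hY, div_eq_mul_inv, norm_mul, hc true r hr, hc false r hr,
      hcc, ← mul_sub, norm_mul]
    set T := Real.exp (-(e * μ true * r.re * r.im / (2 * Real.pi))) with hT
    have hT0 : 0 ≤ T := (Real.exp_pos _).le
    calc ‖c true‖ * ‖S true r - S false r‖ * ‖(d.Y r (X true r))⁻¹‖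
        ≤ k * (L' * ((1 + r.re) * E) * T) * (B * E) := by
          gcongr
          rw [hk]; linarith [norm_nonneg (c false)]
      _ = (k * L' * B) * ((1 + r.re) * E) * E * T := by ring
      _ ≤ _ := by
          gcongr
          have : 0 ≤ k * L := by positivity
          have : 0 ≤ k * L * B := by positivity
          linarith

end Pair

/-- Bounds for the traces of a flat section over a neighbourhood of `x₁ = ∞`. -/
theorem exists_bounds_right (hd : d.Admissible) (e : ℕ) (κ : ℂ) {F : ℂ → ℂ → ℂ}
    (hF : d.FlatOn e κ univ F) : ∃ (K x₀ ρ : ℝ) (μ : Bool → ℝ), 0 ≤ K ∧ 0 ≤ x₀ ∧ 1 / 2 ≤ ρ ∧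
      (d.α ≠ 0 → 3 / 4 ≤ ρ) ∧ (∀ t, μ t / 2 - ρ ≤ -((d.i + d.k + 1 / 2) / 2)) ∧
      (∀ t, -μ t / 2 - ρ ≤ -((d.j + d.l + 1 / 2) / 2)) ∧
      ∀ r : ℂ, x₀ < r.re → |r.im| ≤ Real.pi →
      ‖d.trace F r‖ ≤ K * ∑ t, Real.exp (-(e * μ t * r.re * r.im / (2 * Real.pi))) ∧
      ‖d.traceY F r‖ ≤ K * ∑ t, Real.exp (-(e * μ t * r.re * r.im / (2 * Real.pi)) - ρ * r.re) := by
  have hmul : ∀ (μ : Bool → ℝ) (ρ : ℝ) (r : ℂ),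
      ∑ t, Real.exp (-(e * μ t * r.re * r.im / (2 * Real.pi)) - ρ * r.re) =
      Real.exp (-ρ * r.re) * ∑ t, Real.exp (-(e * μ t * r.re * r.im / (2 * Real.pi))) := by
    intro μ ρ r
    rw [Finset.mul_sum]
    refine Finset.sum_congr rfl fun t _ => ?_
    rw [← Real.exp_add]; congr 1; ring
  rcases exists_ends hd e κ with ⟨hα, hn, M, B, X, S, η, ξ, X', S', η', ξ', hS, hS', hY⟩ |
    ⟨hα, hn, M, B, X, S, η, ξ, hS, hY⟩ | ⟨hα, hn, M, B, X, S, η, ξ, hS, hY⟩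
  -- Two unramified sheets: 1/Y alone decays like exp(-Re r), hence ρ = 1.
  · have hn' : (d.i + d.k + (d.j + d.l) : ℝ) ≤ 1 := by exact_mod_cast hn
    obtain ⟨K, hK, hb⟩ := (isEndPair_unramified hS hS' hY).exists_bounds hF
    refine ⟨K, max M 0, 1, pick (1 - (d.i + d.k) : ℤ) (d.j + d.l - 1 : ℤ), hK, le_max_right _ _, by norm_num, fun _ => by norm_num, ?_, ?_,
      fun r hr him => ?_⟩
    · rintro (_ | _) <;> simp [pick] <;> linarith
    · rintro (_ | _) <;> simp [pick] <;> linarith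
    · obtain ⟨h1, h2, -⟩ := hb r ((le_max_left _ _).trans_lt hr) ((le_max_right _ _).trans hr.le) him
      refine ⟨h1, ?_⟩
      rw [hmul, ← mul_assoc]
      simpa using h2
  -- Here 1/Y decays only like exp(-Re r/2), which does not suffice against the potential exp(Re r).
  -- The cancellation between the sheets contributes another (1 + Re r) exp(-Re r/2), and ρ = 3/4
  -- leaves room for the linear factor.
  · have hn' : (d.i + d.k + (d.j + d.l) : ℝ) = 2 := by exact_mod_cast hn
    obtain ⟨K, hK, hb⟩ := (isEndPair_ramified hS hY).exists_bounds hF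
    refine ⟨K * 4, max M 0, 3 / 4, fun _ => (2 - 2 * (d.i + d.k) : ℤ) / 2, by positivity, le_max_right _ _, by norm_num,
      fun _ => le_rfl, ?_, ?_, fun r hr him => ?_⟩
    · intro t; push_cast; linarith
    · intro t; push_cast; linarith
    · have hr0 : 0 ≤ r.re := (le_max_right _ _).trans hr.le
      obtain ⟨h1, -, h3⟩ := hb r ((le_max_left _ _).trans_lt hr) hr0 him
      refine ⟨h1.trans ?_, ?_⟩
      · gcongr
        linarith
      rw [hmul]
      -- The phases on the two sheets agree; the cancellation depends on this.
      have hζ : ((-(-1) ^ (d.i + d.k) : ℂ)⁻¹ *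
          Complex.exp ((2 - 2 * (d.i + d.k) : ℤ) / 2 * πi)) ^ e = 1 := by
        have : Complex.exp ((2 - 2 * (d.i + d.k) : ℤ) / 2 * πi) = -(-1) ^ (d.i + d.k) := by
          rw [show ((2 - 2 * (d.i + d.k) : ℤ) / 2 * πi : ℂ) = ((1 - (d.i + d.k) : ℤ) : ℂ) * πi by
            push_cast; ring, Complex.exp_int_mul, Complex.exp_pi_mul_I, sub_eq_add_neg,
            zpow_add₀ (by norm_num) 1, neg_one_zpow_neg, zpow_one]
          ring
        rw [this, inv_mul_cancel₀ (neg_ne_zero.2 (zpow_ne_zero _ (by norm_num))), one_pow]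
      refine (h3 rfl rfl hζ).trans ?_
      have h4 : (1 + r.re) * Real.exp (-r.re / (2 : ℕ)) * Real.exp (-r.re / (2 : ℕ)) ≤
          4 * Real.exp (-(3 / 4) * r.re) := by
        have h5 := one_add_mul_exp_le (N := 4) (by norm_num) (x := r.re)
        have h6 : Real.exp (-r.re / (2 : ℕ)) * Real.exp (-r.re / (2 : ℕ)) =
            Real.exp (-r.re / (4 : ℕ)) * Real.exp (-(3 / 4) * r.re) := by
          rw [← Real.exp_add, ← Real.exp_add]; congr 1; push_cast; ring
        rw [mul_assoc, h6, ← mul_assoc]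
        gcongr
        exact_mod_cast h5
      rw [mul_assoc K, mul_assoc K, mul_assoc K 4, ← mul_assoc 4]
      refine mul_le_mul_of_nonneg_left ?_ hK
      refine mul_le_mul h4 ?_ (Real.exp_pos _).le (by positivity)
      exact Finset.single_le_sum (f := fun _ : Bool => Real.exp (-(e * ((2 - 2 * (d.i + d.k) : ℤ) / 2 : ℝ) * r.re * r.im / (2 * Real.pi))))
        (fun _ _ => (Real.exp_pos _).le) (Finset.mem_univ true)
  -- For α = 0 the potential does not grow at this end, and ρ = 1/2 is enough.
  · have hn' : (d.i + d.k + (d.j + d.l) : ℝ) = 1 := by exact_mod_cast hn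
    obtain ⟨K, hK, hb⟩ := (isEndPair_ramified hS hY).exists_bounds hF
    refine ⟨K, max M 0, 1 / 2, fun _ => (1 - 2 * (d.i + d.k) : ℤ) / 2, hK, le_max_right _ _, le_rfl, fun h => absurd hα h, ?_, ?_,
      fun r hr him => ?_⟩
    · intro t; push_cast; linarith
    · intro t; push_cast; linarith
    · obtain ⟨h1, h2, -⟩ := hb r ((le_max_left _ _).trans_lt hr) ((le_max_right _ _).trans hr.le) him
      refine ⟨h1, ?_⟩
      rw [hmul, ← mul_assoc]
      have h3 : -(1 / 2 : ℝ) * r.re = -r.re / (2 : ℕ) := by push_cast; ring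
      rw [h3]
      exact h2

end CurveData

/-! ### Generic points, branch points and local parametrizations -/

theorem isPreconnected_punctured_ball (c : ℂ) (δ : ℝ) : IsPreconnected (ball c δ \ {c}) := by
  rcases le_or_gt δ 0 with hδ | hδ
  · rw [ball_eq_empty.2 hδ, empty_sdiff]
    exact isPreconnected_empty
  have h : ball c δ \ {c} = (fun z => c + Complex.exp z) '' {z | z.re < Real.log δ} := by
    ext z
    constructor
    · rintro ⟨hz, hne⟩
      have h0 : z - c ≠ 0 := sub_ne_zero.2 hne
      refine ⟨Complex.log (z - c), ?_, by simp [Complex.exp_log h0]⟩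
      rw [mem_ofPred_eq, Complex.log_re]
      exact Real.log_lt_log (norm_pos_iff.2 h0) (mem_ball_iff_norm.1 hz)
    · rintro ⟨w, hw, rfl⟩
      refine ⟨?_, by simp [Complex.exp_ne_zero]⟩
      rw [mem_ball_iff_norm, add_sub_cancel_left, Complex.norm_exp]
      exact (Real.lt_log_iff_exp_lt hδ).1 hw
  rw [h]
  exact (convex_halfSpace_re_lt _).isPreconnected.image _ (by fun_prop)

namespace CurveData

variable {d : CurveData}

theorem Admissible.eventually_generic (hd : d.Admissible) (c : ℂ) :
    ∀ᶠ z in 𝓝[≠] c, d.Generic z := by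
  refine Filter.Eventually.and ?_ ?_
  · by_cases h : d.D c = 0
    · exact (d.hasDerivAt_D c).eventually_ne (hd.simple c h)
    · exact ((d.hasDerivAt_D c).continuousAt.eventually_ne h).filter_mono nhdsWithin_le_nhds
  · exact (Complex.hasDerivAt_exp c).eventually_ne (Complex.exp_ne_zero c)

theorem Admissible.exists_generic_ball (hd : d.Admissible) (c : ℂ) {R : Set ℂ} (hR : R ∈ 𝓝 c) :
    ∃ δ > 0, ball c δ ⊆ R ∧ ∀ z ∈ ball c δ, z ≠ c → d.Generic z := by
  have h := hd.eventually_generic c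
  rw [eventually_nhdsWithin_iff] at h
  obtain ⟨δ, hδ, hball⟩ := Metric.eventually_nhds_iff_ball.1 (h.and hR)
  exact ⟨δ, hδ, fun z hz => (hball z hz).2, fun z hz hne => (hball z hz).1 hne⟩

/-- The exceptional set has no accumulation points in the plane, so it is countable, and a countable
set does not disconnect the plane. -/
theorem Admissible.isPreconnected_generic (hd : d.Admissible) :
    IsPreconnected {r | d.Generic r} := by
  have h1 : DiscreteTopology ({r | d.Generic r}ᶜ : Set ℂ) := by
    refine discreteTopology_subtype_iff.2 fun c _ => ?_
    rw [← disjoint_iff, Filter.disjoint_principal_right, compl_compl]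
    exact hd.eventually_generic c
  have h2 : ({r | d.Generic r}ᶜ : Set ℂ).Countable := countable_of_Lindelof_of_discrete
  have h3 := (h2.isConnected_compl_of_one_lt_rank (by simp)).isPreconnected
  rwa [compl_compl] at h3

/-- Near a branch point, the square root of the discriminant is an odd function of a
uniformizer. -/
theorem exists_branch_sheet (hd : d.Admissible) {c : ℂ} (hc : d.D c = 0) {R : Set ℂ}
    (hR : R ∈ 𝓝 c) : ∃ δ > 0, ∃ s : ℂ → ℂ, ContinuousOn s (ball 0 δ) ∧ (∀ u, s (-u) = -s u) ∧
      (∀ u ∈ ball (0 : ℂ) δ, c + u ^ 2 ∈ R ∧ s u ^ 2 = d.D (c + u ^ 2) ∧ (u ≠ 0 → d.Generic (c + u ^ 2))) := by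
  have hDd : Differentiable ℂ d.D := fun z => (d.hasDerivAt_D z).differentiableAt
  have hq : Differentiable ℂ (dslope d.D c) := by
    rw [← differentiableOn_univ]
    exact (Complex.differentiableOn_dslope univ_mem).2 hDd.differentiableOn
  have hq0 : dslope d.D c c ≠ 0 := by
    rw [dslope_same, (d.hasDerivAt_D c).deriv]
    exact hd.simple c hc
  obtain ⟨δ₁, hδ₁, h₁, h₂⟩ := hd.exists_generic_ball c (inter_mem hR
    (hq.continuous.continuousAt.eventually_ne hq0))
  obtain ⟨h, -, hh, -, hd'⟩ := exists_sqrt_ball hδ₁ hq.differentiableOn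
    (fun z hz => (h₁ hz).2) (dslope d.D c c ^ (1 / 2 : ℂ)) (by rw [← Complex.cpow_nat_mul]; norm_num)
  have hmap : ∀ u ∈ ball (0 : ℂ) (min δ₁ 1), c + u ^ 2 ∈ ball c δ₁ := by
    intro u hu
    rw [mem_ball_zero_iff, lt_min_iff] at hu
    rw [mem_ball_iff_norm, add_sub_cancel_left, norm_pow]
    nlinarith [norm_nonneg u]
  -- With D = (z - c)h² and z = c + u², the root √D is u h(c + u²), which is odd in u.
  refine ⟨min δ₁ 1, lt_min hδ₁ one_pos, fun u => u * h (c + u ^ 2), ?_, fun u => ?_, fun u hu => ?_⟩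
  · refine continuousOn_id.mul (ContinuousOn.comp (t := ball c δ₁) (fun z hz =>
      (hd' z hz).continuousAt.continuousWithinAt) (by fun_prop) hmap)
  · simp only [neg_sq]; ring
  · have h3 := h₁ (hmap u hu)
    refine ⟨h3.1, ?_, fun hne => ?_⟩
    · have h4 := sub_smul_dslope d.D c (c + u ^ 2)
      rw [hc, sub_zero, add_sub_cancel_left, smul_eq_mul] at h4
      rw [mul_pow, hh _ (hmap u hu), h4]
    · exact h₂ _ (hmap u hu) (by simpa using hne)

/-- The curve is parametrized by a disc near any of its points. -/
theorem exists_parametrization (hd : d.Admissible) {c x₀ : ℂ} (hx : d.OnCurve c x₀) :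
    ∃ δ > 0, ∃ ρ X : ℂ → ℂ, ρ 0 = c ∧ X 0 = x₀ ∧ ContinuousOn ρ (ball 0 δ) ∧
      ContinuousOn X (ball 0 δ) ∧
      ∀ u ∈ ball (0 : ℂ) δ, d.OnCurve (ρ u) (X u) ∧ (u ≠ 0 → d.Generic (ρ u)) := by
  by_cases hc : d.D c = 0
  · have hY : d.Y c x₀ = 0 := by
      have := hx.sq_Y
      rw [hc] at this
      exact pow_eq_zero_iff two_ne_zero |>.1 this
    -- At a point of the curve with D = 0, a zero of A would force b = C = 0 and a double zero of D.
    have hA : d.A c ≠ 0 := by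
      intro hA
      have h1 := hx.A_mul
      have h2 := hx.C_div
      rw [hA, hY] at h1
      rw [hY] at h2
      have hb : d.b c = 0 := by linear_combination 2 * h1
      have hC : d.C c = 0 := by
        rw [hb] at h2
        simpa [hx.1] using h2
      apply hd.simple c hc
      rw [D', hA, hC, hb]
      ring
    have hC : d.C c ≠ 0 := by
      intro hC
      have h1 := hx.A_mul
      have h2 := hx.C_div
      rw [hC, hY] at h2
      rw [hY] at h1
      have hb : d.b c = 0 := by linear_combination 2 * h2
      rw [hb] at h1
      exact mul_ne_zero hA hx.1 (by linear_combination h1)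
    obtain ⟨δ, hδ, s, hs, hodd, h⟩ := exists_branch_sheet hd hc (R := {z | d.A z ≠ 0 ∧ d.C z ≠ 0})
      (inter_mem (d.continuous_A.continuousAt.eventually_ne hA)
        (d.continuous_C.continuousAt.eventually_ne hC))
    have hs0 : s 0 = 0 := by
      have := hodd 0
      rw [neg_zero] at this
      linear_combination this / 2
    refine ⟨δ, hδ, fun u => c + u ^ 2, fun u => d.root (c + u ^ 2) (s u), by simp, ?_, by fun_prop,
      ?_, fun u hu => ⟨(Y_root (h u hu).1.1 (h u hu).1.2 (h u hu).2.1).1, (h u hu).2.2⟩⟩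
    · simp only [hs0, zero_pow two_ne_zero, add_zero]
      rw [← hY, ← hx.eq_root hA]
    · have hcu : Continuous fun u : ℂ => c + u ^ 2 := by fun_prop
      exact (hs.sub (d.continuous_b.comp hcu).continuousOn).div
        (continuousOn_const.mul (d.continuous_A.comp hcu).continuousOn)
        fun u hu => mul_ne_zero two_ne_zero (h u hu).1.1
  · obtain ⟨δ₁, hδ₁, h₁, h₂⟩ := hd.exists_generic_ball c
      (d.continuous_D.continuousAt.eventually_ne hc)
    obtain ⟨s, hs0, hs, -, hs'⟩ := exists_sqrt_ball hδ₁
      (fun z _ => (d.hasDerivAt_D z).differentiableAt.differentiableWithinAt) (fun z hz => h₁ hz)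
      (d.Y c x₀) hx.sq_Y
    have hsc : ContinuousOn s (ball c δ₁) := fun z hz =>
      (hs' z hz).continuousAt.continuousWithinAt
    have hcs : ContinuousAt s c := (hs' c (mem_ball_self hδ₁)).continuousAt
    have hshift : ∀ δ, δ ≤ δ₁ → MapsTo (fun u => c + u) (ball 0 δ) (ball c δ₁) := by
      intro δ hδ u hu
      rw [mem_ball_zero_iff] at hu
      rw [mem_ball_iff_norm, add_sub_cancel_left]
      exact hu.trans_le hδ
    have hcu : Continuous fun u : ℂ => c + u := by fun_prop
    by_cases hA : d.A c = 0
    -- Where A vanishes the formula (s - b)/(2A) degenerates, and its rationalized form 2C/(-s - b)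
    -- is used.
    · have hne : -s c - d.b c ≠ 0 := by
        have h1 := hx.A_mul
        rw [hA, ← hs0] at h1
        have h2 := hx.Y_ne_zero hc
        rw [← hs0] at h2
        intro h
        apply h2
        linear_combination -h1 - h / 2
      have hC : d.C c ≠ 0 := by
        have h2 := hx.C_div
        intro h0
        rw [h0, zero_div, ← hs0] at h2
        apply hne
        linear_combination -2 * h2
      have hev : ∀ᶠ z in 𝓝 c, -s z - d.b z ≠ 0 ∧ d.C z ≠ 0 :=
        ((hcs.neg.sub d.continuous_b.continuousAt).eventually_ne hne).and
          (d.continuous_C.continuousAt.eventually_ne hC)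
      obtain ⟨δ₂, hδ₂, h₃⟩ := Metric.eventually_nhds_iff_ball.1 hev
      have hm1 := hshift _ (min_le_left δ₁ δ₂)
      have hm2 : ∀ u ∈ ball (0 : ℂ) (min δ₁ δ₂), c + u ∈ ball c δ₂ := by
        intro u hu
        rw [mem_ball_zero_iff, lt_min_iff] at hu
        rw [mem_ball_iff_norm, add_sub_cancel_left]
        exact hu.2
      refine ⟨min δ₁ δ₂, lt_min hδ₁ hδ₂, fun u => c + u,
        fun u => 2 * d.C (c + u) / (-s (c + u) - d.b (c + u)), by simp, ?_, by fun_prop, ?_,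
        fun u hu => ⟨⟨?_, ?_⟩, fun h0 => h₂ _ (hm1 hu) (by simpa using h0)⟩⟩
      · have h2 := hx.C_div
        simp only [add_zero]
        rw [div_eq_iff hne, hs0]
        rw [div_eq_iff hx.1] at h2
        linear_combination 2 * h2
      · exact (continuousOn_const.mul (d.continuous_C.comp hcu).continuousOn).div
          ((hsc.comp hcu.continuousOn hm1).neg.sub (d.continuous_b.comp hcu).continuousOn)
          fun u hu => (h₃ _ (hm2 u hu)).1
      · exact div_ne_zero (mul_ne_zero two_ne_zero (h₃ _ (hm2 u hu)).2) (h₃ _ (hm2 u hu)).1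
      · have h4 := (h₃ _ (hm2 u hu)).1
        have h5 := (h₃ _ (hm2 u hu)).2
        have h6 := hs _ (hm1 hu)
        rw [D] at h6
        rw [curveEq]
        field_simp
        linear_combination h6
    · obtain ⟨δ₂, hδ₂, h₃⟩ := Metric.eventually_nhds_iff_ball.1
        (d.continuous_A.continuousAt.eventually_ne hA)
      have hne : s c - d.b c ≠ 0 := by
        have h1 := hx.A_mul
        rw [← hs0] at h1
        intro h
        rw [h] at h1
        exact mul_ne_zero hA hx.1 (by simpa using h1)
      obtain ⟨δ₃, hδ₃, h₄⟩ := Metric.eventually_nhds_iff_ball.1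
        ((hcs.sub d.continuous_b.continuousAt).eventually_ne hne)
      set δ := min δ₁ (min δ₂ δ₃)
      have hm1 := hshift δ (min_le_left _ _)
      have hm2 : ∀ u ∈ ball (0 : ℂ) δ, c + u ∈ ball c δ₂ ∧ c + u ∈ ball c δ₃ := by
        intro u hu
        rw [mem_ball_zero_iff, lt_min_iff, lt_min_iff] at hu
        simp only [mem_ball_iff_norm, add_sub_cancel_left]
        exact hu.2
      refine ⟨δ, lt_min hδ₁ (lt_min hδ₂ hδ₃), fun u => c + u,
        fun u => d.root (c + u) (s (c + u)), by simp, ?_, by fun_prop, ?_,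
        fun u hu => ⟨⟨?_, ?_⟩, fun h0 => h₂ _ (hm1 hu) (by simpa using h0)⟩⟩
      · simp only [add_zero]
        rw [hs0, ← hx.eq_root hA]
      · exact ((hsc.comp hcu.continuousOn hm1).sub (d.continuous_b.comp hcu).continuousOn).div
          (continuousOn_const.mul (d.continuous_A.comp hcu).continuousOn)
          fun u hu => mul_ne_zero two_ne_zero (h₃ _ (hm2 u hu).1)
      · exact div_ne_zero (h₄ _ (hm2 u hu).2) (mul_ne_zero two_ne_zero (h₃ _ (hm2 u hu).1))
      · have h4 := h₃ _ (hm2 u hu).1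
        have h5 : s (c + u) - d.b (c + u) ≠ 0 := h₄ _ (hm2 u hu).2
        have h6 := hs _ (hm1 hu)
        rw [D] at h6
        simp only [curveEq, root]
        field_simp
        linear_combination h6

/-! ### The reflection exchanging the ends x₁ = ∞ and x₁ = 0 -/

/-- The reflection `x₁ ↦ x₁⁻¹`, `x₂ ↦ x₂⁻¹`. -/
def flip (d : CurveData) : CurveData := ⟨-d.j - d.l, -d.i - d.k, d.l, d.k, d.β, d.α, d.a⟩

theorem row_flip (i : ℤ) (k : ℕ) (r : ℂ) : (-Complex.exp r) ^ (-i - k) * (1 - Complex.exp r) ^ k =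
    (-Complex.exp (-r)) ^ i * (1 - Complex.exp (-r)) ^ k := by
  have h : -Complex.exp (-r) = (-Complex.exp r)⁻¹ := by rw [Complex.exp_neg, inv_neg]
  rw [row_eq, h, inv_zpow', sub_add_cancel]

theorem flip_A (d : CurveData) (r : ℂ) : d.flip.A r = d.C (-r) := row_flip d.j d.l r

theorem flip_C (d : CurveData) (r : ℂ) : d.flip.C r = d.A (-r) := row_flip d.i d.k r

theorem flip_b (d : CurveData) (r : ℂ) : d.flip.b r = d.b (-r) := by
  simp [flip, b]; ring

theorem flip_D (d : CurveData) (r : ℂ) : d.flip.D r = d.D (-r) := by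
  rw [D, D, flip_A, flip_C, flip_b]; ring

theorem flip_A' (d : CurveData) (r : ℂ) : d.flip.A' r = -d.C' (-r) := by
  refine (d.flip.hasDerivAt_A r).unique ?_
  rw [funext d.flip_A]
  have := (d.hasDerivAt_C (-r)).comp r (hasDerivAt_neg r)
  rwa [mul_neg_one] at this

theorem flip_C' (d : CurveData) (r : ℂ) : d.flip.C' r = -d.A' (-r) := by
  refine (d.flip.hasDerivAt_C r).unique ?_
  rw [funext d.flip_C]
  have := (d.hasDerivAt_A (-r)).comp r (hasDerivAt_neg r)
  rwa [mul_neg_one] at this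

theorem flip_b' (d : CurveData) (r : ℂ) : d.flip.b' r = -d.b' (-r) := by
  refine (d.flip.hasDerivAt_b r).unique ?_
  rw [funext d.flip_b]
  have := (d.hasDerivAt_b (-r)).comp r (hasDerivAt_neg r)
  rwa [mul_neg_one] at this

theorem flip_D' (d : CurveData) (r : ℂ) : d.flip.D' r = -d.D' (-r) := by
  refine (d.flip.hasDerivAt_D r).unique ?_
  rw [funext d.flip_D]
  have := (d.hasDerivAt_D (-r)).comp r (hasDerivAt_neg r)
  rwa [mul_neg_one] at this

theorem flip_Y (d : CurveData) (r x : ℂ) : d.flip.Y r x = -d.Y (-r) x⁻¹ := by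
  rw [Y, Y, flip_A, flip_C, div_inv_eq_mul, div_eq_mul_inv]; ring

theorem flip_X₁ (d : CurveData) (r x : ℂ) : d.flip.X₁ r x = -d.X₁ (-r) x⁻¹ := by
  rw [X₁, X₁, flip_A', flip_C', flip_b', div_inv_eq_mul, div_eq_mul_inv]; ring

theorem flip_onCurve {d : CurveData} {r x : ℂ} : d.flip.OnCurve r x ↔ d.OnCurve (-r) x⁻¹ := by
  rw [OnCurve, OnCurve, curveEq, curveEq, flip_A, flip_C, flip_b, div_inv_eq_mul, div_eq_mul_inv]
  refine and_congr (by simp) (by rw [show d.C (-r) * x + d.b (-r) + d.A (-r) * x⁻¹ =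
    d.A (-r) * x⁻¹ + d.b (-r) + d.C (-r) * x by ring])

theorem flip_generic {d : CurveData} {r : ℂ} : d.flip.Generic r ↔ d.Generic (-r) := by
  rw [Generic, Generic, flip_D, Complex.exp_neg, inv_ne_one]

theorem Admissible.flip (hd : d.Admissible) : d.flip.Admissible where
  right := by
    rcases hd.left with ⟨h1, h2, h3⟩ | ⟨h1, h2⟩ | ⟨h1, h2⟩
    · exact Or.inl ⟨by simp only [CurveData.flip]; omega, h2, by simpa [CurveData.flip, add_comm] using h3⟩
    · exact Or.inr (Or.inl ⟨by simp only [CurveData.flip]; omega, h2⟩)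
    · exact Or.inr (Or.inr ⟨by simp only [CurveData.flip]; omega, h2⟩)
  left := by
    rcases hd.right with ⟨h1, h2, h3⟩ | ⟨h1, h2⟩ | ⟨h1, h2⟩
    · exact Or.inl ⟨by simp only [CurveData.flip]; omega, h2, by simpa [CurveData.flip, add_comm] using h3⟩
    · exact Or.inr (Or.inl ⟨by simp only [CurveData.flip]; omega, h2⟩)
    · exact Or.inr (Or.inr ⟨by simp only [CurveData.flip]; omega, h2⟩)
  simple r hr := by
    rw [flip_D'] 
    rw [flip_D] at hr
    exact neg_ne_zero.2 (hd.simple _ hr)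
  a_ne := hd.a_ne

/-- The reflection of a section. -/
def flipSection (F : ℂ → ℂ → ℂ) (r x : ℂ) : ℂ := F (-r) x⁻¹

/-- Reflection reverses the turn, so the shift law at r comes from the one at -r + 2πi; this is why
`R` has to be closed under adding 2πi. The logarithmic derivative keeps its form since r, X₁ and Y
all change sign. -/
theorem FlatOn.flip {e : ℕ} {κ : ℂ} {R : Set ℂ} {F : ℂ → ℂ → ℂ} (h : d.FlatOn e κ R F)
    (hR : ∀ r ∈ R, r + 2 * πi ∈ R) :
    d.flip.FlatOn e κ {r | -r ∈ R} (flipSection F) where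
  ne_zero r hr hg x hx := h.ne_zero _ hr (flip_generic.1 hg) _ (flip_onCurve.1 hx)
  shift r hr hg x hx := by
    have hx' := flip_onCurve.1 hx
    have h1 : d.Generic (-r + 2 * πi) := by
      have := (d.generic_add_int (-r) 1).2 (flip_generic.1 hg)
      simpa using this
    have h2 : d.OnCurve (-r + 2 * πi) x⁻¹ := by
      have := (d.onCurve_add_int (-r) x⁻¹ 1).2 hx'
      simpa using this
    have h3 := h.shift _ (hR _ hr) h1 _ h2
    rw [add_sub_cancel_right] at h3
    have hx0 : (-x) ^ e ≠ 0 := pow_ne_zero e (neg_ne_zero.2 hx.1)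
    rw [flipSection, flipSection, h3, ← mul_assoc ((-x) ^ e), ← mul_pow, neg_sub,
      sub_eq_neg_add (2 * πi)]
    have : -x * -x⁻¹ = 1 := by rw [neg_mul_neg, mul_inv_cancel₀ hx.1]
    rw [this, one_pow, one_mul]
  hasDerivAt r hr hg X hX hc := by
    have hx0 := hc.self_of_nhds.1
    have hneg : Tendsto (fun z : ℂ => -z) (𝓝 (-r)) (𝓝 r) := by
      have := (continuous_neg (G := ℂ)).tendsto (-r)
      rwa [neg_neg] at this
    have hZ : DifferentiableAt ℂ (fun z => (X (-z))⁻¹) (-r) := by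
      have h1 : DifferentiableAt ℂ X (-(-r)) := by rwa [neg_neg]
      exact (DifferentiableAt.comp (g := X) (f := fun z : ℂ => -z) (-r) h1 (by fun_prop)).inv
        (by simpa using hx0)
    have hcZ : ∀ᶠ z in 𝓝 (-r), d.OnCurve z (X (-z))⁻¹ := by
      filter_upwards [hneg.eventually hc] with z hz
      simpa using flip_onCurve.1 hz
    have h1 := h.hasDerivAt (-r) hr (flip_generic.1 hg) _ hZ hcZ
    have h2 := h1.comp r (hasDerivAt_neg r)
    have h3 : (fun z => flipSection F z (X z)) =
        (fun z => F z (X (-z))⁻¹) ∘ fun z => -z := by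
      funext z
      simp [flipSection]
    rw [h3]
    convert! h2 using 1
    rw [neg_neg, flipSection, Λ, Λ, flip_X₁, flip_Y]
    rw [mul_neg, mul_neg, div_neg, show d.flip.a = d.a from rfl]
    ring

theorem trace_flip (F : ℂ → ℂ → ℂ) {r : ℂ} (hr : d.Generic (-r)) :
    d.flip.trace (flipSection F) r = d.trace F (-r) ∧
      d.flip.traceY (flipSection F) r = -d.traceY F (-r) := by
  have hg := flip_generic.2 hr
  obtain ⟨h1, h2⟩ := Y_root hr.A_ne_zero hr.C_ne_zero (d.sqrtD_sq (-r))
  obtain ⟨h3, h4⟩ := Y_root hr.A_ne_zero hr.C_ne_zero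
    (s := -d.sqrtD (-r)) (by rw [neg_sq]; exact d.sqrtD_sq (-r))
  have h5 : d.flip.OnCurve r (d.root (-r) (d.sqrtD (-r)))⁻¹ := flip_onCurve.2 (by rwa [inv_inv])
  have h6 : d.flip.OnCurve r (d.root (-r) (-d.sqrtD (-r)))⁻¹ := flip_onCurve.2 (by rwa [inv_inv])
  have h7 : d.flip.Y r (d.root (-r) (-d.sqrtD (-r)))⁻¹ =
      -d.flip.Y r (d.root (-r) (d.sqrtD (-r)))⁻¹ := by
    rw [flip_Y, flip_Y, inv_inv, inv_inv, h2, h4]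
  rw [trace_eq_of_onCurve _ hg.A_ne_zero h5 h6 h7, traceY_eq_of_onCurve _ hg.A_ne_zero h5 h6 h7,
    flip_Y, inv_inv, h2, flipSection, flipSection, inv_inv, inv_inv, div_neg]
  exact ⟨rfl, rfl⟩

/-- In each type of end, 1/Y tends to 0 and Y² = D. -/
theorem tendsto_norm_D (hd : d.Admissible) :
    Tendsto (fun x : ℝ => ‖d.D x‖) atTop atTop := by
  have key : ∀ {M B : ℝ} {N : ℕ} {m : ℤ} {ph : ℂ} {X S η ξ : ℂ → ℂ},
      d.IsEndSheet 0 0 M B N m ph X S η ξ → Tendsto (fun x : ℝ => ‖d.D x‖) atTop atTop := by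
    intro M B N m ph X S η ξ h
    have hN : (0 : ℝ) < N := Nat.cast_pos.2 h.pos
    have h0 : Tendsto (fun x : ℝ => B * Real.exp (-x / N)) atTop (𝓝 (B * 0)) :=
      (Real.tendsto_exp_atBot.comp (tendsto_neg_atTop_atBot.atBot_div_const hN)).const_mul B
    rw [mul_zero] at h0
    have h1 : Tendsto (fun x : ℝ => ‖(d.Y x (X x))⁻¹‖) atTop (𝓝 0) := by
      refine squeeze_zero' (Eventually.of_forall fun _ => norm_nonneg _) ?_ h0
      filter_upwards [eventually_gt_atTop M] with x hx using h.norm_Y x (by simpa using hx)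
    have h2 : Tendsto (fun x : ℝ => ‖(d.Y x (X x))⁻¹‖ ^ 2) atTop (𝓝[>] 0) := by
      refine tendsto_nhdsWithin_iff.2 ⟨by simpa using h1.pow 2, ?_⟩
      filter_upwards [eventually_gt_atTop M] with x hx
      have hx' : M < (x : ℂ).re := by simpa using hx
      exact pow_pos (norm_pos_iff.2 (inv_ne_zero
        ((h.onCurve x hx').Y_ne_zero (h.generic x hx').1))) 2
    refine h2.inv_tendsto_nhdsGT_zero.congr' ?_
    filter_upwards [eventually_gt_atTop M] with x hx
    rw [Pi.inv_apply, norm_inv, inv_pow, inv_inv, ← norm_pow,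
      (h.onCurve x (by simpa using hx)).sq_Y]
  rcases exists_ends hd 0 0 with ⟨-, -, M, B, X, S, η, ξ, X', S', η', ξ', hS, -, -⟩ |
    ⟨-, -, M, B, X, S, η, ξ, hS, -⟩ | ⟨-, -, M, B, X, S, η, ξ, hS, -⟩
  exacts [key hS, key hS, key hS]

/-- There is a branch point. -/
theorem exists_branch_point (hd : d.Admissible) : ∃ c, d.D c = 0 := by
  by_contra! hne
  obtain ⟨p, hp⟩ : ∃ p : ℕ, (p : ℤ) = 2 - (d.i + d.k + (d.j + d.l)) := by
    refine ⟨(2 - (d.i + d.k + (d.j + d.l))).toNat, Int.toNat_of_nonneg ?_⟩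
    rcases hd.right with h | h | h <;> omega
  open Polynomial in
  obtain ⟨R, hR⟩ : ∃ R : ℂ[X], ∀ w, R.eval w = d.Q p w :=
    ⟨(Polynomial.C d.α - Polynomial.C d.a * X + Polynomial.C d.β * X ^ 2) ^ 2 - 4 * ((-X) ^ p * (1 - X) ^ (d.k + d.l)),
      fun w => by simp [Q, P]⟩
  have hroot : ∀ w, w ≠ 0 → R.eval w ≠ 0 := by
    intro w hw h0
    apply hne (-Complex.log w)
    rw [D_eq d hp, neg_neg, Complex.exp_log hw, ← hR, h0, mul_zero]
  have hR0 : R ≠ 0 := by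
    rintro rfl
    exact hroot 1 one_ne_zero (by simp)
  -- Without branch points, the polynomial exp(-2r) D in w = exp(-r) has no root except possibly w =
  -- 0, so it is a monomial.
  obtain ⟨R₁, hR₁, hdvd⟩ := R.exists_eq_pow_rootMultiplicity_mul_and_not_dvd hR0 0
  have hdeg : R₁.degree = 0 := by
    by_contra h
    obtain ⟨w, hw⟩ := IsAlgClosed.exists_root R₁ h
    rcases eq_or_ne w 0 with rfl | hw0
    · exact hdvd (Polynomial.dvd_iff_isRoot.2 hw)
    · apply hroot w hw0
      rw [hR₁, Polynomial.eval_mul, hw.eq_zero, mul_zero]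
  obtain ⟨c, hc⟩ : ∃ c, R₁ = Polynomial.C c := ⟨_, Polynomial.eq_C_of_degree_eq_zero hdeg⟩
  set s := R.rootMultiplicity 0
  have hD : ∀ x : ℝ, ‖d.D x‖ = ‖c‖ * Real.exp ((2 - s) * x) := by
    intro x
    rw [D_eq d hp, ← hR, hR₁, hc]
    simp only [map_zero, sub_zero, Polynomial.eval_mul, Polynomial.eval_pow, Polynomial.eval_X,
      Polynomial.eval_C, norm_mul, norm_pow, Complex.norm_exp, Complex.neg_re, Complex.ofReal_re]
    rw [← Real.exp_nat_mul, ← Real.exp_nat_mul, mul_comm _ ‖c‖, mul_left_comm, ← Real.exp_add]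
    congr 2
    push_cast
    ring
  have h1 := tendsto_norm_D hd
  have h2 := tendsto_norm_D hd.flip
  have h3 : (fun x : ℝ => ‖d.flip.D x‖) = fun x : ℝ => ‖c‖ * Real.exp ((2 - s) * -x) := by
    funext x
    rw [flip_D, ← hD]
    simp
  -- The product |D(x)| |D(-x)| should tend to infinity, but for a pure exponential it is constant.
  have h4 := h1.atTop_mul_atTop₀ h2
  simp only [hD] at h4
  simp only [funext_iff] at h3
  simp only [h3] at h4
  have h5 : (fun x : ℝ => ‖c‖ * Real.exp ((2 - s) * x) * (‖c‖ * Real.exp ((2 - s) * -x))) =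
      fun _ => ‖c‖ * ‖c‖ := by
    funext x
    rw [mul_mul_mul_comm, ← Real.exp_add]
    simp
  rw [h5] at h4
  exact not_tendsto_const_atTop _ _ h4

end CurveData

/-! ### Neighbourhoods in the complete curve -/

/-- The point of the complete curve with coordinates `(r, x₂)`. -/
def point (r x : ℂ) : ℤ × ℤ → OnePoint ℂ := monomialMap (-Complex.exp r, x)

theorem point_fst (r x : ℂ) : point r x (1, 0) = ((-Complex.exp r : ℂ) : OnePoint ℂ) := by
  simp [point, monomialMap]

theorem point_snd (r x : ℂ) : point r x (0, 1) = ((x : ℂ) : OnePoint ℂ) := by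
  simp [point, monomialMap]

theorem point_congr {r r' : ℂ} (h : Complex.exp r = Complex.exp r') (x : ℂ) :
    point r x = point r' x := by
  rw [point, h, point]

theorem continuousOn_point : ContinuousOn (fun p : ℂ × ℂ => point p.1 p.2) {p | p.2 ≠ 0} := by
  refine continuousOn_pi.2 fun m => OnePoint.continuous_coe.comp_continuousOn ?_
  refine ContinuousOn.mul ?_ ?_
  · exact ContinuousOn.zpow₀ (by fun_prop) m.1 fun p _ =>
      Or.inl (neg_ne_zero.2 (Complex.exp_ne_zero p.1))
  · exact ContinuousOn.zpow₀ continuousOn_snd m.2 fun p hp => Or.inl hp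

theorem eq_of_exp_eq_of_dist {r r' : ℂ} (h : Complex.exp r = Complex.exp r') (hd : dist r r' ≤ 1) :
    r = r' := by
  obtain ⟨n, hn⟩ := Complex.exp_eq_exp_iff_exists_int.1 h
  rcases eq_or_ne n 0 with rfl | h0
  · simpa using hn
  · exfalso
    rw [dist_eq_norm, hn, add_sub_cancel_left, norm_mul] at hd
    have h1 : (1 : ℝ) ≤ ‖(n : ℂ)‖ := by
      rw [Complex.norm_intCast]
      exact_mod_cast Int.one_le_abs h0
    have h2 : ‖(2 * Real.pi * Complex.I : ℂ)‖ = 2 * Real.pi := by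
      simp [abs_of_pos Real.pi_pos]
    rw [h2] at hd
    nlinarith [Real.pi_gt_three]

theorem isOpenMap_neg_exp : IsOpenMap fun r : ℂ => -Complex.exp r :=
  (Homeomorph.neg ℂ).isOpenMap.comp Complex.isOpenMap_exp

theorem exists_neg_exp {x : ℂ} (hx : x ≠ 0) : ∃ r, x = -Complex.exp r :=
  ⟨Complex.log (-x), by rw [Complex.exp_log (neg_ne_zero.2 hx), neg_neg]⟩

namespace CurveData

variable {d : CurveData} {φ : LaurentPoly}

theorem point_mem (h : d.Represents φ) {r x : ℂ} (hx : d.OnCurve r x) :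
    point r x ∈ completeCurve φ d.a :=
  subset_closure ⟨_, (mem_affineCurve h r x).2 hx, rfl⟩

/-- The complete curve over a generic point. -/
theorem exists_point (h : d.Represents φ) {z : ℤ × ℤ → OnePoint ℂ}
    (hz : z ∈ completeCurve φ d.a) {r₀ : ℂ} (hr₀ : z (1, 0) = ((-Complex.exp r₀ : ℂ) : OnePoint ℂ))
    (hg : d.Generic r₀) : ∃ x₀, d.OnCurve r₀ x₀ ∧ z = point r₀ x₀ ∧ ∀ P ∈ 𝓝 (r₀, x₀),
      ∀ᶠ y in 𝓝 z, y ∈ completeCurve φ d.a → ∃ p ∈ P, d.OnCurve p.1 p.2 ∧ y = point p.1 p.2 := by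
  obtain ⟨δ, hδ, hball⟩ := Metric.mem_nhds_iff.1 (d.isOpen_generic.mem_nhds hg)
  obtain ⟨s, -, hs, -, hs'⟩ := exists_sqrt_ball hδ
    (fun z _ => (d.hasDerivAt_D z).differentiableAt.differentiableWithinAt)
    (fun z hz => (hball hz).1) (d.sqrtD r₀) (d.sqrtD_sq r₀)
  -- A radius of at most 1 makes exp injective in the sense needed: r is determined by x₁ and its
  -- distance to r₀.
  set δ' := min (δ / 2) 1 with hδ'
  have hδ'0 : 0 < δ' := lt_min (by linarith) one_pos
  have hsub : closedBall r₀ δ' ⊆ ball r₀ δ :=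
    closedBall_subset_ball ((min_le_left _ _).trans_lt (by linarith))
  have hsc : ContinuousOn s (closedBall r₀ δ') := fun z hz =>
    (hs' z (hsub hz)).continuousAt.continuousWithinAt
  have hroot : ∀ t : ℂ → ℂ, ContinuousOn t (closedBall r₀ δ') →
      IsCompact ((fun r => (r, d.root r (t r))) '' closedBall r₀ δ') := fun t ht =>
    (isCompact_closedBall _ _).image_of_continuousOn (continuousOn_id.prodMk
      ((ht.sub d.continuous_b.continuousOn).div
        (continuousOn_const.mul d.continuous_A.continuousOn)
        fun z hz => mul_ne_zero two_ne_zero (hball (hsub hz)).A_ne_zero))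
  set T : Set (ℂ × ℂ) := {p | p.1 ∈ closedBall r₀ δ' ∧ d.OnCurve p.1 p.2} with hT
  -- Over a closed disc of generic points the curve is the union of two graphs, hence compact.
  -- Taking the closure therefore adds no points there.
  have hTc : IsCompact T := by
    have : T = (fun r => (r, d.root r (s r))) '' closedBall r₀ δ' ∪
        (fun r => (r, d.root r (-s r))) '' closedBall r₀ δ' := by
      ext ⟨r, x⟩
      constructor
      · rintro ⟨hr, hx⟩
        rcases hx.eq_or_eq (hball (hsub hr)).A_ne_zero (hs r (hsub hr)) with h1 | h1
        · exact Or.inl ⟨r, hr, Prod.ext rfl h1.symm⟩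
        · exact Or.inr ⟨r, hr, Prod.ext rfl h1.symm⟩
      · rintro (⟨r', hr', h1⟩ | ⟨r', hr', h1⟩)
        · obtain ⟨rfl, rfl⟩ := Prod.mk.inj h1
          exact ⟨hr', (Y_root (hball (hsub hr')).A_ne_zero (hball (hsub hr')).C_ne_zero
            (hs _ (hsub hr'))).1⟩
        · obtain ⟨rfl, rfl⟩ := Prod.mk.inj h1
          exact ⟨hr', (Y_root (hball (hsub hr')).A_ne_zero (hball (hsub hr')).C_ne_zero
            (by rw [neg_sq]; exact hs _ (hsub hr'))).1⟩
    rw [this]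
    exact (hroot s hsc).union (hroot _ hsc.neg)
  have hTx : T ⊆ {p | p.2 ≠ 0} := fun p hp => hp.2.1
  set I := (fun p : ℂ × ℂ => point p.1 p.2) '' T with hI
  have hIc : IsClosed I := (hTc.image_of_continuousOn (continuousOn_point.mono hTx)).isClosed
  set W : Set (ℤ × ℤ → OnePoint ℂ) :=
    {y | y (1, 0) ∈ ((↑) : ℂ → OnePoint ℂ) '' ((fun r => -Complex.exp r) '' ball r₀ δ')} with hW
  have hWo : IsOpen W := (OnePoint.isOpenEmbedding_coe.isOpenMap _
    (isOpenMap_neg_exp _ isOpen_ball)).preimage (continuous_apply _)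
  have hzW : z ∈ W := by
    rw [hW, mem_ofPred_eq, hr₀]
    exact mem_image_of_mem _ (mem_image_of_mem _ (mem_ball_self hδ'0))
  have hWI : ∀ y ∈ W, y ∈ completeCurve φ d.a → y ∈ I := by
    intro y hy hyc
    have h1 := hWo.inter_closure ⟨hy, hyc⟩
    refine closure_minimal ?_ hIc h1
    rintro _ ⟨hyW, ⟨x₁, x₂⟩, hx, rfl⟩
    obtain ⟨_, ⟨r, hr, rfl⟩, hr2⟩ := hyW
    have h2 : monomialMap (x₁, x₂) (1, 0) = ((x₁ : ℂ) : OnePoint ℂ) := by simp [monomialMap]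
    rw [h2] at hr2
    have hr3 : -Complex.exp r = x₁ := OnePoint.coe_injective hr2
    subst hr3
    exact ⟨(r, x₂), ⟨ball_subset_closedBall hr, (mem_affineCurve h r x₂).1 hx⟩, rfl⟩
  have heq : ∀ p ∈ T, z = point p.1 p.2 → p.1 = r₀ := by
    rintro ⟨r, x⟩ ⟨hr, hx⟩ rfl
    rw [point_fst] at hr₀
    exact eq_of_exp_eq_of_dist (neg_injective (OnePoint.coe_injective hr₀))
      ((mem_closedBall.1 hr).trans (min_le_right _ _))
  obtain ⟨⟨r₁, x₀⟩, hT₀, hz₀⟩ := hWI z hzW hz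
  obtain rfl : r₁ = r₀ := heq _ hT₀ hz₀.symm
  refine ⟨x₀, hT₀.2, hz₀.symm, fun P hP => ?_⟩
  -- The coordinates (1, 0) and (0, 1) separate z from the compact rest of the curve over the disc,
  -- so points near z lie in P.
  have hIP : IsClosed ((fun p : ℂ × ℂ => point p.1 p.2) '' (T \ interior P)) :=
    ((hTc.diff isOpen_interior).image_of_continuousOn
      (continuousOn_point.mono (sdiff_subset.trans hTx))).isClosed
  have hzP : z ∉ (fun p : ℂ × ℂ => point p.1 p.2) '' (T \ interior P) := by
    rintro ⟨⟨r, x⟩, ⟨hp, hnP⟩, hpz⟩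
    have h1 : r = r₁ := heq _ hp hpz.symm
    have h2 : x = x₀ := by
      have h3 : point r x (0, 1) = point r₁ x₀ (0, 1) := by
        simp only at hpz hz₀
        rw [hpz, hz₀]
      rw [point_snd, point_snd] at h3
      exact OnePoint.coe_injective h3
    subst h1 h2
    exact hnP (mem_interior_iff_mem_nhds.2 hP)
  filter_upwards [hWo.mem_nhds hzW, hIP.isOpen_compl.mem_nhds hzP] with y hyW hyP hyc
  obtain ⟨p, hpT, rfl⟩ := hWI y hyW hyc
  refine ⟨p, ?_, hpT.2, rfl⟩
  by_contra hnP
  exact hyP ⟨p, ⟨hpT, fun h0 => hnP (interior_subset h0)⟩, rfl⟩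

/-! ### Charts around all points -/

/-- Flat sections over a neighbourhood `V` of a point `c` of the sphere. -/
structure IsBaseChart (d : CurveData) (e : ℕ) (κ : ℂ) (c : OnePoint ℂ) (V : Set (OnePoint ℂ))
    (σ : ℂ → ℂ → ℂ) : Prop where
  isOpen : IsOpen V
  mem : c ∈ V
  generic : ∀ c' ∈ V, c' ≠ c → ∃ r : ℂ, c' = ((-Complex.exp r : ℂ) : OnePoint ℂ) ∧ d.Generic r
  flatOn : d.FlatOn e κ {r | ((-Complex.exp r : ℂ) : OnePoint ℂ) ∈ V} σ
  ne_zero : ∀ r : ℂ, ((-Complex.exp r : ℂ) : OnePoint ℂ) ∈ V → ∀ x, d.OnCurve r x → σ r x ≠ 0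
  shift : ∀ r : ℂ, ((-Complex.exp r : ℂ) : OnePoint ℂ) ∈ V → ∀ x, d.OnCurve r x →
    σ (r - 2 * πi) x = (-x) ^ e * σ r x
  hasDerivWithinAt : ∀ (ρ x : ℝ → ℂ) (ρ' x' : ℂ) (s : Set ℝ), ∀ t ∈ s, HasDerivAt ρ ρ' t →
    HasDerivAt x x' t → (∀ u ∈ s, d.OnCurve (ρ u) (x u)) →
    d.X₁ (ρ t) (x t) * ρ' + d.Y (ρ t) (x t) * (x' / x t) = 0 →
    ((-Complex.exp (ρ t) : ℂ) : OnePoint ℂ) ∈ V →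
    HasDerivWithinAt (fun u => σ (ρ u) (x u)) (σ (ρ t) (x t) *
      (-(e / (2 * πi)) * ρ t * (x' / x t) + κ * d.ω (ρ t) (x t) ρ' x')) s t

/-- Near a generic point the real curve runs in one sheet, so the derivative along it is the complex
one by the chain rule. It is taken within `s` because the curve condition is only known there. -/
theorem FlatOn.hasDerivWithinAt {e : ℕ} {κ : ℂ} {R : Set ℂ} {σ : ℂ → ℂ → ℂ}
    (hσ : d.FlatOn e κ R σ) {ρ x : ℝ → ℂ} {ρ' x' : ℂ} {s : Set ℝ} {t : ℝ} (hts : t ∈ s)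
    (hρ : HasDerivAt ρ ρ' t) (hx : HasDerivAt x x' t) (hc : ∀ u ∈ s, d.OnCurve (ρ u) (x u))
    (ht : d.X₁ (ρ t) (x t) * ρ' + d.Y (ρ t) (x t) * (x' / x t) = 0) (hR : R ∈ 𝓝 (ρ t))
    (hg : d.Generic (ρ t)) :
    HasDerivWithinAt (fun u => σ (ρ u) (x u)) (σ (ρ t) (x t) *
      (-(e / (2 * πi)) * ρ t * (x' / x t) + κ * d.ω (ρ t) (x t) ρ' x')) s t := by
  obtain ⟨δ, hδ, S, hS0, hS, hev⟩ := exists_local_sheet hg (hc t hts) hR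
  have hmem := mem_ball_self (x := ρ t) hδ
  have hcurve : ∀ᶠ z in 𝓝 (ρ t), d.OnCurve z (d.root z (S z)) := by
    filter_upwards [isOpen_ball.mem_nhds hmem] with z hz
    exact (Y_root (hS z hz).2.1.A_ne_zero (hS z hz).2.1.C_ne_zero (hS z hz).2.2.2.1).1
  have h1 := (hσ.hasDerivAt (ρ t) (mem_of_mem_nhds hR) hg _
    (differentiableAt_root (hS _ hmem).2.2.1 hg) hcurve).scomp t hρ
  have h2 : ∀ᶠ u in 𝓝[s] t, x u = d.root (ρ u) (S (ρ u)) := by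
    have h3 : ContinuousAt (fun u => (ρ u, x u)) t := hρ.continuousAt.prodMk hx.continuousAt
    filter_upwards [nhdsWithin_le_nhds (h3.eventually hev), self_mem_nhdsWithin] with u hu hus
    exact hu (hc u hus)
  have hxt : x t = d.root (ρ t) (S (ρ t)) := h2.self_of_nhdsWithin hts
  have h4 := h1.hasDerivWithinAt.congr_of_eventuallyEq (s := s)
    (f₁ := fun u => σ (ρ u) (x u)) (by
      filter_upwards [h2] with u hu
      rw [hu]; rfl) (by rw [hxt]; rfl)
  convert! h4 using 1
  have hY := (hc t hts).Y_ne_zero hg.1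
  have hpi := two_pi_I_ne
  have h5 : x' / x t = -(d.X₁ (ρ t) (x t) * ρ') / d.Y (ρ t) (x t) := by
    rw [eq_div_iff hY]; linear_combination ht
  rw [h5, ← hxt, ω, if_neg hY, Λ, smul_eq_mul]
  field_simp
  ring

theorem flip_flip (d : CurveData) : d.flip.flip = d := by
  cases d
  simp [flip]

theorem exists_flatOn_right (hd : d.Admissible) (e : ℕ) (κ : ℂ) :
    ∃ (M : ℝ) (σ : ℂ → ℂ → ℂ), (∀ r : ℂ, M < r.re → d.Generic r) ∧
      d.FlatOn e κ {r | M < r.re} σ := by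
  rcases exists_ends hd e κ with ⟨-, -, M, B, X, S, η, ξ, X', S', η', ξ', hS, hS', hY⟩ |
    ⟨-, -, M, B, X, S, η, ξ, hS, hY⟩ | ⟨-, -, M, B, X, S, η, ξ, hS, hY⟩
  · exact ⟨M, _, hS.generic, (isEndPair_unramified hS hS' hY).flatOn⟩
  · exact ⟨M, _, hS.generic, (isEndPair_ramified hS hY).flatOn⟩
  · exact ⟨M, _, hS.generic, (isEndPair_ramified hS hY).flatOn⟩

theorem isBaseChart_of_generic {e : ℕ} {κ : ℂ} {c : OnePoint ℂ} {V : Set (OnePoint ℂ)}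
    {σ : ℂ → ℂ → ℂ} (hV : IsOpen V) (hc : c ∈ V)
    (hgen : ∀ r : ℂ, ((-Complex.exp r : ℂ) : OnePoint ℂ) ∈ V → d.Generic r)
    (hne : ∀ c' ∈ V, c' ≠ c → ∃ r : ℂ, c' = ((-Complex.exp r : ℂ) : OnePoint ℂ))
    (hσ : d.FlatOn e κ {r | ((-Complex.exp r : ℂ) : OnePoint ℂ) ∈ V} σ) :
    d.IsBaseChart e κ c V σ where
  isOpen := hV
  mem := hc
  generic c' hc' h := by
    obtain ⟨r, rfl⟩ := hne c' hc' h
    exact ⟨r, rfl, hgen r hc'⟩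
  flatOn := hσ
  ne_zero r hr := hσ.ne_zero r hr (hgen r hr)
  shift r hr := hσ.shift r hr (hgen r hr)
  hasDerivWithinAt ρ x ρ' x' s t hts hρ hx hc ht hV' := by
    refine hσ.hasDerivWithinAt hts hρ hx hc ht ?_ (hgen _ hV')
    have : Continuous fun r : ℂ => ((-Complex.exp r : ℂ) : OnePoint ℂ) :=
      OnePoint.continuous_coe.comp (by fun_prop)
    exact (hV.preimage this).mem_nhds hV'

theorem exists_isBaseChart (hd : d.Admissible) (e : ℕ) (κ : ℂ) (c : OnePoint ℂ) :
    ∃ V σ, d.IsBaseChart e κ c V σ := by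
  induction c using OnePoint.rec with
  | infty =>
    obtain ⟨M, σ, hg, hσ⟩ := exists_flatOn_right hd e κ
    have hiff : ∀ r : ℂ, ((-Complex.exp r : ℂ) : OnePoint ℂ) ∈
        (((↑) : ℂ → OnePoint ℂ) '' closedBall 0 (Real.exp M))ᶜ ↔ M < r.re := by
      intro r
      simp [Complex.norm_exp]
    refine ⟨_, σ, isBaseChart_of_generic (V := (((↑) : ℂ → OnePoint ℂ) '' closedBall 0 (Real.exp M))ᶜ)
      (OnePoint.isOpen_compl_image_coe.2 ⟨isClosed_closedBall, isCompact_closedBall _ _⟩)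
      (by simp) (fun r hr => hg r ((hiff r).1 hr)) ?_ ?_⟩
    · intro c' hc' hne
      obtain ⟨x, rfl⟩ := OnePoint.ne_infty_iff_exists.1 hne
      have hx : x ≠ 0 := by
        rintro rfl
        exact hc' ⟨0, by simp [Real.exp_nonneg], rfl⟩
      obtain ⟨r, rfl⟩ := exists_neg_exp hx
      exact ⟨r, rfl⟩
    · simpa only [hiff] using hσ
  | coe c =>
    rcases eq_or_ne c 0 with rfl | hc
    · obtain ⟨M, σ, hg, hσ⟩ := exists_flatOn_right hd.flip e κ
      have hiff : ∀ r : ℂ, ((-Complex.exp r : ℂ) : OnePoint ℂ) ∈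
          (((↑) : ℂ → OnePoint ℂ) '' ball 0 (Real.exp (-M))) ↔ M < (-r).re := by
        intro r
        simp [Complex.norm_exp]
        constructor <;> intro <;> linarith
      refine ⟨_, flipSection σ, isBaseChart_of_generic
        (V := ((↑) : ℂ → OnePoint ℂ) '' ball 0 (Real.exp (-M)))
        (OnePoint.isOpenEmbedding_coe.isOpenMap _ isOpen_ball)
        (by simp [Real.exp_pos]) (fun r hr => ?_) ?_ ?_⟩
      · have := flip_generic.1 (hg _ ((hiff r).1 hr))
        rwa [neg_neg] at this
      · rintro _ ⟨x, -, rfl⟩ hne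
        have hx : x ≠ 0 := by
          rintro rfl
          exact hne rfl
        obtain ⟨r, rfl⟩ := exists_neg_exp hx
        exact ⟨r, rfl⟩
      · have := hσ.flip (fun r hr => by simpa using hr)
        rw [flip_flip] at this
        simp only [hiff]
        exact this
    -- The principal logarithm of -c is 0 when c = -1. This is the one branch on which the Todd
    -- function is regular over x₁ = -1.
    · obtain ⟨c₀, hc₀, rfl⟩ : ∃ c₀ ∈ toddRegular, c = -Complex.exp c₀ := by
        refine ⟨Complex.log (-c), ?_, by rw [Complex.exp_log (neg_ne_zero.2 hc), neg_neg]⟩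
        rw [mem_toddRegular, Complex.exp_log (neg_ne_zero.2 hc)]
        by_cases h : -c = 1
        · left; rw [h, Complex.log_one]
        · right; exact h
      obtain ⟨ε, H, K, H', K', hch⟩ := exists_isChart hd e κ hc₀
      have hiff : ∀ r : ℂ, ((-Complex.exp r : ℂ) : OnePoint ℂ) ∈
          ((↑) : ℂ → OnePoint ℂ) '' ((fun r => -Complex.exp r) '' ball c₀ ε) ↔
          r ∈ chartRegion c₀ ε := by
        intro r
        constructor
        · rintro ⟨_, ⟨r', hr', rfl⟩, h2⟩
          obtain ⟨n, hn⟩ := Complex.exp_eq_exp_iff_exists_int.1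
            (neg_injective (OnePoint.coe_injective h2))
          refine ⟨n, ?_⟩
          rwa [show r + 2 * πi * n = r' by rw [hn]; ring]
        · rintro ⟨n, hn⟩
          exact ⟨_, ⟨_, hn, rfl⟩, by simp only [exp_add_int]⟩
      refine ⟨((↑) : ℂ → OnePoint ℂ) '' ((fun r => -Complex.exp r) '' ball c₀ ε),
        d.chartSection e c₀ H K, ?_, ?_, ?_, ?_, ?_, ?_, ?_⟩
      · exact OnePoint.isOpenEmbedding_coe.isOpenMap _ (isOpenMap_neg_exp _ isOpen_ball)
      · exact ⟨_, ⟨_, mem_ball_self hch.pos, rfl⟩, rfl⟩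
      · rintro _ ⟨_, ⟨r, hr, rfl⟩, rfl⟩ hne
        exact ⟨r, rfl, hch.generic r hr (by rintro rfl; exact hne rfl)⟩
      · simp only [hiff]
        exact hch.flatOn
      · intro r _ x hx
        exact chartSection_ne_zero hx.1
      · intro r _ x hx
        exact chartSection_sub r hx.1
      · intro ρ x ρ' x' s t hts hρ hx hcv ht hV
        obtain ⟨Θ, h1, h2⟩ := hasDerivAt_section hch hρ hx (hcv t hts).1 ((hiff _).1 hV)
        rw [h2 (hcv t hts) ht] at h1
        exact h1.hasDerivWithinAt

end CurveData

/-! ### The local system on the complete curve -/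

/-- The number of turns from the principal branch of the logarithm of `exp r` to `r`. -/
def turns (r : ℂ) : ℤ :=
  Classical.choose (Complex.exp_eq_exp_iff_exists_int.1
    (Complex.exp_log (Complex.exp_ne_zero r)).symm)

theorem eq_log_add_turns (r : ℂ) : r = Complex.log (Complex.exp r) + turns r * (2 * πi) := by
  have := Classical.choose_spec (Complex.exp_eq_exp_iff_exists_int.1
    (Complex.exp_log (Complex.exp_ne_zero r)).symm)
  rw [show (2 : ℂ) * πi = 2 * Real.pi * Complex.I by ring]
  exact this

theorem turns_unique {r : ℂ} {n : ℤ} (h : r = Complex.log (Complex.exp r) + n * (2 * πi)) :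
    turns r = n := by
  have h1 := eq_log_add_turns r
  have h2 : ((turns r : ℂ) - n) * (2 * πi) = 0 := by linear_combination h - h1
  have h3 := (mul_eq_zero.1 h2).resolve_right two_pi_I_ne
  exact_mod_cast sub_eq_zero.1 h3

theorem turns_sub (r : ℂ) : turns (r - 2 * πi) = turns r - 1 := by
  apply turns_unique
  have h1 : Complex.exp (r - 2 * πi) = Complex.exp r := by
    have := CurveData.exp_add_int r (-1)
    rw [← this]; congr 1; push_cast; ring
  rw [h1]
  push_cast
  linear_combination eq_log_add_turns r

/-- A nonzero number as a unit. -/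
def toUnit (w : ℂ) : ℂˣ := if h : w ≠ 0 then Units.mk0 w h else 1

theorem coe_toUnit {w : ℂ} (h : w ≠ 0) : (toUnit w : ℂ) = w := by
  rw [toUnit, dif_pos h, Units.val_mk0]

/-- A section as a function on the complete curve. -/
def sectionAt (σ : ℂ → ℂ → ℂ) (z : ℤ × ℤ → OnePoint ℂ) : ℂˣ :=
  toUnit (σ (Complex.log (-(z (1, 0)).elim 0 id)) ((z (0, 1)).elim 0 id))

theorem sectionAt_point (σ : ℂ → ℂ → ℂ) (r x : ℂ) :
    sectionAt σ (point r x) = toUnit (σ (r - turns r * (2 * πi)) x) := by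
  rw [sectionAt, point_fst, point_snd]
  simp only [OnePoint.elim_some, id, neg_neg]
  rw [show Complex.log (Complex.exp r) = r - turns r * (2 * πi) by
    linear_combination -eq_log_add_turns r]

theorem shift_int {σ : ℂ → ℂ} {u : ℂ} (hu : u ≠ 0) {R : Set ℂ}
    (hR : ∀ r ∈ R, ∀ n : ℤ, r + n * (2 * πi) ∈ R) (h : ∀ r ∈ R, σ (r - 2 * πi) = u * σ r)
    {r : ℂ} (hr : r ∈ R) (n : ℤ) : σ (r - n * (2 * πi)) = u ^ n * σ r := by
  have hmem : ∀ n : ℤ, r - n * (2 * πi) ∈ R := fun n => by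
    have := hR r hr (-n)
    rwa [Int.cast_neg, neg_mul, ← sub_eq_add_neg] at this
  induction n with
  | zero => simp
  | succ n ih =>
    rw [zpow_add_one₀ hu, mul_comm (u ^ _) u, mul_assoc, ← ih, ← h _ (hmem _)]
    congr 1; push_cast; ring
  | pred n ih =>
    have := h _ (hmem (-n - 1))
    rw [show r - ((-n - 1 : ℤ) : ℂ) * (2 * πi) - 2 * πi = r - ((-n : ℤ) : ℂ) * (2 * πi) by
      push_cast; ring, ih] at this
    rw [zpow_sub_one₀ hu, mul_right_comm, this]
    field_simp

namespace CurveData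

variable {d : CurveData} {φ : LaurentPoly} {e : ℕ} {κ : ℂ}

/-- `sectionAt` evaluates at the principal logarithm and so jumps across its cut. The jump is a
factor that does not depend on the chart, so it cancels in quotients of sections. -/
theorem IsBaseChart.coe_sectionAt {c : OnePoint ℂ} {V : Set (OnePoint ℂ)} {σ : ℂ → ℂ → ℂ}
    (h : d.IsBaseChart e κ c V σ) {r x : ℂ} (hr : ((-Complex.exp r : ℂ) : OnePoint ℂ) ∈ V)
    (hx : d.OnCurve r x) :
    (sectionAt σ (point r x) : ℂ) = ((-x) ^ e) ^ turns r * σ r x := by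
  have hu : (-x) ^ e ≠ 0 := pow_ne_zero _ (neg_ne_zero.2 hx.1)
  have key := shift_int (σ := fun r => σ r x) hu
    (R := {r | ((-Complex.exp r : ℂ) : OnePoint ℂ) ∈ V ∧ d.OnCurve r x})
    (fun r hr n => by
      rw [mul_comm]
      refine ⟨?_, (d.onCurve_add_int r x n).2 hr.2⟩
      simp only [exp_add_int]
      exact hr.1)
    (fun r hr => h.shift r hr.1 x hr.2) ⟨hr, hx⟩ (turns r)
  rw [sectionAt_point, key, coe_toUnit]
  exact mul_ne_zero (zpow_ne_zero _ hu) (h.ne_zero r hr x hx)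

/-- The flat sections over the charts as a local system on the complete curve. -/
def localSections (h : d.Represents φ) (V : OnePoint ℂ → Set (OnePoint ℂ))
    (σ : OnePoint ℂ → ℂ → ℂ → ℂ) (hσ : ∀ c, d.IsBaseChart e κ c (V c) (σ c)) :
    LocalSections (completeCurve φ d.a) ℂˣ (OnePoint ℂ) where
  U c := {z | z.1 (1, 0) ∈ V c}
  isOpen c := (hσ c).isOpen.preimage ((continuous_apply _).comp continuous_subtype_val)
  index z := z.1 (1, 0)
  mem_index z := (hσ _).mem
  s c z := sectionAt (σ c) z.1
  locallyConst i j := by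
    rintro z ⟨hi, hj⟩
    by_cases hij : i = j
    · subst hij
      simp
    -- Each chart contains no exceptional point other than possibly its centre, so two different
    -- charts overlap only over generic points.
    obtain ⟨r, hr, hg⟩ : ∃ r : ℂ, z.1 (1, 0) = ((-Complex.exp r : ℂ) : OnePoint ℂ) ∧ d.Generic r := by
      by_cases h1 : z.1 (1, 0) = i
      · exact (hσ j).generic _ hj fun h2 => hij (h1.symm.trans h2)
      · exact (hσ i).generic _ hi h1
    obtain ⟨x₀, hx₀, hz, hev⟩ := exists_point h z.2 hr hg
    have hcont : Continuous fun r : ℂ => ((-Complex.exp r : ℂ) : OnePoint ℂ) :=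
      OnePoint.continuous_coe.comp (by fun_prop)
    have hri : ((-Complex.exp r : ℂ) : OnePoint ℂ) ∈ V i := hr ▸ hi
    have hrj : ((-Complex.exp r : ℂ) : OnePoint ℂ) ∈ V j := hr ▸ hj
    have hR := ((hσ i).isOpen.inter (hσ j).isOpen).preimage hcont
    have h1 := ((hσ i).flatOn.mono (R' := _) fun r hr => And.left hr).ratio_eventually
      ((hσ j).flatOn.mono fun r hr => And.right hr) (hR.mem_nhds ⟨hri, hrj⟩) hg hx₀
    have h2 : ∀ᶠ p : ℂ × ℂ in 𝓝 (r, x₀), p.1 ∈ (fun r : ℂ => ((-Complex.exp r : ℂ) : OnePoint ℂ)) ⁻¹'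
        (V i ∩ V j) := continuousAt_fst.eventually (hR.mem_nhds ⟨hri, hrj⟩)
    have h3 := hev _ (h1.and h2)
    rw [← nhdsWithin_univ, nhdsWithin_univ, nhds_subtype_eq_comap]
    have ratio : ∀ {r' x' : ℂ}, ((-Complex.exp r' : ℂ) : OnePoint ℂ) ∈ V i →
        ((-Complex.exp r' : ℂ) : OnePoint ℂ) ∈ V j → d.OnCurve r' x' →
        ((sectionAt (σ i) (point r' x') / sectionAt (σ j) (point r' x') : ℂˣ) : ℂ) =
          σ i r' x' / σ j r' x' := by
      intro r' x' hi' hj' hx'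
      have hu : ((-x') ^ e) ^ turns r' ≠ 0 :=
        zpow_ne_zero _ (pow_ne_zero _ (neg_ne_zero.2 hx'.1))
      rw [Units.val_div_eq_div_val, (hσ i).coe_sectionAt hi' hx', (hσ j).coe_sectionAt hj' hx',
        mul_div_mul_left _ _ hu]
    filter_upwards [preimage_mem_comap h3] with y hy
    obtain ⟨⟨r', x'⟩, ⟨hp1, hp2⟩, hpc, hpy⟩ := hy y.2
    apply Units.ext
    rw [hz, hpy, ratio hp2.1 hp2.2 hpc, ratio hri hrj hx₀]
    exact hp1 hpc

/-! ### Paths in the complete curve -/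

/-- The point of the complete curve with coordinates `(r, x)`. -/
def curvePoint (h : d.Represents φ) {r x : ℂ} (hx : d.OnCurve r x) : completeCurve φ d.a :=
  ⟨point r x, point_mem h hx⟩

theorem curvePoint_congr (h : d.Represents φ) {r x r' x' : ℂ} (hx : d.OnCurve r x)
    (hx' : d.OnCurve r' x') (hr : r = r') (hxx : x = x') : curvePoint h hx = curvePoint h hx' := by
  subst hr hxx
  rfl

theorem continuous_curvePoint (h : d.Represents φ) {T : Type*} [TopologicalSpace T] {ρ X : T → ℂ}
    (hρ : Continuous ρ) (hX : Continuous X) (hc : ∀ t, d.OnCurve (ρ t) (X t)) :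
    Continuous fun t => curvePoint h (hc t) :=
  (continuousOn_point.comp_continuous (hρ.prodMk hX) fun t => (hc t).1).subtype_mk _

theorem exists_path (h : d.Represents φ) {S : Set ℂ} (hS : Convex ℝ S) {ρ X : ℂ → ℂ}
    (hρ : ContinuousOn ρ S) (hX : ContinuousOn X S) (hc : ∀ u ∈ S, d.OnCurve (ρ u) (X u))
    {u v : ℂ} (hu : u ∈ S) (hv : v ∈ S) :
    ∃ L : Path (curvePoint h (hc u hu)) (curvePoint h (hc v hv)),
      ∀ t : unitInterval, ∃ w ∈ S, (L t).1 = point (ρ w) (X w) := by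
  obtain ⟨γ, hγ⟩ := (hS.isPathConnected ⟨u, hu⟩).joinedIn u hu v hv
  have h0 := hρ.comp_continuous γ.continuous hγ
  have h1 := hX.comp_continuous γ.continuous hγ
  refine ⟨⟨⟨_, continuous_curvePoint h h0 h1 fun t => hc (γ t) (hγ t)⟩, ?_, ?_⟩,
    fun t => ⟨γ t, hγ t, rfl⟩⟩
  · exact curvePoint_congr h (hc _ (hγ 0)) _ (congrArg ρ γ.source) (congrArg X γ.source)
  · exact curvePoint_congr h (hc _ (hγ 1)) _ (congrArg ρ γ.target) (congrArg X γ.target)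

variable (p : completeCurve φ d.a)

/-- The point `(r, x)` of the curve is joined to `p`. -/
def JoinedTo (h : d.Represents φ) (r x : ℂ) : Prop :=
  ∃ hx : d.OnCurve r x, Joined p (curvePoint h hx)

variable {p}

theorem joinedTo_congr (h : d.Represents φ) {S : Set ℂ} (hS : Convex ℝ S) {ρ X : ℂ → ℂ}
    (hρ : ContinuousOn ρ S) (hX : ContinuousOn X S) (hc : ∀ u ∈ S, d.OnCurve (ρ u) (X u))
    {u v : ℂ} (hu : u ∈ S) (hv : v ∈ S) (hj : JoinedTo p h (ρ u) (X u)) :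
    JoinedTo p h (ρ v) (X v) := by
  obtain ⟨L, -⟩ := exists_path h hS hρ hX hc hu hv
  exact ⟨hc v hv, hj.2.trans ⟨L⟩⟩

theorem continuousOn_root {S : Set ℂ} {s : ℂ → ℂ} (hs : ContinuousOn s S)
    (hA : ∀ z ∈ S, d.A z ≠ 0) : ContinuousOn (fun z => d.root z (s z)) S :=
  (hs.sub d.continuous_b.continuousOn).div (continuousOn_const.mul d.continuous_A.continuousOn)
    fun z hz => mul_ne_zero two_ne_zero (hA z hz)

/-- Over a small disc of generic points the curve consists of two sheets, each path connected. Hence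
whether some point, or every point, over r is joined to `p` is locally constant in r. -/
theorem joinedTo_eventually (h : d.Represents φ) {r : ℂ} (hg : d.Generic r) :
    ∀ᶠ z in 𝓝 r, d.Generic z ∧ ((∃ x, JoinedTo p h z x) ↔ ∃ x, JoinedTo p h r x) ∧
      ((∀ x, d.OnCurve z x → JoinedTo p h z x) ↔ ∀ x, d.OnCurve r x → JoinedTo p h r x) := by
  obtain ⟨δ, hδ, hball⟩ := Metric.mem_nhds_iff.1 (d.isOpen_generic.mem_nhds hg)
  obtain ⟨s, -, hs, -, hs'⟩ := exists_sqrt_ball hδ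
    (fun z _ => (d.hasDerivAt_D z).differentiableAt.differentiableWithinAt)
    (fun z hz => (hball hz).1) (d.sqrtD r) (d.sqrtD_sq r)
  have hsc : ContinuousOn s (ball r δ) := fun z hz => (hs' z hz).continuousAt.continuousWithinAt
  have hA : ∀ z ∈ ball r δ, d.A z ≠ 0 := fun z hz => (hball hz).A_ne_zero
  have hcon : ∀ z ∈ ball r δ, d.OnCurve z (d.root z (s z)) := fun z hz =>
    (Y_root (hA z hz) (hball hz).C_ne_zero (hs z hz)).1
  have hcon' : ∀ z ∈ ball r δ, d.OnCurve z (d.root z (-s z)) := fun z hz =>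
    (Y_root (hA z hz) (hball hz).C_ne_zero (by rw [neg_sq]; exact hs z hz)).1
  have key : ∀ z ∈ ball r δ, ∀ z' ∈ ball r δ,
      (JoinedTo p h z (d.root z (s z)) → JoinedTo p h z' (d.root z' (s z'))) ∧
      (JoinedTo p h z (d.root z (-s z)) → JoinedTo p h z' (d.root z' (-s z'))) :=
    fun z hz z' hz' =>
      ⟨joinedTo_congr h (convex_ball r δ) continuousOn_id (continuousOn_root hsc hA) hcon hz hz',
      joinedTo_congr h (convex_ball r δ) continuousOn_id (continuousOn_root hsc.neg hA) hcon' hz hz'⟩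
  have hE : ∀ z ∈ ball r δ, ((∃ x, JoinedTo p h z x) ↔
      JoinedTo p h z (d.root z (s z)) ∨ JoinedTo p h z (d.root z (-s z))) := by
    intro z hz
    constructor
    · rintro ⟨x, hx⟩
      rcases hx.1.eq_or_eq (hA z hz) (hs z hz) with h1 | h1
      · left; rwa [← h1]
      · right; rwa [← h1]
    · rintro (h1 | h1) <;> exact ⟨_, h1⟩
  have hF : ∀ z ∈ ball r δ, ((∀ x, d.OnCurve z x → JoinedTo p h z x) ↔
      JoinedTo p h z (d.root z (s z)) ∧ JoinedTo p h z (d.root z (-s z))) := by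
    intro z hz
    constructor
    · intro h1
      exact ⟨h1 _ (hcon z hz), h1 _ (hcon' z hz)⟩
    · rintro ⟨h1, h2⟩ x hx
      rcases hx.eq_or_eq (hA z hz) (hs z hz) with h3 | h3
      · rwa [h3]
      · rwa [h3]
  have hr := mem_ball_self (x := r) hδ
  filter_upwards [isOpen_ball.mem_nhds hr] with z hz
  rw [hE z hz, hE r hr, hF z hz, hF r hr]
  have k1 := key z hz r hr
  have k2 := key r hr z hz
  exact ⟨hball hz, by tauto, by tauto⟩

/-- Generic values of r form a connected set, so it suffices to join the two points over one of
them. Near a branch point they are exchanged by u ↦ -u, and a path in the punctured u-disc joins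
them. -/
theorem joinedTo_of_generic (h : d.Represents φ) (hd : d.Admissible) {r₀ x₀ : ℂ}
    (h₀ : d.OnCurve r₀ x₀) (hp : p.1 = point r₀ x₀) {r x : ℂ} (hr : d.Generic r)
    (hx : d.OnCurve r x) : JoinedTo p h r x := by
  have hconst : ∀ {Q : ℂ → Prop}, (∀ r, d.Generic r → ∀ᶠ z in 𝓝 r, (Q z ↔ Q r)) →
      ∀ {z z' : ℂ}, d.Generic z → d.Generic z' → Q z → Q z' := by
    intro Q hQ z z' hz hz' hQz
    have : PreconnectedSpace {r | d.Generic r} :=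
      isPreconnected_iff_preconnectedSpace.1 hd.isPreconnected_generic
    have hloc : IsLocallyConstant fun r : {r | d.Generic r} => Q r := by
      rw [IsLocallyConstant.iff_eventually_eq]
      intro r
      have := hQ r r.2
      rw [nhds_subtype_eq_comap]
      filter_upwards [preimage_mem_comap this] with y hy
      exact propext hy
    have := hloc.apply_eq_of_preconnectedSpace ⟨z, hz⟩ ⟨z', hz'⟩
    simp only at this
    rwa [← this]
  have hp' : p = curvePoint h h₀ := Subtype.ext hp
  obtain ⟨r₁, hr₁, x₁, hx₁⟩ : ∃ r₁, d.Generic r₁ ∧ ∃ x₁, JoinedTo p h r₁ x₁ := by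
    obtain ⟨δ, hδ, ρ, X, h1, h2, hρ, hX, hc⟩ := exists_parametrization hd h₀
    have hmem : ((δ / 2 : ℝ) : ℂ) ∈ ball (0 : ℂ) δ := by
      simp [abs_of_pos hδ]; linarith
    refine ⟨ρ (δ / 2 : ℝ), (hc _ hmem).2 (by exact_mod_cast (by linarith : δ / 2 ≠ 0)), X (δ / 2 : ℝ), ?_⟩
    refine joinedTo_congr h (convex_ball 0 δ) hρ hX (fun u hu => (hc u hu).1)
      (mem_ball_self hδ) hmem ?_
    rw [h1, h2, hp']
    exact ⟨h₀, Joined.refl _⟩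
  obtain ⟨c, hc⟩ := exists_branch_point hd
  obtain ⟨δ, hδ, s, hs, hodd, hsu⟩ := exists_branch_sheet hd hc univ_mem
  obtain ⟨r₂, hr₂, hall⟩ : ∃ r₂, d.Generic r₂ ∧ ∀ x, d.OnCurve r₂ x → JoinedTo p h r₂ x := by
    have hmem : ∀ z ∈ {z : ℂ | z.re < Real.log δ}, Complex.exp z ∈ ball (0 : ℂ) δ := by
      intro z hz
      rw [mem_ball_zero_iff, Complex.norm_exp]
      exact (Real.lt_log_iff_exp_lt hδ).1 hz
    have hgen : ∀ z ∈ {z : ℂ | z.re < Real.log δ}, d.Generic (c + Complex.exp z ^ 2) := fun z hz =>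
      (hsu _ (hmem z hz)).2.2 (Complex.exp_ne_zero z)
    have hconv : Convex ℝ {z : ℂ | z.re < Real.log δ} :=
      convex_halfSpace_lt Complex.reCLM.toLinearMap.isLinear _
    have hρ : ContinuousOn (fun z => c + Complex.exp z ^ 2) {z : ℂ | z.re < Real.log δ} := by
      fun_prop
    have hsc : ContinuousOn (fun z => s (Complex.exp z)) {z : ℂ | z.re < Real.log δ} :=
      hs.comp Complex.continuous_exp.continuousOn hmem
    have hX : ContinuousOn (fun z => d.root (c + Complex.exp z ^ 2) (s (Complex.exp z)))
        {z : ℂ | z.re < Real.log δ} :=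
      (hsc.sub (d.continuous_b.comp_continuousOn hρ)).div
        (continuousOn_const.mul (d.continuous_A.comp_continuousOn hρ))
        fun z hz => mul_ne_zero two_ne_zero (hgen z hz).A_ne_zero
    have hcv : ∀ z ∈ {z : ℂ | z.re < Real.log δ},
        d.OnCurve (c + Complex.exp z ^ 2) (d.root (c + Complex.exp z ^ 2) (s (Complex.exp z))) :=
      fun z hz => (Y_root (hgen z hz).A_ne_zero (hgen z hz).C_ne_zero (hsu _ (hmem z hz)).2.1).1
    set z₀ : ℂ := ((Real.log δ - 1 : ℝ) : ℂ)
    have hz₀ : z₀ ∈ {z : ℂ | z.re < Real.log δ} := by simp [z₀]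
    have hz₁ : z₀ + πi ∈ {z : ℂ | z.re < Real.log δ} := by simp [z₀]
    -- With u = exp z, moving z by πi passes from u to -u along a path that avoids 0.
    have hexp : Complex.exp (z₀ + πi) = -Complex.exp z₀ := by
      rw [Complex.exp_add, Complex.exp_pi_mul_I, mul_neg_one]
    have k1 := joinedTo_congr (p := p) h hconv hρ hX hcv hz₀ hz₁
    have k2 := joinedTo_congr (p := p) h hconv hρ hX hcv hz₁ hz₀
    simp only [hexp, neg_sq, hodd] at k1 k2
    have hg₀ := hgen z₀ hz₀
    have hS := (hsu _ (hmem z₀ hz₀)).2.1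
    refine ⟨_, hg₀, fun x hx => ?_⟩
    obtain ⟨x', hx'⟩ := hconst (Q := fun r => ∃ x, JoinedTo p h r x)
      (fun r hr => (joinedTo_eventually h hr).mono fun z hz => hz.2.1) hr₁ hg₀ ⟨x₁, hx₁⟩
    rcases hx.eq_or_eq hg₀.A_ne_zero hS with h1 | h1 <;>
      rcases hx'.1.eq_or_eq hg₀.A_ne_zero hS with h2 | h2 <;> rw [h2] at hx' <;> rw [h1]
    · exact hx'
    · exact k2 hx'
    · exact k1 hx'
    · exact hx'
  exact hconst (Q := fun r => ∀ x, d.OnCurve r x → JoinedTo p h r x)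
    (fun r hr => (joinedTo_eventually h hr).mono fun z hz => hz.2.2) hr₂ hr hall x hx

end CurveData

/-! ### Monodromy along loops -/

/-- Primitives of functions that are continuous on the unit interval. -/
theorem exists_primitive {g : ℝ → ℂ} (hg : ContinuousOn g (Icc 0 1)) :
    ∃ G : ℝ → ℂ, (∀ t ∈ Icc (0 : ℝ) 1, G t = ∫ s in (0 : ℝ)..t, g s) ∧
      ∀ t ∈ Icc (0 : ℝ) 1, HasDerivAt G (g t) t := by
  have hc : Continuous (IccExtend zero_le_one ((Icc (0 : ℝ) 1).domRestrict g)) :=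
    (continuousOn_iff_continuous_domRestrict.1 hg).Icc_extend'
  have heq : ∀ t ∈ Icc (0 : ℝ) 1, IccExtend zero_le_one ((Icc (0 : ℝ) 1).domRestrict g) t = g t :=
    fun t ht => IccExtend_of_mem _ _ ht
  refine ⟨fun t => ∫ s in (0 : ℝ)..t, IccExtend zero_le_one ((Icc (0 : ℝ) 1).domRestrict g) s, ?_, ?_⟩
  · intro t ht
    refine intervalIntegral.integral_congr fun s hs => heq s ?_
    rw [uIcc_of_le ht.1] at hs
    exact ⟨hs.1, hs.2.trans ht.2⟩
  · intro t ht
    have := (hc.integral_hasStrictDerivAt 0 t).hasDerivAt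
    rwa [heq t ht] at this

theorem const_of_hasDerivWithinAt_zero {q : ℝ → ℂ} {s : Set ℝ} (hs : Convex ℝ s)
    (h : ∀ t ∈ s, HasDerivWithinAt q 0 s t) {t t' : ℝ} (ht : t ∈ s) (ht' : t' ∈ s) : q t = q t' := by
  have := hs.norm_image_sub_le_of_norm_hasDerivWithin_le (C := 0) h (by simp) ht' ht
  rw [zero_mul, norm_le_zero_iff] at this
  exact sub_eq_zero.1 this

namespace CurveData

variable {d : CurveData} {φ : LaurentPoly} {e : ℕ} {κ : ℂ} {p : ℂ × ℂ}

theorem continuousOn_X₁_comp {T : Type*} [TopologicalSpace T] {S : Set T} {ρ x : T → ℂ}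
    (hρ : ContinuousOn ρ S) (hx : ContinuousOn x S) (h0 : ∀ t ∈ S, x t ≠ 0) :
    ContinuousOn (fun t => d.X₁ (ρ t) (x t)) S := by
  have hA := d.continuous_A
  have hC := d.continuous_C
  have hexp : ∀ i : ℤ, Continuous fun r : ℂ => (-Complex.exp r) ^ i := fun i =>
    (by fun_prop : Continuous fun r : ℂ => -Complex.exp r).zpow₀ i fun r =>
      Or.inl (neg_ne_zero.2 (Complex.exp_ne_zero r))
  have hA' : Continuous d.A' := by
    have := hexp (d.i + 1)
    unfold A'
    fun_prop
  have hC' : Continuous d.C' := by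
    have := hexp (d.j + 1)
    unfold C'
    fun_prop
  have hb' : Continuous d.b' := by
    unfold b'
    fun_prop
  unfold X₁
  exact (((hA'.comp_continuousOn hρ).mul hx).add (hb'.comp_continuousOn hρ)).add
    ((hC'.comp_continuousOn hρ).div hx h0)

theorem continuousOn_Y_comp {T : Type*} [TopologicalSpace T] {S : Set T} {ρ x : T → ℂ}
    (hρ : ContinuousOn ρ S) (hx : ContinuousOn x S) (h0 : ∀ t ∈ S, x t ≠ 0) :
    ContinuousOn (fun t => d.Y (ρ t) (x t)) S := by
  intro t ht
  exact (continuousAt_Y (d := d) (h0 t ht)).comp_continuousWithinAt (f := fun t => (ρ t, x t))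
    ((hρ t ht).prodMk (hx t ht))

theorem holomorphicForm_eq (h : d.Represents φ) {r x : ℂ} (hx : x ≠ 0) (w₁ w₂ : ℂ) :
    holomorphicForm φ d.a (-Complex.exp r, x) (w₁, w₂) = d.ω r x (w₁ / -Complex.exp r) w₂ := by
  have he : -Complex.exp r ≠ 0 := neg_ne_zero.2 (Complex.exp_ne_zero r)
  have h1 := h.partial₁_eq r x
  have h2 := h.partial₂_eq r x hx
  rw [holomorphicForm, ω, ← h1, ← h2]
  simp only [mul_eq_zero, hx, false_or]
  rw [show (2 : ℂ) * πi = 2 * Real.pi * Complex.I by ring]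
  split_ifs with h3
  · by_cases h4 : partial₁ φ (-Complex.exp r, x) = 0
    · simp [h4]
    · have := two_pi_I_ne
      have h5 := Complex.exp_ne_zero r
      field_simp
  · have h5 := Complex.exp_ne_zero r
    field_simp

/-- On tangent vectors the two cases in the definition of ω are values of a single expression with
nowhere vanishing denominator. This shows that ω is continuous along a loop, branch points included.
-/
theorem ω_eq {r x v w : ℂ} (h : d.X₁ r x * v + d.Y r x * (w / x) = 0)
    (h0 : d.Y r x = 0 → d.X₁ r x ≠ 0) :
    d.ω r x v w = (2 * πi)⁻¹ * d.a * ((starRingEnd ℂ (d.X₁ r x) * (w / x) -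
      starRingEnd ℂ (d.Y r x) * v) / ((‖d.X₁ r x‖ ^ 2 + ‖d.Y r x‖ ^ 2 : ℝ) : ℂ)) := by
  rw [ω]
  congr 1
  split_ifs with hY
  · have hX := h0 hY
    rw [hY]
    push_cast
    rw [← Complex.conj_mul']
    have : starRingEnd ℂ (d.X₁ r x) ≠ 0 := (map_ne_zero _).2 hX
    simp
    field_simp
  · have hv : w / x = -(d.X₁ r x * v) / d.Y r x := by
      rw [eq_div_iff hY]; linear_combination h
    have hpos : ((‖d.X₁ r x‖ ^ 2 + ‖d.Y r x‖ ^ 2 : ℝ) : ℂ) ≠ 0 := by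
      have : 0 < ‖d.Y r x‖ := norm_pos_iff.2 hY
      exact_mod_cast (by positivity : (‖d.X₁ r x‖ ^ 2 + ‖d.Y r x‖ ^ 2 : ℝ) ≠ 0)
    rw [hv, div_eq_div_iff hY hpos]
    push_cast
    rw [← Complex.conj_mul', ← Complex.conj_mul']
    field_simp
    ring

/-- A lift of a loop to the coordinates `(r, x)`. -/
theorem exists_lift (h : d.Represents φ) (L : CurveLoop φ d.a p) :
    ∃ ρ : ℝ → ℂ, ρ 0 = Complex.log (-p.1) ∧
      ρ 1 = Complex.log (-p.1) + ∫ t in (0 : ℝ)..1, L.dlog₁ t ∧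
      ∀ t ∈ Icc (0 : ℝ) 1, ρ t = L.log₁ t ∧ HasDerivAt ρ (L.dlog₁ t) t ∧
        -Complex.exp (ρ t) = (L.toFun t).1 ∧ d.OnCurve (ρ t) (L.toFun t).2 ∧
        HasDerivAt (fun t => (L.toFun t).2) (deriv L.toFun t).2 t ∧
        d.X₁ (ρ t) (L.toFun t).2 * L.dlog₁ t + d.Y (ρ t) (L.toFun t).2 * L.dlog₂ t = 0 := by
  have hL : ∀ t, HasDerivAt L.toFun (deriv L.toFun t) t := fun t =>
    (L.contDiff.differentiable (by norm_num) t).hasDerivAt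
  have hL1 : ∀ t, HasDerivAt (fun t => (L.toFun t).1) (deriv L.toFun t).1 t := fun t => (hL t).fst
  have hL2 : ∀ t, HasDerivAt (fun t => (L.toFun t).2) (deriv L.toFun t).2 t := fun t => (hL t).snd
  have hL' : Continuous (deriv L.toFun) := L.contDiff.continuous_deriv (by norm_num)
  have hd1 : ContinuousOn L.dlog₁ (Icc 0 1) :=
    (continuous_fst.comp hL').continuousOn.div (continuous_fst.comp L.contDiff.continuous).continuousOn
      fun t ht => (L.mem t ht).1
  have hd2 : ContinuousOn L.dlog₂ (Icc 0 1) :=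
    (continuous_snd.comp hL').continuousOn.div (continuous_snd.comp L.contDiff.continuous).continuousOn
      fun t ht => (L.mem t ht).2.1
  obtain ⟨G, hG, hG'⟩ := exists_primitive hd1
  set ρ : ℝ → ℂ := fun t => Complex.log (-p.1) + G t with hρ
  have hρ' : ∀ t ∈ Icc (0 : ℝ) 1, HasDerivAt ρ (L.dlog₁ t) t := fun t ht => (hG' t ht).const_add _
  have h0 : (0 : ℝ) ∈ Icc (0 : ℝ) 1 := by simp
  have h1 : (1 : ℝ) ∈ Icc (0 : ℝ) 1 := by simp
  have hp1 : p.1 ≠ 0 := L.base_mem.1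
  have hρ0 : ρ 0 = Complex.log (-p.1) := by simp [hρ, hG 0 h0]
  have hexp : ∀ t ∈ Icc (0 : ℝ) 1, -Complex.exp (ρ t) = (L.toFun t).1 := by
    intro t ht
    have := const_of_hasDerivWithinAt_zero (q := fun t => Complex.exp (-ρ t) * (L.toFun t).1)
      (convex_Icc (0 : ℝ) 1) (fun t ht => by
        have := ((hρ' t ht).neg.cexp.mul (hL1 t)).hasDerivWithinAt (s := Icc 0 1)
        convert! this using 1
        have := (L.mem t ht).1
        simp only [CurveLoop.dlog₁, Pi.neg_apply]
        field_simp
        ring) ht h0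
    simp only [hρ0, L.source, Complex.exp_neg, Complex.exp_log (neg_ne_zero.2 hp1)] at this
    rw [inv_mul_eq_div, div_eq_iff (Complex.exp_ne_zero _)] at this
    rw [this]
    field_simp
  have hcv : ∀ t ∈ Icc (0 : ℝ) 1, d.OnCurve (ρ t) (L.toFun t).2 := by
    intro t ht
    refine (mem_affineCurve h _ _).1 ?_
    rw [hexp t ht]
    exact L.mem t ht
  refine ⟨ρ, hρ0, by simp only [hρ, hG 1 h1], fun t ht => ⟨by simp only [hρ, hG t ht]; rfl, hρ' t ht,
    hexp t ht, hcv t ht, hL2 t, ?_⟩⟩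
  have hρc : ContinuousOn ρ (Icc 0 1) := fun t ht => (hρ' t ht).continuousAt.continuousWithinAt
  have hxc : ContinuousOn (fun t => (L.toFun t).2) (Icc 0 1) :=
    (continuous_snd.comp L.contDiff.continuous).continuousOn
  have hcont : ContinuousOn (fun t => d.X₁ (ρ t) (L.toFun t).2 * L.dlog₁ t +
      d.Y (ρ t) (L.toFun t).2 * L.dlog₂ t) (Icc 0 1) :=
    ((continuousOn_X₁_comp hρc hxc fun t ht => (hcv t ht).1).mul hd1).add
      ((continuousOn_Y_comp hρc hxc fun t ht => (hcv t ht).1).mul hd2)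
  -- The loop is on the curve only for t in [0, 1], so the tangent relation is derived in the
  -- interior and extended to the end points by continuity.
  have hz : EqOn (fun t => d.X₁ (ρ t) (L.toFun t).2 * L.dlog₁ t +
      d.Y (ρ t) (L.toFun t).2 * L.dlog₂ t) (fun _ => 0) (Ioo 0 1) := by
    intro t ht
    have hev : ∀ᶠ s in 𝓝 t, d.OnCurve (ρ s) (L.toFun s).2 := by
      filter_upwards [isOpen_Ioo.mem_nhds ht] with s hs using hcv s (Ioo_subset_Icc_self hs)
    have := tangent_of_eventually (hρ' t (Ioo_subset_Icc_self ht)) (hL2 t) hev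
    simp only [CurveLoop.dlog₂]
    exact this
  exact hz.of_subset_closure hcont continuousOn_const Ioo_subset_Icc_self
    (by rw [closure_Ioo zero_ne_one]) ht

/-- The solution of the differential equation of flat sections along a loop. -/
theorem exists_flat_along (h : d.Represents φ) (hd : d.Admissible) (e : ℕ) (κ : ℂ)
    (L : CurveLoop φ d.a p) :
    ∃ ρ G : ℝ → ℂ, turns (ρ 0) = 0 ∧ G 0 = 0 ∧
      ((-(L.toFun 1).2) ^ e) ^ turns (ρ 1) * Complex.exp (G 1) =
        Complex.exp (-(e / (2 * πi)) * L.regulator + κ * L.period) ∧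
      ∀ t ∈ Icc (0 : ℝ) 1, ContinuousAt ρ t ∧ monomialMap (L.toFun t) = point (ρ t) (L.toFun t).2 ∧
        d.OnCurve (ρ t) (L.toFun t).2 ∧
        ∀ (c : OnePoint ℂ) (V : Set (OnePoint ℂ)) (σ : ℂ → ℂ → ℂ), d.IsBaseChart e κ c V σ →
          ((-Complex.exp (ρ t) : ℂ) : OnePoint ℂ) ∈ V →
          HasDerivWithinAt (fun u => Complex.exp (G u) / σ (ρ u) (L.toFun u).2) 0 (Icc 0 1) t := by
  obtain ⟨ρ, hρ0, hρ1, hρ⟩ := exists_lift h L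
  set x : ℝ → ℂ := fun t => (L.toFun t).2 with hx
  set x' : ℝ → ℂ := fun t => (deriv L.toFun t).2 with hx'
  have hL' : Continuous (deriv L.toFun) := L.contDiff.continuous_deriv (by norm_num)
  have h0 : (0 : ℝ) ∈ Icc (0 : ℝ) 1 := by simp
  have h1 : (1 : ℝ) ∈ Icc (0 : ℝ) 1 := by simp
  have hd1 : ContinuousOn L.dlog₁ (Icc 0 1) :=
    (continuous_fst.comp hL').continuousOn.div (continuous_fst.comp L.contDiff.continuous).continuousOn
      fun t ht => (L.mem t ht).1
  have hd2 : ContinuousOn L.dlog₂ (Icc 0 1) :=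
    (continuous_snd.comp hL').continuousOn.div (continuous_snd.comp L.contDiff.continuous).continuousOn
      fun t ht => (L.mem t ht).2.1
  have hρc : ContinuousOn ρ (Icc 0 1) := fun t ht => (hρ t ht).2.1.continuousAt.continuousWithinAt
  have hxc : ContinuousOn x (Icc 0 1) := (continuous_snd.comp L.contDiff.continuous).continuousOn
  have hx0 : ∀ t ∈ Icc (0 : ℝ) 1, x t ≠ 0 := by
    intro t ht
    obtain ⟨-, -, -, h3, -⟩ := hρ t ht
    exact h3.1
  have hYc : ContinuousOn (fun t => d.Y (ρ t) (x t)) (Icc 0 1) :=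
    continuousOn_Y_comp hρc hxc hx0
  have hXc : ContinuousOn (fun t => d.X₁ (ρ t) (x t)) (Icc 0 1) :=
    continuousOn_X₁_comp hρc hxc hx0
  have hform : ∀ t ∈ Icc (0 : ℝ) 1, holomorphicForm φ d.a (L.toFun t) (deriv L.toFun t) =
      d.ω (ρ t) (x t) (L.dlog₁ t) (x' t) := by
    intro t ht
    have := holomorphicForm_eq h (hρ t ht).2.2.2.1.1 (r := ρ t) (deriv L.toFun t).1
      (deriv L.toFun t).2
    rw [(hρ t ht).2.2.1] at this
    exact this
  have hωc : ContinuousOn (fun t => d.ω (ρ t) (x t) (L.dlog₁ t) (x' t)) (Icc 0 1) := by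
    have hX0 : ∀ t ∈ Icc (0 : ℝ) 1, d.Y (ρ t) (x t) = 0 → d.X₁ (ρ t) (x t) ≠ 0 := fun t ht =>
      (hρ t ht).2.2.2.1.X₁_ne_zero hd
    refine ContinuousOn.congr ?_ fun t ht => ω_eq (hρ t ht).2.2.2.2.2 (hX0 t ht)
    refine continuousOn_const.mul (ContinuousOn.div ?_ ?_ ?_)
    · exact ((Complex.continuous_conj.comp_continuousOn hXc).mul hd2).sub
        ((Complex.continuous_conj.comp_continuousOn hYc).mul hd1)
    · exact Complex.continuous_ofReal.comp_continuousOn ((hXc.norm.pow 2).add (hYc.norm.pow 2))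
    · intro t ht
      rw [Ne, Complex.ofReal_eq_zero]
      by_cases hY : d.Y (ρ t) (x t) = 0
      · have := norm_pos_iff.2 (hX0 t ht hY); positivity
      · have := norm_pos_iff.2 hY; positivity
  have hgc : ContinuousOn (fun t => -(e / (2 * πi)) * ρ t * L.dlog₂ t +
      κ * d.ω (ρ t) (x t) (L.dlog₁ t) (x' t)) (Icc 0 1) :=
    ((continuousOn_const.mul hρc).mul hd2).add (continuousOn_const.mul hωc)
  obtain ⟨G, hG, hG'⟩ := exists_primitive hgc
  have hsec : ∀ t ∈ Icc (0 : ℝ) 1, monomialMap (L.toFun t) = point (ρ t) (x t) := by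
    intro t ht
    rw [point, (hρ t ht).2.2.1]
  refine ⟨ρ, G, ?_, by rw [hG 0 h0]; simp, ?_, fun t ht => ⟨(hρ t ht).2.1.continuousAt, hsec t ht,
    (hρ t ht).2.2.2.1, ?_⟩⟩
  · apply turns_unique
    rw [hρ0, Complex.exp_log (neg_ne_zero.2 L.base_mem.1)]
    simp
  · have hp2 : -p.2 ≠ 0 := neg_ne_zero.2 L.base_mem.2.1
    have hx1 : x 1 = p.2 := by simp only [hx, L.target]
    have hexp1 : Complex.log (Complex.exp (ρ 1)) = Complex.log (-p.1) := by
      rw [← neg_neg (Complex.exp (ρ 1)), (hρ 1 h1).2.2.1, L.target]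
    -- The loop closes in x₁, so r returns up to a number of turns. The resulting factor
    -- ((-x₂)^e)^turns supplies precisely the boundary term log(-x₂(p)) ∫ dlog x₁ of the regulator.
    have hint : ∫ t in (0 : ℝ)..1, L.dlog₁ t = turns (ρ 1) * (2 * πi) := by
      have := eq_log_add_turns (ρ 1)
      rw [hexp1] at this
      linear_combination this - hρ1
    have hu1 : ((-x 1) ^ e) ^ turns (ρ 1) = Complex.exp (e * turns (ρ 1) * Complex.log (-p.2)) := by
      rw [hx1, mul_comm (e : ℂ), mul_assoc, Complex.exp_int_mul, Complex.exp_nat_mul,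
        Complex.exp_log hp2]
    have hG1 : G 1 = -(e / (2 * πi)) * (∫ t in (0 : ℝ)..1, L.log₁ t * L.dlog₂ t) + κ * L.period := by
      have i1 : IntervalIntegrable (fun t => -(e / (2 * πi)) * ρ t * L.dlog₂ t) volume 0 1 :=
        ContinuousOn.intervalIntegrable (by
          rw [uIcc_of_le zero_le_one]; exact (continuousOn_const.mul hρc).mul hd2)
      have i2 : IntervalIntegrable (fun t => κ * d.ω (ρ t) (x t) (L.dlog₁ t) (x' t)) volume 0 1 :=
        ContinuousOn.intervalIntegrable (by
          rw [uIcc_of_le zero_le_one]; exact continuousOn_const.mul hωc)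
      rw [hG 1 h1, intervalIntegral.integral_add i1 i2, intervalIntegral.integral_const_mul,
        CurveLoop.period, ← intervalIntegral.integral_const_mul (-((e : ℂ) / (2 * πi)))]
      congr 1
      · refine intervalIntegral.integral_congr fun t ht => ?_
        rw [uIcc_of_le zero_le_one] at ht
        simp only [(hρ t ht).1, mul_assoc]
      · congr 1
        refine intervalIntegral.integral_congr fun t ht => ?_
        rw [uIcc_of_le zero_le_one] at ht
        exact (hform t ht).symm
    change ((-x 1) ^ e) ^ turns (ρ 1) * Complex.exp (G 1) = _
    rw [hu1, hG1, ← Complex.exp_add, CurveLoop.regulator, hint]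
    congr 1
    have := two_pi_I_ne
    field_simp
    ring

  · intro c V σ hσ hV
    have hu := hρ t ht
    have d1 := hσ.hasDerivWithinAt ρ x (L.dlog₁ t) (x' t) (Icc (0 : ℝ) 1) t ht hu.2.1
      hu.2.2.2.2.1 (fun t ht => (hρ t ht).2.2.2.1) hu.2.2.2.2.2 hV
    have hs0 := hσ.ne_zero (ρ t) hV (x t) hu.2.2.2.1
    have d2 := ((hG' t ht).cexp.hasDerivWithinAt (s := Icc (0 : ℝ) 1)).div d1 hs0
    convert! d2 using 1
    rw [eq_comm, div_eq_zero_iff]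
    left
    simp only [CurveLoop.dlog₂]
    ring

/-- Parallel transport along a loop. -/
theorem exists_transport (h : d.Represents φ) (hd : d.Admissible)
    {V : OnePoint ℂ → Set (OnePoint ℂ)} {σ : OnePoint ℂ → ℂ → ℂ → ℂ}
    (hσ : ∀ c, d.IsBaseChart e κ c (V c) (σ c)) (L : CurveLoop φ d.a p) :
    ∃ v : unitInterval → ℂˣ, (localSections h V σ hσ).IsTransport L.toPath v ∧ v 0 = 1 ∧
      (v 1 : ℂ) = Complex.exp (-(e / (2 * πi)) * L.regulator + κ * L.period) := by
  obtain ⟨ρ, G, ht0, hG0, hG1, hρ⟩ := exists_flat_along h hd e κ L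
  have hu : ∀ t ∈ Icc (0 : ℝ) 1, ((-(L.toFun t).2) ^ e) ^ turns (ρ t) ≠ 0 := fun t ht =>
    zpow_ne_zero _ (pow_ne_zero _ (neg_ne_zero.2 (hρ t ht).2.2.1.1))
  have hne : ∀ t ∈ Icc (0 : ℝ) 1, ((-(L.toFun t).2) ^ e) ^ turns (ρ t) * Complex.exp (G t) ≠ 0 :=
    fun t ht => mul_ne_zero (hu t ht) (Complex.exp_ne_zero _)
  refine ⟨fun t => toUnit (((-(L.toFun t).2) ^ e) ^ turns (ρ t) * Complex.exp (G t)),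
    fun t => ?_, ?_, ?_⟩
  · obtain ⟨c, hc⟩ : ∃ c : OnePoint ℂ, c = ((-Complex.exp (ρ t) : ℂ) : OnePoint ℂ) := ⟨_, rfl⟩
    have hcont : Continuous fun r : ℂ => ((-Complex.exp r : ℂ) : OnePoint ℂ) :=
      OnePoint.continuous_coe.comp (by fun_prop)
    have hW : {u | ((-Complex.exp (ρ u) : ℂ) : OnePoint ℂ) ∈ V c} ∈ 𝓝 (t : ℝ) :=
      (hcont.continuousAt.comp (hρ t t.2).1) ((hσ c).isOpen.mem_nhds (hc ▸ (hσ c).mem))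
    obtain ⟨δ, hδ, hball⟩ := Metric.mem_nhds_iff.1 hW
    have key : ∀ u ∈ Icc (0 : ℝ) 1 ∩ ball (t : ℝ) δ, Complex.exp (G u) / σ c (ρ u) (L.toFun u).2 =
        Complex.exp (G t) / σ c (ρ t) (L.toFun t).2 := fun u hu' =>
      const_of_hasDerivWithinAt_zero (q := fun u => Complex.exp (G u) / σ c (ρ u) (L.toFun u).2)
        ((convex_Icc (0 : ℝ) 1).inter (convex_ball _ _))
        (fun u hu' => ((hρ u hu'.1).2.2.2 c _ _ (hσ c) (hball hu'.2)).mono inter_subset_left)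
        hu' ⟨t.2, mem_ball_self hδ⟩
    have hratio : ∀ u : unitInterval, (u : ℝ) ∈ ball (t : ℝ) δ →
        ((toUnit (((-(L.toFun u).2) ^ e) ^ turns (ρ u) * Complex.exp (G u)) /
          sectionAt (σ c) (monomialMap (L.toFun u)) : ℂˣ) : ℂ) =
          Complex.exp (G u) / σ c (ρ u) (L.toFun u).2 := by
      intro u hu'
      rw [Units.val_div_eq_div_val, coe_toUnit (hne u u.2), (hρ u u.2).2.1,
        (hσ c).coe_sectionAt (hball hu') (hρ u u.2).2.2.1, mul_div_mul_left _ _ (hu u u.2)]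
    refine ⟨c, ?_, ?_⟩
    · change monomialMap (L.toFun t) (1, 0) ∈ V c
      rw [(hρ t t.2).2.1, point_fst, ← hc]
      exact (hσ c).mem
    · have hev : ∀ᶠ u : unitInterval in 𝓝 t, (u : ℝ) ∈ ball (t : ℝ) δ :=
        continuous_subtype_val.continuousAt (isOpen_ball.mem_nhds (mem_ball_self hδ))
      refine hev.mono fun u hu' => Units.ext ?_
      exact (hratio u hu').trans ((key u ⟨u.2, hu'⟩).trans (hratio t (mem_ball_self hδ)).symm)
  · apply Units.ext
    rw [coe_toUnit (hne _ (by simp))]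
    simp [ht0, hG0]
  · rw [coe_toUnit (hne _ (by simp))]
    exact hG1

end CurveData

/-- The statement does not mention a topology on `G`. The discrete one is chosen here, so that the
result applies to ℂˣ in spite of its usual topology. -/
theorem LocalSections.exists_global_of_generators {X G ι : Type*} [TopologicalSpace X] [CommGroup G]
    (S : LocalSections X G ι) (p : X) (T : Set (FundamentalGroup X p))
    (hT : Subgroup.closure (Abelianization.of '' T) = ⊤)
    (hmon : ∀ q ∈ T, ∃ L : Path p p, q = FundamentalGroup.fromPath (Path.Homotopic.Quotient.mk L) ∧
      ∃ v, S.IsTransport L v ∧ v 0 = v 1) :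
    ∃ f : X → G, ∀ x y : X, Joined p x → ∀ (L : Path x y) (v : unitInterval → G),
      S.IsTransport L v → v 1 / v 0 = f y / f x := by
  let _ : TopologicalSpace G := ⊥
  have : DiscreteTopology G := ⟨rfl⟩
  exact S.exists_global p T hT hmon

/-! ### Existence of a global flat section -/

namespace CurveData

variable {d : CurveData} {φ : LaurentPoly} {e : ℕ} {κ : ℂ} {p : ℂ × ℂ}

/-- If the monodromy is trivial along a basis of the homology, there are global flat sections. -/
theorem exists_flat (h : d.Represents φ) (hd : d.Admissible) (e : ℕ) (κ : ℂ)
    (γ β : CurveLoop φ d.a p) (hb : IsHomologyBasis γ β)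
    (hγ : Complex.exp (-(e / (2 * πi)) * γ.regulator + κ * γ.period) = 1)
    (hβ : Complex.exp (-(e / (2 * πi)) * β.regulator + κ * β.period) = 1) :
    ∃ F, d.FlatOn e κ univ F := by
  choose V σ hσ using exists_isBaseChart hd e κ
  have hmon : ∀ L : CurveLoop φ d.a p,
      Complex.exp (-(e / (2 * πi)) * L.regulator + κ * L.period) = 1 →
      ∃ v, (localSections h V σ hσ).IsTransport L.toPath v ∧ v 0 = v 1 := by
    intro L hL
    obtain ⟨v, hv, h0, h1⟩ := exists_transport h hd hσ L
    exact ⟨v, hv, by rw [h0]; exact Units.ext (by rw [h1, hL]; rfl)⟩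
  obtain ⟨f, hf⟩ := (localSections h V σ hσ).exists_global_of_generators
    (toComplete p γ.base_mem)
    {FundamentalGroup.fromPath (Path.Homotopic.Quotient.mk γ.toPath),
      FundamentalGroup.fromPath (Path.Homotopic.Quotient.mk β.toPath)}
    (by rw [image_pair]; exact hb) (by
      rintro q (rfl | rfl)
      · exact ⟨_, rfl, hmon γ hγ⟩
      · exact ⟨_, rfl, hmon β hβ⟩)
  obtain ⟨r₀, hr₀⟩ := exists_neg_exp γ.base_mem.1
  have hp₀ : d.OnCurve r₀ p.2 := (mem_affineCurve h _ _).1 (by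
    rw [← hr₀]; exact γ.base_mem)
  have hp₁ : (toComplete p γ.base_mem).1 = point r₀ p.2 := by
    rw [point, ← hr₀]; rfl
  classical
  -- The factor removes the normalization to the principal logarithm, so that F is locally a
  -- constant multiple of the sections σ.
  set F : ℂ → ℂ → ℂ := fun r x => if hx : d.OnCurve r x then
    (f (curvePoint h hx) : ℂ) * (((-x) ^ e) ^ turns r)⁻¹ else 0 with hF
  have hFx : ∀ {r x} (hx : d.OnCurve r x),
      F r x = (f (curvePoint h hx) : ℂ) * (((-x) ^ e) ^ turns r)⁻¹ := fun hx => dif_pos hx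
  have hu : ∀ {r x : ℂ}, d.OnCurve r x → (-x) ^ e ≠ 0 := fun hx =>
    pow_ne_zero _ (neg_ne_zero.2 hx.1)
  refine ⟨F, fun r _ _ x hx => ?_, fun r _ _ x hx => ?_, fun r _ hg X hX hXc => ?_⟩
  · rw [hFx hx]
    exact mul_ne_zero (Units.ne_zero _) (inv_ne_zero (zpow_ne_zero _ (hu hx)))
  · have hx' : d.OnCurve (r - 2 * πi) x := by
      have := (d.onCurve_add_int r x (-1)).2 hx
      rwa [show r + 2 * πi * ((-1 : ℤ) : ℂ) = r - 2 * πi by push_cast; ring] at this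
    have hexp : Complex.exp (r - 2 * πi) = Complex.exp r := by
      have := exp_add_int r (-1)
      rwa [show r + 2 * πi * ((-1 : ℤ) : ℂ) = r - 2 * πi by push_cast; ring] at this
    have hpt : curvePoint h hx' = curvePoint h hx := Subtype.ext (point_congr hexp x)
    rw [hFx hx', hFx hx, hpt, turns_sub, zpow_sub_one₀ (hu hx), mul_inv, inv_inv]
    ring
  · obtain ⟨c, hc⟩ : ∃ c : OnePoint ℂ, c = ((-Complex.exp r : ℂ) : OnePoint ℂ) := ⟨_, rfl⟩
    have hcont : Continuous fun r : ℂ => ((-Complex.exp r : ℂ) : OnePoint ℂ) :=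
      OnePoint.continuous_coe.comp (by fun_prop)
    have hVo := (hσ c).isOpen.preimage hcont
    have hrV : ((-Complex.exp r : ℂ) : OnePoint ℂ) ∈ V c := hc ▸ (hσ c).mem
    obtain ⟨B, hB, s, hs0, hs, hev⟩ := exists_local_sheet hg hXc.self_of_nhds
      (hVo.mem_nhds hrV)
    have hr := mem_ball_self (x := r) hB
    have hsc : ContinuousOn s (ball r B) := fun z hz =>
      (hs z hz).2.2.1.continuousAt.continuousWithinAt
    have hA : ∀ z ∈ ball r B, d.A z ≠ 0 := fun z hz => (hs z hz).2.1.A_ne_zero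
    have hcv : ∀ z ∈ ball r B, d.OnCurve z (d.root z (s z)) := fun z hz =>
      (Y_root (hA z hz) (hs z hz).2.1.C_ne_zero (hs z hz).2.2.2.1).1
    have hroot : ∀ᶠ z in 𝓝 r, X z = d.root z (s z) := by
      have h1 : ContinuousAt (fun z => (z, X z)) r := continuousAt_id.prodMk hX.continuousAt
      filter_upwards [h1.eventually hev, hXc] with z h2 h3 using h2 h3
    have hXr : X r = d.root r (s r) := hroot.self_of_nhds
    -- Along a path inside one sheet the chart section itself is a transport, so the global section
    -- is proportional to it.
    have key : ∀ z ∈ ball r B, F z (d.root z (s z)) =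
        F r (X r) / σ c r (X r) * σ c z (d.root z (s z)) := by
      intro z hz
      obtain ⟨L, hL⟩ := exists_path h (convex_ball r B) continuousOn_id
        (continuousOn_root hsc hA) hcv hr hz
      have hLV : ∀ t, L t ∈ (localSections h V σ hσ).U c := by
        intro t
        obtain ⟨w, hw, hLw⟩ := hL t
        change (L t).1 (1, 0) ∈ V c
        rw [hLw, point_fst]
        exact (hs w hw).1
      have hj := (joinedTo_of_generic (p := toComplete p γ.base_mem) h hd hp₀ hp₁ hg (hcv r hr)).2
      have h1 := hf _ _ hj L (fun t => (localSections h V σ hσ).s c (L t))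
        (fun t => ⟨c, hLV t, Filter.Eventually.of_forall fun t' => by rw [div_self', div_self']⟩)
      rw [L.source, L.target] at h1
      have h2 := congrArg (Units.val) h1
      rw [Units.val_div_eq_div_val, Units.val_div_eq_div_val] at h2
      change (sectionAt (σ c) (point z (d.root z (s z))) : ℂ) /
        (sectionAt (σ c) (point r (d.root r (s r))) : ℂ) = _ at h2
      have hzV : ((-Complex.exp z : ℂ) : OnePoint ℂ) ∈ V c := (hs z hz).1
      rw [(hσ c).coe_sectionAt hzV (hcv z hz), (hσ c).coe_sectionAt hrV (hcv r hr)] at h2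
      have n1 := (hσ c).ne_zero z hzV _ (hcv z hz)
      have n2 := (hσ c).ne_zero r hrV _ (hcv r hr)
      have n3 := zpow_ne_zero (turns z) (hu (hcv z hz))
      have n4 := zpow_ne_zero (turns r) (hu (hcv r hr))
      have n5 := Units.ne_zero (f (curvePoint h (hcv r hr)))
      rw [hXr, hFx (hcv z hz), hFx (hcv r hr)]
      rw [div_eq_div_iff (mul_ne_zero n4 n2) n5] at h2
      field_simp
      simp only [id] at h2
      linear_combination -h2
    have h2 := ((hσ c).flatOn.hasDerivAt r hrV hg X hX hXc).const_mul (F r (X r) / σ c r (X r))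
    have n2 := (hσ c).ne_zero r hrV _ hXc.self_of_nhds
    rw [← mul_assoc, div_mul_cancel₀ _ n2] at h2
    refine h2.congr_of_eventuallyEq ?_
    filter_upwards [hroot, isOpen_ball.mem_nhds hr] with z h3 h4
    simp only [h3]
    exact key z h4

end CurveData

/-! ### Analytic continuation of the traces -/

/-- The continuous extension of a function across isolated points. -/
def regularize (f : ℂ → ℂ) (c : ℂ) : ℂ := limUnder (𝓝[≠] c) f

theorem regularize_eq {f : ℂ → ℂ} {c : ℂ} (h : ContinuousAt f c) : regularize f c = f c :=
  (h.mono_left nhdsWithin_le_nhds).limUnder_eq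

/-- Riemann's theorem on removable singularities; the regularized function agrees with f at the
nearby points, where f is differentiable. -/
theorem differentiableAt_regularize {f : ℂ → ℂ} {c : ℂ}
    (hf : ∀ᶠ z in 𝓝[≠] c, DifferentiableAt ℂ f z) (hb : ∃ K, ∀ᶠ z in 𝓝[≠] c, ‖f z‖ ≤ K) :
    DifferentiableAt ℂ (regularize f) c := by
  obtain ⟨K, hK⟩ := hb
  obtain ⟨δ, hδ, hball⟩ := Metric.eventually_nhds_iff_ball.1
    (eventually_nhdsWithin_iff.1 (hf.and hK))
  have h1 := Complex.differentiableOn_update_limUnder_of_bddAbove (f := f) (c := c)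
    (ball_mem_nhds c hδ) (fun z hz => (hball z hz.1 hz.2).1.differentiableWithinAt)
    ⟨K, by rintro _ ⟨z, hz, rfl⟩; exact (hball z hz.1 hz.2).2⟩
  refine (h1.differentiableAt (ball_mem_nhds c hδ)).congr_of_eventuallyEq ?_
  filter_upwards [ball_mem_nhds c hδ] with z hz
  rcases eq_or_ne z c with rfl | hne
  · rw [Function.update_self]; rfl
  · rw [Function.update_of_ne hne, regularize_eq (hball z hz hne).1.continuousAt]

namespace CurveData

variable {d : CurveData} {e : ℕ} {κ : ℂ} {F : ℂ → ℂ → ℂ}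

theorem exists_generic_sheet {r : ℂ} (hg : d.Generic r) :
    ∃ s : ℂ → ℂ, ∀ᶠ z in 𝓝 r, d.Generic z ∧ DifferentiableAt ℂ s z ∧ s z ^ 2 = d.D z ∧ s z ≠ 0 ∧
      d.OnCurve z (d.root z (s z)) ∧ d.OnCurve z (d.root z (-s z)) ∧
      d.Y z (d.root z (s z)) = s z ∧ d.Y z (d.root z (-s z)) = -s z := by
  obtain ⟨δ, hδ, hball⟩ := Metric.mem_nhds_iff.1 (d.isOpen_generic.mem_nhds hg)
  obtain ⟨s, -, hs, hs0, hs'⟩ := exists_sqrt_ball hδ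
    (fun z _ => (d.hasDerivAt_D z).differentiableAt.differentiableWithinAt)
    (fun z hz => (hball hz).1) (d.sqrtD r) (d.sqrtD_sq r)
  refine ⟨s, ?_⟩
  filter_upwards [ball_mem_nhds r hδ] with z hz
  obtain ⟨h1, h2⟩ := Y_root (hball hz).A_ne_zero (hball hz).C_ne_zero (hs z hz)
  obtain ⟨h3, h4⟩ := Y_root (s := -s z) (hball hz).A_ne_zero (hball hz).C_ne_zero
    (by rw [neg_sq]; exact hs z hz)
  exact ⟨hball hz, (hs' z hz).differentiableAt, hs z hz, hs0 z hz, h1, h3, h2, h4⟩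

theorem FlatOn.hasDerivAt_trace (hF : d.FlatOn e κ univ F) {r : ℂ} (hg : d.Generic r) :
    DifferentiableAt ℂ (d.trace F) r ∧ DifferentiableAt ℂ (d.traceY F) r := by
  obtain ⟨s, hs⟩ := exists_generic_sheet hg
  obtain ⟨-, hsd, -, hs0, -⟩ := hs.self_of_nhds
  have h1 := hF.hasDerivAt r (mem_univ _) hg _ (differentiableAt_root hsd hg)
    (hs.mono fun z hz => hz.2.2.2.2.1)
  have h2 := hF.hasDerivAt r (mem_univ _) hg _ (differentiableAt_root hsd.neg hg)
    (hs.mono fun z hz => hz.2.2.2.2.2.1)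
  constructor
  · refine (h1.add h2).differentiableAt.congr_of_eventuallyEq ?_
    filter_upwards [hs] with z hz
    exact trace_eq F hz.2.2.1
  · refine ((h1.sub h2).differentiableAt.div hsd hs0).congr_of_eventuallyEq ?_
    filter_upwards [hs] with z hz
    exact traceY_eq F hz.2.2.1

/-- Flat sections near a point where the Todd function is regular. -/
theorem FlatOn.exists_bound (hF : d.FlatOn e κ univ F) (hd : d.Admissible) {c : ℂ}
    (hc : c ∈ toddRegular) :
    ∃ B, ∀ᶠ z in 𝓝[≠] c, ‖d.trace F z‖ ≤ B ∧ ‖d.traceY F z‖ ≤ B := by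
  obtain ⟨ε, H, K, H', K', hch⟩ := exists_isChart hd e κ hc
  have hcε := mem_ball_self (x := c) hch.pos
  have hsec : ∀ z ∈ ball c ε, ∀ x, d.chartSection e c H K z x =
      Complex.exp (H z + d.Y z x * K z) := by
    intro z hz x
    have := hch.section_eq (r := z) (x := x) (n := 0) (by simpa using hz)
    simpa using this
  have hHc : ContinuousAt H c := (hch.hasDerivAt_H c hcε).continuousAt
  have hKc : ContinuousAt K c := (hch.hasDerivAt_K c hcε).continuousAt
  have hreg : ∀ z ∈ ball c ε, chartRegion c ε ∈ 𝓝 z := fun z hz =>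
    mem_of_superset (isOpen_ball.mem_nhds hz) fun w hw => ⟨0, by simpa using hw⟩
  have hσ0 : ∀ z ∈ ball c ε, ∀ x, d.chartSection e c H K z x ≠ 0 := fun z hz x => by
    rw [hsec z hz]; exact Complex.exp_ne_zero _
  by_cases hDc : d.D c = 0
  · obtain ⟨δ, hδ, s, hs, hodd, hsu⟩ := exists_branch_sheet hd hDc (ball_mem_nhds c hch.pos)
    have hcont : ContinuousOn (fun u : ℂ => d.root (c + u ^ 2) (s u)) (ball 0 δ \ {0}) := by
      refine ContinuousOn.div ?_ ?_ ?_
      · exact (hs.mono sdiff_subset).sub (d.continuous_b.comp (by fun_prop)).continuousOn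
      · exact (continuous_const.mul (d.continuous_A.comp (by fun_prop))).continuousOn
      · intro u hu
        exact mul_ne_zero two_ne_zero ((hsu u hu.1).2.2 hu.2).A_ne_zero
    set u₀ : ℂ := ((δ / 2 : ℝ) : ℂ)
    have hu₀ : u₀ ∈ ball (0 : ℂ) δ \ {0} := by
      refine ⟨?_, ?_⟩
      · simp [u₀, abs_of_pos hδ]; linarith
      · simp [u₀, hδ.ne']
    -- The punctured u-disc is connected and covers both sheets, so a single constant k serves for
    -- both. The difference of the two values is then O(√D), and dividing it by √D leaves it
    -- bounded.
    obtain ⟨k, hk⟩ : ∃ k, ∀ u ∈ ball (0 : ℂ) δ \ {0}, F (c + u ^ 2) (d.root (c + u ^ 2) (s u)) =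
        k * Complex.exp (H (c + u ^ 2) + s u * K (c + u ^ 2)) := by
      refine ⟨F (c + u₀ ^ 2) (d.root (c + u₀ ^ 2) (s u₀)) / d.chartSection e c H K (c + u₀ ^ 2)
        (d.root (c + u₀ ^ 2) (s u₀)), fun u hu => ?_⟩
      have h1 := (hF.mono (subset_univ _)).ratio_const hch.flatOn
        (isPreconnected_punctured_ball 0 δ) (ρ := fun u => c + u ^ 2) (by fun_prop) hcont
        (fun u hu => hreg _ (hsu u hu.1).1) (fun u hu => (hsu u hu.1).2.2 hu.2)
        (fun u hu => (Y_root ((hsu u hu.1).2.2 hu.2).A_ne_zero ((hsu u hu.1).2.2 hu.2).C_ne_zero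
          (hsu u hu.1).2.1).1) hu hu₀
      have h2 := (Y_root ((hsu u hu.1).2.2 hu.2).A_ne_zero ((hsu u hu.1).2.2 hu.2).C_ne_zero
          (hsu u hu.1).2.1).2
      rw [← h1, ← h2, ← hsec _ (hsu u hu.1).1, h2, div_mul_cancel₀ _ (hσ0 _ (hsu u hu.1).1 _)]
    have hz : ∀ᶠ z in 𝓝[≠] c, ∃ w : ℂ, w ^ 2 = d.D z ∧ w ≠ 0 ∧
        d.trace F z = k * Complex.exp (H z) * (Complex.exp (w * K z) + Complex.exp (-(w * K z))) ∧
        d.traceY F z = k * Complex.exp (H z) *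
          (Complex.exp (w * K z) - Complex.exp (-(w * K z))) / w := by
      have hne : ∀ᶠ z in 𝓝[≠] c, z ≠ c := eventually_mem_nhdsWithin
      filter_upwards [nhdsWithin_le_nhds (ball_mem_nhds c (pow_pos hδ 2)), hne] with z hzb hzc
      obtain ⟨u, hu⟩ := IsAlgClosed.exists_pow_nat_eq (z - c) two_pos
      have hu0 : u ≠ 0 := by
        rintro rfl
        apply hzc
        linear_combination -hu
      have hub : u ∈ ball (0 : ℂ) δ := by
        rw [mem_ball_zero_iff]
        rw [mem_ball_iff_norm, ← hu, norm_pow] at hzb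
        exact lt_of_pow_lt_pow_left₀ 2 hδ.le hzb
      obtain rfl : z = c + u ^ 2 := by linear_combination -hu
      obtain ⟨h1, h2, h3⟩ := hsu u hub
      have hub' : -u ∈ ball (0 : ℂ) δ \ {0} := ⟨by simpa using hub, by simpa using hu0⟩
      have k1 := hk u ⟨hub, hu0⟩
      have k2 := hk (-u) hub'
      rw [neg_sq, hodd] at k2
      have hw0 : s u ≠ 0 := by
        intro h0
        apply (h3 hu0).1
        rw [← h2, h0]; simp
      refine ⟨s u, h2, hw0, ?_, ?_⟩
      · rw [trace_eq F h2, k1, k2, Complex.exp_add, Complex.exp_add, neg_mul]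
        ring
      · rw [traceY_eq F h2, k1, k2, Complex.exp_add, Complex.exp_add, neg_mul]
        ring
    have hsmall : ∀ᶠ z in 𝓝 c, ‖d.D z‖ * ‖K z‖ ^ 2 < 1 / 16 := by
      have : ContinuousAt (fun z => ‖d.D z‖ * ‖K z‖ ^ 2) c :=
        (d.continuous_D.continuousAt.norm).mul (hKc.norm.pow 2)
      refine this.eventually_lt continuousAt_const ?_
      simp [hDc]
    have hHb : ∀ᶠ z in 𝓝 c, ‖k * Complex.exp (H z)‖ < ‖k * Complex.exp (H c)‖ + 1 := by
      refine ContinuousAt.eventually_lt ?_ continuousAt_const (lt_add_one _)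
      exact (continuousAt_const.mul hHc.cexp).norm
    have hKb : ∀ᶠ z in 𝓝 c, ‖K z‖ < ‖K c‖ + 1 :=
      hKc.norm.eventually_lt continuousAt_const (lt_add_one _)
    set B₁ := ‖k * Complex.exp (H c)‖ + 1
    set B₂ := ‖K c‖ + 1
    have hB₁ : 0 < B₁ := by positivity
    have hB₂ : 0 < B₂ := by positivity
    refine ⟨B₁ * 8 + B₁ * (8 * B₂), ?_⟩
    filter_upwards [hz, nhdsWithin_le_nhds hsmall, nhdsWithin_le_nhds hHb, nhdsWithin_le_nhds hKb]
      with z ⟨w, hw, hw0, ht, htY⟩ h1 h2 h3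
    set v := w * K z with hv
    have hv1 : ‖v‖ ≤ 1 / 4 := by
      rw [← hw, norm_pow, ← mul_pow, ← norm_mul, ← hv] at h1
      nlinarith [norm_nonneg v]
    have he1 : ‖Complex.exp v - 1‖ ≤ 2 * ‖v‖ := Complex.norm_exp_sub_one_le (by linarith)
    have he2 : ‖Complex.exp (-v) - 1‖ ≤ 2 * ‖v‖ := by
      have := Complex.norm_exp_sub_one_le (x := -v) (by rw [norm_neg]; linarith)
      rwa [norm_neg] at this
    have hadd : ‖Complex.exp v + Complex.exp (-v)‖ ≤ 8 := by
      have : Complex.exp v + Complex.exp (-v) = (Complex.exp v - 1) + (Complex.exp (-v) - 1) + 2 := by ring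
      rw [this]
      have h4 := norm_add₃_le (a := Complex.exp v - 1) (b := Complex.exp (-v) - 1) (c := 2)
      simp only [Complex.norm_ofNat] at h4
      linarith
    have hsub : ‖Complex.exp v - Complex.exp (-v)‖ ≤ 8 * ‖v‖ := by
      have : Complex.exp v - Complex.exp (-v) = (Complex.exp v - 1) - (Complex.exp (-v) - 1) := by ring
      rw [this]
      refine (norm_sub_le _ _).trans ?_
      linarith [norm_nonneg v]
    constructor
    · rw [ht, norm_mul]
      have := mul_le_mul h2.le hadd (norm_nonneg _) hB₁.le
      have : 0 ≤ B₁ * (8 * B₂) := by positivity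
      linarith
    · rw [htY, norm_div, norm_mul, div_le_iff₀ (norm_pos_iff.2 hw0)]
      have h5 := mul_le_mul h2.le hsub (norm_nonneg _) hB₁.le
      have hvn : ‖v‖ = ‖w‖ * ‖K z‖ := by rw [hv, norm_mul]
      rw [hvn] at h5
      have h6 : B₁ * (8 * (‖w‖ * ‖K z‖)) ≤ B₁ * (8 * B₂) * ‖w‖ := by
        have := mul_le_mul_of_nonneg_left h3.le (by positivity : 0 ≤ B₁ * 8 * ‖w‖)
        linarith
      have h7 : 0 ≤ B₁ * 8 * ‖w‖ := by positivity
      rw [add_mul]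
      linarith
  -- Away from branch points the sheets are separate, each with its own constant, and √D does not
  -- vanish.
  · obtain ⟨δ, hδ, hsub, hgen⟩ := hd.exists_generic_ball c (inter_mem (ball_mem_nhds c hch.pos)
      (d.continuous_D.continuousAt.eventually_ne hDc))
    obtain ⟨s, -, hs, hs0, hs'⟩ := exists_sqrt_ball hδ
      (fun z _ => (d.hasDerivAt_D z).differentiableAt.differentiableWithinAt)
      (fun z hz => (hsub hz).2) (d.sqrtD c) (d.sqrtD_sq c)
    have hcδ := mem_ball_self (x := c) hδ
    have hsc : ContinuousOn s (ball c δ) := fun z hz => (hs' z hz).continuousAt.continuousWithinAt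
    have key : ∀ t : ℂ → ℂ, ContinuousOn t (ball c δ) → (∀ z ∈ ball c δ, t z ^ 2 = d.D z) →
        ∃ k, ∀ z ∈ ball c δ \ {c}, F z (d.root z (t z)) = k * Complex.exp (H z + t z * K z) := by
      intro t ht ht2
      set u₀ : ℂ := c + ((δ / 2 : ℝ) : ℂ)
      have hu₀ : u₀ ∈ ball c δ \ {c} := by
        refine ⟨?_, ?_⟩
        · simp [u₀, abs_of_pos hδ]; linarith
        · simp [u₀, hδ.ne']
      refine ⟨F u₀ (d.root u₀ (t u₀)) / d.chartSection e c H K u₀ (d.root u₀ (t u₀)), fun z hz => ?_⟩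
      have hA : ∀ z ∈ ball c δ \ {c}, d.A z ≠ 0 := fun z hz => (hgen z hz.1 hz.2).A_ne_zero
      have hY : ∀ z ∈ ball c δ \ {c}, d.OnCurve z (d.root z (t z)) ∧ d.Y z (d.root z (t z)) = t z :=
        fun z hz => Y_root (hA z hz) (hgen z hz.1 hz.2).C_ne_zero (ht2 z hz.1)
      have h1 := (hF.mono (subset_univ _)).ratio_const hch.flatOn
        (isPreconnected_punctured_ball c δ) continuousOn_id
        (continuousOn_root (ht.mono sdiff_subset) hA)
        (fun z hz => hreg _ (hsub hz.1).1) (fun z hz => hgen z hz.1 hz.2)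
        (fun z hz => (hY z hz).1) hz hu₀
      simp only [id] at h1
      rw [← h1]
      nth_rewrite 4 [← (hY z hz).2]
      rw [← hsec _ (hsub hz.1).1, div_mul_cancel₀ _ (hσ0 _ (hsub hz.1).1 _)]
    obtain ⟨k₁, hk₁⟩ := key s hsc hs
    obtain ⟨k₂, hk₂⟩ := key (fun z => -s z) hsc.neg fun z hz => by rw [neg_sq]; exact hs z hz
    have hsc' := (hs' c hcδ).continuousAt
    have c1 : ContinuousAt (fun z => k₁ * Complex.exp (H z + s z * K z)) c :=
      continuousAt_const.mul (hHc.add (hsc'.mul hKc)).cexp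
    have c2 : ContinuousAt (fun z => k₂ * Complex.exp (H z + -s z * K z)) c :=
      continuousAt_const.mul (hHc.add (hsc'.neg.mul hKc)).cexp
    obtain ⟨B₁, b1⟩ : ∃ B, ∀ᶠ z in 𝓝 c, ‖k₁ * Complex.exp (H z + s z * K z) +
        k₂ * Complex.exp (H z + -s z * K z)‖ < B :=
      ⟨_, (c1.add c2).norm.eventually_lt continuousAt_const (lt_add_one _)⟩
    obtain ⟨B₂, b2⟩ : ∃ B, ∀ᶠ z in 𝓝 c, ‖(k₁ * Complex.exp (H z + s z * K z) -
        k₂ * Complex.exp (H z + -s z * K z)) / s z‖ < B :=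
      ⟨_, ((c1.sub c2).div hsc' (hs0 c hcδ)).norm.eventually_lt continuousAt_const (lt_add_one _)⟩
    refine ⟨max B₁ B₂, ?_⟩
    have hne : ∀ᶠ z in 𝓝[≠] c, z ≠ c := eventually_mem_nhdsWithin
    filter_upwards [nhdsWithin_le_nhds b1, nhdsWithin_le_nhds b2, hne,
      nhdsWithin_le_nhds (ball_mem_nhds c hδ)] with z h1 h2 h3 h4
    constructor
    · refine le_trans ?_ (le_max_left _ _)
      rw [trace_eq F (hs z h4), hk₁ z ⟨h4, h3⟩, hk₂ z ⟨h4, h3⟩]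
      exact h1.le
    · refine le_trans ?_ (le_max_right _ _)
      rw [traceY_eq F (hs z h4), hk₁ z ⟨h4, h3⟩, hk₂ z ⟨h4, h3⟩]
      exact h2.le

end CurveData

/-! ### Traces in the strip and the difference equations -/

theorem mem_toddRegular_of_abs_im_lt {r : ℂ} (h : |r.im| < 2 * Real.pi) : r ∈ toddRegular := by
  rw [mem_toddRegular]
  by_cases hr : Complex.exp r = 1
  · left
    obtain ⟨n, hn⟩ := Complex.exp_eq_one_iff.1 hr
    have him : r.im = n * (2 * Real.pi) := by rw [hn]; simp
    have hn0 : n = 0 := by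
      by_contra h0
      have h1 : (1 : ℝ) ≤ |(n : ℝ)| := by exact_mod_cast Int.one_le_abs h0
      rw [him, abs_mul, abs_of_pos (by positivity : 0 < 2 * Real.pi)] at h
      nlinarith [Real.pi_pos]
    rw [hn, hn0]; simp
  · exact Or.inr hr

namespace CurveData

variable {d : CurveData} {κ : ℂ} {F : ℂ → ℂ → ℂ}

theorem FlatOn.differentiableAt_regularize {e : ℕ} (hF : d.FlatOn e κ univ F) (hd : d.Admissible)
    {r : ℂ} (hr : r ∈ toddRegular) :
    DifferentiableAt ℂ (regularize (d.trace F)) r ∧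
      DifferentiableAt ℂ (regularize (d.traceY F)) r := by
  obtain ⟨B, hB⟩ := hF.exists_bound hd hr
  have hg := hd.eventually_generic r
  exact ⟨QuantumCurve.differentiableAt_regularize (hg.mono fun z hz => (hF.hasDerivAt_trace hz).1)
      ⟨B, hB.mono fun z hz => hz.1⟩,
    QuantumCurve.differentiableAt_regularize (hg.mono fun z hz => (hF.hasDerivAt_trace hz).2)
      ⟨B, hB.mono fun z hz => hz.2⟩⟩

theorem FlatOn.regularize_trace {e : ℕ} (hF : d.FlatOn e κ univ F) {r : ℂ} (hr : d.Generic r) :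
    regularize (d.trace F) r = d.trace F r ∧ regularize (d.traceY F) r = d.traceY F r :=
  ⟨regularize_eq (hF.hasDerivAt_trace hr).1.continuousAt,
    regularize_eq (hF.hasDerivAt_trace hr).2.continuousAt⟩

theorem root_sub (d : CurveData) (r s : ℂ) : d.root (r - 2 * πi) s = d.root r s := by
  rw [sub_two_pi_I, root, root, A_add_int, b_add_int]

theorem generic_sub {r : ℂ} : d.Generic (r - 2 * πi) ↔ d.Generic r := by
  rw [sub_two_pi_I, generic_add_int]

theorem D_sub (d : CurveData) (r : ℂ) : d.D (r - 2 * πi) = d.D r := by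
  rw [sub_two_pi_I, D_add_int]

theorem eq_of_eventually_generic (hd : d.Admissible) {f g : ℂ → ℂ} {r : ℂ} (hf : ContinuousAt f r)
    (hg : ContinuousAt g r) (h : ∀ z, d.Generic z → f z = g z) : f r = g r :=
  tendsto_nhds_unique_of_eventuallyEq (hf.mono_left nhdsWithin_le_nhds)
    (hg.mono_left nhdsWithin_le_nhds) ((hd.eventually_generic r).mono h)

/-- The turn multiplies F by -x₂, and -A x₂ = (b - Y)/2. Dividing by Y and summing over the two
points gives the formula. The companion formula uses -C/x₂ = (b + Y)/2, and the sum of both is the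
eigenvalue equation. -/
theorem FlatOn.traceY_sub (hF : d.FlatOn 1 κ univ F) {r : ℂ} (hr : d.Generic r) :
    d.A r * d.traceY F (r - 2 * πi) = (d.b r * d.traceY F r - d.trace F r) / 2 := by
  have hs := d.sqrtD_sq r
  have hs' : d.sqrtD r ^ 2 = d.D (r - 2 * πi) := by rw [D_sub, hs]
  obtain ⟨h1, h2⟩ := Y_root hr.A_ne_zero hr.C_ne_zero hs
  obtain ⟨h3, h4⟩ := Y_root (s := -d.sqrtD r) hr.A_ne_zero hr.C_ne_zero (by rw [neg_sq, hs])
  have k1 := h1.A_mul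
  have k2 := h3.A_mul
  rw [h2] at k1
  rw [h4] at k2
  have hs0 : d.sqrtD r ≠ 0 := by
    intro h0; apply hr.1; rw [← hs, h0]; simp
  rw [traceY_eq F hs', root_sub, root_sub, hF.shift r (mem_univ _) hr _ h1,
    hF.shift r (mem_univ _) hr _ h3, traceY_eq F hs, trace_eq F hs]
  set x₁ := d.root r (d.sqrtD r)
  set x₂ := d.root r (-d.sqrtD r)
  field_simp
  linear_combination (-2 * F r x₁) * k1 + (2 * F r x₂) * k2

theorem FlatOn.traceY_add (hF : d.FlatOn 1 κ univ F) {r : ℂ} (hr : d.Generic r) :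
    d.C r * d.traceY F (r + 2 * πi) = (d.b r * d.traceY F r + d.trace F r) / 2 := by
  have hs := d.sqrtD_sq r
  have hadd : r + 2 * πi - 2 * πi = r := by ring
  have hr' : d.Generic (r + 2 * πi) := by rw [← generic_sub, hadd]; exact hr
  have hs' : d.sqrtD r ^ 2 = d.D (r + 2 * πi) := by
    rw [← d.D_sub (r + 2 * πi), hadd, hs]
  obtain ⟨h1, h2⟩ := Y_root hr.A_ne_zero hr.C_ne_zero hs
  obtain ⟨h3, h4⟩ := Y_root (s := -d.sqrtD r) hr.A_ne_zero hr.C_ne_zero (by rw [neg_sq, hs])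
  have k1 := h1.C_div
  have k2 := h3.C_div
  rw [h2] at k1
  rw [h4] at k2
  have hs0 : d.sqrtD r ≠ 0 := by
    intro h0; apply hr.1; rw [← hs, h0]; simp
  have hroot : ∀ s, d.root (r + 2 * πi) s = d.root r s := fun s => by
    rw [← d.root_sub (r + 2 * πi), hadd]
  have hsh : ∀ x, d.OnCurve r x → F (r + 2 * πi) x = -F r x / x := by
    intro x hx
    have hx' : d.OnCurve (r + 2 * πi) x := by rw [← onCurve_sub, hadd]; exact hx
    have := hF.shift _ (mem_univ _) hr' x hx'
    rw [hadd] at this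
    rw [this]
    have := hx.1
    field_simp
  rw [traceY_eq F hs', hroot, hroot, hsh _ h1, hsh _ h3, traceY_eq F hs, trace_eq F hs]
  have n1 := h1.1
  have n2 := h3.1
  set x₁ := d.root r (d.sqrtD r)
  set x₂ := d.root r (-d.sqrtD r)
  rw [div_eq_iff n1] at k1
  rw [div_eq_iff n2] at k2
  field_simp
  linear_combination (-2 * F r x₁ * x₂) * k1 + (2 * F r x₂ * x₁) * k2

/-- The two traces determine the values of F at both points, and these do not vanish. -/
theorem FlatOn.not_trace_eq_zero {e : ℕ} (hF : d.FlatOn e κ univ F) {r : ℂ} (hr : d.Generic r) :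
    ¬ (d.trace F r = 0 ∧ d.traceY F r = 0) := by
  rintro ⟨h1, h2⟩
  have hs0 : d.sqrtD r ≠ 0 := by
    intro h0; apply hr.1; rw [← d.sqrtD_sq, h0]; simp
  rw [trace] at h1
  rw [traceY, div_eq_zero_iff] at h2
  have h3 := h2.resolve_right hs0
  exact hF.ne_zero r (mem_univ _) hr _ (Y_root hr.A_ne_zero hr.C_ne_zero (d.sqrtD_sq r)).1
    (by linear_combination (h1 + h3) / 2)

/-- The open strip where the traces are analytic. -/
def strip : Set ℂ := {r | |r.im| < 2 * Real.pi}

theorem isOpen_strip : IsOpen strip := isOpen_lt (by fun_prop) continuous_const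

theorem convex_strip : Convex ℝ strip := by
  have : strip = Complex.imCLM ⁻¹' (Ioo (-(2 * Real.pi)) (2 * Real.pi)) := by
    ext r
    simp [strip, abs_lt]
  rw [this]
  exact (convex_Ioo _ _).linear_preimage Complex.imCLM.toLinearMap

/-- For 0 < Im r < 2π both r and r - 2πi lie in the strip of holomorphy, so the relation extends by
continuity from generic points. -/
theorem FlatOn.A_mul_regularize (hF : d.FlatOn 1 κ univ F) (hd : d.Admissible) {r : ℂ}
    (h0 : 0 < r.im) (h1 : r.im < 2 * Real.pi) :
    d.A r * regularize (d.traceY F) (r - 2 * πi) =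
      (d.b r * regularize (d.traceY F) r - regularize (d.trace F) r) / 2 := by
  have m1 : r ∈ toddRegular := mem_toddRegular_of_abs_im_lt (by rwa [abs_of_pos h0])
  have m2 : r - 2 * πi ∈ toddRegular := mem_toddRegular_of_abs_im_lt (by
    simp only [Complex.sub_im, Complex.mul_im, Complex.re_ofNat, Complex.im_ofNat, Complex.mul_re,
      Complex.ofReal_re, Complex.ofReal_im, Complex.I_re, Complex.I_im]
    rw [abs_lt]; constructor <;> linarith)
  have c1 := (hF.differentiableAt_regularize hd m1).1.continuousAt
  have c2 := (hF.differentiableAt_regularize hd m1).2.continuousAt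
  have c3 : ContinuousAt (fun r => regularize (d.traceY F) (r - 2 * πi)) r :=
    (hF.differentiableAt_regularize hd m2).2.continuousAt.comp (f := fun r => r - 2 * πi) (by fun_prop)
  refine eq_of_eventually_generic hd (f := fun r => d.A r * regularize (d.traceY F) (r - 2 * πi))
    (g := fun r => (d.b r * regularize (d.traceY F) r - regularize (d.trace F) r) / 2)
    (d.continuous_A.continuousAt.mul c3) (((d.continuous_b.continuousAt.mul c2).sub c1).div_const 2)
    fun z hz => ?_
  simp only [(hF.regularize_trace hz).1, (hF.regularize_trace hz).2,
    (hF.regularize_trace (generic_sub.2 hz)).2, hF.traceY_sub hz]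

theorem FlatOn.C_mul_regularize (hF : d.FlatOn 1 κ univ F) (hd : d.Admissible) {r : ℂ}
    (h0 : r.im < 0) (h1 : -(2 * Real.pi) < r.im) :
    d.C r * regularize (d.traceY F) (r + 2 * πi) =
      (d.b r * regularize (d.traceY F) r + regularize (d.trace F) r) / 2 := by
  have m1 : r ∈ toddRegular := mem_toddRegular_of_abs_im_lt (by rw [abs_of_neg h0]; linarith)
  have m2 : r + 2 * πi ∈ toddRegular := mem_toddRegular_of_abs_im_lt (by
    simp only [Complex.add_im, Complex.mul_im, Complex.re_ofNat, Complex.im_ofNat, Complex.mul_re,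
      Complex.ofReal_re, Complex.ofReal_im, Complex.I_re, Complex.I_im]
    rw [abs_lt]; constructor <;> linarith)
  have c1 := (hF.differentiableAt_regularize hd m1).1.continuousAt
  have c2 := (hF.differentiableAt_regularize hd m1).2.continuousAt
  have c3 : ContinuousAt (fun r => regularize (d.traceY F) (r + 2 * πi)) r :=
    (hF.differentiableAt_regularize hd m2).2.continuousAt.comp (f := fun r => r + 2 * πi) (by fun_prop)
  refine eq_of_eventually_generic hd (f := fun r => d.C r * regularize (d.traceY F) (r + 2 * πi))
    (g := fun r => (d.b r * regularize (d.traceY F) r + regularize (d.trace F) r) / 2)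
    (d.continuous_C.continuousAt.mul c3) (((d.continuous_b.continuousAt.mul c2).add c1).div_const 2)
    fun z hz => ?_
  have hz' : d.Generic (z + 2 * πi) := by rw [← generic_sub, add_sub_cancel_right]; exact hz
  simp only [(hF.regularize_trace hz).1, (hF.regularize_trace hz).2,
    (hF.regularize_trace hz').2, hF.traceY_add hz]

/-- The trace does not vanish identically on the real line. -/
theorem FlatOn.exists_regularize_ne_zero (hF : d.FlatOn 1 κ univ F) (hd : d.Admissible) :
    ∃ x : ℝ, regularize (d.traceY F) x ≠ 0 := by
  by_contra! h
  have hdiff : AnalyticOnNhd ℂ (regularize (d.traceY F)) strip :=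
    DifferentiableOn.analyticOnNhd (fun r hr => (hF.differentiableAt_regularize hd
      (mem_toddRegular_of_abs_im_lt hr)).2.differentiableWithinAt) isOpen_strip
  have h0 : (0 : ℂ) ∈ strip := by simp [strip, Real.pi_pos]
  have hfreq : ∃ᶠ z in 𝓝[≠] (0 : ℂ), regularize (d.traceY F) z = 0 := by
    have h1 : Tendsto (fun x : ℝ => (x : ℂ)) (𝓝[≠] 0) (𝓝[≠] 0) := by
      refine tendsto_nhdsWithin_of_tendsto_nhds_of_eventually_within _ ?_ ?_
      · have : Tendsto (fun x : ℝ => (x : ℂ)) (𝓝 0) (𝓝 ((0 : ℝ) : ℂ)) :=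
          Complex.continuous_ofReal.tendsto 0
        exact this.mono_left nhdsWithin_le_nhds
      · filter_upwards [self_mem_nhdsWithin] with x hx
        simpa using hx
    exact h1.frequently (Filter.Eventually.of_forall fun x => h x).frequently
  -- By the identity theorem ψ vanishes on the whole strip. The shift relation then makes the other
  -- trace vanish too, which is impossible at a generic point.
  have hz := hdiff.eqOn_zero_of_preconnected_of_frequently_eq_zero convex_strip.isPreconnected h0 hfreq
  obtain ⟨r, hr, hg⟩ : ∃ r : ℂ, (0 < r.im ∧ r.im < 2 * Real.pi) ∧ d.Generic r := by
    have h1 : ∀ᶠ r : ℂ in 𝓝[≠] (πi), 0 < r.im ∧ r.im < 2 * Real.pi := by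
      refine nhdsWithin_le_nhds (IsOpen.mem_nhds ?_ ?_)
      · exact (isOpen_lt continuous_const Complex.continuous_im).inter
          (isOpen_lt Complex.continuous_im continuous_const)
      · simp [Real.pi_pos]
    exact (h1.and (hd.eventually_generic _)).exists
  have k1 : regularize (d.traceY F) r = 0 := hz (by
    simp only [strip, mem_ofPred_eq, abs_lt]; constructor <;> linarith [Real.pi_pos])
  have k2 : regularize (d.traceY F) (r - 2 * πi) = 0 := hz (by
    simp only [strip, mem_ofPred_eq, Complex.sub_im, Complex.mul_im, Complex.re_ofNat,
      Complex.im_ofNat, Complex.mul_re,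
      Complex.ofReal_re, Complex.ofReal_im, Complex.I_re, Complex.I_im, abs_lt]
    constructor <;> linarith)
  have k3 := hF.A_mul_regularize hd hr.1 hr.2
  rw [k1, k2] at k3
  refine hF.not_trace_eq_zero hg ⟨?_, ?_⟩
  · rw [← (hF.regularize_trace hg).1]; linear_combination 2 * k3
  · rw [← (hF.regularize_trace hg).2, k1]

end CurveData

/-! ### Growth and decay of the traces -/

theorem exists_bound_on_compact {T : Type*} [TopologicalSpace T] {S : Set T} (hS : IsCompact S)
    {f E : T → ℝ} (hf : ContinuousOn f S) (hE : ContinuousOn E S) (h0 : ∀ t ∈ S, 0 < E t) :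
    ∃ K, 0 ≤ K ∧ ∀ t ∈ S, f t ≤ K * E t := by
  obtain ⟨K, hK⟩ := hS.bddAbove_image (hf.div hE fun t ht => (h0 t ht).ne')
  refine ⟨max K 0, le_max_right _ _, fun t ht => ?_⟩
  rw [← div_le_iff₀ (h0 t ht)]
  exact (hK (mem_image_of_mem _ ht)).trans (le_max_left _ _)

/-- The weight `x₁ ^ i * (1 + x₁) ^ k` at `x₁ = exp x`. -/
def rowWeight (i : ℤ) (k : ℕ) (x : ℝ) : ℝ := Real.exp (i * x) * (1 + Real.exp x) ^ k

theorem rowWeight_pos (i : ℤ) (k : ℕ) (x : ℝ) : 0 < rowWeight i k x := by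
  unfold rowWeight; positivity

theorem continuous_rowWeight (i : ℤ) (k : ℕ) : Continuous (rowWeight i k) := by
  unfold rowWeight; fun_prop

theorem rowWeight_neg (i : ℤ) (k : ℕ) (x : ℝ) : rowWeight (-i - k) k x = rowWeight i k (-x) := by
  have h : 1 + Real.exp x = Real.exp x * (1 + Real.exp (-x)) := by
    rw [mul_add, ← Real.exp_add]; simp [add_comm]
  rw [rowWeight, rowWeight, h, mul_pow, ← Real.exp_nat_mul, ← mul_assoc, ← Real.exp_add]
  congr 2
  push_cast; ring

theorem rowWeight_le (i : ℤ) (k : ℕ) {x : ℝ} (hx : 0 ≤ x) :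
    rowWeight i k x ≤ 2 ^ k * Real.exp ((i + k) * x) := by
  have h1 : 1 + Real.exp x ≤ 2 * Real.exp x := by linarith [Real.one_le_exp hx]
  calc rowWeight i k x ≤ Real.exp (i * x) * (2 * Real.exp x) ^ k := by
        unfold rowWeight; gcongr
    _ = 2 ^ k * Real.exp ((i + k) * x) := by
        rw [mul_pow, ← Real.exp_nat_mul, add_mul, Real.exp_add]; ring

namespace CurveData

variable {d : CurveData} {κ : ℂ} {F : ℂ → ℂ → ℂ}

/-- The weight of the potential term. -/
def potential (d : CurveData) (x : ℝ) : ℝ := d.α.re * Real.exp x + d.β.re * Real.exp (-x) + 1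

theorem Admissible.α_eq (hd : d.Admissible) : d.α = d.α.re ∧ 0 ≤ d.α.re := by
  rcases hd.right with ⟨-, h, -⟩ | ⟨-, h⟩ | ⟨-, h⟩ <;> rw [h] <;> simp

theorem Admissible.β_eq (hd : d.Admissible) : d.β = d.β.re ∧ 0 ≤ d.β.re := by
  rcases hd.left with ⟨-, h, -⟩ | ⟨-, h⟩ | ⟨-, h⟩ <;> rw [h] <;> simp

/-- The summand 1 in the potential is not part of φ̂; it lets the weighted norm dominate the plain
L²-norm. -/
theorem Admissible.one_le_potential (hd : d.Admissible) (x : ℝ) : 1 ≤ d.potential x := by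
  have := mul_nonneg hd.α_eq.2 (Real.exp_nonneg x)
  have := mul_nonneg hd.β_eq.2 (Real.exp_nonneg (-x))
  unfold potential; linarith

theorem continuous_potential (d : CurveData) : Continuous d.potential := by
  unfold potential; fun_prop

theorem potential_flip (d : CurveData) (x : ℝ) : d.flip.potential x = d.potential (-x) := by
  simp [potential, flip]; ring

/-- The inequalities between μ, ρ and the degrees i + k and j + l of the rows say that on the lines
Im r = -π and Im r = π the squared trace beats the weight by exp(-x/2). On the real line the
potential is beaten because ρ ≥ 3/4 when α ≠ 0 and ρ ≥ 1/2 in any case. -/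
theorem FlatOn.exists_right (hF : d.FlatOn 1 κ univ F) (hd : d.Admissible) :
    ∃ K M x₀ : ℝ, 0 ≤ K ∧ 0 ≤ M ∧ 0 ≤ x₀ ∧ (∀ r : ℂ, x₀ < r.re → d.Generic r) ∧
      (∀ r : ℂ, x₀ < r.re → |r.im| ≤ Real.pi → ‖d.trace F r‖ ≤ K * Real.exp (M * r.re) ∧
        ‖d.traceY F r‖ ≤ K * Real.exp (M * r.re)) ∧
      ∀ x : ℝ, x₀ < x →
        rowWeight d.i d.k x * ‖d.traceY F (x - πi)‖ ^ 2 ≤ K * Real.exp (-x / 2) ∧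
        rowWeight d.j d.l x * ‖d.traceY F (x + πi)‖ ^ 2 ≤ K * Real.exp (-x / 2) ∧
        d.potential x * ‖d.traceY F x‖ ^ 2 ≤ K * Real.exp (-x / 2) := by
  obtain ⟨K, x₁, ρ, μ, hK, hx₁, hρ, hρα, hμ, hμ', hb⟩ := exists_bounds_right hd 1 κ hF
  obtain ⟨x₂, -, hgen, -⟩ := exists_flatOn_right hd 1 κ
  set M := |μ true| + |μ false| with hM
  have hμM : ∀ t, |μ t| ≤ M := by
    rintro (_ | _) <;> simp only [hM] <;> linarith [abs_nonneg (μ true), abs_nonneg (μ false)]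
  have hpi := Real.pi_pos
  have hx0 : ∀ x, max x₁ x₂ < x → x₁ < x ∧ x₂ < x ∧ 0 < x := fun x hx =>
    ⟨(le_max_left _ _).trans_lt hx, (le_max_right _ _).trans_lt hx,
      hx₁.trans_lt ((le_max_left _ _).trans_lt hx)⟩
  have hexp : ∀ r : ℂ, 0 < r.re → |r.im| ≤ Real.pi → ∀ t,
      -((1 : ℕ) * μ t * r.re * r.im / (2 * Real.pi)) ≤ M * r.re := by
    intro r hr him t
    have h1 : |μ t * r.im| ≤ M * Real.pi := by
      rw [abs_mul]; exact mul_le_mul (hμM t) him (abs_nonneg _) ((abs_nonneg _).trans (hμM t))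
    have h2 : -(μ t * r.im) ≤ M * Real.pi := (neg_le_abs _).trans h1
    have h3 : -((1 : ℕ) * μ t * r.re * r.im / (2 * Real.pi)) =
        -(μ t * r.im) * (r.re / (2 * Real.pi)) := by push_cast; ring
    rw [h3]
    have h4 := mul_le_mul_of_nonneg_right h2 (by positivity : 0 ≤ r.re / (2 * Real.pi))
    have h5 : M * Real.pi * (r.re / (2 * Real.pi)) = M * r.re / 2 := by field_simp
    have h6 : 0 ≤ M * r.re := mul_nonneg ((abs_nonneg _).trans (hμM t)) hr.le
    linarith
  have hline : ∀ (x y q : ℝ), max x₁ x₂ < x → |y| ≤ Real.pi →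
      (∀ t, -(μ t * y / (2 * Real.pi)) - ρ ≤ -q) →
      ‖d.traceY F (x + y * Complex.I)‖ ≤ 2 * K * Real.exp (-q * x) := by
    intro x y q hx hy hq
    have h1 := (hb (x + y * Complex.I) (by simpa using (hx0 x hx).1) (by simpa using hy)).2
    refine h1.trans ?_
    simp only [Fintype.sum_bool]
    have h2 : ∀ t, -((1 : ℕ) * μ t * (x + y * Complex.I : ℂ).re * (x + y * Complex.I : ℂ).im /
        (2 * Real.pi)) - ρ * (x + y * Complex.I : ℂ).re ≤ -q * x := by
      intro t
      have h3 := mul_le_mul_of_nonneg_right (hq t) (hx0 x hx).2.2.le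
      simp
      have h4 : μ t * x * y / (2 * Real.pi) = μ t * y / (2 * Real.pi) * x := by ring
      rw [h4]; linarith
    have h5 := Real.exp_le_exp.2 (h2 true)
    have h6 := Real.exp_le_exp.2 (h2 false)
    calc _ ≤ K * (Real.exp (-q * x) + Real.exp (-q * x)) := by gcongr
      _ = _ := by ring
  have hsq : ∀ (W q x c : ℝ) (z : ℂ), 0 ≤ c → 0 ≤ W → W ≤ c * Real.exp ((2 * q - 1 / 2) * x) →
      ‖d.traceY F z‖ ≤ 2 * K * Real.exp (-q * x) →
      W * ‖d.traceY F z‖ ^ 2 ≤ c * (2 * K) ^ 2 * Real.exp (-x / 2) := by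
    intro W q x c z hc hW0 hW hz
    calc W * ‖d.traceY F z‖ ^ 2 ≤ (c * Real.exp ((2 * q - 1 / 2) * x)) *
          (2 * K * Real.exp (-q * x)) ^ 2 := by gcongr
      _ = c * (2 * K) ^ 2 * (Real.exp ((2 * q - 1 / 2) * x) * Real.exp (-q * x) ^ 2) := by ring
      _ = _ := by rw [← Real.exp_nat_mul, ← Real.exp_add]; congr 2; push_cast; ring
  set c₀ := d.α.re + d.β.re + 1 with hc₀
  have hα := hd.α_eq.2
  have hβ := hd.β_eq.2
  set K' := 2 * K + 2 ^ d.k * (2 * K) ^ 2 + 2 ^ d.l * (2 * K) ^ 2 + c₀ * (2 * K) ^ 2 with hK'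
  have n1 : 0 ≤ 2 ^ d.k * (2 * K) ^ 2 := by positivity
  have n2 : 0 ≤ 2 ^ d.l * (2 * K) ^ 2 := by positivity
  have n3 : 0 ≤ c₀ * (2 * K) ^ 2 := by positivity
  have hM0 : 0 ≤ M := by positivity
  refine ⟨K', M, max x₁ x₂, by positivity, hM0, hx₁.trans (le_max_left _ _),
    fun r hr => hgen r (hx0 _ hr).2.1, fun r hr him => ?_, fun x hx => ⟨?_, ?_, ?_⟩⟩
  · obtain ⟨h1, h2⟩ := hb r (hx0 _ hr).1 him
    have h3 := fun t => Real.exp_le_exp.2 (hexp r (hx0 _ hr).2.2 him t)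
    simp only [Fintype.sum_bool] at h1 h2
    have h4 : 2 * K ≤ K' := by linarith
    have h5 : K * (Real.exp (M * r.re) + Real.exp (M * r.re)) ≤ K' * Real.exp (M * r.re) := by
      have := mul_le_mul_of_nonneg_right h4 (Real.exp_nonneg (M * r.re))
      linarith
    constructor
    · refine h1.trans (le_trans ?_ h5)
      gcongr
      · exact Real.exp_le_exp.1 (h3 true)
      · exact Real.exp_le_exp.1 (h3 false)
    · refine h2.trans (le_trans ?_ h5)
      have h6 : 0 ≤ ρ * r.re := mul_nonneg (by linarith) (hx0 _ hr).2.2.le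
      gcongr
      · linarith [hexp r (hx0 _ hr).2.2 him true]
      · linarith [hexp r (hx0 _ hr).2.2 him false]
  · have h1 := hline x (-Real.pi) ((d.i + d.k + 1 / 2) / 2) hx (by rw [abs_neg, abs_of_pos hpi])
      fun t => by
        have : -(μ t * -Real.pi / (2 * Real.pi)) = μ t / 2 := by field_simp
        rw [this]; exact hμ t
    rw [show (x : ℂ) + ((-Real.pi : ℝ) : ℂ) * Complex.I = x - πi by push_cast; ring] at h1
    refine (hsq _ _ x (2 ^ d.k) _ (by positivity) (rowWeight_pos d.i d.k x).le
      ((rowWeight_le d.i d.k (hx0 x hx).2.2.le).trans_eq ?_) h1).trans ?_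
    · congr 2; ring
    · have : 2 ^ d.k * (2 * K) ^ 2 ≤ K' := by linarith
      gcongr
  · have h1 := hline x Real.pi ((d.j + d.l + 1 / 2) / 2) hx (by rw [abs_of_pos hpi])
      fun t => by
        have : -(μ t * Real.pi / (2 * Real.pi)) = -μ t / 2 := by field_simp
        rw [this]; exact hμ' t
    refine (hsq _ _ x (2 ^ d.l) _ (by positivity) (rowWeight_pos d.j d.l x).le
      ((rowWeight_le d.j d.l (hx0 x hx).2.2.le).trans_eq ?_) h1).trans ?_
    · congr 2; ring
    · have : 2 ^ d.l * (2 * K) ^ 2 ≤ K' := by linarith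
      gcongr
  · have hx' := (hx0 x hx).2.2
    have hp : 0 ≤ d.potential x := zero_le_one.trans (hd.one_le_potential x)
    have he1 : Real.exp (-x) ≤ 1 := Real.exp_le_one_iff.2 (by linarith)
    have key : ∀ q : ℝ, (d.α ≠ 0 → 3 / 4 ≤ q) → 1 / 2 ≤ q → q ≤ ρ →
        d.potential x * ‖d.traceY F x‖ ^ 2 ≤ c₀ * (2 * K) ^ 2 * Real.exp (-x / 2) := by
      intro q hqα hq1 hq
      have h1 := hline x 0 q hx (by simpa using hpi.le) fun t => by simpa using hq
      simp only [Complex.ofReal_zero, zero_mul, add_zero] at h1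
      refine hsq _ q x c₀ _ (by positivity) hp ?_ h1
      have e1 : 1 ≤ Real.exp ((2 * q - 1 / 2) * x) := Real.one_le_exp (by nlinarith)
      have e2 : d.α.re * Real.exp x ≤ d.α.re * Real.exp ((2 * q - 1 / 2) * x) := by
        by_cases h0 : d.α = 0
        · simp [h0]
        · have := hqα h0
          gcongr
          nlinarith
      have e3 : d.β.re * Real.exp (-x) ≤ d.β.re * Real.exp ((2 * q - 1 / 2) * x) := by
        gcongr
        nlinarith
      unfold potential
      rw [hc₀]
      linarith
    refine (key ρ hρα hρ le_rfl).trans ?_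
    have : c₀ * (2 * K) ^ 2 ≤ K' := by linarith
    gcongr

theorem FlatOn.flip_univ {e : ℕ} (hF : d.FlatOn e κ univ F) :
    d.flip.FlatOn e κ univ (flipSection F) :=
  (hF.flip fun _ _ => mem_univ _).mono fun _ _ => mem_univ _

/-- Growth of the traces in the strip and their decay on three lines. -/
theorem FlatOn.exists_bounds (hF : d.FlatOn 1 κ univ F) (hd : d.Admissible) :
    ∃ K M : ℝ, 0 ≤ K ∧ 0 ≤ M ∧
      (∀ r : ℂ, |r.im| ≤ Real.pi →
        ‖regularize (d.trace F) r‖ ≤ K * Real.exp (M * |r.re|) ∧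
        ‖regularize (d.traceY F) r‖ ≤ K * Real.exp (M * |r.re|)) ∧
      ∀ x : ℝ,
        rowWeight d.i d.k x * ‖regularize (d.traceY F) (x - πi)‖ ^ 2 ≤ K * Real.exp (-|x| / 2) ∧
        rowWeight d.j d.l x * ‖regularize (d.traceY F) (x + πi)‖ ^ 2 ≤ K * Real.exp (-|x| / 2) ∧
        d.potential x * ‖regularize (d.traceY F) x‖ ^ 2 ≤ K * Real.exp (-|x| / 2) := by
  obtain ⟨K₁, M₁, x₁, hK₁, hM₁, hx₁, hg₁, hs₁, hl₁⟩ := hF.exists_right hd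
  obtain ⟨K₂, M₂, x₂, hK₂, hM₂, hx₂, hg₂, hs₂, hl₂⟩ := hF.flip_univ.exists_right hd.flip
  have hpi := Real.pi_pos
  set x₀ := max x₁ x₂
  have hcont : ∀ r : ℂ, |r.im| ≤ Real.pi → ContinuousAt (regularize (d.trace F)) r ∧
      ContinuousAt (regularize (d.traceY F)) r := fun r hr =>
    have := hF.differentiableAt_regularize hd
      (mem_toddRegular_of_abs_im_lt (r := r) (by linarith))
    ⟨this.1.continuousAt, this.2.continuousAt⟩
  have hflip : ∀ r : ℂ, r.re < -x₂ → d.Generic r ∧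
      d.flip.trace (flipSection F) (-r) = regularize (d.trace F) r ∧
      ‖d.flip.traceY (flipSection F) (-r)‖ = ‖regularize (d.traceY F) r‖ := by
    intro r hr
    have h1 : d.Generic (-(-r)) := flip_generic.1 (hg₂ (-r) (by simp; linarith))
    obtain ⟨h2, h3⟩ := trace_flip F h1
    rw [neg_neg] at h1 h2 h3
    rw [(hF.regularize_trace h1).1, (hF.regularize_trace h1).2, h2, h3, norm_neg]
    exact ⟨h1, rfl, rfl⟩
  have hright : ∀ r : ℂ, x₁ < r.re → regularize (d.trace F) r = d.trace F r ∧
      regularize (d.traceY F) r = d.traceY F r := fun r hr => hF.regularize_trace (hg₁ r hr)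
  -- the compact part of the strip
  have hcpt : IsCompact (Icc (-x₀) x₀ ×ℂ Icc (-Real.pi) Real.pi) :=
    isCompact_Icc.reProdIm isCompact_Icc
  obtain ⟨K₃, hK₃, hb₃⟩ := exists_bound_on_compact hcpt
    (f := fun r => ‖regularize (d.trace F) r‖ + ‖regularize (d.traceY F) r‖) (E := fun _ => 1)
    (fun r hr => ((hcont r (abs_le.2 hr.2)).1.norm.add
      (hcont r (abs_le.2 hr.2)).2.norm).continuousWithinAt) continuousOn_const
    fun _ _ => one_pos
  have hline : ∀ (w : ℝ → ℝ) (y : ℝ), |y| ≤ Real.pi → Continuous w → ∃ K, 0 ≤ K ∧ ∀ x ∈ Icc (-x₀) x₀,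
      w x * ‖regularize (d.traceY F) (x + y * Complex.I)‖ ^ 2 ≤ K * Real.exp (-|x| / 2) := by
    intro w y hy hw
    refine exists_bound_on_compact isCompact_Icc (fun x hx => ContinuousAt.continuousWithinAt ?_)
      (by fun_prop) fun _ _ => Real.exp_pos _
    refine hw.continuousAt.mul (ContinuousAt.pow (ContinuousAt.norm ?_) 2)
    exact (hcont (x + y * Complex.I) (by simpa using hy)).2.comp (f := fun x : ℝ => (x + y * Complex.I : ℂ))
      (by fun_prop)
  obtain ⟨K₄, hK₄, hb₄⟩ := hline (rowWeight d.i d.k) (-Real.pi) (by rw [abs_neg, abs_of_pos hpi])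
    (continuous_rowWeight _ _)
  obtain ⟨K₅, hK₅, hb₅⟩ := hline (rowWeight d.j d.l) Real.pi (by rw [abs_of_pos hpi])
    (continuous_rowWeight _ _)
  obtain ⟨K₆, hK₆, hb₆⟩ := hline d.potential 0 (by simpa using hpi.le) d.continuous_potential
  have hsub : ∀ x : ℝ, (x : ℂ) + ((-Real.pi : ℝ) : ℂ) * Complex.I = x - πi :=
    fun x => by push_cast; ring
  simp only [hsub] at hb₄
  simp only [Complex.ofReal_zero, zero_mul, add_zero] at hb₆
  set K := K₁ + K₂ + K₃ + K₄ + K₅ + K₆ with hK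
  have l1 : K₁ ≤ K := by linarith
  have l2 : K₂ ≤ K := by linarith
  have l3 : K₃ ≤ K := by linarith
  have l4 : K₄ ≤ K := by linarith
  have l5 : K₅ ≤ K := by linarith
  have l6 : K₆ ≤ K := by linarith
  have cases : ∀ x : ℝ, x ∈ Icc (-x₀) x₀ ∨ (x₁ < x ∧ |x| = x) ∨ (x < -x₂ ∧ |x| = -x) := by
    intro x
    by_cases h : x ∈ Icc (-x₀) x₀
    · exact Or.inl h
    · rw [mem_Icc, not_and_or, not_le, not_le] at h
      rcases h with h | h
      · right; right
        have : x < -x₂ := by linarith [le_max_right x₁ x₂]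
        exact ⟨this, abs_of_neg (by linarith)⟩
      · right; left
        have : x₁ < x := by linarith [le_max_left x₁ x₂]
        exact ⟨this, abs_of_pos (by linarith)⟩
  refine ⟨K, max M₁ M₂, by positivity, hM₁.trans (le_max_left _ _), fun r him => ?_, fun x => ?_⟩
  · have hexp : ∀ {K' M' : ℝ}, 0 ≤ K' → K' ≤ K → M' ≤ max M₁ M₂ →
        K' * Real.exp (M' * |r.re|) ≤ K * Real.exp (max M₁ M₂ * |r.re|) := by
      intro K' M' h0 h1 h2
      gcongr
    rcases cases r.re with h | ⟨h, he⟩ | ⟨h, he⟩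
    · have h1 := hb₃ r ⟨h, abs_le.1 him⟩
      have h2 := hexp (M' := 0) hK₃ l3 (hM₁.trans (le_max_left _ _))
      simp only [zero_mul, Real.exp_zero] at h2
      have := norm_nonneg (regularize (d.trace F) r)
      have := norm_nonneg (regularize (d.traceY F) r)
      constructor <;> linarith
    · obtain ⟨h1, h2⟩ := hs₁ r h him
      have h3 := hexp hK₁ l1 (le_max_left M₁ M₂)
      rw [(hright r h).1, (hright r h).2]
      rw [he] at h3 ⊢
      exact ⟨h1.trans h3, h2.trans h3⟩
    · obtain ⟨h1, h2⟩ := hs₂ (-r) (by simp; linarith) (by simpa using him)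
      have h3 := hexp hK₂ l2 (le_max_right M₁ M₂)
      rw [(hflip r h).2.1] at h1
      rw [(hflip r h).2.2] at h2
      rw [he] at h3 ⊢
      exact ⟨h1.trans h3, h2.trans h3⟩
  · have hexp : ∀ {K' : ℝ}, K' ≤ K → K' * Real.exp (-|x| / 2) ≤ K * Real.exp (-|x| / 2) := by
      intro K' h1
      gcongr
    rcases cases x with h | ⟨h, he⟩ | ⟨h, he⟩
    · exact ⟨(hb₄ x h).trans (hexp l4), (hb₅ x h).trans (hexp l5), (hb₆ x h).trans (hexp l6)⟩
    · obtain ⟨h1, h2, h3⟩ := hl₁ x h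
      have h4 := hexp l1
      rw [he] at h4 ⊢
      rw [(hright (x - πi) (by simpa using h)).2, (hright (x + πi) (by simpa using h)).2,
        (hright x (by simpa using h)).2]
      exact ⟨h1.trans h4, h2.trans h4, h3.trans h4⟩
    · obtain ⟨h1, h2, h3⟩ := hl₂ (-x) (by linarith)
      have h4 := hexp l2
      rw [he] at h4 ⊢
      have e1 := (hflip (x + πi) (by simpa using h)).2.2
      have e2 := (hflip (x - πi) (by simpa using h)).2.2
      have e3 := (hflip x (by simpa using h)).2.2
      rw [show -((x : ℂ) + πi) = ((-x : ℝ) : ℂ) - πi by push_cast; ring] at e1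
      rw [show -((x : ℂ) - πi) = ((-x : ℝ) : ℂ) + πi by push_cast; ring] at e2
      rw [show -(x : ℂ) = ((-x : ℝ) : ℂ) by push_cast; ring] at e3
      rw [e1] at h1
      rw [e2] at h2
      rw [e3, show d.flip.potential (-x) = d.potential x by rw [potential_flip, neg_neg]] at h3
      have w1 : rowWeight d.flip.i d.flip.k (-x) = rowWeight d.j d.l x := by
        have := rowWeight_neg d.j d.l (-x)
        rwa [neg_neg] at this
      have w2 : rowWeight d.flip.j d.flip.l (-x) = rowWeight d.i d.k x := by
        have := rowWeight_neg d.i d.k (-x)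
        rwa [neg_neg] at this
      rw [w1] at h1
      rw [w2] at h2
      exact ⟨h2.trans h4, h1.trans h4, h3.trans h4⟩

end CurveData

/-! ### The quantization condition -/

namespace CurveData

variable {d : CurveData} {φ : LaurentPoly} {F : ℂ → ℂ → ℂ} {p : ℂ × ℂ}

theorem FlatOn.traceY_sub_of_zero {κ : ℂ} (hF : d.FlatOn 0 κ univ F) {r : ℂ} (hr : d.Generic r) :
    d.traceY F (r - 2 * πi) = d.traceY F r := by
  have hs := d.sqrtD_sq r
  have hs' : d.sqrtD r ^ 2 = d.D (r - 2 * πi) := by rw [D_sub, hs]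
  rw [traceY_eq F hs', root_sub, root_sub,
    hF.shift r (mem_univ _) hr _ (Y_root hr.A_ne_zero hr.C_ne_zero hs).1,
    hF.shift r (mem_univ _) hr _ (Y_root hr.A_ne_zero hr.C_ne_zero (by rw [neg_sq, hs])).1,
    traceY_eq F hs, pow_zero, pow_zero, one_mul, one_mul]

/-- The exponential of the holomorphic form is not single valued. -/
theorem not_flatOn_zero (hd : d.Admissible) (hF : d.FlatOn 0 1 univ F) : False := by
  have hper : ∀ {r : ℂ}, d.Generic r → ∀ n : ℤ, d.traceY F (r - n * (2 * πi)) = d.traceY F r := by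
    intro r hr n
    have := shift_int (σ := d.traceY F) (u := 1) one_ne_zero (R := {r | d.Generic r})
      (fun r hr n => by rw [mul_comm]; exact (d.generic_add_int r n).2 hr)
      (fun r hr => by rw [one_mul]; exact hF.traceY_sub_of_zero hr) hr n
    rwa [one_zpow, one_mul] at this
  set E := regularize (d.traceY F) with hE
  -- For e = 0 the trace is 2πi-periodic, so bounds and removability of singularities may be checked
  -- for |Im r| ≤ π.
  have hred : ∀ r : ℂ, ∃ n : ℤ, |(r - n * (2 * πi)).im| ≤ Real.pi := by
    intro r
    refine ⟨round (r.im / (2 * Real.pi)), ?_⟩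
    have h1 := abs_sub_round (r.im / (2 * Real.pi))
    have h2 : (r - (round (r.im / (2 * Real.pi)) : ℂ) * (2 * πi)).im =
        (r.im / (2 * Real.pi) - round (r.im / (2 * Real.pi))) * (2 * Real.pi) := by
      have := Real.pi_ne_zero
      simp
      field_simp
    rw [h2, abs_mul, abs_of_pos (by positivity : 0 < 2 * Real.pi)]
    have := mul_le_mul_of_nonneg_right h1 (by positivity : 0 ≤ 2 * Real.pi)
    linarith
  have hEdiff : Differentiable ℂ E := by
    intro c
    obtain ⟨n, hn⟩ := hred c
    obtain ⟨B, hB⟩ := hF.exists_bound hd (c := c - n * (2 * πi))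
      (mem_toddRegular_of_abs_im_lt (by linarith [Real.pi_pos]))
    have ht : Tendsto (fun z : ℂ => z - n * (2 * πi)) (𝓝[≠] c) (𝓝[≠] (c - n * (2 * πi))) := by
      refine tendsto_nhdsWithin_of_tendsto_nhds_of_eventually_within _ ?_ ?_
      · exact (Continuous.tendsto (by fun_prop) c).mono_left nhdsWithin_le_nhds
      · filter_upwards [self_mem_nhdsWithin] with z hz h0
        exact hz (sub_left_injective h0)
    refine QuantumCurve.differentiableAt_regularize
      ((hd.eventually_generic c).mono fun z hz => (hF.hasDerivAt_trace hz).2) ⟨B, ?_⟩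
    filter_upwards [ht.eventually hB, hd.eventually_generic c] with z hz hg
    rw [hper hg n] at hz
    exact hz.2
  have hEgen : ∀ {r : ℂ}, d.Generic r → E r = d.traceY F r := fun hr => (hF.regularize_trace hr).2
  have hEper : ∀ (r : ℂ) (n : ℤ), E (r - n * (2 * πi)) = E r := by
    intro r n
    refine eq_of_eventually_generic hd (f := fun r => E (r - n * (2 * πi)))
      (hEdiff.continuous.comp (by fun_prop)).continuousAt
      hEdiff.continuous.continuousAt fun z hz => ?_
    have hz' : d.Generic (z - n * (2 * πi)) := by
      have := (d.generic_add_int z (-n)).2 hz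
      rwa [show z + 2 * πi * ((-n : ℤ) : ℂ) = z - n * (2 * πi) by push_cast; ring] at this
    rw [hEgen hz', hper hz n, hEgen hz]
  have hright : ∀ {d : CurveData} {F : ℂ → ℂ → ℂ}, d.Admissible → d.FlatOn 0 1 univ F →
      ∃ K x₀ : ℝ, 0 ≤ K ∧ 0 ≤ x₀ ∧ ∀ r : ℂ, x₀ < r.re → |r.im| ≤ Real.pi →
        d.Generic r ∧ ‖d.traceY F r‖ ≤ K * Real.exp (-(1 / 2) * r.re) := by
    intro d F hd hF
    obtain ⟨K, x₁, ρ, μ, hK, hx₁, hρ, -, -, -, hb⟩ := exists_bounds_right hd 0 1 hF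
    obtain ⟨x₂, -, hgen, -⟩ := exists_flatOn_right hd 0 1
    refine ⟨K * 2, max x₁ x₂, by positivity, hx₁.trans (le_max_left _ _), fun r hr him =>
      ⟨hgen r ((le_max_right _ _).trans_lt hr), ?_⟩⟩
    have hr0 : 0 < r.re := (hx₁.trans (le_max_left _ _)).trans_lt hr
    refine (hb r ((le_max_left _ _).trans_lt hr) him).2.trans ?_
    rw [mul_assoc]
    refine mul_le_mul_of_nonneg_left ?_ hK
    simp only [Nat.cast_zero, zero_mul, zero_div, neg_zero, zero_sub, Finset.sum_const,
      Finset.card_univ, Fintype.card_bool, nsmul_eq_mul, Nat.cast_ofNat]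
    gcongr
    nlinarith
  obtain ⟨K₁, x₁, hK₁, hx₁, h₁⟩ := hright hd hF
  obtain ⟨K₂, x₂, hK₂, hx₂, h₂⟩ := hright hd.flip hF.flip_univ
  have hleft : ∀ r : ℂ, r.re < -x₂ → |r.im| ≤ Real.pi → ‖E r‖ ≤ K₂ := by
    intro r hr him
    obtain ⟨hg, hb⟩ := h₂ (-r) (by simp; linarith) (by simpa using him)
    have h1 : d.Generic (-(-r)) := flip_generic.1 hg
    rw [(trace_flip F h1).2, norm_neg, neg_neg] at hb
    rw [neg_neg] at h1
    rw [hEgen h1]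
    refine hb.trans (mul_le_of_le_one_right hK₂ (Real.exp_le_one_iff.2 ?_))
    simp; linarith
  have hcpt : IsCompact (Icc (-x₂) x₁ ×ℂ Icc (-Real.pi) Real.pi) :=
    isCompact_Icc.reProdIm isCompact_Icc
  obtain ⟨K₃, hK₃, h₃⟩ := exists_bound_on_compact hcpt (f := fun r => ‖E r‖) (E := fun _ => 1)
    hEdiff.continuous.norm.continuousOn continuousOn_const fun _ _ => one_pos
  have hbdd : Bornology.IsBounded (range E) := by
    refine isBounded_iff_forall_norm_le.2 ⟨K₁ + K₂ + K₃, ?_⟩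
    rintro _ ⟨r, rfl⟩
    obtain ⟨n, hn⟩ := hred r
    rw [← hEper r n]
    set w := r - n * (2 * πi)
    by_cases hw1 : x₁ < w.re
    · obtain ⟨hg, hb⟩ := h₁ w hw1 hn
      rw [hEgen hg]
      have := hb.trans (mul_le_of_le_one_right hK₁ (Real.exp_le_one_iff.2 (by linarith)))
      linarith
    · by_cases hw2 : w.re < -x₂
      · linarith [hleft w hw2 hn]
      · have := h₃ w ⟨⟨not_lt.1 hw2, not_lt.1 hw1⟩, abs_le.1 hn⟩
        simp only [mul_one] at this
        linarith
  obtain ⟨c, hc⟩ := hEdiff.exists_const_forall_eq_of_bounded hbdd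
  -- The trace is constant by Liouville's theorem, and it decays towards x₁ = ∞.
  have hc0 : c = 0 := by
    have h1 : Tendsto (fun x : ℝ => K₁ * Real.exp (-(1 / 2) * x)) atTop (𝓝 0) := by
      have : Tendsto (fun x : ℝ => Real.exp (-(1 / 2) * x)) atTop (𝓝 0) :=
        Real.tendsto_exp_atBot.comp (tendsto_id.const_mul_atTop_of_neg (by norm_num))
      simpa using this.const_mul K₁
    have h2 : ∀ᶠ x : ℝ in atTop, ‖c‖ ≤ K₁ * Real.exp (-(1 / 2) * x) := by
      filter_upwards [eventually_gt_atTop x₁] with x hx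
      obtain ⟨hg, hb⟩ := h₁ (x : ℂ) (by simpa using hx) (by simpa using Real.pi_pos.le)
      rw [← hEgen hg, hc] at hb
      simpa using hb
    exact norm_le_zero_iff.1 (ge_of_tendsto h1 h2)
  obtain ⟨r, hr⟩ : ∃ r, d.Generic r := (hd.eventually_generic 0).exists
  obtain ⟨s, hs⟩ := exists_generic_sheet hr
  obtain ⟨-, hsd, hs2, hs0, hx, hx', hY, hY'⟩ := hs.self_of_nhds
  have k1 := hF.hasDerivAt r (mem_univ _) hr _ (differentiableAt_root hsd hr)
    (hs.mono fun z hz => hz.2.2.2.2.1)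
  have k2 := hF.hasDerivAt r (mem_univ _) hr _ (differentiableAt_root hsd.neg hr)
    (hs.mono fun z hz => hz.2.2.2.2.2.1)
  -- The values on the two sheets agree, but for e = 0 their logarithmic derivatives are ∓a/(2πi s),
  -- so a = 0.
  have heq : ∀ᶠ z in 𝓝 r, F z (d.root z (s z)) = F z (d.root z (-s z)) := by
    filter_upwards [hs] with z hz
    have h1 := hEgen hz.1
    rw [hc, hc0, traceY_eq F hz.2.2.1, eq_comm, div_eq_zero_iff] at h1
    exact sub_eq_zero.1 (h1.resolve_right hz.2.2.2.1)
  have k3 := k1.unique (k2.congr_of_eventuallyEq heq)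
  have h0 := hF.ne_zero r (mem_univ _) hr _ hx
  simp only [Pi.neg_apply] at k3
  rw [← heq.self_of_nhds] at k3
  have k4 := mul_left_cancel₀ h0 k3
  rw [Λ, Λ, hY, hY'] at k4
  have hpi := two_pi_I_ne
  have ha := hd.a_ne
  field_simp at k4
  simp only [Nat.cast_zero, zero_mul, zero_sub] at k4
  exact ha (by linear_combination (-1 / 2) * k4)

/-- The quantization condition. -/
theorem exists_flat_of_mem (h : d.Represents φ) (hd : d.Admissible) (γ β : CurveLoop φ d.a p)
    (hb : IsHomologyBasis γ β) (hV : normalFunction γ β ∈ periodLattice γ β) :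
    ∃ κ F, d.FlatOn 1 κ univ F := by
  -- If both periods vanish, e = 0 and κ = 1 have trivial monodromy along the basis.
  have hne : ¬ (γ.period = 0 ∧ β.period = 0) := by
    rintro ⟨h1, h2⟩
    obtain ⟨F, hF⟩ := exists_flat h hd 0 1 γ β hb (by simp [h1]) (by simp [h2])
    exact not_flatOn_zero hd hF
  obtain ⟨m, n, hmn⟩ := AddSubgroup.mem_closure_pair.1 hV
  have hpi : (Real.pi : ℂ) ≠ 0 := Complex.ofReal_ne_zero.2 Real.pi_ne_zero
  have hI := Complex.I_ne_zero
  have hI2 := Complex.I_sq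
  rw [normalFunction, zsmul_eq_mul, zsmul_eq_mul, inv_mul_eq_div, eq_div_iff (by simp [hpi])] at hmn
  -- The hypothesis is the compatibility of these two linear equations for κ, so either one with a
  -- nonzero period may be solved and the other follows.
  obtain ⟨κ, h1, h2⟩ : ∃ κ : ℂ, κ * γ.period = (γ.regulator - 4 * Real.pi ^ 2 * n) / (2 * πi) ∧
      κ * β.period = (β.regulator + 4 * Real.pi ^ 2 * m) / (2 * πi) := by
    by_cases hγ : γ.period = 0
    · have hβ : β.period ≠ 0 := fun hβ => hne ⟨hγ, hβ⟩
      refine ⟨(β.regulator + 4 * Real.pi ^ 2 * m) / (2 * πi) / β.period, ?_,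
        div_mul_cancel₀ _ hβ⟩
      rw [hγ] at hmn ⊢
      have : γ.regulator - 4 * Real.pi ^ 2 * n = 0 :=
        (mul_eq_zero.1 (by linear_combination -hmn :
          (γ.regulator - 4 * Real.pi ^ 2 * n) * β.period = 0)).resolve_right hβ
      rw [this]; simp
    · refine ⟨(γ.regulator - 4 * Real.pi ^ 2 * n) / (2 * πi) / γ.period,
        div_mul_cancel₀ _ hγ, ?_⟩
      field_simp
      linear_combination -hmn
  obtain ⟨F, hF⟩ := exists_flat h hd 1 κ γ β hb
    (Complex.exp_eq_one_iff.2 ⟨n, by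
      rw [h1]
      push_cast
      field_simp
      linear_combination (-4 * Real.pi ^ 2 * n : ℂ) * hI2⟩)
    (Complex.exp_eq_one_iff.2 ⟨-m, by
      rw [h2]
      push_cast
      field_simp
      linear_combination (4 * Real.pi ^ 2 * m : ℂ) * hI2⟩)
  exact ⟨κ, F, hF⟩

end CurveData

/-! ### Contour shifts -/

theorem integrable_exp_neg_mul_abs {c : ℝ} (hc : 0 < c) :
    Integrable fun x : ℝ => Real.exp (-c * |x|) := by
  have h1 : Integrable fun x : ℝ => 2 * (1 + (c * x) ^ 2)⁻¹ :=
    (integrable_inv_one_add_sq.comp_mul_left' hc.ne').const_mul 2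
  refine h1.mono' (by fun_prop) (ae_of_all _ fun x => ?_)
  rw [Real.norm_of_nonneg (Real.exp_pos _).le, neg_mul, Real.exp_neg, ← div_eq_mul_inv,
    le_div_iff₀ (by positivity), inv_mul_le_iff₀ (Real.exp_pos _)]
  have h2 := Real.quadratic_le_exp_of_nonneg (x := c * |x|) (by positivity)
  have h3 : (c * |x|) ^ 2 = (c * x) ^ 2 := by rw [mul_pow, mul_pow, sq_abs]
  have h4 : 0 ≤ c * |x| := by positivity
  nlinarith

theorem mul_abs_sub_mul_sq_le (L : ℝ) {c : ℝ} (hc : 0 < c) (t : ℝ) :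
    L * |t| - c * t ^ 2 ≤ L ^ 2 / (4 * c) := by
  rw [le_div_iff₀ (by positivity), ← sq_abs t]
  nlinarith [sq_nonneg (L - 2 * c * |t|)]

theorem integrable_exp_mul_abs_sub_mul_sq (L : ℝ) {c : ℝ} (hc : 0 < c) :
    Integrable fun t : ℝ => Real.exp (L * |t| - c * t ^ 2) := by
  refine ((integrable_exp_neg_mul_abs one_pos).const_mul
    (Real.exp ((L + 1) ^ 2 / (4 * c)))).mono' (by fun_prop) (ae_of_all _ fun t => ?_)
  rw [Real.norm_of_nonneg (Real.exp_pos _).le, ← Real.exp_add, Real.exp_le_exp]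
  linarith [mul_abs_sub_mul_sq_le (L + 1) hc t]

/-- Holomorphic functions on a closed horizontal strip of at most exponential growth. -/
def GrowsOn (b : ℝ) (f : ℂ → ℂ) : Prop :=
  (∀ z : ℂ, |z.im| ≤ b → DifferentiableAt ℂ f z) ∧
    ∃ K M : ℝ, ∀ z : ℂ, |z.im| ≤ b → ‖f z‖ ≤ K * Real.exp (M * |z.re|)

/-- Holomorphic functions on a closed horizontal strip decaying faster than all exponentials. -/
def DecaysOn (b : ℝ) (f : ℂ → ℂ) : Prop :=
  (∀ z : ℂ, |z.im| ≤ b → DifferentiableAt ℂ f z) ∧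
    ∀ N : ℝ, ∃ K : ℝ, ∀ z : ℂ, |z.im| ≤ b → ‖f z‖ ≤ K * Real.exp (-N * |z.re|)

theorem DecaysOn.growsOn {b : ℝ} {f : ℂ → ℂ} (hf : DecaysOn b f) : GrowsOn b f :=
  ⟨hf.1, let ⟨K, hK⟩ := hf.2 0; ⟨K, -0, hK⟩⟩

theorem GrowsOn.mul_decaysOn {b : ℝ} {f g : ℂ → ℂ} (hf : GrowsOn b f) (hg : DecaysOn b g) :
    DecaysOn b fun z => f z * g z := by
  refine ⟨fun z hz => (hf.1 z hz).mul (hg.1 z hz), fun N => ?_⟩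
  obtain ⟨K, M, hK⟩ := hf.2
  obtain ⟨K', hK'⟩ := hg.2 (N + M)
  refine ⟨K * K', fun z hz => ?_⟩
  rw [norm_mul]
  refine (mul_le_mul (hK z hz) (hK' z hz) (norm_nonneg _) ((norm_nonneg _).trans (hK z hz))).trans
    (le_of_eq ?_)
  rw [mul_mul_mul_comm, ← Real.exp_add]
  ring_nf

theorem DecaysOn.exists_bound {b : ℝ} {f : ℂ → ℂ} (hf : DecaysOn b f) :
    ∃ K : ℝ, 0 ≤ K ∧ ∀ z : ℂ, |z.im| ≤ b → ‖f z‖ ≤ K * Real.exp (-1 * |z.re|) := by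
  obtain ⟨K, hK⟩ := hf.2 1
  exact ⟨|K|, abs_nonneg _, fun z hz => (hK z hz).trans
    (mul_le_mul_of_nonneg_right (le_abs_self K) (Real.exp_pos _).le)⟩

theorem DecaysOn.continuous_line {b : ℝ} {f : ℂ → ℂ} (hf : DecaysOn b f) {y : ℝ} (hy : |y| ≤ b) :
    Continuous fun x : ℝ => f (x + y * Complex.I) :=
  continuous_iff_continuousAt.2 fun x => ContinuousAt.comp
    (f := fun x : ℝ => (x : ℂ) + y * Complex.I) (hf.1 _ (by simpa using hy)).continuousAt
    (by fun_prop)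

theorem DecaysOn.integrable {b : ℝ} {f : ℂ → ℂ} (hf : DecaysOn b f) {y : ℝ} (hy : |y| ≤ b) :
    Integrable fun x : ℝ => f (x + y * Complex.I) := by
  obtain ⟨K, -, hK⟩ := hf.exists_bound
  refine ((integrable_exp_neg_mul_abs one_pos).const_mul K).mono'
    (hf.continuous_line hy).aestronglyMeasurable (ae_of_all _ fun x => ?_)
  simpa using hK (x + y * Complex.I) (by simpa using hy)

/-- Cauchy's theorem on rectangles; the integrals over the vertical sides are O(exp(-T)). -/
theorem DecaysOn.integral_shift {b : ℝ} {f : ℂ → ℂ} (hf : DecaysOn b f) {y : ℝ} (hy : |y| ≤ b) :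
    ∫ x : ℝ, f (x + y * Complex.I) = ∫ x : ℝ, f x := by
  have hb : 0 ≤ b := (abs_nonneg y).trans hy
  have him : ∀ t ∈ uIcc 0 y, |t| ≤ b := by
    intro t ht
    have h := abs_sub_left_of_mem_uIcc ht
    rw [sub_zero, sub_zero] at h
    exact h.trans hy
  have hrect : ∀ T : ℝ, (∫ x : ℝ in -T..T, f x) - (∫ x : ℝ in -T..T, f (x + y * Complex.I)) +
      Complex.I • (∫ s : ℝ in 0..y, f (T + s * Complex.I)) -
      Complex.I • (∫ s : ℝ in 0..y, f (-T + s * Complex.I)) = 0 := by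
    intro T
    have := Complex.integral_boundary_rect_eq_zero_of_differentiableOn f (-T : ℂ)
      (T + y * Complex.I) fun z hz => (hf.1 z (him _ (by simpa using hz.2))).differentiableWithinAt
    simpa using this
  obtain ⟨K, hK0, hK⟩ := hf.exists_bound
  have hside : ∀ T : ℝ, ∀ s ∈ uIcc 0 y, ‖f (T + s * Complex.I)‖ ≤ K * Real.exp (-1 * |T|) := by
    intro T s hs
    simpa using hK (T + s * Complex.I) (by simpa using him s hs)
  have hv : ∀ T : ℝ, ‖∫ s : ℝ in 0..y, f (T + s * Complex.I)‖ ≤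
      K * Real.exp (-1 * |T|) * |y - 0| := fun T =>
    intervalIntegral.norm_integral_le_of_norm_le_const fun s hs => hside T s (uIoc_subset_uIcc hs)
  have hlim : Tendsto (fun T : ℝ => K * Real.exp (-1 * |T|) * |y - 0|) atTop (𝓝 0) := by
    have : Tendsto (fun T : ℝ => Real.exp (-1 * |T|)) atTop (𝓝 0) :=
      Real.tendsto_exp_atBot.comp
        ((tendsto_neg_atTop_atBot.comp tendsto_abs_atTop_atTop).congr fun T => by simp)
    simpa using (this.const_mul K).mul_const |y - 0|
  have hR := squeeze_zero_norm hv hlim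
  have hL : Tendsto (fun T : ℝ => ∫ s : ℝ in 0..y, f (-T + s * Complex.I)) atTop (𝓝 0) :=
    squeeze_zero_norm (fun T => by simpa using hv (-T)) hlim
  have h0 := intervalIntegral_tendsto_integral (hf.integrable (y := 0) (by simpa using hb))
    tendsto_neg_atTop_atBot tendsto_id
  have h1 := intervalIntegral_tendsto_integral (hf.integrable hy)
    tendsto_neg_atTop_atBot tendsto_id
  have h2 := ((h0.sub h1).add (hR.const_smul Complex.I)).sub (hL.const_smul Complex.I)
  have h3 := tendsto_nhds_unique (h2.congr fun T => by simpa using hrect T) tendsto_const_nhds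
  simp only [smul_zero, add_zero, sub_zero, Complex.ofReal_zero, zero_mul] at h3
  exact (sub_eq_zero.1 h3).symm

/-! ### Test functions -/

theorem decaysOn_of_mem_testFunctions {h : ℂ → ℂ} (hh : h ∈ testFunctions) (b : ℝ) (c : ℝ) :
    DecaysOn b fun z => h (z + c * Complex.I) := by
  refine ⟨fun z _ => (hh.1 _).comp z (by fun_prop), fun N => ?_⟩
  obtain ⟨C, hC⟩ := hh.2 (b + |c|) N
  refine ⟨C, fun z hz => ?_⟩
  simpa using hC (z + c * Complex.I) (by
    simpa using (abs_add_le z.im c).trans (add_le_add_left hz _))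

theorem sub_mem_testFunctions {f g : ℂ → ℂ} (hf : f ∈ testFunctions) (hg : g ∈ testFunctions) :
    f - g ∈ testFunctions := by
  refine ⟨hf.1.sub hg.1, fun b K => ?_⟩
  obtain ⟨C, hC⟩ := hf.2 b K
  obtain ⟨C', hC'⟩ := hg.2 b K
  refine ⟨C + C', fun z hz => (norm_sub_le _ _).trans ?_⟩
  rw [add_mul]
  exact add_le_add (hC z hz) (hC' z hz)

/-- The holomorphic function with conjugate values on the real line. -/
def conjReflect (h : ℂ → ℂ) (z : ℂ) : ℂ := (starRingEnd ℂ) (h ((starRingEnd ℂ) z))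

theorem conjReflect_mem_testFunctions {h : ℂ → ℂ} (hh : h ∈ testFunctions) :
    conjReflect h ∈ testFunctions := by
  refine ⟨fun z => ?_, fun b K => ?_⟩
  · have := hh.1 ((starRingEnd ℂ) z)
    simpa [Function.comp_def, conjReflect] using! this.star_star
  · obtain ⟨C, hC⟩ := hh.2 b K
    refine ⟨C, fun z hz => ?_⟩
    simpa [conjReflect] using hC ((starRingEnd ℂ) z) (by simpa using hz)

namespace CurveData

variable {d : CurveData} {φ : LaurentPoly} {F : ℂ → ℂ → ℂ} {κ : ℂ}

theorem growsOn_row (i : ℤ) (k : ℕ) (b : ℝ) :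
    GrowsOn b fun r => (-Complex.exp r) ^ i * (1 - Complex.exp r) ^ k := by
  refine ⟨fun z _ => (hasDerivAt_row i k z).differentiableAt, 2 ^ k, |(i : ℝ)| + k, fun z _ => ?_⟩
  have h1 : ‖Complex.exp z‖ = Real.exp z.re := Complex.norm_exp z
  have h2 : ‖(-Complex.exp z) ^ i‖ ≤ Real.exp (|(i : ℝ)| * |z.re|) := by
    rw [norm_zpow, norm_neg, h1, ← Real.rpow_intCast, ← Real.exp_mul, mul_comm z.re, Real.exp_le_exp, ← abs_mul]
    exact le_abs_self _
  have h3 : ‖1 - Complex.exp z‖ ≤ 2 * Real.exp |z.re| := by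
    refine (norm_sub_le _ _).trans ?_
    rw [norm_one, h1]
    have := Real.one_le_exp (abs_nonneg z.re)
    have := Real.exp_le_exp.2 (le_abs_self z.re)
    linarith
  rw [norm_mul, norm_pow]
  refine (mul_le_mul h2 (pow_le_pow_left₀ (norm_nonneg _) h3 k) (by positivity)
    (by positivity)).trans (le_of_eq ?_)
  rw [mul_pow, ← Real.exp_nat_mul, add_mul, Real.exp_add]
  ring

theorem conj_row (i : ℤ) (k : ℕ) (r : ℂ) :
    (starRingEnd ℂ) ((-Complex.exp r) ^ i * (1 - Complex.exp r) ^ k) =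
      (-Complex.exp ((starRingEnd ℂ) r)) ^ i * (1 - Complex.exp ((starRingEnd ℂ) r)) ^ k := by
  simp [map_zpow₀, ← Complex.exp_conj]

/-- On the rows x₂ and x₂⁻¹ the sign of -x̂₂ cancels the sign in front of φ. As b contains the
parameter, the term of degree 0 in x₂ is a - b. -/
theorem Represents.quantumAction_eq (h : d.Represents φ) (f : ℂ → ℂ) (z : ℂ) :
    quantumAction φ f z = d.A z * f (z - 2 * πi) + d.C z * f (z + 2 * πi) +
      (d.a - d.b z) * f z := by
  have hx : -Complex.exp z ≠ 0 := neg_ne_zero.2 (Complex.exp_ne_zero z)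
  have := h fun m => (-Complex.exp z) ^ m.1 * ((-1) ^ m.2 * f (z - 2 * Real.pi * Complex.I * m.2))
  simp only [← mul_assoc, ← Finset.sum_mul, sum_choose_mul_zpow hx] at this
  rw [quantumAction]
  simp only [← mul_assoc]
  rw [this]
  simp [A, C, b, Complex.exp_neg, ← sub_eq_add_neg]
  ring_nf

end CurveData

theorem growsOn_const (b : ℝ) (c : ℂ) : GrowsOn b fun _ => c :=
  ⟨fun _ _ => differentiableAt_const c, ‖c‖, 0, fun _ _ => by simp⟩

theorem DecaysOn.add {b : ℝ} {f g : ℂ → ℂ} (hf : DecaysOn b f) (hg : DecaysOn b g) :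
    DecaysOn b fun z => f z + g z := by
  refine ⟨fun z hz => (hf.1 z hz).add (hg.1 z hz), fun N => ?_⟩
  obtain ⟨K, hK⟩ := hf.2 N
  obtain ⟨K', hK'⟩ := hg.2 N
  refine ⟨K + K', fun z hz => (norm_add_le _ _).trans ?_⟩
  rw [add_mul]
  exact add_le_add (hK z hz) (hK' z hz)

theorem DecaysOn.const_mul {b : ℝ} {f : ℂ → ℂ} (hf : DecaysOn b f) (c : ℂ) :
    DecaysOn b fun z => c * f z :=
  (growsOn_const b c).mul_decaysOn hf

theorem DecaysOn.integrable_real {b : ℝ} {f : ℂ → ℂ} (hf : DecaysOn b f) (hb : 0 ≤ b) :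
    Integrable fun x : ℝ => f x := by
  simpa using hf.integrable (y := 0) (by simpa using hb)

theorem integral_add_add {f g h : ℝ → ℂ} (hf : Integrable f) (hg : Integrable g)
    (hh : Integrable h) : (∫ x, f x) + (∫ x, g x) + ∫ x, h x = ∫ x, (f x + g x + h x) := by
  rw [← integral_add hf hg]
  exact (integral_add (hf.add hg) hh).symm

namespace CurveData

variable {d : CurveData} {φ : LaurentPoly} {F : ℂ → ℂ → ℂ} {κ : ℂ}

theorem growsOn_b (d : CurveData) (s : ℝ) : GrowsOn s d.b := by
  refine ⟨fun z _ => (d.hasDerivAt_b z).differentiableAt, ‖d.α‖ + ‖d.β‖ + ‖d.a‖, 1, fun z _ => ?_⟩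
  have h1 : ‖Complex.exp z‖ ≤ Real.exp |z.re| := by
    rw [Complex.norm_exp, Real.exp_le_exp]; exact le_abs_self _
  have h2 : ‖Complex.exp (-z)‖ ≤ Real.exp |z.re| := by
    rw [Complex.norm_exp, Real.exp_le_exp]; exact neg_le_abs _
  have h3 := Real.one_le_exp (abs_nonneg z.re)
  rw [b, one_mul, add_mul, add_mul]
  refine (norm_add_le _ _).trans (add_le_add ((norm_sub_le _ _).trans (add_le_add ?_ ?_)) ?_)
  · rw [norm_mul, norm_neg]; gcongr
  · rw [norm_mul]; gcongr
  · exact le_mul_of_one_le_right (norm_nonneg _) h3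

theorem Admissible.sub_b (hd : d.Admissible) (x : ℝ) :
    d.a - d.b x = ((d.potential x - 1 : ℝ) : ℂ) := by
  rw [b, potential, hd.α_eq.1, hd.β_eq.1]
  push_cast
  simp only [Complex.ofReal_re]
  ring

theorem Represents.conj_quantumAction (h : d.Represents φ) (hd : d.Admissible) (f : ℂ → ℂ) (x : ℝ) :
    (starRingEnd ℂ) (quantumAction φ f x) = d.A x * conjReflect f (x + 2 * πi) +
      d.C x * conjReflect f (x - 2 * πi) + (d.a - d.b x) * conjReflect f x := by
  have hA : (starRingEnd ℂ) (d.A x) = d.A x := by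
    simpa [A] using conj_row d.i d.k (x : ℂ)
  have hC : (starRingEnd ℂ) (d.C x) = d.C x := by
    simpa [C] using conj_row d.j d.l (x : ℂ)
  rw [h.quantumAction_eq, hd.sub_b]
  simp only [map_add, map_mul, hA, hC, Complex.conj_ofReal, conjReflect]
  simp [← sub_eq_add_neg, map_ofNat]

theorem FlatOn.growsOn (hF : d.FlatOn 1 κ univ F) (hd : d.Admissible) :
    GrowsOn Real.pi (regularize (d.trace F)) ∧ GrowsOn Real.pi (regularize (d.traceY F)) := by
  obtain ⟨K, M, -, -, h, -⟩ := hF.exists_bounds hd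
  have hdiff : ∀ z : ℂ, |z.im| ≤ Real.pi → z ∈ toddRegular := fun z hz =>
    mem_toddRegular_of_abs_im_lt (by linarith [Real.pi_pos])
  exact ⟨⟨fun z hz => (hF.differentiableAt_regularize hd (hdiff z hz)).1, K, M,
      fun z hz => (h z hz).1⟩,
    ⟨fun z hz => (hF.differentiableAt_regularize hd (hdiff z hz)).2, K, M,
      fun z hz => (h z hz).2⟩⟩

theorem sub_two_pi (d : CurveData) (r : ℂ) : d.A (r - 2 * πi) = d.A r ∧ d.C (r - 2 * πi) = d.C r := by
  rw [sub_two_pi_I, A_add_int, C_add_int]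
  exact ⟨rfl, rfl⟩

/-- The eigenvalue equation, tested against a test function. -/
theorem FlatOn.innerL2_quantumAction (hF : d.FlatOn 1 κ univ F) (h : d.Represents φ)
    (hd : d.Admissible) {f : ℂ → ℂ} (hf : f ∈ testFunctions) :
    innerL2 (fun r => regularize (d.traceY F) r) (onReal (quantumAction φ f)) =
      innerL2 (fun r => d.a * regularize (d.traceY F) r) (onReal f) := by
  have hpi := Real.pi_pos
  obtain ⟨hΘ, hΨ⟩ := hF.growsOn hd
  set Θ := regularize (d.trace F)
  set Ψ := regularize (d.traceY F)
  set g := conjReflect f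
  have hg := conjReflect_mem_testFunctions hf
  have hg0 : DecaysOn Real.pi g := by simpa using decaysOn_of_mem_testFunctions hg Real.pi 0
  have hbΨ := (d.growsOn_b Real.pi).mul_decaysOn (hΨ.mul_decaysOn hg0)
  have hΘg := hΘ.mul_decaysOn hg0
  -- the two shifted traces
  have hu : DecaysOn Real.pi fun z => (d.b z * Ψ z - Θ z) / 2 * g z := by
    have := (hbΨ.add (hΘg.const_mul (-1))).const_mul (1 / 2)
    convert this using 2
    ring
  have hv : DecaysOn Real.pi fun z => (d.b z * Ψ z + Θ z) / 2 * g z := by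
    have := (hbΨ.add hΘg).const_mul (1 / 2)
    convert this using 2
    ring
  have hA : DecaysOn Real.pi fun z => Ψ z * (d.A z * g (z + 2 * πi)) := by
    have := decaysOn_of_mem_testFunctions hg Real.pi (2 * Real.pi)
    push_cast at this
    simp only [mul_assoc (2 : ℂ)] at this
    exact hΨ.mul_decaysOn ((growsOn_row d.i d.k _).mul_decaysOn this)
  have hC : DecaysOn Real.pi fun z => Ψ z * (d.C z * g (z - 2 * πi)) := by
    have := decaysOn_of_mem_testFunctions hg Real.pi (-(2 * Real.pi))
    push_cast at this
    simp only [neg_mul, ← sub_eq_add_neg, mul_assoc (2 : ℂ)] at this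
    exact hΨ.mul_decaysOn ((growsOn_row d.j d.l _).mul_decaysOn this)
  have hApi : |-Real.pi| ≤ Real.pi := by rw [abs_neg, abs_of_pos hpi]
  have hpi' : |Real.pi| ≤ Real.pi := (abs_of_pos hpi).le
  -- Instead of shifting Ψ by 2πi out of its strip, the left integral is moved to Im = -π and the
  -- right one to Im = π. There the integrands agree by the difference equation. The term with C is
  -- treated with the two lines exchanged.
  have eA : ∫ x : ℝ, Ψ x * (d.A x * g (x + 2 * πi)) =
      ∫ x : ℝ, (d.b x * Ψ x - Θ x) / 2 * g x := by
    rw [← hA.integral_shift hApi, ← hu.integral_shift hpi']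
    refine integral_congr_ae (ae_of_all _ fun x => ?_)
    have h1 := hF.A_mul_regularize hd (r := (x : ℂ) + πi) (by simpa using hpi)
      (by simp; linarith)
    have h2 : (x : ℂ) + πi - 2 * πi = x + (-Real.pi : ℝ) * Complex.I := by push_cast; ring
    have h3 := (d.sub_two_pi ((x : ℂ) + πi)).1
    have h4 : (x : ℂ) + (-Real.pi : ℝ) * Complex.I + 2 * πi = x + πi := by push_cast; ring
    rw [h2] at h1 h3
    beta_reduce
    rw [h4, h3, ← h1]
    ring
  have eC : ∫ x : ℝ, Ψ x * (d.C x * g (x - 2 * πi)) =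
      ∫ x : ℝ, (d.b x * Ψ x + Θ x) / 2 * g x := by
    rw [← hC.integral_shift hpi', ← hv.integral_shift hApi]
    refine integral_congr_ae (ae_of_all _ fun x => ?_)
    have h1 := hF.C_mul_regularize hd (r := (x : ℂ) + (-Real.pi : ℝ) * Complex.I)
      (by simpa using hpi) (by simp; linarith)
    have h2 : (x : ℂ) + (-Real.pi : ℝ) * Complex.I + 2 * πi = x + πi := by push_cast; ring
    have h4 : (x : ℂ) + πi - 2 * πi = x + (-Real.pi : ℝ) * Complex.I := by push_cast; ring
    have h3 := (d.sub_two_pi ((x : ℂ) + πi)).2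
    rw [h2] at h1
    rw [h4] at h3
    beta_reduce
    rw [h4, ← h3, ← h1]
    ring
  have hB : DecaysOn Real.pi fun z => d.a * (Ψ z * g z) + -1 * (d.b z * (Ψ z * g z)) :=
    ((hΨ.mul_decaysOn hg0).const_mul d.a).add (hbΨ.const_mul (-1))
  have e1 : innerL2 (fun r => Ψ r) (onReal (quantumAction φ f)) =
      (∫ x : ℝ, Ψ x * (d.A x * g (x + 2 * πi))) + (∫ x : ℝ, Ψ x * (d.C x * g (x - 2 * πi))) +
        ∫ x : ℝ, (d.a * (Ψ x * g x) + -1 * (d.b x * (Ψ x * g x))) := by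
    rw [integral_add_add (hA.integrable_real hpi.le) (hC.integrable_real hpi.le)
      (hB.integrable_real hpi.le)]
    refine integral_congr_ae (ae_of_all _ fun x => ?_)
    beta_reduce
    rw [onReal, h.conj_quantumAction hd]
    ring
  rw [e1, eA, eC, integral_add_add (hu.integrable_real hpi.le) (hv.integrable_real hpi.le)
    (hB.integrable_real hpi.le)]
  refine integral_congr_ae (ae_of_all _ fun x => ?_)
  have hx : (starRingEnd ℂ) (onReal f x) = g x := by simp [onReal, g, conjReflect]
  beta_reduce
  rw [hx]
  ring

/-! ### The quadratic form -/

/-- On the lines Im z = ±π one has x₁ = exp x > 0, so the coefficients of φ̂ become positive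
weights. This is the source of the positivity of φ̂. -/
theorem row_eq_rowWeight (i : ℤ) (k : ℕ) (x : ℝ) {z : ℂ} (hz : Complex.exp z = -Complex.exp x) :
    (-Complex.exp z) ^ i * (1 - Complex.exp z) ^ k = (rowWeight i k x : ℂ) := by
  rw [hz, rowWeight, ← Complex.ofReal_exp]
  push_cast
  rw [neg_neg, sub_neg_eq_add, ← Complex.exp_int_mul]

theorem A_eq_rowWeight (d : CurveData) (x : ℝ) : d.A (x + πi) = rowWeight d.i d.k x :=
  row_eq_rowWeight _ _ _ (by rw [Complex.exp_add, Complex.exp_pi_mul_I, mul_neg_one])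

theorem C_eq_rowWeight (d : CurveData) (x : ℝ) : d.C (x - πi) = rowWeight d.j d.l x :=
  row_eq_rowWeight _ _ _ (by rw [Complex.exp_sub, Complex.exp_pi_mul_I, div_neg, div_one])

/-- The quadratic form of `φ̂` on a test function. -/
theorem Represents.innerL2_quantumAction_self (h : d.Represents φ) (hd : d.Admissible) {f : ℂ → ℂ}
    (hf : f ∈ testFunctions) :
    Integrable (fun x : ℝ => rowWeight d.i d.k x * ‖f (x - πi)‖ ^ 2) ∧
    Integrable (fun x : ℝ => rowWeight d.j d.l x * ‖f (x + πi)‖ ^ 2) ∧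
    Integrable (fun x : ℝ => (d.potential x - 1) * ‖f x‖ ^ 2) ∧
    innerL2 (onReal (quantumAction φ f)) (onReal f) =
      (((∫ x : ℝ, rowWeight d.i d.k x * ‖f (x - πi)‖ ^ 2) +
        (∫ x : ℝ, rowWeight d.j d.l x * ‖f (x + πi)‖ ^ 2) +
        ∫ x : ℝ, (d.potential x - 1) * ‖f x‖ ^ 2 : ℝ) : ℂ) := by
  have hpi := Real.pi_pos
  have hpi' : |Real.pi| ≤ Real.pi := (abs_of_pos hpi).le
  have hApi : |-Real.pi| ≤ Real.pi := by rw [abs_neg, abs_of_pos hpi]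
  set g := conjReflect f with hgdef
  have hg := conjReflect_mem_testFunctions hf
  have hg0 : DecaysOn Real.pi g := by simpa using decaysOn_of_mem_testFunctions hg Real.pi 0
  have hf0 : DecaysOn Real.pi f := by simpa using decaysOn_of_mem_testFunctions hf Real.pi 0
  have hA : DecaysOn Real.pi fun z => d.A z * (f (z - 2 * πi) * g z) := by
    have := decaysOn_of_mem_testFunctions hf Real.pi (-(2 * Real.pi))
    push_cast at this
    simp only [neg_mul, ← sub_eq_add_neg, mul_assoc (2 : ℂ)] at this
    exact (growsOn_row d.i d.k _).mul_decaysOn (this.growsOn.mul_decaysOn hg0)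
  have hC : DecaysOn Real.pi fun z => d.C z * (f (z + 2 * πi) * g z) := by
    have := decaysOn_of_mem_testFunctions hf Real.pi (2 * Real.pi)
    push_cast at this
    simp only [mul_assoc (2 : ℂ)] at this
    exact (growsOn_row d.j d.l _).mul_decaysOn (this.growsOn.mul_decaysOn hg0)
  have hB : DecaysOn Real.pi fun z => d.a * (f z * g z) + -1 * (d.b z * (f z * g z)) :=
    ((hf0.growsOn.mul_decaysOn hg0).const_mul d.a).add
      (((d.growsOn_b Real.pi).mul_decaysOn (hf0.growsOn.mul_decaysOn hg0)).const_mul (-1))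
  -- After the shift by πi the arguments of f and of its reflection are conjugate to each other, so
  -- their product is a square of an absolute value.
  have pA : ∀ x : ℝ, d.A (x + Real.pi * Complex.I) *
      (f (x + Real.pi * Complex.I - 2 * πi) * g (x + Real.pi * Complex.I)) =
      ((rowWeight d.i d.k x * ‖f (x - πi)‖ ^ 2 : ℝ) : ℂ) := by
    intro x
    have h1 : (x : ℂ) + πi - 2 * πi = x - πi := by ring
    have h2 : (starRingEnd ℂ) ((x : ℂ) + πi) = x - πi := by simp [sub_eq_add_neg]
    rw [A_eq_rowWeight, h1, hgdef, conjReflect, h2, Complex.mul_conj, Complex.normSq_eq_norm_sq]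
    push_cast
    rfl
  have pC : ∀ x : ℝ, d.C (x + (-Real.pi : ℝ) * Complex.I) *
      (f (x + (-Real.pi : ℝ) * Complex.I + 2 * πi) * g (x + (-Real.pi : ℝ) * Complex.I)) =
      ((rowWeight d.j d.l x * ‖f (x + πi)‖ ^ 2 : ℝ) : ℂ) := by
    intro x
    have h0 : (x : ℂ) + (-Real.pi : ℝ) * Complex.I = x - πi := by push_cast; ring
    have h1 : (x : ℂ) - πi + 2 * πi = x + πi := by ring
    have h2 : (starRingEnd ℂ) ((x : ℂ) - πi) = x + πi := by simp
    rw [h0, C_eq_rowWeight, h1, hgdef, conjReflect, h2, Complex.mul_conj,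
      Complex.normSq_eq_norm_sq]
    push_cast
    rfl
  have pB : ∀ x : ℝ, d.a * (f x * g x) + -1 * (d.b x * (f x * g x)) =
      (((d.potential x - 1) * ‖f x‖ ^ 2 : ℝ) : ℂ) := by
    intro x
    have h2 : f x * g x = ((‖f x‖ ^ 2 : ℝ) : ℂ) := by
      rw [hgdef, conjReflect, Complex.conj_ofReal, Complex.mul_conj, Complex.normSq_eq_norm_sq]
    rw [Complex.ofReal_mul, ← hd.sub_b, h2]
    ring
  have iA := hA.integrable hpi'
  have iC := hC.integrable hApi
  have iB := hB.integrable_real hpi.le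
  simp only [pA] at iA
  simp only [pC] at iC
  simp only [pB] at iB
  refine ⟨iA.re, iC.re, iB.re, ?_⟩
  have e1 : innerL2 (onReal (quantumAction φ f)) (onReal f) =
      (∫ x : ℝ, d.A x * (f (x - 2 * πi) * g x)) + (∫ x : ℝ, d.C x * (f (x + 2 * πi) * g x)) +
        ∫ x : ℝ, (d.a * (f x * g x) + -1 * (d.b x * (f x * g x))) := by
    rw [integral_add_add (hA.integrable_real hpi.le) (hC.integrable_real hpi.le)
      (hB.integrable_real hpi.le)]
    refine integral_congr_ae (ae_of_all _ fun x => ?_)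
    have hx : (starRingEnd ℂ) (f x) = g x := by simp [g, conjReflect]
    beta_reduce
    rw [onReal, onReal, h.quantumAction_eq, hx]
    ring
  rw [e1, ← hA.integral_shift hpi', ← hC.integral_shift hApi]
  simp only [pA, pC, pB]
  rw [integral_complex_ofReal, integral_complex_ofReal, integral_complex_ofReal]
  push_cast
  rfl

end CurveData

/-! ### Gaussian mollification -/

theorem norm_cexp_neg_mul_sq (c : ℝ) (z : ℂ) :
    ‖Complex.exp (-(c : ℂ) * z ^ 2)‖ = Real.exp (-c * (z.re ^ 2 - z.im ^ 2)) := by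
  rw [Complex.norm_exp, ← Complex.ofReal_neg, Complex.re_ofReal_mul, sq z, Complex.mul_re]
  ring_nf

theorem const_mul_mem_testFunctions {f : ℂ → ℂ} (hf : f ∈ testFunctions) (c : ℂ) :
    (fun z => c * f z) ∈ testFunctions := by
  refine ⟨hf.1.const_mul c, fun b K => ?_⟩
  obtain ⟨C, hC⟩ := hf.2 b K
  refine ⟨‖c‖ * C, fun z hz => ?_⟩
  rw [norm_mul, mul_assoc]
  exact mul_le_mul_of_nonneg_left (hC z hz) (norm_nonneg c)

/-- The convolution with a Gaussian of a function with Gaussian decay is a test function. -/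
theorem gaussian_convolution_mem_testFunctions {u : ℝ → ℂ} (hu : Continuous u) {K M c N : ℝ}
    (hc : 0 < c) (hN : 0 < N) (hb : ∀ t, ‖u t‖ ≤ K * Real.exp (M * |t| - c * t ^ 2)) :
    (fun z : ℂ => ∫ t : ℝ, u t * Complex.exp (-(N : ℂ) * (z - t) ^ 2)) ∈ testFunctions := by
  have hK : 0 ≤ K := by
    have := (norm_nonneg _).trans (hb 0)
    exact nonneg_of_mul_nonneg_left this (Real.exp_pos _)
  have hint : ∀ L, Integrable fun t => K * Real.exp (L * |t| - c * t ^ 2) := fun L =>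
    (integrable_exp_mul_abs_sub_mul_sq L hc).const_mul K
  have hker : ∀ (z : ℂ) (t R : ℝ), |z.im| ≤ R →
      ‖Complex.exp (-(N : ℂ) * (z - t) ^ 2)‖ ≤
        Real.exp (N * R ^ 2) * Real.exp (-N * (z.re - t) ^ 2) := by
    intro z t R hR
    have h1 : z.im ^ 2 ≤ R ^ 2 := sq_le_sq' (by linarith [neg_abs_le z.im])
      ((le_abs_self _).trans hR)
    rw [norm_cexp_neg_mul_sq, ← Real.exp_add, Real.exp_le_exp]
    simp only [Complex.sub_re, Complex.ofReal_re, Complex.sub_im, Complex.ofReal_im, sub_zero]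
    nlinarith
  have hker' : ∀ (z : ℂ) (t R : ℝ), |z.im| ≤ R →
      ‖Complex.exp (-(N : ℂ) * (z - t) ^ 2)‖ ≤ Real.exp (N * R ^ 2) := fun z t R hR =>
    (hker z t R hR).trans (mul_le_of_le_one_right (Real.exp_pos _).le
      (Real.exp_le_one_iff.2 (by nlinarith [sq_nonneg (z.re - t)])))
  refine ⟨fun z₀ => ?_, fun b L => ?_⟩
  · have hR : ∀ z ∈ ball z₀ 1, |z.im| ≤ ‖z₀‖ + 1 ∧ ‖z‖ ≤ ‖z₀‖ + 1 := by
      intro z hz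
      have h1 : ‖z‖ ≤ ‖z₀‖ + 1 := by
        have := norm_le_norm_add_norm_sub' z z₀
        rw [mem_ball, dist_eq_norm] at hz
        linarith
      exact ⟨(Complex.abs_im_le_norm z).trans h1, h1⟩
    refine (hasDerivAt_integral_of_dominated_loc_of_deriv_le (μ := volume) (x₀ := z₀)
      (F := fun z t => u t * Complex.exp (-(N : ℂ) * (z - t) ^ 2))
      (F' := fun z t => u t * (Complex.exp (-(N : ℂ) * (z - t) ^ 2) * (-(N : ℂ) * (2 * (z - t)))))
      (bound := fun t => Real.exp (N * (‖z₀‖ + 1) ^ 2) * (N * (2 * (‖z₀‖ + 2))) *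
        (K * Real.exp ((M + 1) * |t| - c * t ^ 2)))
      (ball_mem_nhds z₀ one_pos) ?_ ?_ ?_ ?_ ?_ ?_).2.differentiableAt
    · exact Eventually.of_forall fun z => by fun_prop
    · refine ((hint M).const_mul (Real.exp (N * (‖z₀‖ + 1) ^ 2))).mono' (by fun_prop)
        (ae_of_all _ fun t => ?_)
      rw [norm_mul, mul_comm]
      exact mul_le_mul (hker' z₀ t _ (hR z₀ (mem_ball_self one_pos)).1) (hb t) (norm_nonneg _)
        (Real.exp_pos _).le
    · fun_prop
    · refine ae_of_all _ fun t z hz => ?_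
      have h1 := hker' z t _ (hR z hz).1
      have h2 : ‖-(N : ℂ) * (2 * (z - t))‖ ≤ N * (2 * (‖z₀‖ + 2)) * Real.exp |t| := by
        have h3 : ‖z - t‖ ≤ ‖z‖ + |t| := by
          simpa using norm_sub_le z (t : ℂ)
        have h4 := (hR z hz).2
        have h5 := Real.add_one_le_exp |t|
        have h6 := Real.one_le_exp (abs_nonneg t)
        have h7 := mul_le_mul_of_nonneg_left h6 (norm_nonneg z₀)
        rw [norm_mul, norm_mul, norm_neg, Complex.norm_real, Real.norm_of_nonneg hN.le,
          Complex.norm_ofNat, mul_assoc, mul_assoc 2]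
        gcongr
        linarith
      have h8 : K * Real.exp ((M + 1) * |t| - c * t ^ 2) =
          K * Real.exp (M * |t| - c * t ^ 2) * Real.exp |t| := by
        rw [mul_assoc, ← Real.exp_add]
        ring_nf
      rw [norm_mul, norm_mul, h8]
      refine (mul_le_mul (hb t) (mul_le_mul h1 h2 (norm_nonneg _) (Real.exp_pos _).le)
        (by positivity) (by positivity)).trans (le_of_eq (by ring))
    · exact (hint (M + 1)).const_mul _
    · refine ae_of_all _ fun t z _ => ?_
      have h1 : HasDerivAt (fun z : ℂ => -(N : ℂ) * (z - t) ^ 2) (-(N : ℂ) * (2 * (z - t))) z := by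
        have := (((hasDerivAt_id z).sub_const (t : ℂ)).pow 2).const_mul (-(N : ℂ))
        simpa using this
      exact h1.cexp.const_mul _
  · set C := Real.exp (N * b ^ 2) * Real.exp (L ^ 2 / (4 * N))
    refine ⟨C * ∫ t : ℝ, K * Real.exp ((M + |L|) * |t| - c * t ^ 2), fun z hz => ?_⟩
    -- Since |Re z| ≤ |t| + |Re z - t|, a factor exp(L |Re z|) is absorbed partly by the decay of u
    -- and partly by the Gaussian kernel.
    have hpt : ∀ t : ℝ, ‖u t * Complex.exp (-(N : ℂ) * (z - t) ^ 2)‖ ≤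
        C * Real.exp (-L * |z.re|) * (K * Real.exp ((M + |L|) * |t| - c * t ^ 2)) := by
      intro t
      have h1 := hker z t b hz
      have h2 : |L| * |z.re - t| - N * (z.re - t) ^ 2 ≤ |L| ^ 2 / (4 * N) :=
        mul_abs_sub_mul_sq_le _ hN _
      have h3 : L * |z.re| ≤ |L| * |t| + |L| * |z.re - t| := by
        have h4 : |z.re| ≤ |t| + |z.re - t| := by
          have := abs_add_le t (z.re - t)
          rwa [add_sub_cancel] at this
        have h5 := mul_le_mul_of_nonneg_left h4 (abs_nonneg L)
        have h6 := mul_le_mul_of_nonneg_right (le_abs_self L) (abs_nonneg z.re)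
        linarith
      rw [sq_abs] at h2
      rw [norm_mul]
      refine (mul_le_mul (hb t) h1 (norm_nonneg _) (by positivity)).trans ?_
      have : K * Real.exp (M * |t| - c * t ^ 2) *
          (Real.exp (N * b ^ 2) * Real.exp (-N * (z.re - t) ^ 2)) =
          K * Real.exp (M * |t| - c * t ^ 2 + N * b ^ 2 + -N * (z.re - t) ^ 2) := by
        rw [Real.exp_add, Real.exp_add]; ring
      rw [this]
      have : C * Real.exp (-L * |z.re|) * (K * Real.exp ((M + |L|) * |t| - c * t ^ 2)) =
          K * Real.exp (N * b ^ 2 + L ^ 2 / (4 * N) + -L * |z.re| +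
            ((M + |L|) * |t| - c * t ^ 2)) := by
        rw [Real.exp_add, Real.exp_add, Real.exp_add]; ring
      rw [this]
      refine mul_le_mul_of_nonneg_left (Real.exp_le_exp.2 ?_) hK
      linarith
    refine (norm_integral_le_of_norm_le (((hint (M + |L|)).const_mul _)) (ae_of_all _ hpt)).trans
      (le_of_eq ?_)
    rw [integral_const_mul]
    ring

/-- A function cut off by a broad Gaussian. -/
def cutoff (N : ℝ) (f : ℂ → ℂ) (z : ℂ) : ℂ := f z * Complex.exp (-((N⁻¹ : ℝ) : ℂ) * z ^ 2)

/-- A function cut off by a broad Gaussian and convolved with a narrow one. -/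
def mollify (N : ℝ) (f : ℂ → ℂ) (z : ℂ) : ℂ :=
  (Real.sqrt (N / Real.pi) : ℂ) * ∫ t : ℝ, cutoff N f t * Complex.exp (-(N : ℂ) * (z - t) ^ 2)

theorem GrowsOn.decaysOn_cutoff {b N : ℝ} {f : ℂ → ℂ} (hf : GrowsOn b f) (hN : 0 < N) :
    DecaysOn b (cutoff N f) := by
  refine hf.mul_decaysOn ⟨fun z _ => by fun_prop, fun L => ?_⟩
  refine ⟨Real.exp (N⁻¹ * b ^ 2 + L ^ 2 / (4 * N⁻¹)), fun z hz => ?_⟩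
  have h1 : z.im ^ 2 ≤ b ^ 2 := sq_le_sq' (by linarith [neg_abs_le z.im])
    ((le_abs_self _).trans hz)
  have h2 := mul_abs_sub_mul_sq_le L (inv_pos.2 hN) z.re
  have h3 := mul_le_mul_of_nonneg_left h1 (inv_pos.2 hN).le
  rw [norm_cexp_neg_mul_sq, ← Real.exp_add, Real.exp_le_exp]
  linarith

theorem GrowsOn.mollify_mem_testFunctions {b N : ℝ} {f : ℂ → ℂ} (hf : GrowsOn b f) (hb : 0 ≤ b)
    (hN : 0 < N) : mollify N f ∈ testFunctions := by
  obtain ⟨K, M, hK⟩ := hf.2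
  refine const_mul_mem_testFunctions (gaussian_convolution_mem_testFunctions (K := K) (M := M)
    (c := N⁻¹) ?_ (inv_pos.2 hN) hN fun t => ?_) _
  · simpa using (hf.decaysOn_cutoff hN).continuous_line (y := 0) (by simpa using hb)
  · have h1 := hK t (by simpa using hb)
    rw [cutoff, norm_mul, norm_cexp_neg_mul_sq, sub_eq_add_neg (M * |t|), Real.exp_add,
      ← mul_assoc]
    refine mul_le_mul (by simpa using h1) (le_of_eq ?_) (Real.exp_pos _).le
      ((norm_nonneg _).trans (by simpa using h1))
    simp

/-- The mollification on a horizontal line only uses the values on this line. -/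
theorem GrowsOn.mollify_line {b N : ℝ} {f : ℂ → ℂ} (hf : GrowsOn b f) (hN : 0 < N) {y : ℝ}
    (hy : |y| ≤ b) (x : ℝ) :
    mollify N f (x + y * Complex.I) = (Real.sqrt Real.pi : ℂ)⁻¹ * ∫ s : ℝ,
      cutoff N f (((x + (Real.sqrt N)⁻¹ * s : ℝ) : ℂ) + y * Complex.I) *
        (Real.exp (-s ^ 2) : ℂ) := by
  have hsN : 0 < Real.sqrt N := Real.sqrt_pos.2 hN
  -- Moving the contour of the convolution to ζ = t + iy makes the kernel real at the point x + iy.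
  -- The substitution t = x + s/√N then normalizes it.
  have hker : GrowsOn b fun ζ : ℂ => Complex.exp (-(N : ℂ) * (x + y * Complex.I - ζ) ^ 2) := by
    refine ⟨fun z _ => by fun_prop, Real.exp (N * (2 * b) ^ 2), 0, fun z hz => ?_⟩
    rw [norm_cexp_neg_mul_sq, zero_mul, Real.exp_zero, mul_one, Real.exp_le_exp]
    have h1 : |y - z.im| ≤ 2 * b := (abs_sub _ _).trans (by linarith)
    have h2 : (y - z.im) ^ 2 ≤ (2 * b) ^ 2 := by
      rw [← sq_abs]; exact pow_le_pow_left₀ (abs_nonneg _) h1 2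
    simp only [Complex.sub_re, Complex.add_re, Complex.ofReal_re, Complex.re_ofReal_mul,
      Complex.I_re, mul_zero, add_zero, Complex.sub_im, Complex.add_im, Complex.ofReal_im,
      Complex.im_ofReal_mul, Complex.I_im, mul_one, zero_add]
    nlinarith [sq_nonneg (x - z.re)]
  have hdec := hker.mul_decaysOn (hf.decaysOn_cutoff hN)
  set H : ℝ → ℂ := fun t => Complex.exp (-(N : ℂ) * ((x : ℂ) + y * Complex.I -
    (t + y * Complex.I)) ^ 2) * cutoff N f (t + y * Complex.I) with hH
  have h1 : ∫ t : ℝ, cutoff N f t * Complex.exp (-(N : ℂ) * (x + y * Complex.I - t) ^ 2) =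
      ∫ t, H t := by
    rw [hH, hdec.integral_shift hy]
    simp only [mul_comm]
  have h2 : ∫ s : ℝ, H (x + (Real.sqrt N)⁻¹ * s) = (Real.sqrt N : ℂ) * ∫ t, H t := by
    rw [Measure.integral_comp_mul_left (fun t => H (x + t)) (Real.sqrt N)⁻¹,
      integral_add_left_eq_self H x, inv_inv, abs_of_pos hsN, Complex.real_smul]
  have h3 : ∀ s : ℝ, H (x + (Real.sqrt N)⁻¹ * s) =
      cutoff N f (((x + (Real.sqrt N)⁻¹ * s : ℝ) : ℂ) + y * Complex.I) *
        (Real.exp (-s ^ 2) : ℂ) := by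
    intro s
    rw [hH]
    beta_reduce
    rw [mul_comm (Complex.exp _)]
    congr 1
    rw [Complex.ofReal_exp]
    congr 1
    have h4 : ((Real.sqrt N)⁻¹ * s) ^ 2 * N = s ^ 2 := by
      rw [mul_pow, inv_pow, Real.sq_sqrt hN.le]
      field_simp
    have h5 : (((Real.sqrt N : ℂ))⁻¹ * s) ^ 2 * N = (s : ℂ) ^ 2 := by exact_mod_cast h4
    push_cast
    linear_combination -h5
  have h6 : (Real.sqrt (N / Real.pi) : ℂ) = (Real.sqrt Real.pi : ℂ)⁻¹ * Real.sqrt N := by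
    rw [Real.sqrt_div hN.le]
    push_cast
    rw [div_eq_inv_mul]
  rw [mollify, h1, h6, mul_assoc, ← h2]
  simp only [h3]

theorem norm_cutoff_le {f : ℂ → ℂ} {N e : ℝ} (hN : 1 ≤ N) {t y : ℝ}
    (h : ‖f (t + y * Complex.I)‖ ≤ e) :
    ‖cutoff N f (t + y * Complex.I)‖ ≤ e * Real.exp (y ^ 2) := by
  rw [cutoff, norm_mul, norm_cexp_neg_mul_sq]
  refine mul_le_mul h (Real.exp_le_exp.2 ?_) (Real.exp_pos _).le ((norm_nonneg _).trans h)
  have h1 : N⁻¹ ≤ 1 := inv_le_one_of_one_le₀ hN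
  have h2 : 0 ≤ N⁻¹ := by positivity
  simp only [Complex.add_re, Complex.ofReal_re, Complex.re_ofReal_mul, Complex.I_re, mul_zero,
    add_zero, Complex.add_im, Complex.ofReal_im, Complex.im_ofReal_mul, Complex.I_im, mul_one,
    zero_add]
  nlinarith [mul_nonneg h2 (sq_nonneg t), mul_nonneg (sub_nonneg.2 h1) (sq_nonneg y)]

section Envelope

variable {b y L : ℝ} {f : ℂ → ℂ} {E : ℝ → ℝ}

/-- An envelope E that varies by at most exp(L |t - x|) bounds f under the kernel by its value at x,
uniformly in N ≥ 1. This gives the majorants for dominated convergence, first in s and then in x. -/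
theorem norm_mollify_integrand_le (hE : ∀ t : ℝ, ‖f (t + y * Complex.I)‖ ≤ E t)
    (hEL : ∀ x t : ℝ, E t ≤ E x * Real.exp (L * |t - x|)) (hL : 0 ≤ L) {N : ℝ} (hN : 1 ≤ N)
    (x s : ℝ) :
    ‖cutoff N f (((x + (Real.sqrt N)⁻¹ * s : ℝ) : ℂ) + y * Complex.I) *
      (Real.exp (-s ^ 2) : ℂ)‖ ≤ E x * Real.exp (y ^ 2) * Real.exp (L * |s| - 1 * s ^ 2) := by
  have h0 : 0 ≤ E x := (norm_nonneg _).trans (hE x)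
  have h1 : E (x + (Real.sqrt N)⁻¹ * s) ≤ E x * Real.exp (L * |s|) := by
    refine (hEL x _).trans ?_
    have h2 : (Real.sqrt N)⁻¹ ≤ 1 := inv_le_one_of_one_le₀ (Real.one_le_sqrt.2 hN)
    have h3 : (Real.sqrt N)⁻¹ * |s| ≤ |s| := mul_le_of_le_one_left (abs_nonneg s) h2
    rw [add_sub_cancel_left, abs_mul, abs_of_nonneg (by positivity : 0 ≤ (Real.sqrt N)⁻¹)]
    gcongr
  have h4 := norm_cutoff_le hN ((hE (x + (Real.sqrt N)⁻¹ * s)).trans h1)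
  rw [norm_mul, Complex.norm_real, Real.norm_of_nonneg (Real.exp_pos _).le, sub_eq_add_neg,
    Real.exp_add, one_mul]
  refine (mul_le_mul_of_nonneg_right h4 (Real.exp_pos _).le).trans (le_of_eq ?_)
  ring

theorem GrowsOn.norm_mollify_le (hf : GrowsOn b f) (hy : |y| ≤ b)
    (hE : ∀ t : ℝ, ‖f (t + y * Complex.I)‖ ≤ E t)
    (hEL : ∀ x t : ℝ, E t ≤ E x * Real.exp (L * |t - x|)) (hL : 0 ≤ L) {N : ℝ} (hN : 1 ≤ N)
    (x : ℝ) :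
    ‖mollify N f (x + y * Complex.I)‖ ≤ (Real.sqrt Real.pi)⁻¹ *
      (Real.exp (y ^ 2) * ∫ s : ℝ, Real.exp (L * |s| - 1 * s ^ 2)) * E x := by
  rw [hf.mollify_line (by linarith) hy, norm_mul, norm_inv, Complex.norm_real,
    Real.norm_of_nonneg (Real.sqrt_nonneg _), mul_assoc]
  refine mul_le_mul_of_nonneg_left ?_ (by positivity)
  refine (norm_integral_le_of_norm_le ((integrable_exp_mul_abs_sub_mul_sq L one_pos).const_mul _)
    (ae_of_all _ (norm_mollify_integrand_le hE hEL hL hN x))).trans (le_of_eq ?_)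
  rw [integral_const_mul]
  ring

theorem GrowsOn.continuous_line (hf : GrowsOn b f) (hy : |y| ≤ b) :
    Continuous fun x : ℝ => f (x + y * Complex.I) :=
  continuous_iff_continuousAt.2 fun x => ContinuousAt.comp
    (f := fun x : ℝ => (x : ℂ) + y * Complex.I) (hf.1 _ (by simpa using hy)).continuousAt
    (by fun_prop)

theorem tendsto_natCast_add_one : Tendsto (fun n : ℕ => (n : ℝ) + 1) atTop atTop :=
  tendsto_atTop_add_const_right _ _ tendsto_natCast_atTop_atTop

theorem GrowsOn.tendsto_mollify (hf : GrowsOn b f) (hy : |y| ≤ b)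
    (hE : ∀ t : ℝ, ‖f (t + y * Complex.I)‖ ≤ E t)
    (hEL : ∀ x t : ℝ, E t ≤ E x * Real.exp (L * |t - x|)) (hL : 0 ≤ L) (x : ℝ) :
    Tendsto (fun n : ℕ => mollify (n + 1) f (x + y * Complex.I)) atTop
      (𝓝 (f (x + y * Complex.I))) := by
  have hN : ∀ n : ℕ, (1 : ℝ) ≤ n + 1 := fun n => by linarith [Nat.cast_nonneg (α := ℝ) n]
  have hlim : Tendsto (fun n : ℕ => ∫ s : ℝ,
      cutoff (n + 1) f (((x + (Real.sqrt (n + 1))⁻¹ * s : ℝ) : ℂ) + y * Complex.I) *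
        (Real.exp (-s ^ 2) : ℂ)) atTop
      (𝓝 (∫ s : ℝ, f (x + y * Complex.I) * (Real.exp (-s ^ 2) : ℂ))) := by
    refine tendsto_integral_of_dominated_convergence _ (fun n => ?_)
      ((integrable_exp_mul_abs_sub_mul_sq L one_pos).const_mul (E x * Real.exp (y ^ 2)))
      (fun n => ae_of_all _ (norm_mollify_integrand_le hE hEL hL (hN n) x))
      (ae_of_all _ fun s => ?_)
    · have h1 := (hf.decaysOn_cutoff (by linarith [hN n] : (0 : ℝ) < n + 1)).continuous_line hy
      exact ((h1.comp (by fun_prop : Continuous fun s : ℝ => x + (Real.sqrt (n + 1))⁻¹ * s)).mul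
        (by fun_prop)).aestronglyMeasurable
    · refine Tendsto.mul_const _ ?_
      have h1 : Tendsto (fun n : ℕ => x + (Real.sqrt (n + 1))⁻¹ * s) atTop (𝓝 x) := by
        have := ((Real.tendsto_sqrt_atTop.comp tendsto_natCast_add_one).inv_tendsto_atTop.mul_const
          s).const_add x
        simpa using this
      have h2 : Tendsto (fun n : ℕ => f (((x + (Real.sqrt (n + 1))⁻¹ * s : ℝ) : ℂ) +
          y * Complex.I)) atTop (𝓝 (f (x + y * Complex.I))) :=
        ((hf.continuous_line hy).tendsto x).comp h1
      have h3 : Tendsto (fun n : ℕ => ((((n : ℝ) + 1)⁻¹ : ℝ) : ℂ)) atTop (𝓝 0) := by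
        have := (Complex.continuous_ofReal.tendsto 0).comp
          tendsto_natCast_add_one.inv_tendsto_atTop
        simpa [Function.comp_def] using this
      have h4 : Tendsto (fun n : ℕ => (((x + (Real.sqrt (n + 1))⁻¹ * s : ℝ) : ℂ) +
          y * Complex.I) ^ 2) atTop (𝓝 (((x : ℂ) + y * Complex.I) ^ 2)) :=
        (((Complex.continuous_ofReal.tendsto x).comp h1).add_const _).pow 2
      have h5 := h2.mul ((Complex.continuous_exp.tendsto _).comp (h3.neg.mul h4))
      simpa [cutoff, Function.comp_def] using h5
  have hgauss : ∫ s : ℝ, f (x + y * Complex.I) * (Real.exp (-s ^ 2) : ℂ) =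
      f (x + y * Complex.I) * Real.sqrt Real.pi := by
    have := integral_gaussian 1
    rw [integral_const_mul, integral_complex_ofReal]
    simp only [neg_mul, one_mul, div_one] at this
    rw [this]
  have hpi : (Real.sqrt Real.pi : ℂ) ≠ 0 :=
    Complex.ofReal_ne_zero.2 (Real.sqrt_pos.2 Real.pi_pos).ne'
  have := hlim.const_mul (Real.sqrt Real.pi : ℂ)⁻¹
  rw [hgauss, mul_comm (f _), inv_mul_cancel_left₀ hpi] at this
  refine this.congr fun n => ?_
  rw [hf.mollify_line (by linarith [hN n]) hy]

/-- Mollifications converge in weighted `L²`-norms on horizontal lines. -/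
theorem GrowsOn.tendsto_integral_mollify (hf : GrowsOn b f) (hy : |y| ≤ b)
    (hE : ∀ t : ℝ, ‖f (t + y * Complex.I)‖ ≤ E t)
    (hEL : ∀ x t : ℝ, E t ≤ E x * Real.exp (L * |t - x|)) (hL : 0 ≤ L) {w : ℝ → ℝ}
    (hw : Continuous w) (hw0 : ∀ x, 0 ≤ w x) (hint : Integrable fun x => w x * E x ^ 2) :
    (∀ n : ℕ, Integrable fun x : ℝ => w x *
      ‖mollify (n + 1) f (x + y * Complex.I) - f (x + y * Complex.I)‖ ^ 2) ∧
    Tendsto (fun n : ℕ => ∫ x : ℝ, w x *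
      ‖mollify (n + 1) f (x + y * Complex.I) - f (x + y * Complex.I)‖ ^ 2) atTop (𝓝 0) := by
  have hN : ∀ n : ℕ, (1 : ℝ) ≤ n + 1 := fun n => by linarith [Nat.cast_nonneg (α := ℝ) n]
  have hb : 0 ≤ b := (abs_nonneg y).trans hy
  set B := (Real.sqrt Real.pi)⁻¹ * (Real.exp (y ^ 2) * ∫ s : ℝ, Real.exp (L * |s| - 1 * s ^ 2))
  have hmeas : ∀ n : ℕ, AEStronglyMeasurable (fun x : ℝ => w x *
      ‖mollify (n + 1) f (x + y * Complex.I) - f (x + y * Complex.I)‖ ^ 2) volume := by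
    intro n
    have h1 := (hf.mollify_mem_testFunctions hb (by linarith [hN n] : (0 : ℝ) < n + 1)).1.continuous
    have h2 := hf.continuous_line hy
    exact (hw.mul (((h1.comp (by fun_prop)).sub h2).norm.pow 2)).aestronglyMeasurable
  have hbound : ∀ (n : ℕ) (x : ℝ), ‖w x *
      ‖mollify (n + 1) f (x + y * Complex.I) - f (x + y * Complex.I)‖ ^ 2‖ ≤
      (B + 1) ^ 2 * (w x * E x ^ 2) := by
    intro n x
    have h1 := hf.norm_mollify_le hy hE hEL hL (hN n) x
    have h2 : ‖mollify (n + 1) f (x + y * Complex.I) - f (x + y * Complex.I)‖ ≤ (B + 1) * E x := by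
      refine (norm_sub_le _ _).trans ?_
      rw [add_mul, one_mul]
      exact add_le_add h1 (hE x)
    rw [Real.norm_of_nonneg (mul_nonneg (hw0 x) (sq_nonneg _))]
    refine (mul_le_mul_of_nonneg_left (pow_le_pow_left₀ (norm_nonneg _) h2 2) (hw0 x)).trans
      (le_of_eq ?_)
    ring
  refine ⟨fun n => (hint.const_mul _).mono' (hmeas n) (ae_of_all _ (hbound n)), ?_⟩
  have := tendsto_integral_of_dominated_convergence _ hmeas (hint.const_mul ((B + 1) ^ 2))
    (fun n => ae_of_all _ (hbound n)) (f := fun _ => (0 : ℝ)) (ae_of_all _ fun x => ?_)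
  · simpa using this
  · have h1 := ((hf.tendsto_mollify hy hE hEL hL x).sub_const (f (x + y * Complex.I))).norm.pow 2
    simpa using h1.const_mul (w x)

end Envelope

/-- Mollifications converge in a weighted `L²`-norm with a slowly varying weight. -/
theorem GrowsOn.tendsto_integral_mollify_of_weight {b y L K : ℝ} {f : ℂ → ℂ} (hf : GrowsOn b f)
    (hy : |y| ≤ b) {w : ℝ → ℝ} (hw : Continuous w) (hw0 : ∀ x, 0 < w x) (hL : 0 ≤ L)
    (hwL : ∀ x t, w x ≤ w t * Real.exp (L * |t - x|))
    (hK : ∀ x : ℝ, w x * ‖f (x + y * Complex.I)‖ ^ 2 ≤ K * Real.exp (-|x| / 2)) :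
    (∀ n : ℕ, Integrable fun x : ℝ => w x *
      ‖mollify (n + 1) f (x + y * Complex.I) - f (x + y * Complex.I)‖ ^ 2) ∧
    Tendsto (fun n : ℕ => ∫ x : ℝ, w x *
      ‖mollify (n + 1) f (x + y * Complex.I) - f (x + y * Complex.I)‖ ^ 2) atTop (𝓝 0) := by
  have hK0 : 0 ≤ K := nonneg_of_mul_nonneg_left
    ((mul_nonneg (hw0 0).le (sq_nonneg _)).trans (hK 0)) (Real.exp_pos _)
  have hE0 : ∀ t, 0 ≤ K * Real.exp (-|t| / 2) / w t := fun t =>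
    div_nonneg (mul_nonneg hK0 (Real.exp_pos _).le) (hw0 t).le
  -- The envelope is chosen so that w E² = K exp(-|t|/2), which is integrable. The extra 1 in `L +
  -- 1` covers the variation of exp(-|t|/2).
  refine hf.tendsto_integral_mollify (E := fun t => Real.sqrt (K * Real.exp (-|t| / 2) / w t))
    (L := L + 1) hy (fun t => ?_) (fun x t => ?_) (by linarith) hw (fun x => (hw0 x).le) ?_
  · refine Real.le_sqrt_of_sq_le ?_
    rw [le_div_iff₀ (hw0 t), mul_comm]
    exact hK t
  · refine Real.sqrt_le_iff.2 ⟨by positivity, ?_⟩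
    rw [mul_pow, Real.sq_sqrt (hE0 x), div_mul_eq_mul_div, div_le_div_iff₀ (hw0 t) (hw0 x)]
    have h1 := hwL x t
    have h2 : |x| ≤ |t| + |t - x| := by
      have := abs_add_le t (x - t)
      rwa [add_sub_cancel, abs_sub_comm x t] at this
    have h3 : Real.exp (-|t| / 2) * Real.exp (L * |t - x|) ≤
        Real.exp (-|x| / 2) * Real.exp ((L + 1) * |t - x|) ^ 2 := by
      rw [← Real.exp_nat_mul, ← Real.exp_add, ← Real.exp_add, Real.exp_le_exp]
      have h4 := mul_nonneg hL (abs_nonneg (t - x))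
      have h5 := abs_nonneg (t - x)
      push_cast
      linarith
    calc K * Real.exp (-|t| / 2) * w x
        ≤ K * Real.exp (-|t| / 2) * (w t * Real.exp (L * |t - x|)) :=
          mul_le_mul_of_nonneg_left h1 (mul_nonneg hK0 (Real.exp_pos _).le)
      _ = K * w t * (Real.exp (-|t| / 2) * Real.exp (L * |t - x|)) := by ring
      _ ≤ K * w t * (Real.exp (-|x| / 2) * Real.exp ((L + 1) * |t - x|) ^ 2) :=
          mul_le_mul_of_nonneg_left h3 (mul_nonneg hK0 (hw0 t).le)
      _ = _ := by ring
  · refine ((integrable_exp_neg_mul_abs (c := 1 / 2) (by norm_num)).const_mul K).congr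
      (ae_of_all _ fun x => ?_)
    beta_reduce
    rw [Real.sq_sqrt (hE0 x), mul_div_cancel₀ _ (hw0 x).ne']
    ring_nf

/-! ### The eigenfunction lies in the form domain -/

namespace CurveData

variable {d : CurveData} {φ : LaurentPoly} {F : ℂ → ℂ → ℂ} {κ : ℂ}

theorem exp_le_exp_mul_exp_abs (x t : ℝ) : Real.exp x ≤ Real.exp t * Real.exp |t - x| := by
  rw [← Real.exp_add, Real.exp_le_exp]
  linarith [neg_abs_le (t - x)]

theorem rowWeight_le_mul_exp (i : ℤ) (k : ℕ) (x t : ℝ) :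
    rowWeight i k x ≤ rowWeight i k t * Real.exp ((|(i : ℝ)| + k) * |t - x|) := by
  have h1 : Real.exp (i * x) ≤ Real.exp (i * t) * Real.exp (|(i : ℝ)| * |t - x|) := by
    have := exp_le_exp_mul_exp_abs (i * x) (i * t)
    rwa [← mul_sub, abs_mul] at this
  have h2 : 1 + Real.exp x ≤ (1 + Real.exp t) * Real.exp |t - x| := by
    have := exp_le_exp_mul_exp_abs x t
    have := Real.one_le_exp (abs_nonneg (t - x))
    linarith
  rw [rowWeight, rowWeight]
  refine (mul_le_mul h1 (pow_le_pow_left₀ (by positivity) h2 k) (by positivity)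
    (by positivity)).trans (le_of_eq ?_)
  rw [mul_pow, add_mul, Real.exp_add, ← Real.exp_nat_mul]
  ring

theorem Admissible.potential_le_mul_exp (hd : d.Admissible) (x t : ℝ) :
    d.potential x ≤ d.potential t * Real.exp (1 * |t - x|) := by
  have h1 := mul_le_mul_of_nonneg_left (exp_le_exp_mul_exp_abs x t) hd.α_eq.2
  have h2 := mul_le_mul_of_nonneg_left (exp_le_exp_mul_exp_abs (-x) (-t)) hd.β_eq.2
  rw [show -t - -x = -(t - x) by ring, abs_neg] at h2
  have h3 := Real.one_le_exp (abs_nonneg (t - x))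
  rw [potential, potential, one_mul]
  linarith

end CurveData

/-- The inequality |u - v|² ≤ 2(|u - c|² + |v - c|²) turns convergence in the weighted norms into
the Cauchy condition for the quadratic form. -/
theorem integral_mul_norm_sub_sq_le {w w' : ℝ → ℝ} (hw : ∀ x, 0 ≤ w x) (hww : ∀ x, w x ≤ w' x)
    {u v c : ℝ → ℂ} (hu : Integrable fun x => w' x * ‖u x - c x‖ ^ 2)
    (hv : Integrable fun x => w' x * ‖v x - c x‖ ^ 2) :
    ∫ x, w x * ‖u x - v x‖ ^ 2 ≤
      2 * ((∫ x, w' x * ‖u x - c x‖ ^ 2) + ∫ x, w' x * ‖v x - c x‖ ^ 2) := by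
  rw [← integral_add hu hv, ← integral_const_mul]
  refine integral_mono_of_nonneg (ae_of_all _ fun x => mul_nonneg (hw x) (sq_nonneg _))
    ((hu.add hv).const_mul 2) (ae_of_all _ fun x => ?_)
  have h1 : ‖u x - v x‖ ≤ ‖u x - c x‖ + ‖v x - c x‖ := by
    rw [norm_sub_rev (v x)]
    exact norm_sub_le_norm_sub_add_norm_sub _ _ _
  have h2 : ‖u x - v x‖ ^ 2 ≤ 2 * (‖u x - c x‖ ^ 2 + ‖v x - c x‖ ^ 2) := by
    have := pow_le_pow_left₀ (norm_nonneg _) h1 2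
    nlinarith [sq_nonneg (‖u x - c x‖ - ‖v x - c x‖)]
  have h3 := mul_le_mul (hww x) h2 (sq_nonneg _) ((hw x).trans (hww x))
  exact h3.trans (le_of_eq (by ring))

theorem tendsto_eLpNorm_two {f : ℕ → ℝ → ℂ} (hf : ∀ n, MemLp (f n) 2 volume)
    (h : Tendsto (fun n => ∫ x, ‖f n x‖ ^ 2) atTop (𝓝 0)) :
    Tendsto (fun n => eLpNorm (f n) 2 volume) atTop (𝓝 0) := by
  have h1 : ∀ n, eLpNorm (f n) 2 volume = ENNReal.ofReal (Real.sqrt (∫ x, ‖f n x‖ ^ 2)) := by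
    intro n
    rw [(hf n).eLpNorm_eq_integral_rpow_norm two_ne_zero ENNReal.ofNat_ne_top, Real.sqrt_eq_rpow]
    simp
  simp only [h1]
  have h2 := (ENNReal.continuous_ofReal.tendsto _).comp ((Real.continuous_sqrt.tendsto _).comp h)
  simpa [Function.comp_def] using h2

namespace CurveData

variable {d : CurveData} {φ : LaurentPoly} {F : ℂ → ℂ → ℂ} {κ : ℂ}

theorem FlatOn.continuous_regularize (hF : d.FlatOn 1 κ univ F) (hd : d.Admissible) :
    Continuous fun x : ℝ => regularize (d.traceY F) x := by
  simpa using (hF.growsOn hd).2.continuous_line (y := 0) (by simpa using Real.pi_pos.le)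

theorem FlatOn.memLp_regularize (hF : d.FlatOn 1 κ univ F) (hd : d.Admissible) :
    MemLp (fun x : ℝ => regularize (d.traceY F) x) 2 volume := by
  obtain ⟨K, M, -, -, -, h⟩ := hF.exists_bounds hd
  have hc := hF.continuous_regularize hd
  refine (memLp_two_iff_integrable_sq_norm hc.aestronglyMeasurable).2 ?_
  refine ((integrable_exp_neg_mul_abs (c := 1 / 2) (by norm_num)).const_mul K).mono'
    (hc.norm.pow 2).aestronglyMeasurable (ae_of_all _ fun x => ?_)
  have h1 := (h x).2.2
  rw [Real.norm_of_nonneg (sq_nonneg _), show -(1 / 2) * |x| = -|x| / 2 by ring]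
  exact (le_mul_of_one_le_left (sq_nonneg _) (hd.one_le_potential x)).trans h1

/-- The mollifications of ψ are test functions and converge to it in the three weighted norms on Im
r = -π, π and 0. The quadratic form of a difference is the sum of such norms, and the norm with the
potential also controls L²-convergence. -/
theorem FlatOn.inFormDomain (hF : d.FlatOn 1 κ univ F) (h : d.Represents φ) (hd : d.Admissible) :
    InFormDomain φ fun x => regularize (d.traceY F) x := by
  obtain ⟨K, M, -, -, -, hK⟩ := hF.exists_bounds hd
  have hpi := Real.pi_pos
  have hΨ := (hF.growsOn hd).2
  have hΨc := hF.continuous_regularize hd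
  set Ψ := regularize (d.traceY F)
  have htest : ∀ n : ℕ, mollify (n + 1) Ψ ∈ testFunctions := fun n =>
    hΨ.mollify_mem_testFunctions hpi.le (by positivity)
  have cast_neg : ∀ x : ℝ, (x : ℂ) + (-Real.pi : ℝ) * Complex.I = x - πi := fun x => by
    push_cast; ring
  have cast_zero : ∀ x : ℝ, (x : ℂ) + (0 : ℝ) * Complex.I = x := fun x => by simp
  have h1 := hΨ.tendsto_integral_mollify_of_weight (y := -Real.pi)
    (by rw [abs_neg, abs_of_pos hpi]) (continuous_rowWeight d.i d.k) (rowWeight_pos d.i d.k)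
    (by positivity) (rowWeight_le_mul_exp d.i d.k) fun x => by
      rw [cast_neg]; exact (hK x).1
  have h2 := hΨ.tendsto_integral_mollify_of_weight (y := Real.pi)
    (abs_of_pos hpi).le (continuous_rowWeight d.j d.l) (rowWeight_pos d.j d.l)
    (by positivity) (rowWeight_le_mul_exp d.j d.l) fun x => (hK x).2.1
  have h3 := hΨ.tendsto_integral_mollify_of_weight (y := 0) (by simpa using hpi.le)
    d.continuous_potential (fun x => one_pos.trans_le (hd.one_le_potential x))
    zero_le_one hd.potential_le_mul_exp fun x => by
      rw [cast_zero]; exact (hK x).2.2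
  simp only [cast_neg] at h1
  simp only [cast_zero] at h3
  refine ⟨fun n => mollify (n + 1) Ψ, htest, ?_, ?_⟩
  · have hmeas : ∀ n : ℕ, Continuous fun r : ℝ => onReal (mollify (n + 1) Ψ) r - Ψ r := fun n =>
      ((htest n).1.continuous.comp Complex.continuous_ofReal).sub hΨc
    have hle : ∀ (n : ℕ) (x : ℝ), ‖onReal (mollify (n + 1) Ψ) x - Ψ x‖ ^ 2 ≤
        d.potential x * ‖mollify (n + 1) Ψ x - Ψ x‖ ^ 2 := fun n x =>
      le_mul_of_one_le_left (sq_nonneg _) (hd.one_le_potential x)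
    refine tendsto_eLpNorm_two (fun n => ?_) ?_
    · refine (memLp_two_iff_integrable_sq_norm (hmeas n).aestronglyMeasurable).2 ?_
      refine (h3.1 n).mono' ((hmeas n).norm.pow 2).aestronglyMeasurable (ae_of_all _ fun x => ?_)
      rw [Real.norm_of_nonneg (sq_nonneg _)]
      exact hle n x
    · exact squeeze_zero (fun n => integral_nonneg fun x => sq_nonneg _)
        (fun n => integral_mono_of_nonneg (ae_of_all _ fun x => sq_nonneg _) (h3.1 n)
          (ae_of_all _ (hle n))) h3.2
  · rw [← prod_atTop_atTop_eq]
    have hlim : ∀ {N : ℕ → ℝ}, Tendsto N atTop (𝓝 0) →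
        Tendsto (fun n : ℕ × ℕ => 2 * (N n.1 + N n.2)) (atTop ×ˢ atTop) (𝓝 0) := by
      intro N hN
      simpa using ((hN.comp tendsto_fst).add (hN.comp tendsto_snd)).const_mul 2
    have hbound := ((hlim h1.2).add (hlim h2.2)).add (hlim h3.2)
    rw [add_zero, add_zero] at hbound
    refine squeeze_zero_norm (fun n => ?_) hbound
    have hpot : ∀ x, 0 ≤ d.potential x - 1 := fun x => sub_nonneg.2 (hd.one_le_potential x)
    rw [(h.innerL2_quantumAction_self hd (sub_mem_testFunctions (htest n.1) (htest n.2))).2.2.2,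
      Complex.norm_real, Real.norm_of_nonneg (add_nonneg (add_nonneg
        (integral_nonneg fun x => mul_nonneg (rowWeight_pos d.i d.k x).le (sq_nonneg _))
        (integral_nonneg fun x => mul_nonneg (rowWeight_pos d.j d.l x).le (sq_nonneg _)))
        (integral_nonneg fun x => mul_nonneg (hpot x) (sq_nonneg _)))]
    exact add_le_add (add_le_add
      (integral_mul_norm_sub_sq_le (fun x => (rowWeight_pos d.i d.k x).le) (fun _ => le_rfl)
        (h1.1 n.1) (h1.1 n.2))
      (integral_mul_norm_sub_sq_le (fun x => (rowWeight_pos d.j d.l x).le) (fun _ => le_rfl)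
        (h2.1 n.1) (h2.1 n.2)))
      (integral_mul_norm_sub_sq_le hpot (fun x => sub_le_self _ zero_le_one)
        (h3.1 n.1) (h3.1 n.2))

/-- The trace of a global flat section is an eigenfunction. -/
theorem FlatOn.isQuantumEigenvalue (hF : d.FlatOn 1 κ univ F) (h : d.Represents φ)
    (hd : d.Admissible) : IsQuantumEigenvalue φ d.a := by
  refine ⟨fun x => regularize (d.traceY F) x, fun h0 => ?_, hF.memLp_regularize hd,
    (hF.memLp_regularize hd).const_mul d.a, hF.inFormDomain h hd,
    fun f hf => hF.innerL2_quantumAction h hd hf⟩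
  obtain ⟨x, hx⟩ := hF.exists_regularize_ne_zero hd
  exact hx (congrFun ((hF.continuous_regularize hd).ae_eq_iff_eq volume continuous_zero |>.1 h0) x)

end CurveData

end

end QuantumCurve

theorem mainTheorem1 (Δ : Set (ℝ × ℝ)) (hΔ : QuantumCurve.IsReflexive Δ)
    (hstrip : Δ ⊆ Set.univ ×ˢ Set.Icc (-1 : ℝ) 1)
    (φ : QuantumCurve.LaurentPoly) (hφ : QuantumCurve.IsIntegrallyTempered Δ φ)
    (a : ℂ) (ha : a ∈ QuantumCurve.moduli φ)
    (p : ℂ × ℂ) (γ β : QuantumCurve.CurveLoop φ a p)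
    (hbasis : QuantumCurve.IsHomologyBasis γ β)
    (hV : QuantumCurve.normalFunction γ β ∈ QuantumCurve.periodLattice γ β) :
    QuantumCurve.IsQuantumEigenvalue φ a := by
  obtain ⟨d, rfl, hrep, hadm⟩ := QuantumCurve.exists_admissible hΔ hstrip hφ ha
  obtain ⟨κ, F, hF⟩ := QuantumCurve.CurveData.exists_flat_of_mem hrep hadm γ β hbasis hV
  exact hF.isQuantumEigenvalue hrep hadm
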